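/- Let $B$ be a compact Hausdorff space. Let $X$ be a smooth manifold with boundary (Hausdorff, second countable) whose boundary $M=\partial X$ is compact, with inclusion $\iota:M\to X$. For a smooth manifold $F$, possibly with boundary, give $\mathrm{Diff}(F)$ the $C^\infty$ topology (uniform convergence of each derivative on compact subsets of charts). A *manifold over $B$* with fibre $F$ is a fibre bundle $F\hookrightarrow\mathcal Z\to B$ with structure group $\mathrm{Diff}(F)$, i.e. with an atlas of local trivialisations whose transition functions are continuous maps to $\mathrm{Diff}(F)$. An *isomorphism* of manifolds over $B$ is a homeomorphism over $B$ which in local trivialisations is a continuous family of diffeomorphisms of the fibres. For $N\subset F$, a *submanifold with fibre $N$* of $\mathcal Z$ is a subset of $\mathcal Z$ that corresponds to $N$ in every trivialisation of some atlas of compatible local trivialisations of $\mathcal Z$. Let $\mathcal M$ and $\mathcal X$ be manifolds over $B$ with fibres $M$ and $X$ such that $\mathcal M=\partial_B\mathcal X$, i.e. there is a map $j:\mathcal M\to\mathcal X$ over $B$ which in suitable local trivialisations of $\mathcal M$ and $\mathcal X$ is $\mathrm{id}\times\iota$. Then there are an open subset $W\subset X$, a submanifold $\mathcal W$ of $\mathcal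 X$ with fibre $W$ and structure group $\mathrm{Diff}(\overline W,M)$, and an isomorphism of manifolds over $B$ $$\Phi:\mathcal M\times[0,1)\to\mathcal W\subset\mathcal X$$ such that $\Phi$ restricts to a collar neighbourhood of the boundary on each fibre. More precisely: 1. $\overline W$ is a closed collar of $M$ in $X$: there is a smooth embedding $\varphi:M\times[0,1]\to X$ with $\varphi(m,0)=\iota(m)$, $\varphi(M\times[0,1))=W$ and $\varphi(M\times[0,1])=\overline W$. 2. There is an atlas of compatible local trivialisations of $\mathcal X$ identifying $\mathcal W$ with $W$, whose transition functions restrict to continuous maps to the group $\mathrm{Diff}(\overline W,M)$ of diffeomorphisms of $\overline W\cong M\times[0,1]$ that leave $M\cong M\times\{0\}$ invariant; $\mathcal W$ carries the structure of a manifold over $B$ with fibre $W$ given by restricting this atlas. 3. For every $b\in B$, the map $\Phi_b:M_b\times[0,1)\to X_b$ between the fibres over $b$ is a diffeomorphism onto an open subset of $X_b$ and $\Phi_b(z,0)=j(z)$ for all $z\in M_b$. -/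

import Mathlib

open scoped Manifold ContDiff Topology
open Set Filter Bundle

noncomputable section

/-! ### The `C^∞` topology on spaces of smooth maps and on diffeomorphism groups -/

section SmoothTopology

variable {E H E' H' X Y : Type*}
  [NormedAddCommGroup E] [NormedSpace ℝ E] [TopologicalSpace H] {I : ModelWithCorners ℝ E H}
  [NormedAddCommGroup E'] [NormedSpace ℝ E'] [TopologicalSpace H'] {I' : ModelWithCorners ℝ E' H'}
  [TopologicalSpace X] [ChartedSpace H X] [TopologicalSpace Y] [ChartedSpace H' Y]

variable (I I') in
/-- The expression of `f : X → Y` in the (extended) charts at `x : X` and `y : Y`. -/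
def chartRep (f : X → Y) (x : X) (y : Y) : E → E' :=
  extChartAt I' y ∘ f ∘ (extChartAt I x).symm

/-- The smooth maps `g` which carry `K` into the domain of the chart at `y` and whose partial
derivatives of order at most `r`, in the charts at `x` and `y`, are uniformly `ε`-close on `K` to
those of `f` (i.e. the supremum of the differences is less than `ε`). Derivatives are taken within
`range I`, which makes sense of them also at boundary points. -/
def smoothNhd (f : C^∞⟮I, X; I', Y⟯) (x : X) (y : Y) (K : Set X) (r : ℕ) (ε : ℝ) :
    Set C^∞⟮I, X; I', Y⟯ :=
  {g | MapsTo g K (chartAt H' y).source ∧ ∃ δ < ε, ∀ k ≤ r, ∀ u ∈ K,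
    ‖iteratedFDerivWithin ℝ k (chartRep I I' g x y) (range I) (extChartAt I x u) -
      iteratedFDerivWithin ℝ k (chartRep I I' f x y) (range I) (extChartAt I x u)‖ ≤ δ}

/-- The `C^∞` topology on the space of smooth maps `X → Y`: uniform convergence of each
derivative (on compact sets, in charts). -/
instance smoothTopology : TopologicalSpace C^∞⟮I, X; I', Y⟯ :=
  TopologicalSpace.generateFrom
    {N | ∃ (f : C^∞⟮I, X; I', Y⟯) (x : X) (y : Y) (K : Set X) (r : ℕ) (ε : ℝ),
      IsCompact K ∧ K ⊆ (chartAt H x).source ∧ MapsTo f K (chartAt H' y).source ∧ 0 < ε ∧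
      N = smoothNhd f x y K r ε}

/-- The `C^∞` topology on the set of diffeomorphisms; for `X = Y` this is the topology of
the group `Diff(X)`. -/
instance diffeomorphTopology : TopologicalSpace (X ≃ₘ^∞⟮I, I'⟯ Y) :=
  TopologicalSpace.induced Diffeomorph.toContMDiffMap smoothTopology

theorem self_mem_smoothNhd (f : C^∞⟮I, X; I', Y⟯) {x : X} {y : Y} {K : Set X} {r : ℕ} {ε : ℝ}
    (hf : MapsTo f K (chartAt H' y).source) (hε : 0 < ε) : f ∈ smoothNhd f x y K r ε :=
  ⟨hf, 0, hε, fun k _ u _ => by simp⟩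

theorem continuous_smooth_iff {B : Type*} [TopologicalSpace B] (g : B → C^∞⟮I, X; I', Y⟯) :
    Continuous g ↔ ∀ (b : B) (x : X) (y : Y) (K : Set X) (r : ℕ) (ε : ℝ),
      IsCompact K → K ⊆ (chartAt H x).source → MapsTo (g b) K (chartAt H' y).source → 0 < ε →
      ∀ᶠ c in 𝓝 b, g c ∈ smoothNhd (g b) x y K r ε := by
  constructor
  · intro hg b x y K r ε hK hKx hKy hε
    have ho : IsOpen (smoothNhd (g b) x y K r ε) :=
      TopologicalSpace.isOpen_generateFrom_of_mem ⟨g b, x, y, K, r, ε, hK, hKx, hKy, hε, rfl⟩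
    exact (ho.preimage hg).mem_nhds (self_mem_smoothNhd (g b) hKy hε)
  · intro h
    refine continuous_generateFrom_iff.2 ?_
    rintro _ ⟨f, x, y, K, r, ε, hK, hKx, -, -, rfl⟩
    refine isOpen_iff_mem_nhds.2 ?_
    rintro b ⟨hbK, δ, hδ, hb⟩
    filter_upwards [h b x y K r (ε - δ) hK hKx hbK (by linarith)] with c hc
    obtain ⟨hcK, δ', hδ', hc⟩ := hc
    refine ⟨hcK, δ' + δ, by linarith, fun k hk u hu => ?_⟩
    refine (norm_sub_le_norm_sub_add_norm_sub _ _ _).trans (add_le_add (hc k hk u hu) (hb k hk u hu))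

theorem continuous_diffeo_iff {B : Type*} [TopologicalSpace B] (g : B → X ≃ₘ^∞⟮I, I'⟯ Y) :
    Continuous g ↔ ∀ (b : B) (x : X) (y : Y) (K : Set X) (r : ℕ) (ε : ℝ),
      IsCompact K → K ⊆ (chartAt H x).source → MapsTo (g b) K (chartAt H' y).source → 0 < ε →
      ∀ᶠ c in 𝓝 b, (g c).toContMDiffMap ∈ smoothNhd (g b).toContMDiffMap x y K r ε := by
  rw [continuous_induced_rng, continuous_smooth_iff]
  rfl

theorem chartRep_contDiffWithinAt [IsManifold I ∞ X] [IsManifold I' ∞ Y] {f : X → Y}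
    (hf : ContMDiff I I' ∞ f) {x : X} {y : Y} {u : X} (hu : u ∈ (chartAt H x).source)
    (hy : f u ∈ (chartAt H' y).source) :
    ContDiffWithinAt ℝ ∞ (chartRep I I' f x y) (range I) (extChartAt I x u) :=
  ((contMDiffAt_iff_of_mem_source hu hy).1 hf.contMDiffAt).2

end SmoothTopology

section Families

variable {E H E' H' X Y T B : Type*}
  [NormedAddCommGroup E] [NormedSpace ℝ E] [TopologicalSpace H] (I : ModelWithCorners ℝ E H)
  [NormedAddCommGroup E'] [NormedSpace ℝ E'] [TopologicalSpace H'] (I' : ModelWithCorners ℝ E' H')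
  [TopologicalSpace X] [ChartedSpace H X] [TopologicalSpace Y] [ChartedSpace H' Y]
  [TopologicalSpace B]

/-- `h` restricts to a continuous map from `U ⊆ B` to the space of diffeomorphisms `X → Y`. -/
def IsDiffFamily (U : Set B) (h : B → X → Y) : Prop :=
  ∃ g : U → (X ≃ₘ^∞⟮I, I'⟯ Y), Continuous g ∧ ∀ (b : U) (x : X), g b x = h b x

theorem norm_iteratedFDerivWithin_inl_comp_fst_le {E E' F F' : Type*}
    [NormedAddCommGroup E] [NormedSpace ℝ E] [NormedAddCommGroup E'] [NormedSpace ℝ E']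
    [NormedAddCommGroup F] [NormedSpace ℝ F] [NormedAddCommGroup F'] [NormedSpace ℝ F']
    {s : Set E} {t : Set F} (hs : UniqueDiffOn ℝ s) (ht : UniqueDiffOn ℝ t) {d : E → E'}
    {p : E × F} (hp : p ∈ s ×ˢ t) (hd : ContDiffWithinAt ℝ ∞ d s p.1) (k : ℕ) :
    ‖iteratedFDerivWithin ℝ k (fun q : E × F => ((d q.1, 0) : E' × F')) (s ×ˢ t) p‖ ≤
      ‖iteratedFDerivWithin ℝ k d s p.1‖ := by
  have hd' : ContDiffWithinAt ℝ ∞ (d ∘ Prod.fst) (s ×ˢ t) p :=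
    hd.comp p contDiffWithinAt_fst (fun q hq => hq.1)
  have h1 : (fun q : E × F => ((d q.1, 0) : E' × F')) =
      ContinuousLinearMap.inl ℝ E' F' ∘ (d ∘ Prod.fst) := by
    ext q <;> simp
  rw [h1]
  refine ((ContinuousLinearMap.inl ℝ E' F').norm_iteratedFDerivWithin_comp_left hd'
    (hs.prod ht) hp (n := k) (by exact_mod_cast le_top)).trans ?_
  have h2 : ‖iteratedFDerivWithin ℝ k (d ∘ Prod.fst) (s ×ˢ t) p‖ ≤
      ‖iteratedFDerivWithin ℝ k d s p.1‖ := by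
    obtain ⟨U, hU, hpU, hdU⟩ := (hd.of_le (m := (k : ℕ∞ω))
      (by exact_mod_cast le_top)).contDiffOn' le_rfl (by simp)
    rw [insert_eq_of_mem hp.1] at hdU
    have hsU : UniqueDiffOn ℝ (s ∩ U) := hs.inter hU
    have h3 := ((hdU.ftaylorSeriesWithin hsU).compContinuousLinearMap
      (ContinuousLinearMap.fst ℝ E F)).mono
        (t := (s ×ˢ t) ∩ (Prod.fst ⁻¹' U)) (fun q hq => ⟨hq.1.1, hq.2⟩)
    have hU' : IsOpen (Prod.fst ⁻¹' U : Set (E × F)) := hU.preimage continuous_fst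
    have h4 := h3.eq_iteratedFDerivWithin_of_uniqueDiffOn le_rfl ((hs.prod ht).inter hU')
      ⟨hp, hpU⟩
    rw [iteratedFDerivWithin_inter_open hU' hpU] at h4
    have h5 : iteratedFDerivWithin ℝ k (d ∘ Prod.fst) (s ×ˢ t) p =
        (iteratedFDerivWithin ℝ k d s p.1).compContinuousLinearMap
          (fun _ => ContinuousLinearMap.fst ℝ E F) := by
      rw [← iteratedFDerivWithin_inter_open hU hpU]
      exact h4.symm
    rw [h5]
    refine (ContinuousMultilinearMap.norm_compContinuousLinearMap_le _ _).trans ?_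
    refine mul_le_of_le_one_right (norm_nonneg _) ?_
    exact Finset.prod_le_one (fun _ _ => norm_nonneg _)
      (fun _ _ => ContinuousLinearMap.norm_fst_le ℝ E F)
  calc _ ≤ 1 * ‖iteratedFDerivWithin ℝ k (d ∘ Prod.fst) (s ×ˢ t) p‖ := by
        gcongr
        exact ContinuousLinearMap.norm_inl_le_one ℝ E' F'
    _ ≤ _ := by rw [one_mul]; exact h2

variable {I I'}

/-- The product of a continuous family of diffeomorphisms with an identity map. -/
theorem IsDiffFamily.prod_id [IsManifold I ∞ X] [IsManifold I' ∞ Y]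
    {E₁ H₁ : Type*} [NormedAddCommGroup E₁] [NormedSpace ℝ E₁] [TopologicalSpace H₁]
    (J : ModelWithCorners ℝ E₁ H₁) [TopologicalSpace T] [ChartedSpace H₁ T] [IsManifold J ∞ T]
    {U : Set B} {h : B → X → Y} (hh : IsDiffFamily I I' U h) :
    IsDiffFamily (I.prod J) (I'.prod J) U (fun b (q : X × T) => (h b q.1, q.2)) := by
  obtain ⟨g, hg, hgh⟩ := hh
  refine ⟨fun b => (g b).prodCongr (Diffeomorph.refl J T ∞), ?_, fun b q => by
    simp only [← hgh]
    rfl⟩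
  rw [continuous_diffeo_iff] at hg ⊢
  intro b x y K r ε hK hKx hKy hε
  have hx : ∀ u ∈ K, u.1 ∈ (chartAt H x.1).source ∧ u.2 ∈ (chartAt H₁ x.2).source := by
    intro u hu
    simpa using hKx hu
  have hy : ∀ u ∈ K, g b u.1 ∈ (chartAt H' y.1).source ∧ u.2 ∈ (chartAt H₁ y.2).source := by
    intro u hu
    simpa using hKy hu
  have hK1 : ∀ {P : X → Prop}, (∀ u ∈ K, P u.1) → ∀ u ∈ Prod.fst '' K, P u := by
    rintro P hP _ ⟨u, hu, rfl⟩
    exact hP u hu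
  filter_upwards [hg b x.1 y.1 (Prod.fst '' K) r ε (hK.image continuous_fst)
    (hK1 fun u hu => (hx u hu).1) (hK1 fun u hu => (hy u hu).1) hε] with c hc
  obtain ⟨hcK, δ, hδ, hc⟩ := hc
  have hyc : ∀ u ∈ K, g c u.1 ∈ (chartAt H' y.1).source := fun u hu => hcK (mem_image_of_mem _ hu)
  refine ⟨fun u hu => ?_, δ, hδ, fun k hk u hu => ?_⟩
  · have : (g c u.1, u.2) ∈ (chartAt H' y.1).source ×ˢ (chartAt H₁ y.2).source :=
      ⟨hyc u hu, (hy u hu).2⟩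
    simpa using this
  · have hsm : ∀ a : U, g a u.1 ∈ (chartAt H' y.1).source →
        ContDiffWithinAt ℝ ∞ (chartRep (I.prod J) (I'.prod J)
          ((g a).prodCongr (Diffeomorph.refl J T ∞)) x y) (range (I.prod J))
          (extChartAt (I.prod J) x u) := fun a ha =>
      chartRep_contDiffWithinAt (Diffeomorph.contMDiff _) (hKx hu) (by
        simpa using ⟨ha, (hy u hu).2⟩)
    have hsm1 : ∀ a : U, g a u.1 ∈ (chartAt H' y.1).source →
        ContDiffWithinAt ℝ ∞ (chartRep I I' (g a) x.1 y.1) (range I)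
          (extChartAt I x.1 u.1) := fun a ha =>
      chartRep_contDiffWithinAt (g a).contMDiff (hx u hu).1 ha
    have hmem : extChartAt (I.prod J) x u ∈ range (I.prod J) := by
      exact ⟨chartAt (ModelProd H H₁) x u, rfl⟩
    have hmem1 : extChartAt I x.1 u.1 ∈ range I := ⟨chartAt H x.1 u.1, rfl⟩
    have hk' : ((k : ℕ) : ℕ∞ω) ≤ ∞ := by exact_mod_cast le_top
    have e1 := iteratedFDerivWithin_sub_apply ((hsm c (hyc u hu)).of_le hk')
      ((hsm b (hy u hu).1).of_le hk') (I.prod J).uniqueDiffOn hmem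
    have e2 := iteratedFDerivWithin_sub_apply ((hsm1 c (hyc u hu)).of_le hk')
      ((hsm1 b (hy u hu).1).of_le hk') I.uniqueDiffOn hmem1
    have key := norm_iteratedFDerivWithin_inl_comp_fst_le (F' := E₁) I.uniqueDiffOn J.uniqueDiffOn
      (p := extChartAt (I.prod J) x u)
      (d := chartRep I I' (g c) x.1 y.1 - chartRep I I' (g b) x.1 y.1)
      (by rw [← ModelWithCorners.range_prod]; exact hmem)
      ((hsm1 c (hyc u hu)).sub (hsm1 b (hy u hu).1)) k
    have hfun : chartRep (I.prod J) (I'.prod J)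
          ((g c).prodCongr (Diffeomorph.refl J T ∞)) x y -
        chartRep (I.prod J) (I'.prod J) ((g b).prodCongr (Diffeomorph.refl J T ∞)) x y =
        fun q : E × E₁ => ((chartRep I I' (g c) x.1 y.1 - chartRep I I' (g b) x.1 y.1) q.1, 0) := by
      funext q
      refine Prod.ext ?_ ?_
      · rfl
      · exact sub_self _
    have hle := hc k hk u.1 (mem_image_of_mem _ hu)
    rw [← ModelWithCorners.range_prod, ← hfun, e1] at key
    refine key.trans ?_
    refine le_trans (le_of_eq ?_) hle
    rw [show (extChartAt (I.prod J) x u).1 = extChartAt I x.1 u.1 from rfl]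
    rw [e2]
    rfl

open TopologicalSpace in
/-- A diffeomorphism which maps the open set `W` onto the open set `W'` restricts to a
diffeomorphism from `W` to `W'`. -/
def Diffeomorph.restrictOpens (f : X ≃ₘ^∞⟮I, I'⟯ Y) (W : Opens X) (W' : Opens Y)
    (h : ∀ x, f x ∈ W' ↔ x ∈ W) : W ≃ₘ^∞⟮I, I'⟯ W' where
  toFun x := ⟨f x, (h x).2 x.2⟩
  invFun y := ⟨f.symm y, (h _).1 (by simp)⟩
  left_inv x := by simp
  right_inv y := by simp
  contMDiff_toFun := (ContMDiff.subtypeVal_comp_iff W' _).1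
    (f.contMDiff.comp contMDiff_subtype_val)
  contMDiff_invFun := (ContMDiff.subtypeVal_comp_iff W _).1
    (f.symm.contMDiff.comp contMDiff_subtype_val)

open TopologicalSpace in
theorem chartRep_restrict_eventuallyEq {W : Opens X} {W' : Opens Y} {f : X → Y} {f' : W → W'}
    (hf : ∀ x, (f' x : Y) = f x) (x : W) (y : W') {u : W} (hu : u ∈ (chartAt H x).source) :
    chartRep I I' f' x y =ᶠ[𝓝[range I] (extChartAt I x u)] chartRep I I' f x y := by
  have hmem : (extChartAt I x).target ∈ 𝓝[range I] (extChartAt I x u) := by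
    have hu' : u ∈ (extChartAt I x).source := by rwa [extChartAt_source]
    exact extChartAt_target_mem_nhdsWithin' hu'
  filter_upwards [hmem] with v hv
  have hsymm : ((extChartAt I x).symm v : X) = (extChartAt I (x : X)).symm v := by
    have hv' : I.symm v ∈ (chartAt H x).target := by
      have := hv
      rw [extChartAt_target] at this
      exact this.1
    exact ((chartAt H (x : X)).subtypeRestr_symm_eqOn ⟨x⟩ hv').symm
  have h2 : chartRep I I' f' x y v = extChartAt I' (y : Y) (f' ((extChartAt I x).symm v)) := rfl
  rw [h2, hf, hsymm]
  rfl

open TopologicalSpace in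
/-- A continuous family of diffeomorphisms mapping the open set `W` onto `W'` restricts to
a continuous family of diffeomorphisms from `W` to `W'`. -/
theorem IsDiffFamily.restrictOpens {U : Set B} {h : B → X → Y} (hh : IsDiffFamily I I' U h)
    {W : Opens X} {W' : Opens Y} (hW : ∀ b ∈ U, ∀ x, h b x ∈ W' ↔ x ∈ W)
    {h' : B → W → W'} (hh' : ∀ b ∈ U, ∀ x, (h' b x : Y) = h b x) : IsDiffFamily I I' U h' := by
  obtain ⟨g, hg, hgh⟩ := hh
  have hgW : ∀ b x, g b x ∈ W' ↔ x ∈ W := fun b x => by rw [hgh]; exact hW b b.2 x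
  refine ⟨fun b => (g b).restrictOpens W W' (hgW b), ?_, fun b x => ?_⟩
  swap
  · apply Subtype.ext
    rw [hh' b b.2, ← hgh]
    rfl
  rw [continuous_diffeo_iff] at hg ⊢
  intro b x y K r ε hK hKx hKy hε
  have hsrc : ∀ {z u : W}, u ∈ (chartAt H z).source → (u : X) ∈ (chartAt H (z : X)).source := by
    intro z u hu
    rw [Opens.chartAt_eq, OpenPartialHomeomorph.subtypeRestr_source] at hu
    exact hu
  have hsrc' : ∀ {z u : W'}, u ∈ (chartAt H' z).source ↔
      (u : Y) ∈ (chartAt H' (z : Y)).source := by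
    intro z u
    rw [Opens.chartAt_eq, OpenPartialHomeomorph.subtypeRestr_source]
    rfl
  have hK1 : ∀ {P : X → Prop}, (∀ u ∈ K, P u) → ∀ u ∈ Subtype.val '' K, P u := by
    rintro P hP _ ⟨u, hu, rfl⟩
    exact hP u hu
  filter_upwards [hg b x y (Subtype.val '' K) r ε (hK.image continuous_subtype_val)
    (hK1 fun u hu => hsrc (hKx hu)) (hK1 fun u hu => hsrc'.1 (hKy hu)) hε] with c hc
  obtain ⟨hcK, δ, hδ, hc⟩ := hc
  refine ⟨fun u hu => hsrc'.2 (hcK (mem_image_of_mem _ hu)), δ, hδ, fun k hk u hu => ?_⟩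
  have hle := hc k hk u (mem_image_of_mem _ hu)
  have hmem : extChartAt I x u ∈ range I := ⟨chartAt H x u, rfl⟩
  have heq : ∀ a : U, iteratedFDerivWithin ℝ k
      (chartRep I I' ((g a).restrictOpens W W' (hgW a)) x y) (range I) (extChartAt I x u) =
      iteratedFDerivWithin ℝ k (chartRep I I' (g a) x y) (range I) (extChartAt I x u) := by
    intro a
    have h1 := chartRep_restrict_eventuallyEq (I := I) (I' := I') (f := g a)
      (f' := (g a).restrictOpens W W' (hgW a)) (fun _ => rfl) x y (hKx hu)
    exact h1.iteratedFDerivWithin_eq (h1.eq_of_nhdsWithin hmem) k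
  exact (le_of_eq (congrArg norm (congrArg₂ (· - ·) (heq c) (heq b)))).trans hle

end Families

/-! ### Manifolds over `B` -/

section ManifoldsOver

open TopologicalSpace

variable {E H E' H' E₁ H₁ F F' T B Z Z' : Type*}
  [NormedAddCommGroup E] [NormedSpace ℝ E] [TopologicalSpace H] {I : ModelWithCorners ℝ E H}
  [NormedAddCommGroup E'] [NormedSpace ℝ E'] [TopologicalSpace H'] {I' : ModelWithCorners ℝ E' H'}
  [NormedAddCommGroup E₁] [NormedSpace ℝ E₁] [TopologicalSpace H₁]
  [TopologicalSpace F] [ChartedSpace H F] [TopologicalSpace F'] [ChartedSpace H' F']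
  [TopologicalSpace T] [ChartedSpace H₁ T]
  [TopologicalSpace B] [TopologicalSpace Z] [TopologicalSpace Z']

/-- A manifold over `B` with fibre the smooth manifold `F` and total space `Z`: a fibre bundle
`F ↪ Z → B` with structure group `Diff(F)`, i.e. an atlas of local trivialisations whose transition
functions are continuous maps to `Diff(F)`. (Diffeomorphisms of a manifold with boundary
automatically leave the boundary invariant.) -/
structure ManifoldOver {E H : Type*} [NormedAddCommGroup E] [NormedSpace ℝ E] [TopologicalSpace H]
    (I : ModelWithCorners ℝ E H) (F : Type*) [TopologicalSpace F] [ChartedSpace H F]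
    (B : Type*) [TopologicalSpace B] (Z : Type*) [TopologicalSpace Z] where
  /-- the bundle projection -/
  proj : Z → B
  /-- an atlas of local trivialisations -/
  atlas : Set (Trivialization F proj)
  exists_mem_atlas : ∀ b, ∃ e ∈ atlas, b ∈ e.baseSet
  isDiffFamily : ∀ e ∈ atlas, ∀ e' ∈ atlas,
    IsDiffFamily I I (e.baseSet ∩ e'.baseSet) (e.coordChange e')

/-- A local trivialisation of the manifold `P` over `B`: one which is compatible with the atlas. -/
def ManifoldOver.IsLocalTriv (P : ManifoldOver I F B Z) (e : Trivialization F P.proj) : Prop :=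
  ∀ e' ∈ P.atlas, IsDiffFamily I I (e.baseSet ∩ e'.baseSet) (e.coordChange e') ∧
    IsDiffFamily I I (e'.baseSet ∩ e.baseSet) (e'.coordChange e)

/-- An isomorphism of manifolds over `B`: a homeomorphism over `B` which in local trivialisations is
a continuous family of diffeomorphisms of the fibres. -/
structure ManifoldOver.IsIso (P : ManifoldOver I F B Z) (P' : ManifoldOver I' F' B Z')
    (Φ : Z ≃ₜ Z') : Prop where
  proj_eq : ∀ z, P'.proj (Φ z) = P.proj z
  isDiffFamily : ∀ e ∈ P.atlas, ∀ e' ∈ P'.atlas, IsDiffFamily I I' (e.baseSet ∩ e'.baseSet)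
    (fun b x => (e' (Φ (e.toOpenPartialHomeomorph.symm (b, x)))).2)

/-- The local trivialisation `e × id` of `Z × T → B`. -/
def Bundle.Trivialization.prodFibre {proj : Z → B} (e : Trivialization F proj) (T : Type*)
    [TopologicalSpace T] : Trivialization (F × T) (fun p : Z × T => proj p.1) where
  toFun p := ((e p.1).1, ((e p.1).2, p.2))
  invFun q := (e.toOpenPartialHomeomorph.symm (q.1, q.2.1), q.2.2)
  source := (fun p : Z × T => proj p.1) ⁻¹' e.baseSet
  target := e.baseSet ×ˢ univ
  map_source' p hp := ⟨by rw [e.coe_fst' hp]; exact hp, mem_univ _⟩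
  map_target' q hq := by
    change proj _ ∈ e.baseSet
    rw [e.proj_symm_apply' hq.1]
    exact hq.1
  left_inv' p hp := Prod.ext (e.toOpenPartialHomeomorph.left_inv (e.mem_source.2 hp)) rfl
  right_inv' q hq := by
    have := e.apply_symm_apply' hq.1 (x := q.2.1)
    refine Prod.ext ?_ (Prod.ext ?_ rfl)
    · exact (Prod.ext_iff.1 this).1
    · exact (Prod.ext_iff.1 this).2
  open_source := by
    have : (fun p : Z × T => proj p.1) ⁻¹' e.baseSet = Prod.fst ⁻¹' e.source := by
      rw [e.source_eq]; rfl
    rw [this]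
    exact e.open_source.preimage continuous_fst
  open_target := e.open_baseSet.prod isOpen_univ
  continuousOn_toFun := by
    have h : ContinuousOn (fun p : Z × T => e p.1)
        ((fun p : Z × T => proj p.1) ⁻¹' e.baseSet) :=
      ContinuousOn.comp (t := e.source) e.toOpenPartialHomeomorph.continuousOn continuousOn_fst
        (fun p hp => e.mem_source.2 hp)
    exact h.fst.prodMk (h.snd.prodMk continuousOn_snd)
  continuousOn_invFun := by
    refine ContinuousOn.prodMk ?_ (Continuous.continuousOn (by fun_prop))
    refine ContinuousOn.comp (t := e.target) e.toOpenPartialHomeomorph.continuousOn_symm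
      (f := fun q : B × F × T => (q.1, q.2.1)) (Continuous.continuousOn (by fun_prop)) ?_
    intro q hq
    exact e.mem_target.2 hq.1
  baseSet := e.baseSet
  open_baseSet := e.open_baseSet
  source_eq := rfl
  target_eq := rfl
  proj_toFun p hp := e.coe_fst' hp

/-- The product `Z × T` of a manifold over `B` with a manifold `T`; its fibre is `F × T`. -/
def ManifoldOver.prod [IsManifold I ∞ F] (P : ManifoldOver I F B Z)
    (J : ModelWithCorners ℝ E₁ H₁) (T : Type*) [TopologicalSpace T] [ChartedSpace H₁ T]
    [IsManifold J ∞ T] : ManifoldOver (I.prod J) (F × T) B (Z × T) where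
  proj p := P.proj p.1
  atlas := {e | ∃ e₀ ∈ P.atlas, e = e₀.prodFibre T}
  exists_mem_atlas b := by
    obtain ⟨e, he, hb⟩ := P.exists_mem_atlas b
    exact ⟨_, ⟨e, he, rfl⟩, hb⟩
  isDiffFamily := by
    rintro _ ⟨e, he, rfl⟩ _ ⟨e', he', rfl⟩
    exact (P.isDiffFamily e he e' he').prod_id J

/-- `A` exhibits the subset `S` of `Z` as a submanifold (sub-bundle) with fibre `N ⊆ F` of the
manifold `P` over `B`: `A` is an atlas of local trivialisations of `P` which identify `S` with
`N`, so that its transition functions are continuous maps to the group of diffeomorphisms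
of `F` that preserve `N`. -/
structure ManifoldOver.IsSubmanifoldAtlas (P : ManifoldOver I F B Z) (N : Set F) (S : Set Z)
    (A : Set (Trivialization F P.proj)) : Prop where
  exists_mem : ∀ b, ∃ e ∈ A, b ∈ e.baseSet
  isLocalTriv : ∀ e ∈ A, P.IsLocalTriv e
  isDiffFamily : ∀ e ∈ A, ∀ e' ∈ A, IsDiffFamily I I (e.baseSet ∩ e'.baseSet) (e.coordChange e')
  mem_iff : ∀ e ∈ A, ∀ z, P.proj z ∈ e.baseSet → (z ∈ S ↔ (e z).2 ∈ N)

theorem Bundle.Trivialization.symm_mem_of_mem_iff {proj : Z → B} (e : Trivialization F proj)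
    {N : Set F} {S : Set Z} (h : ∀ z, proj z ∈ e.baseSet → (z ∈ S ↔ (e z).2 ∈ N)) {b : B}
    (hb : b ∈ e.baseSet) {x : N} : e.toOpenPartialHomeomorph.symm (b, (x : F)) ∈ S := by
  rw [h _ (by rwa [e.proj_symm_apply' hb]), e.apply_symm_apply' hb]
  exact x.2

open Classical in
/-- The local trivialisation `S → B` with fibre `N` induced by a trivialisation `e` of `Z → B` which
identifies `S` with `N`. The values outside of `e.source` and `e.target` are irrelevant. -/
def Bundle.Trivialization.restrictSub {proj : Z → B} (e : Trivialization F proj) (N : Set F)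
    (S : Set Z) (h : ∀ z, proj z ∈ e.baseSet → (z ∈ S ↔ (e z).2 ∈ N))
    (hN : S → Nonempty N) (hS : B × N → Nonempty S) :
    Trivialization N (fun z : S => proj z) where
  toFun z := ((e z).1, if hz : (e z).2 ∈ N then ⟨(e z).2, hz⟩ else (hN z).some)
  invFun q :=
    if hq : e.toOpenPartialHomeomorph.symm (q.1, q.2) ∈ S then ⟨_, hq⟩ else (hS q).some
  source := (fun z : S => proj z) ⁻¹' e.baseSet
  target := e.baseSet ×ˢ univ
  map_source' z hz := ⟨by rw [e.coe_fst' hz]; exact hz, mem_univ _⟩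
  map_target' q hq := by
    rw [dif_pos (e.symm_mem_of_mem_iff h hq.1)]
    change proj (e.toOpenPartialHomeomorph.symm (q.1, (q.2 : F))) ∈ e.baseSet
    rw [e.proj_symm_apply' hq.1]
    exact hq.1
  left_inv' z hz := by
    have hz' : (e z).2 ∈ N := (h z hz).1 z.2
    have h1 : e.toOpenPartialHomeomorph.symm ((e z).1, (e z).2) = z :=
      e.toOpenPartialHomeomorph.left_inv (e.mem_source.2 hz)
    apply Subtype.ext
    simp only [dif_pos hz', h1, Subtype.coe_prop, dif_pos]
  right_inv' q hq := by
    have hq' := e.symm_mem_of_mem_iff h hq.1 (x := q.2)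
    have h1 := e.apply_symm_apply' hq.1 (x := (q.2 : F))
    rw [dif_pos hq']
    refine Prod.ext ?_ (Subtype.ext ?_)
    · simp only [h1]
    · simp only [h1, Subtype.coe_prop, dif_pos]
  open_source := by
    have : (fun z : S => proj z) ⁻¹' e.baseSet = Subtype.val ⁻¹' e.source := by
      rw [e.source_eq]; rfl
    rw [this]
    exact e.open_source.preimage continuous_subtype_val
  open_target := e.open_baseSet.prod isOpen_univ
  continuousOn_toFun := by
    have hc : ContinuousOn (fun z : S => e z) ((fun z : S => proj z) ⁻¹' e.baseSet) :=
      ContinuousOn.comp (t := e.source) e.toOpenPartialHomeomorph.continuousOn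
        continuous_subtype_val.continuousOn (fun z hz => e.mem_source.2 hz)
    refine hc.fst.prodMk (Topology.IsInducing.subtypeVal.continuousOn_iff.2 ?_)
    refine hc.snd.congr fun z hz => ?_
    simp only [Function.comp_apply, dif_pos ((h z hz).1 z.2)]
  continuousOn_invFun := by
    have hc : ContinuousOn (fun q : B × N => e.toOpenPartialHomeomorph.symm (q.1, (q.2 : F)))
        (e.baseSet ×ˢ univ) :=
      ContinuousOn.comp (t := e.target) e.toOpenPartialHomeomorph.continuousOn_symm
        (f := fun q : B × N => (q.1, (q.2 : F))) (Continuous.continuousOn (by fun_prop))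
        (fun q hq => e.mem_target.2 hq.1)
    refine Topology.IsInducing.subtypeVal.continuousOn_iff.2 (hc.congr fun q hq => ?_)
    simp only [Function.comp_apply, dif_pos (e.symm_mem_of_mem_iff h hq.1 (x := q.2))]
  baseSet := e.baseSet
  open_baseSet := e.open_baseSet
  source_eq := rfl
  target_eq := rfl
  proj_toFun z hz := e.coe_fst' hz

variable {P : ManifoldOver I F B Z} {N : Set F} {S : Set Z} {A : Set (Trivialization F P.proj)}

theorem ManifoldOver.IsSubmanifoldAtlas.nonempty_fibre (hA : P.IsSubmanifoldAtlas N S A) (z : S) :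
    Nonempty N := by
  obtain ⟨e, he, hb⟩ := hA.exists_mem (P.proj z)
  exact ⟨⟨_, (hA.mem_iff e he z hb).1 z.2⟩⟩

theorem ManifoldOver.IsSubmanifoldAtlas.nonempty_total (hA : P.IsSubmanifoldAtlas N S A)
    (q : B × N) : Nonempty S := by
  obtain ⟨e, he, hb⟩ := hA.exists_mem q.1
  exact ⟨⟨_, e.symm_mem_of_mem_iff (hA.mem_iff e he) hb (x := q.2)⟩⟩

/-- A submanifold with open fibre `W ⊆ F` is itself a manifold over `B`; its local trivialisations
are the restrictions of those of the ambient manifold over `B`. -/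
def ManifoldOver.restrict (P : ManifoldOver I F B Z) {W : Opens F} {S : Set Z}
    {A : Set (Trivialization F P.proj)} (hA : P.IsSubmanifoldAtlas W S A) :
    ManifoldOver I W B S where
  proj z := P.proj z
  atlas := {e | ∃ (e₀ : Trivialization F P.proj) (h : e₀ ∈ A),
    e = e₀.restrictSub W S (hA.mem_iff e₀ h) hA.nonempty_fibre hA.nonempty_total}
  exists_mem_atlas b := by
    obtain ⟨e, he, hb⟩ := hA.exists_mem b
    exact ⟨_, ⟨e, he, rfl⟩, hb⟩
  isDiffFamily := by
    rintro _ ⟨e, he, rfl⟩ _ ⟨e', he', rfl⟩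
    refine (hA.isDiffFamily e he e' he').restrictOpens (fun b hb x => ?_) (fun b hb x => ?_)
    · have h1 : P.proj (e.toOpenPartialHomeomorph.symm (b, x)) = b := e.proj_symm_apply' hb.1
      have h2 := hA.mem_iff e he (e.toOpenPartialHomeomorph.symm (b, x)) (h1.symm ▸ hb.1)
      have h3 := hA.mem_iff e' he' (e.toOpenPartialHomeomorph.symm (b, x)) (h1.symm ▸ hb.2)
      rw [e.apply_symm_apply' hb.1] at h2
      exact h3.symm.trans h2
    · have hmem : e.toOpenPartialHomeomorph.symm (b, (x : F)) ∈ S :=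
        e.symm_mem_of_mem_iff (hA.mem_iff e he) hb.1
      have h1 : P.proj (e.toOpenPartialHomeomorph.symm (b, (x : F))) = b := e.proj_symm_apply' hb.1
      have h2 := (hA.mem_iff e' he' _ (h1.symm ▸ hb.2)).1 hmem
      have h3 : (e.restrictSub W S (hA.mem_iff e he) hA.nonempty_fibre
          hA.nonempty_total).toOpenPartialHomeomorph.symm (b, x) = ⟨_, hmem⟩ := dif_pos hmem
      unfold Trivialization.coordChange
      rw [h3]
      exact congrArg Subtype.val (dif_pos h2)

end ManifoldsOver

/-! ### Boundaries over `B` and collars -/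

section Collars

open Manifold

/-- The map from `[0,1)` to the closed half-line `{x : ℝ¹ | 0 ≤ x₀}`. -/
def icoToHalfSpace (t : Ico (0 : ℝ) 1) : EuclideanHalfSpace 1 :=
  ⟨!₂[(t : ℝ)], t.2.1⟩

theorem isOpenEmbedding_icoToHalfSpace : Topology.IsOpenEmbedding icoToHalfSpace := by
  have hval : Continuous fun p : EuclideanHalfSpace 1 => p.1 0 := by
    have h1 : Continuous fun p : EuclideanHalfSpace 1 => p.1 := continuous_subtype_val
    fun_prop
  have hcont : Continuous icoToHalfSpace := by
    refine Continuous.subtype_mk ?_ _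
    fun_prop
  have hrange : range icoToHalfSpace = {p : EuclideanHalfSpace 1 | p.1 0 < 1} := by
    ext p
    constructor
    · rintro ⟨t, rfl⟩
      exact t.2.2
    · intro hp
      refine ⟨⟨p.1 0, p.2, hp⟩, Subtype.ext ?_⟩
      ext i
      fin_cases i
      rfl
  refine ⟨Topology.IsEmbedding.mk ?_ ?_, ?_⟩
  · refine Topology.IsInducing.of_comp hcont hval ?_
    exact Topology.IsInducing.subtypeVal
  · intro s t h
    exact Subtype.ext (congrArg (fun p : EuclideanHalfSpace 1 => p.1 0) h)
  · rw [hrange]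
    exact isOpen_lt hval continuous_const

/-- The standard smooth structure (with boundary) on the interval `[0,1)`. -/
instance icoChartedSpace : ChartedSpace (EuclideanHalfSpace 1) (Ico (0 : ℝ) 1) :=
  isOpenEmbedding_icoToHalfSpace.singletonChartedSpace

instance icoIsManifold : IsManifold (𝓡∂ 1) ∞ (Ico (0 : ℝ) 1) :=
  isOpenEmbedding_icoToHalfSpace.isManifold_singleton

variable {M X B 𝓜 𝓧 : Type*} [TopologicalSpace M] [TopologicalSpace X] [TopologicalSpace B]
  [TopologicalSpace 𝓜] [TopologicalSpace 𝓧]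

/-- `ι : M → X` identifies the manifold `M` with the boundary of the manifold with boundary `X`. -/
structure IsBoundaryInclusion (n : ℕ) [ChartedSpace (EuclideanSpace ℝ (Fin n)) M]
    [ChartedSpace (EuclideanHalfSpace (n + 1)) X] (ι : M → X) : Prop where
  isSmoothEmbedding : IsSmoothEmbedding (𝓡 n) (𝓡∂ (n + 1)) ∞ ι
  range_eq : range ι = (𝓡∂ (n + 1)).boundary X

/-- Let `ι : M → X` be the inclusion of the boundary. The map `j : 𝓜 → 𝓧` identifies the
manifold `P𝓜` over `B` with the boundary over `B` of the manifold `P𝓧` over `B`, i.e. with the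
submanifold induced by `ι`: in suitable local trivialisations, `j` is the map `id × ι`. -/
structure IsBoundaryOver {n : ℕ} [ChartedSpace (EuclideanSpace ℝ (Fin n)) M]
    [ChartedSpace (EuclideanHalfSpace (n + 1)) X] (ι : M → X) (P𝓜 : ManifoldOver (𝓡 n) M B 𝓜)
    (P𝓧 : ManifoldOver (𝓡∂ (n + 1)) X B 𝓧) (j : 𝓜 → 𝓧) : Prop where
  proj_eq : ∀ z, P𝓧.proj (j z) = P𝓜.proj z
  exists_localTriv : ∀ b, ∃ e₀ e, P𝓜.IsLocalTriv e₀ ∧ P𝓧.IsLocalTriv e ∧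
    b ∈ e₀.baseSet ∧ b ∈ e.baseSet ∧
    ∀ z, P𝓜.proj z ∈ e₀.baseSet → P𝓜.proj z ∈ e.baseSet → (e (j z)).2 = ι (e₀ z).2

/-- `c : M × [0,1) → X` is an (open) collar of the boundary `ι : M → X`: a diffeomorphism onto an
open subset of `X` which restricts to `ι` on `M × {0}`. -/
structure IsCollar (n : ℕ) [ChartedSpace (EuclideanSpace ℝ (Fin n)) M]
    [ChartedSpace (EuclideanHalfSpace (n + 1)) X] (ι : M → X) (c : M × Ico (0 : ℝ) 1 → X) : Prop where
  apply_zero : ∀ m, c (m, 0) = ι m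
  injective : Function.Injective c
  isLocalDiffeomorph : IsLocalDiffeomorph ((𝓡 n).prod (𝓡∂ 1)) (𝓡∂ (n + 1)) ∞ c

/-- `φ : M × [0,1] → X` is a closed collar of the boundary `ι : M → X`, with interior part `W`:
it is a smooth embedding which restricts to `ι` on `M × {0}`, maps `M × [0,1)` onto the
open set `W`, and has the closure of `W` as its image. -/
structure IsClosedCollar (n : ℕ) [ChartedSpace (EuclideanSpace ℝ (Fin n)) M]
    [ChartedSpace (EuclideanHalfSpace (n + 1)) X] (ι : M → X) (W : TopologicalSpace.Opens X)
    (φ : M × Icc (0 : ℝ) 1 → X) : Prop where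
  apply_zero : ∀ m, φ (m, 0) = ι m
  isEmbedding : Topology.IsEmbedding φ
  contMDiff : ContMDiff ((𝓡 n).prod (𝓡∂ 1)) (𝓡∂ (n + 1)) ∞ φ
  injective_mfderiv : ∀ q,
    Function.Injective (mfderiv ((𝓡 n).prod (𝓡∂ 1)) (𝓡∂ (n + 1)) φ q)
  image_eq : φ '' {q | (q.2 : ℝ) < 1} = W
  range_eq : range φ = closure (W : Set X)

/-- The transition functions of the local trivialisations in `A`, restricted to the compact
submanifold `K = φ (M × [0,1])` of `X`, are continuous maps to the group `Diff(K, M)` of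
diffeomorphisms of `K` that leave `M = φ (M × {0})` invariant. (Here `K` is
identified with `M × [0,1]` by means of `φ`.) -/
def HasCollarStructureGroup {n : ℕ} [ChartedSpace (EuclideanSpace ℝ (Fin n)) M]
    [ChartedSpace (EuclideanHalfSpace (n + 1)) X] (P𝓧 : ManifoldOver (𝓡∂ (n + 1)) X B 𝓧)
    (A : Set (Trivialization X P𝓧.proj)) (φ : M × Icc (0 : ℝ) 1 → X) : Prop :=
  ∀ e ∈ A, ∀ e' ∈ A, ∃ h : B → M × Icc (0 : ℝ) 1 → M × Icc (0 : ℝ) 1,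
    IsDiffFamily ((𝓡 n).prod (𝓡∂ 1)) ((𝓡 n).prod (𝓡∂ 1)) (e.baseSet ∩ e'.baseSet) h ∧
    ∀ b ∈ e.baseSet ∩ e'.baseSet, ∀ q,
      e.coordChange e' b (φ q) = φ (h b q) ∧ ((h b q).2 = 0 ↔ q.2 = 0)

end Collars

end

set_option linter.unusedSectionVars false

/-! A collar is usually obtained from the flow of an inward vector field. No flow is needed here.
Suppose that a smooth map `C : 𝓜 × [0,1) → 𝓧` over `B` extends `j` and leaves the boundary with
positive normal velocity. Its fibre derivative along `𝓜 × {0}` is then invertible, so `C` is a local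
diffeomorphism there. As `𝓜` is compact, `C` is injective with smooth inverse for short times, and
rescaling time gives a collar `Φ` over `B` (`exists_isCollarOver`).

Such a `C` is made from the stationary map `j ∘ Prod.fst` by composing with finitely many pushes.
Each push moves points inwards inside one chart of the fibre and is cut off in `B`
(`exists_chart_push`, `IsPreCollar.exists_push`). Initial velocities add up under these
compositions, and the sign of the normal component does not depend on the local trivialisation, so
no push spoils an earlier one.

The transition functions are only continuous in `b`. `MFamAt` therefore asks for joint continuity in
`(b, x)` of all derivatives along the fibre. On locally compact fibres this amounts to continuity
for the `C^∞` topology (`mfamAt_of_continuous_diffeo`, `continuous_diffeo_of_mfamAt`). The analytic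
core is the inverse function theorem for such families on manifolds with boundary,
`MFamAt.inverse_function`. It rests on `halfSpace_inverse_quantitative`, which extends a map
linearly across the boundary, and on `FamAt.of_local_inverse`, which bootstraps regularity from `Dg
= (Df ∘ g)⁻¹`.

There remains the structure group. Fix a collar `c` of the fibre, which is the case of a one-point
base. In a trivialisation where `j` becomes `ι`, let `σ b` be the time coordinate of `Φ`, seen
through `c`. It vanishes at `t = 0`, and near the boundary it has positive `t`-derivative and is at
most `C * t` (`IsCollarOver.exists_time_bounds`). Hence for small `κ` there is an increasing
interpolation between `κ * σ b` near the boundary and `t` further away (`exists_collar_stretch`).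
Changing the trivialisation by the resulting diffeomorphism, extended by the identity, carries level
`t` of `Φ` to level `κ * t` of `c` (`IsCollarOver.exists_straighten`). Since `B` is compact, one `κ`
serves for a whole atlas. Transition functions of this atlas preserve the small levels of `c`, so
they restrict to the closed collar, where they keep the collar parameter and in particular the
boundary (`IsGoodCollar.hasCollarStructureGroup`). The submanifold `𝓦` consists of the levels of `Φ`
below some small `s`. -/

noncomputable section

/-! ### Continuous families of smooth maps between normed spaces -/

section FamAt

variable {B B' E F G : Type*} [TopologicalSpace B] [TopologicalSpace B']
  [NormedAddCommGroup E] [NormedSpace ℝ E] [NormedAddCommGroup F] [NormedSpace ℝ F]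
  [NormedAddCommGroup G] [NormedSpace ℝ G]
  {N : ℕ} {s : Set E} {t : Set F} {f : B → E → F} {b₀ : B} {x₀ : E}

/-- Near `(b₀, x₀)`, the maps `f b` are of class `C^N` on `s`, and their derivatives of order at most
`N` depend continuously on both variables at `(b₀, x₀)`. -/
def FamAt (N : ℕ) (s : Set E) (f : B → E → F) (b₀ : B) (x₀ : E) : Prop :=
  (∀ᶠ p : B × E in 𝓝 b₀ ×ˢ 𝓝[s] x₀, ContDiffWithinAt ℝ N (f p.1) s p.2) ∧
    ∀ k ≤ N, Tendsto (fun p : B × E => iteratedFDerivWithin ℝ k (f p.1) s p.2)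
      (𝓝 b₀ ×ˢ 𝓝[s] x₀) (𝓝 (iteratedFDerivWithin ℝ k (f b₀) s x₀))

/-- `FamAt` is an eventual condition in `(b, x)`, whereas a derivative within `s` depends on the
germ of a single map `f b`. This converts the former into the latter at all nearby points. -/
theorem eventually_prod_nhdsWithin_slice {P : B × E → Prop}
    (h : ∀ᶠ p in 𝓝 b₀ ×ˢ 𝓝[s] x₀, P p) :
    ∀ᶠ p in 𝓝 b₀ ×ˢ 𝓝[s] x₀, ∀ᶠ x in 𝓝[s] p.2, P (p.1, x) := by
  rw [← nhdsWithin_univ b₀, ← nhdsWithin_prod_eq] at *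
  filter_upwards [eventually_eventually_nhdsWithin.2 h] with p hp
  refine Tendsto.eventually (l₂ := 𝓝[univ ×ˢ s] p) ?_ hp
  refine tendsto_nhdsWithin_iff.2 ⟨?_, ?_⟩
  · exact (tendsto_const_nhds.prodMk_nhds tendsto_id).mono_left nhdsWithin_le_nhds
  · filter_upwards [self_mem_nhdsWithin] with x hx using ⟨mem_univ _, hx⟩

theorem eventually_snd_mem_prod_nhdsWithin :
    ∀ᶠ p : B × E in 𝓝 b₀ ×ˢ 𝓝[s] x₀, p.2 ∈ s :=
  tendsto_snd.eventually self_mem_nhdsWithin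

theorem eventually_prod_nhdsWithin_self {P : B × E → Prop} (hx : x₀ ∈ s)
    (h : ∀ᶠ p in 𝓝 b₀ ×ˢ 𝓝[s] x₀, P p) : P (b₀, x₀) := by
  rw [← nhdsWithin_univ b₀, ← nhdsWithin_prod_eq] at h
  exact h.self_of_nhdsWithin (show (b₀, x₀) ∈ univ ×ˢ s from ⟨mem_univ _, hx⟩)

theorem FamAt.contDiffWithinAt (h : FamAt N s f b₀ x₀) (hx : x₀ ∈ s) :
    ContDiffWithinAt ℝ N (f b₀) s x₀ :=
  eventually_prod_nhdsWithin_self hx h.1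

theorem FamAt.congr {g : B → E → F} (h : FamAt N s f b₀ x₀) (hx : x₀ ∈ s)
    (hfg : ∀ᶠ p in 𝓝 b₀ ×ˢ 𝓝[s] x₀, f p.1 p.2 = g p.1 p.2) : FamAt N s g b₀ x₀ := by
  have h1 : ∀ᶠ p in 𝓝 b₀ ×ˢ 𝓝[s] x₀, f p.1 =ᶠ[𝓝[s] p.2] g p.1 :=
    eventually_prod_nhdsWithin_slice hfg
  refine ⟨?_, fun k hk => ?_⟩
  · filter_upwards [h.1, h1, hfg] with p hp h1 h2
    exact hp.congr_of_eventuallyEq h1.symm h2.symm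
  · have e0 : iteratedFDerivWithin ℝ k (f b₀) s x₀ = iteratedFDerivWithin ℝ k (g b₀) s x₀ :=
      Filter.EventuallyEq.iteratedFDerivWithin_eq
        (eventually_prod_nhdsWithin_self hx h1) (eventually_prod_nhdsWithin_self hx hfg) k
    rw [← e0]
    refine (h.2 k hk).congr' ?_
    filter_upwards [h1, hfg] with p h1 h2
    exact Filter.EventuallyEq.iteratedFDerivWithin_eq h1 h2 k

theorem FamAt.tendsto (h : FamAt N s f b₀ x₀) :
    Tendsto (fun p : B × E => f p.1 p.2) (𝓝 b₀ ×ˢ 𝓝[s] x₀) (𝓝 (f b₀ x₀)) := by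
  have h0 := h.2 0 (Nat.zero_le _)
  have := ((continuousMultilinearCurryFin0 ℝ E F).continuous.tendsto _).comp h0
  simpa [Function.comp_def, iteratedFDerivWithin_zero_eq_comp] using this

theorem FamAt.param {f : B → E → F} {β : B' → B} {c₀ : B'} (hβ : ContinuousAt β c₀)
    (h : FamAt N s f (β c₀) x₀) : FamAt N s (fun c => f (β c)) c₀ x₀ := by
  have ht : Tendsto (fun p : B' × E => (β p.1, p.2)) (𝓝 c₀ ×ˢ 𝓝[s] x₀)
      (𝓝 (β c₀) ×ˢ 𝓝[s] x₀) := Tendsto.prodMap hβ tendsto_id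
  exact ⟨ht.eventually h.1, fun k hk => (h.2 k hk).comp ht⟩

theorem famAt_const {f : E → F} (hs : UniqueDiffOn ℝ s) (hx : x₀ ∈ s)
    (h : ContDiffWithinAt ℝ N f s x₀) : FamAt N s (fun _ : B => f) b₀ x₀ := by
  refine ⟨?_, fun k hk => ?_⟩
  · have := h.eventually (by simp)
    rw [insert_eq_of_mem hx] at this
    exact tendsto_snd.eventually this
  · have h1 : ContinuousWithinAt (iteratedFDerivWithin ℝ k f s) s x₀ := by
      obtain ⟨u, hu, hxu, h2⟩ := h.contDiffOn' le_rfl (by simp)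
      rw [insert_eq_of_mem hx] at h2
      have h3 := (h2.continuousOn_iteratedFDerivWithin (m := k) (by exact_mod_cast hk) (hs.inter hu)) x₀
        ⟨hx, hxu⟩
      have h4 : ContinuousWithinAt (iteratedFDerivWithin ℝ k f (s ∩ u)) s x₀ :=
        h3.mono_of_mem_nhdsWithin (inter_mem_nhdsWithin _ (hu.mem_nhds hxu))
      refine h4.congr_of_eventuallyEq ?_ (iteratedFDerivWithin_inter_open hu hxu).symm
      filter_upwards [mem_nhdsWithin_of_mem_nhds (hu.mem_nhds hxu)] with y hy
      exact (iteratedFDerivWithin_inter_open hu hy).symm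
    exact Tendsto.comp (g := iteratedFDerivWithin ℝ k f s) h1 tendsto_snd

/-- Nothing is differentiated in the parameter, so a function of `b` alone need only be continuous.
-/
theorem famAt_of_continuousAt {f : B → F} (hf : ContinuousAt f b₀) : FamAt N s (fun b (_ : E) => f b) b₀ x₀ := by
  refine ⟨Eventually.of_forall fun _ => contDiffWithinAt_const, fun k _ => ?_⟩
  rcases k with _ | k
  · rw [iteratedFDerivWithin_zero_eq_comp]
    have : Tendsto (fun p : B × E => (continuousMultilinearCurryFin0 ℝ E F).symm (f p.1))
        (𝓝 b₀ ×ˢ 𝓝[s] x₀) (𝓝 ((continuousMultilinearCurryFin0 ℝ E F).symm (f b₀))) :=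
      ((continuousMultilinearCurryFin0 ℝ E F).symm.continuous.tendsto _).comp
        (Tendsto.comp hf tendsto_fst)
    exact this
  · simp only [iteratedFDerivWithin_succ_const]
    exact tendsto_const_nhds

theorem FamAt.prodMk {g : B → E → G} (hs : UniqueDiffOn ℝ s) (hx : x₀ ∈ s)
    (hf : FamAt N s f b₀ x₀) (hg : FamAt N s g b₀ x₀) :
    FamAt N s (fun b x => (f b x, g b x)) b₀ x₀ := by
  refine ⟨?_, fun k hk => ?_⟩
  · filter_upwards [hf.1, hg.1] with p h1 h2 using h1.prodMk h2
  · have hk' : ((k : ℕ) : ℕ∞ω) ≤ N := by exact_mod_cast hk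
    rw [iteratedFDerivWithin_prodMk (hf.contDiffWithinAt hx) (hg.contDiffWithinAt hx) hs hx hk']
    have h1 := ((ContinuousMultilinearMap.prodL ℝ (fun _ : Fin k => E) F G).continuous.tendsto
      (iteratedFDerivWithin ℝ k (f b₀) s x₀, iteratedFDerivWithin ℝ k (g b₀) s x₀)).comp
      ((hf.2 k hk).prodMk_nhds (hg.2 k hk))
    refine h1.congr' ?_
    filter_upwards [hf.1, hg.1, eventually_snd_mem_prod_nhdsWithin] with p h1 h2 h3
    rw [iteratedFDerivWithin_prodMk h1 h2 hs h3 hk']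
    rfl

/-- By Faà di Bruno, the `k`-th derivative of the composite is a fixed polynomial expression in the
derivatives of order at most `k` of the two maps, and joint continuity passes through it. -/
theorem FamAt.comp {g : B → F → G} (hs : UniqueDiffOn ℝ s) (ht : UniqueDiffOn ℝ t) (hx : x₀ ∈ s)
    (hg : FamAt N t g b₀ (f b₀ x₀)) (hf : FamAt N s f b₀ x₀)
    (hst : ∀ᶠ p in 𝓝 b₀ ×ˢ 𝓝[s] x₀, f p.1 p.2 ∈ t) :
    FamAt N s (fun b x => g b (f b x)) b₀ x₀ := by
  have hlim : Tendsto (fun p : B × E => (p.1, f p.1 p.2)) (𝓝 b₀ ×ˢ 𝓝[s] x₀)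
      (𝓝 b₀ ×ˢ 𝓝[t] (f b₀ x₀)) :=
    tendsto_fst.prodMk (tendsto_nhdsWithin_iff.2 ⟨hf.tendsto, hst⟩)
  have hst' : ∀ᶠ p in 𝓝 b₀ ×ˢ 𝓝[s] x₀, ∀ᶠ x in 𝓝[s] p.2, f p.1 x ∈ t :=
    eventually_prod_nhdsWithin_slice hst
  have hg1 := hlim.eventually hg.1
  refine ⟨?_, fun k hk => ?_⟩
  · filter_upwards [hf.1, hg1, hst'] with p h1 h2 h3
    exact h2.comp_of_preimage_mem_nhdsWithin p.2 h1 h3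
  · have hk' : ((k : ℕ) : ℕ∞ω) ≤ N := by exact_mod_cast hk
    have key : ∀ᶠ p in 𝓝 b₀ ×ˢ 𝓝[s] x₀, iteratedFDerivWithin ℝ k (fun x => g p.1 (f p.1 x)) s p.2 =
        (ftaylorSeriesWithin ℝ (g p.1) t (f p.1 p.2)).taylorComp
          (ftaylorSeriesWithin ℝ (f p.1) s p.2) k := by
      filter_upwards [hf.1, hg1, hst', eventually_snd_mem_prod_nhdsWithin] with p h1 h2 h3 h4
      exact iteratedFDerivWithin_comp_of_eventually_mem h2 h1 ht hs h4 h3 hk'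
    rw [eventually_prod_nhdsWithin_self hx key]
    refine Tendsto.congr' (key.mono fun p hp => hp.symm) ?_
    simp only [FormalMultilinearSeries.taylorComp]
    refine tendsto_finsetSum _ fun c _ => ?_
    simp only [FormalMultilinearSeries.compAlongOrderedFinpartition]
    have h1 : Tendsto (fun p : B × E => iteratedFDerivWithin ℝ c.length (g p.1) t (f p.1 p.2))
        (𝓝 b₀ ×ˢ 𝓝[s] x₀) (𝓝 (iteratedFDerivWithin ℝ c.length (g b₀) t (f b₀ x₀))) :=
      (hg.2 c.length (c.length_le.trans hk)).comp hlim
    have h2 : Tendsto (fun p : B × E => fun i : Fin c.length =>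
        iteratedFDerivWithin ℝ (c.partSize i) (f p.1) s p.2) (𝓝 b₀ ×ˢ 𝓝[s] x₀)
        (𝓝 fun i => iteratedFDerivWithin ℝ (c.partSize i) (f b₀) s x₀) :=
      tendsto_pi_nhds.2 fun i => hf.2 _ ((c.partSize_le i).trans hk)
    have h3 : Continuous fun q : (F [×c.length]→L[ℝ] G) × (∀ i, E [×c.partSize i]→L[ℝ] F) =>
        c.compAlongOrderedFinpartitionL ℝ E F G q.1 q.2 := by
      fun_prop
    exact (h3.tendsto _).comp (h1.prodMk_nhds h2)

theorem FamAt.fderivWithin (hs : UniqueDiffOn ℝ s) (hx : x₀ ∈ s) (hf : FamAt (N + 1) s f b₀ x₀) :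
    FamAt N s (fun b => fderivWithin ℝ (f b) s) b₀ x₀ := by
  refine ⟨?_, fun k hk => ?_⟩
  · filter_upwards [hf.1, eventually_snd_mem_prod_nhdsWithin] with p h1 h2
    exact h1.fderivWithin_right hs (by simp) h2
  · have h1 := ((continuousMultilinearCurryRightEquiv' ℝ k E F).continuous.tendsto _).comp
      (hf.2 (k + 1) (by omega))
    have e : ∀ (b : B) (x : E), x ∈ s → (continuousMultilinearCurryRightEquiv' ℝ k E F)
        (iteratedFDerivWithin ℝ (k + 1) (f b) s x) =
        iteratedFDerivWithin ℝ k (fun y => _root_.fderivWithin ℝ (f b) s y) s x := by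
      intro b x hx
      rw [iteratedFDerivWithin_succ_eq_comp_right hs hx]
      simp
    rw [e _ _ hx] at h1
    refine h1.congr' ?_
    filter_upwards [eventually_snd_mem_prod_nhdsWithin] with p hp using e _ _ hp

/-- This raises the order by one. It is the inductive step for local inverses, whose derivative is
expressed through the inverse itself. -/
theorem FamAt.of_hasFDerivWithinAt {f' : B → E → E →L[ℝ] F} (hs : UniqueDiffOn ℝ s) (hx : x₀ ∈ s)
    (hlim : Tendsto (fun p : B × E => f p.1 p.2) (𝓝 b₀ ×ˢ 𝓝[s] x₀) (𝓝 (f b₀ x₀)))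
    (hd : ∀ᶠ p in 𝓝 b₀ ×ˢ 𝓝[s] x₀, HasFDerivWithinAt (f p.1) (f' p.1 p.2) s p.2)
    (hf' : FamAt N s f' b₀ x₀) : FamAt (N + 1) s f b₀ x₀ := by
  have hd' := eventually_prod_nhdsWithin_slice hd
  refine ⟨?_, fun k hk => ?_⟩
  · filter_upwards [hd', hf'.1, eventually_snd_mem_prod_nhdsWithin] with p h1 h2 h3
    have := (contDiffWithinAt_succ_iff_hasFDerivWithinAt' (𝕜 := ℝ) (n := (N : ℕ∞ω)) (f := f p.1)
      (s := s) (x := p.2) (by simp)).2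
    refine this ⟨{x | HasFDerivWithinAt (f p.1) (f' p.1 x) s x} ∩ s, ?_, ?_, by simp, f' p.1,
      fun x hx => hx.1, h2⟩
    · rw [insert_eq_of_mem h3]
      exact inter_mem h1 self_mem_nhdsWithin
    · rw [insert_eq_of_mem h3]
      exact inter_subset_right
  · rcases k with _ | k
    · rw [iteratedFDerivWithin_zero_eq_comp]
      exact ((continuousMultilinearCurryFin0 ℝ E F).symm.continuous.tendsto _).comp hlim
    · have e : ∀ᶠ p in 𝓝 b₀ ×ˢ 𝓝[s] x₀, iteratedFDerivWithin ℝ (k + 1) (f p.1) s p.2 =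
          (continuousMultilinearCurryRightEquiv' ℝ k E F).symm
            (iteratedFDerivWithin ℝ k (f' p.1) s p.2) := by
        filter_upwards [hd', hd, eventually_snd_mem_prod_nhdsWithin] with p h1 h0 h2
        rw [iteratedFDerivWithin_succ_eq_comp_right hs h2]
        simp only [Function.comp_apply]
        congr 1
        refine Filter.EventuallyEq.iteratedFDerivWithin_eq ?_ (h0.fderivWithin (hs _ h2)) k
        filter_upwards [h1, self_mem_nhdsWithin] with x hx hxs using hx.fderivWithin (hs _ hxs)
      rw [eventually_prod_nhdsWithin_self hx e]
      refine Tendsto.congr' (e.mono fun p hp => hp.symm) ?_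
      exact ((continuousMultilinearCurryRightEquiv' ℝ k E F).symm.continuous.tendsto _).comp
        (hf'.2 k (by omega))

end FamAt

/-! ### Continuous families of smooth maps between manifolds -/

section MFamAt

variable {B B' E H E' H' E'' H'' X Y Z : Type*} [TopologicalSpace B] [TopologicalSpace B']
  [NormedAddCommGroup E] [NormedSpace ℝ E] [TopologicalSpace H] {I : ModelWithCorners ℝ E H}
  [NormedAddCommGroup E'] [NormedSpace ℝ E'] [TopologicalSpace H'] {I' : ModelWithCorners ℝ E' H'}
  [NormedAddCommGroup E''] [NormedSpace ℝ E''] [TopologicalSpace H'']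
  {I'' : ModelWithCorners ℝ E'' H''}
  [TopologicalSpace X] [ChartedSpace H X] [TopologicalSpace Y] [ChartedSpace H' Y]
  [TopologicalSpace Z] [ChartedSpace H'' Z]
  {N : ℕ} {b₀ : B} {x₀ : X} {f : B → X → Y}

variable (I I') in
/-- Near `(b₀, x₀)`, the maps `f b` form a continuous family of smooth maps: all derivatives in
charts depend continuously on both variables. -/
def MFamAt (f : B → X → Y) (b₀ : B) (x₀ : X) : Prop :=
  ContinuousAt (fun p : B × X => f p.1 p.2) (b₀, x₀) ∧
    ∀ N, FamAt N (range I) (fun b => chartRep I I' (f b) x₀ (f b₀ x₀)) b₀ (extChartAt I x₀ x₀)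

theorem tendsto_prod_extChartAt {x u : X} (hu : u ∈ (chartAt H x).source) :
    Tendsto (fun p : B × X => (p.1, extChartAt I x p.2)) (𝓝 (b₀, u))
      (𝓝 b₀ ×ˢ 𝓝[range I] (extChartAt I x u)) := by
  rw [nhds_prod_eq]
  refine tendsto_fst.prodMk (Tendsto.comp ?_ tendsto_snd)
  rw [← extChartAt_source I] at hu
  exact (map_extChartAt_nhds' hu).le

theorem tendsto_prod_extChartAt_symm {x u : X} (hu : u ∈ (chartAt H x).source) :
    Tendsto (fun p : B × E => (p.1, (extChartAt I x).symm p.2))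
      (𝓝 b₀ ×ˢ 𝓝[range I] (extChartAt I x u)) (𝓝 (b₀, u)) := by
  rw [nhds_prod_eq]
  refine tendsto_fst.prodMk (Tendsto.comp ?_ tendsto_snd)
  rw [← extChartAt_source I] at hu
  exact (map_extChartAt_symm_nhdsWithin_range' hu).le

theorem eventually_snd_mem_extChartAt_target {x u : X} (hu : u ∈ (chartAt H x).source) :
    ∀ᶠ p : B × E in 𝓝 b₀ ×ˢ 𝓝[range I] (extChartAt I x u), p.2 ∈ (extChartAt I x).target := by
  rw [← extChartAt_source I] at hu
  exact tendsto_snd.eventually (extChartAt_target_mem_nhdsWithin' hu)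

theorem chartRep_extChartAt {g : X → Y} {x u : X} {y : Y} (hu : u ∈ (chartAt H x).source) :
    chartRep I I' g x y (extChartAt I x u) = extChartAt I' y (g u) := by
  simp only [chartRep, Function.comp_apply]
  rw [(extChartAt I x).left_inv (by rwa [extChartAt_source])]

/-- Coordinate changes are smooth and independent of `b`, so composing with them on both sides keeps
the derivatives jointly continuous. This frees `MFamAt` from the preferred charts in its definition.
-/
theorem famAt_chart_change [IsManifold I ∞ X] [IsManifold I' ∞ Y] {u x x' : X} {y y' : Y}
    (hc : ContinuousAt (fun p : B × X => f p.1 p.2) (b₀, u))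
    (hx : u ∈ (chartAt H x).source) (hx' : u ∈ (chartAt H x').source)
    (hy : f b₀ u ∈ (chartAt H' y).source) (hy' : f b₀ u ∈ (chartAt H' y').source)
    (h : FamAt N (range I) (fun b => chartRep I I' (f b) x y) b₀ (extChartAt I x u)) :
    FamAt N (range I) (fun b => chartRep I I' (f b) x' y') b₀ (extChartAt I x' u) := by
  have hmem : extChartAt I x' u ∈ range I := ⟨_, rfl⟩
  have hN : ((N : ℕ) : ℕ∞ω) ≤ ∞ := by exact_mod_cast le_top
  have hinv : (extChartAt I x').symm (extChartAt I x' u) = u :=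
    (extChartAt I x').left_inv (by rwa [extChartAt_source])
  have hT : FamAt N (range I) (fun _ : B => extChartAt I x ∘ (extChartAt I x').symm) b₀
      (extChartAt I x' u) := by
    refine famAt_const I.uniqueDiffOn hmem ?_
    refine (contDiffWithinAt_ext_coord_change x x' ?_).of_le hN
    rw [PartialEquiv.trans_source]
    refine ⟨(extChartAt I x').map_source (by rwa [extChartAt_source]), ?_⟩
    simp only [mem_preimage, hinv, extChartAt_source]
    exact hx
  have hTu : (extChartAt I x ∘ (extChartAt I x').symm) (extChartAt I x' u) = extChartAt I x u := by
    rw [Function.comp_apply, hinv]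
  have h1 : FamAt N (range I) (fun b v => chartRep I I' (f b) x y
      ((extChartAt I x ∘ (extChartAt I x').symm) v)) b₀ (extChartAt I x' u) := by
    refine FamAt.comp I.uniqueDiffOn I.uniqueDiffOn hmem (by rwa [hTu]) hT ?_
    exact Eventually.of_forall fun p => ⟨_, rfl⟩
  have hS : FamAt N (range I') (fun _ : B => extChartAt I' y' ∘ (extChartAt I' y).symm) b₀
      (chartRep I I' (f b₀) x y ((extChartAt I x ∘ (extChartAt I x').symm) (extChartAt I x' u))) := by
    have hfu : chartRep I I' (f b₀) x y (extChartAt I x u) = extChartAt I' y (f b₀ u) :=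
      chartRep_extChartAt hx
    rw [hTu, hfu]
    refine famAt_const I'.uniqueDiffOn ⟨_, rfl⟩ ?_
    refine (contDiffWithinAt_ext_coord_change y' y ?_).of_le hN
    rw [PartialEquiv.trans_source]
    refine ⟨(extChartAt I' y).map_source (by rwa [extChartAt_source]), ?_⟩
    simp only [mem_preimage]
    rw [(extChartAt I' y).left_inv (by rwa [extChartAt_source]), extChartAt_source]
    exact hy'
  have h2 := FamAt.comp I.uniqueDiffOn I'.uniqueDiffOn hmem hS h1
    (Eventually.of_forall fun p => ⟨_, rfl⟩)
  refine h2.congr hmem ?_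
  have hl := tendsto_prod_extChartAt_symm (I := I) (b₀ := b₀) hx'
  have hxn : ∀ᶠ p : B × X in 𝓝 (b₀, u), p.2 ∈ (chartAt H x).source :=
    continuousAt_snd.eventually ((chartAt H x).open_source.mem_nhds hx)
  have hyn := hc.eventually ((chartAt H' y).open_source.mem_nhds hy)
  filter_upwards [hl.eventually hxn, hl.eventually hyn] with p hp1 hp2
  simp only [chartRep, Function.comp_apply]
  rw [(extChartAt I x).left_inv (by rwa [extChartAt_source]),
    (extChartAt I' y).left_inv (by rwa [extChartAt_source])]

theorem MFamAt.famAt [IsManifold I ∞ X] [IsManifold I' ∞ Y] {u x : X} {y : Y}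
    (h : MFamAt I I' f b₀ u) (hx : u ∈ (chartAt H x).source)
    (hy : f b₀ u ∈ (chartAt H' y).source) :
    FamAt N (range I) (fun b => chartRep I I' (f b) x y) b₀ (extChartAt I x u) :=
  famAt_chart_change h.1 (mem_chart_source H u) hx (mem_chart_source H' _) hy (h.2 N)

theorem mfamAt_of_famAt [IsManifold I ∞ X] [IsManifold I' ∞ Y] {u x : X} {y : Y}
    (hc : ContinuousAt (fun p : B × X => f p.1 p.2) (b₀, u)) (hx : u ∈ (chartAt H x).source)
    (hy : f b₀ u ∈ (chartAt H' y).source)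
    (h : ∀ N, FamAt N (range I) (fun b => chartRep I I' (f b) x y) b₀ (extChartAt I x u)) :
    MFamAt I I' f b₀ u :=
  ⟨hc, fun N => famAt_chart_change hc hx (mem_chart_source H u) hy (mem_chart_source H' _) (h N)⟩

theorem MFamAt.continuousAt_fibre (h : MFamAt I I' f b₀ x₀) : ContinuousAt (f b₀) x₀ :=
  ContinuousAt.comp (f := fun x => (b₀, x)) h.1 (by fun_prop)

theorem MFamAt.contMDiffAt (h : MFamAt I I' f b₀ x₀) : ContMDiffAt I I' ∞ (f b₀) x₀ := by
  rw [contMDiffAt_iff]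
  refine ⟨h.continuousAt_fibre, contDiffWithinAt_infty.2 fun N => ?_⟩
  exact (h.2 N).contDiffWithinAt ⟨_, rfl⟩

theorem mfamAt_const {f : X → Y} (h : ContMDiffAt I I' ∞ f x₀) :
    MFamAt I I' (fun _ : B => f) b₀ x₀ := by
  refine ⟨ContinuousAt.comp (f := fun p : B × X => p.2) h.continuousAt continuousAt_snd,
    fun N => ?_⟩
  refine famAt_const I.uniqueDiffOn ⟨_, rfl⟩ ?_
  exact ((contMDiffAt_iff.1 h).2).of_le (by exact_mod_cast le_top)

theorem MFamAt.congr {g : B → X → Y} (h : MFamAt I I' f b₀ x₀)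
    (hfg : ∀ᶠ p : B × X in 𝓝 (b₀, x₀), f p.1 p.2 = g p.1 p.2) : MFamAt I I' g b₀ x₀ := by
  refine ⟨h.1.congr hfg, fun N => ?_⟩
  rw [← (show f b₀ x₀ = g b₀ x₀ from hfg.self_of_nhds)]
  refine (h.2 N).congr ⟨_, rfl⟩ ?_
  have hl := tendsto_prod_extChartAt_symm (I := I) (b₀ := b₀) (mem_chart_source H x₀)
  filter_upwards [hl.eventually hfg] with p hp
  simp only [chartRep, Function.comp_apply, hp]

theorem MFamAt.param {f : B → X → Y} {β : B' → B} {c₀ : B'} (hβ : ContinuousAt β c₀)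
    (h : MFamAt I I' f (β c₀) x₀) : MFamAt I I' (fun c => f (β c)) c₀ x₀ := by
  refine ⟨?_, fun N => FamAt.param
    (f := fun b => chartRep I I' (f b) x₀ (f (β c₀) x₀)) hβ (h.2 N)⟩
  refine ContinuousAt.comp (g := fun p : B × X => f p.1 p.2) (f := fun p : B' × X => (β p.1, p.2)) h.1 ?_
  exact (ContinuousAt.comp (f := fun p : B' × X => p.1) hβ continuousAt_fst).prodMk continuousAt_snd

theorem MFamAt.comp {g : B → Y → Z} (hg : MFamAt I' I'' g b₀ (f b₀ x₀)) (hf : MFamAt I I' f b₀ x₀) :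
    MFamAt I I'' (fun b x => g b (f b x)) b₀ x₀ := by
  refine ⟨ContinuousAt.comp (g := fun p : B × Y => g p.1 p.2) (f := fun p : B × X => (p.1, f p.1 p.2))
    hg.1 (continuousAt_fst.prodMk hf.1), fun N => ?_⟩
  have hmem : extChartAt I x₀ x₀ ∈ range I := ⟨_, rfl⟩
  have hg' := hg.2 N
  have e : extChartAt I' (f b₀ x₀) (f b₀ x₀) =
      chartRep I I' (f b₀) x₀ (f b₀ x₀) (extChartAt I x₀ x₀) :=
    (chartRep_extChartAt (mem_chart_source H x₀)).symm
  rw [e] at hg'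
  have h2 := FamAt.comp I.uniqueDiffOn I'.uniqueDiffOn hmem hg' (hf.2 N)
    (Eventually.of_forall fun p => ⟨_, rfl⟩)
  refine h2.congr hmem ?_
  have hl := tendsto_prod_extChartAt_symm (I := I) (b₀ := b₀) (mem_chart_source H x₀)
  have hyn := hf.1.eventually ((chartAt H' (f b₀ x₀)).open_source.mem_nhds (mem_chart_source H' _))
  filter_upwards [hl.eventually hyn] with p hp
  simp only [chartRep, Function.comp_apply]
  rw [(extChartAt I' (f b₀ x₀)).left_inv (by rwa [extChartAt_source])]

theorem MFamAt.comp_of_eq {g : B → Y → Z} {y : Y} (hg : MFamAt I' I'' g b₀ y)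
    (hf : MFamAt I I' f b₀ x₀) (hy : f b₀ x₀ = y) :
    MFamAt I I'' (fun b x => g b (f b x)) b₀ x₀ := by
  subst hy
  exact hg.comp hf

theorem MFamAt.prodMk {g : B → X → Z} (hf : MFamAt I I' f b₀ x₀) (hg : MFamAt I I'' g b₀ x₀) :
    MFamAt I (I'.prod I'') (fun b x => (f b x, g b x)) b₀ x₀ := by
  refine ⟨hf.1.prodMk hg.1, fun N => ?_⟩
  exact (hf.2 N).prodMk I.uniqueDiffOn ⟨_, rfl⟩ (hg.2 N)

theorem mfamAt_of_continuousAt {F : Type*} [NormedAddCommGroup F] [NormedSpace ℝ F] {f : B → F}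
    (hf : ContinuousAt f b₀) : MFamAt I 𝓘(ℝ, F) (fun b (_ : X) => f b) b₀ x₀ := by
  refine ⟨ContinuousAt.comp (f := fun p : B × X => p.1) hf continuousAt_fst, fun N => ?_⟩
  exact famAt_of_continuousAt hf

/-- `IsDiffFamily` is indexed by the subtype `U`, `MFamAt` by `B`. The latter only sees germs in the
parameter, so the two agree on an open `U`. -/
theorem mfamAt_subtype {U : Set B} (hU : IsOpen U) {b : U} {h : B → X → Y} {g : U → X → Y}
    (hgh : ∀ c x, g c x = h c x) : MFamAt I I' g b x₀ ↔ MFamAt I I' h b x₀ := by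
  have e : g = fun c : U => h c := by
    funext c x
    exact hgh c x
  rw [e]
  constructor
  · rintro ⟨h1, h2⟩
    have hm : 𝓝 (b : B) = map Subtype.val (𝓝 b) := (hU.isOpenEmbedding_subtypeVal.map_nhds_eq b).symm
    have hm' : ∀ l : Filter E, 𝓝 (b : B) ×ˢ l = map (Prod.map Subtype.val id) (𝓝 b ×ˢ l) := by
      intro l
      rw [hm, ← Filter.prod_map_map_eq', map_id]
    refine ⟨?_, fun N => ⟨?_, fun k hk => ?_⟩⟩
    · have hm2 : 𝓝 ((b : B), x₀) = map (Prod.map Subtype.val id) (𝓝 (b, x₀)) := by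
        rw [nhds_prod_eq, nhds_prod_eq, hm, ← Filter.prod_map_map_eq', map_id]
      rw [ContinuousAt, hm2, tendsto_map'_iff]
      exact h1
    · rw [hm', eventually_map]
      exact (h2 N).1
    · rw [hm', tendsto_map'_iff]
      exact (h2 N).2 k hk
  · intro h1
    exact h1.param continuousAt_subtype_val

variable [IsManifold I ∞ X] [IsManifold I' ∞ Y]

/-- Local compactness gives a compact neighbourhood `K` of `u` on which the topology controls all
derivatives uniformly. The topology compares `g c` with `g b` at the same point, the constant family
`g b` compares nearby points, and the triangle inequality combines the two. -/
theorem mfamAt_of_continuous_diffeo [LocallyCompactSpace X] {g : B → X ≃ₘ^∞⟮I, I'⟯ Y}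
    (hg : Continuous g) (b : B) (u : X) : MFamAt I I' (fun c x => g c x) b u := by
  rw [continuous_diffeo_iff] at hg
  set y := g b u with hy
  have hys : (g b) ⁻¹' (chartAt H' y).source ∈ 𝓝 u :=
    (g b).continuous.continuousAt.preimage_mem_nhds
      ((chartAt H' y).open_source.mem_nhds (mem_chart_source H' y))
  obtain ⟨K, hKu, hKs, hKc⟩ := local_compact_nhds
    (inter_mem ((chartAt H u).open_source.mem_nhds (mem_chart_source H u)) hys)
  have hK1 : K ⊆ (chartAt H u).source := fun w hw => (hKs hw).1
  have hK2 : MapsTo (g b) K (chartAt H' y).source := fun w hw => (hKs hw).2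
  have key : ∀ (r : ℕ) (ε : ℝ), 0 < ε → ∀ᶠ c in 𝓝 b,
      (g c).toContMDiffMap ∈ smoothNhd (g b).toContMDiffMap u y K r ε :=
    fun r ε hε => hg b u y K r ε hKc hK1 hK2 hε
  have hmaps : ∀ᶠ p : B × X in 𝓝 (b, u), g p.1 p.2 ∈ (chartAt H' y).source ∧ p.2 ∈ K := by
    rw [nhds_prod_eq]
    filter_upwards [(key 0 1 one_pos).prod_mk hKu] with p hp
    exact ⟨hp.1.1 hp.2, hp.2⟩
  have hfam : ∀ N, FamAt N (range I) (fun c => chartRep I I' (g c) u y) b (extChartAt I u u) := by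
    intro N
    have hl := tendsto_prod_extChartAt_symm (I := I) (b₀ := b) (mem_chart_source H u)
    have ht := eventually_snd_mem_extChartAt_target (I := I) (b₀ := b) (mem_chart_source H u)
    refine ⟨?_, fun k hk => ?_⟩
    · filter_upwards [hl.eventually hmaps, ht] with p hp hpt
      have := chartRep_contDiffWithinAt (I := I) (I' := I') (g p.1).contMDiff (hK1 hp.2) hp.1
      rw [(extChartAt I u).right_inv hpt] at this
      exact this.of_le (by exact_mod_cast le_top)
    · have hb : FamAt N (range I) (fun _ : B => chartRep I I' (g b) u y) b (extChartAt I u u) := by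
        refine famAt_const I.uniqueDiffOn ⟨_, rfl⟩ ?_
        exact (chartRep_contDiffWithinAt (g b).contMDiff (mem_chart_source H u)
          (mem_chart_source H' _)).of_le (by exact_mod_cast le_top)
      have hb' := hb.2 k hk
      rw [Metric.tendsto_nhds] at hb' ⊢
      intro ε hε
      have hk' : ∀ᶠ p : B × E in 𝓝 b ×ˢ 𝓝[range I] (extChartAt I u u),
          (g p.1).toContMDiffMap ∈ smoothNhd (g b).toContMDiffMap u y K N (ε / 2) :=
        tendsto_fst.eventually (key N (ε / 2) (half_pos hε))
      filter_upwards [hb' (ε / 2) (half_pos hε), hk', hl.eventually hmaps, ht] with p h1 h2 h3 hpt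
      obtain ⟨-, δ, hδ, h2⟩ := h2
      have h4 := h2 k hk _ h3.2
      rw [(extChartAt I u).right_inv hpt, ← dist_eq_norm] at h4
      exact (dist_triangle _ _ _).trans_lt (by
        have := h4.trans_lt hδ
        have e : ((g p.1).toContMDiffMap : X → Y) = g p.1 := rfl
        have e' : ((g b).toContMDiffMap : X → Y) = g b := rfl
        rw [e, e'] at this
        linarith)
  refine mfamAt_of_famAt ?_ (mem_chart_source H u) (mem_chart_source H' y) hfam
  -- Joint continuity of the map itself is the case of derivatives of order zero, transported back
  -- from the charts.
  have h1 := (hfam 0).tendsto.comp (tendsto_prod_extChartAt (I := I) (mem_chart_source H u))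
  rw [chartRep_extChartAt (mem_chart_source H u)] at h1
  have h2 := ((continuousAt_extChartAt_symm (I := I') y).tendsto).comp h1
  rw [extChartAt_to_inv] at h2
  refine Tendsto.congr' ?_ h2
  filter_upwards [hmaps] with p hp
  simp only [Function.comp_apply]
  rw [chartRep_extChartAt (hK1 hp.2), (extChartAt I' y).left_inv]
  rw [extChartAt_source]
  exact hp.1

/-- The form in which the bundle hypotheses enter: transition functions are pointwise smooth
families, with no reference to the function space topology. -/
theorem IsDiffFamily.mfamAt [LocallyCompactSpace X] {U : Set B} (hU : IsOpen U) {h : B → X → Y}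
    (hh : IsDiffFamily I I' U h) {b : B} (hb : b ∈ U) (x : X) : MFamAt I I' h b x := by
  obtain ⟨g, hg, hgh⟩ := hh
  exact (mfamAt_subtype hU (b := ⟨b, hb⟩) hgh).1 (mfamAt_of_continuous_diffeo hg ⟨b, hb⟩ x)

/-- Jointly continuous derivatives are close to those of `g b` near each point of the compact set
`K`, and the tube lemma makes this uniform over `K`. -/
theorem continuous_diffeo_of_mfamAt {g : B → X ≃ₘ^∞⟮I, I'⟯ Y}
    (h : ∀ b x, MFamAt I I' (fun c x => g c x) b x) : Continuous g := by
  rw [continuous_diffeo_iff]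
  intro b x y K r ε hK hKx hKy hε
  -- `smoothNhd` asks for a uniform bound strictly below `ε`; hence `ε / 2`.
  have main : ∀ᶠ c in 𝓝 b, ∀ u ∈ K, g c u ∈ (chartAt H' y).source ∧ (u ∈ K → ∀ k ≤ r,
      ‖iteratedFDerivWithin ℝ k (chartRep I I' (g c) x y) (range I) (extChartAt I x u) -
        iteratedFDerivWithin ℝ k (chartRep I I' (g b) x y) (range I) (extChartAt I x u)‖ ≤
          ε / 2) := by
    refine hK.eventually_forall_of_forall_eventually fun u hu => ?_
    have hmaps := (h b u).1.eventually ((chartAt H' y).open_source.mem_nhds (hKy hu))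
    have hl := tendsto_prod_extChartAt (I := I) (b₀ := b) (hKx hu)
    have h1 : ∀ k ≤ r, ∀ᶠ p : B × X in 𝓝 (b, u),
      ‖iteratedFDerivWithin ℝ k (chartRep I I' (g p.1) x y) (range I) (extChartAt I x p.2) -
        iteratedFDerivWithin ℝ k (chartRep I I' (g b) x y) (range I) (extChartAt I x p.2)‖ ≤
          ε / 2 := by
      intro k hk
      have hf := ((h b u).famAt (N := r) (hKx hu) (hKy hu)).2 k hk
      have hf2 := hf.comp hl
      -- The same limit with the parameter frozen at `b`. Subtracting compares `g c` and `g b` at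
      -- one moving point, as `smoothNhd` does.
      have hf3 := hf.comp ((tendsto_const_nhds (x := b)).prodMk (tendsto_snd.comp hl))
      have hf4 := (hf2.sub hf3).norm
      rw [sub_self, norm_zero] at hf4
      filter_upwards [hf4.eventually_lt_const (half_pos hε)] with p hp using hp.le
    have h2 : ∀ᶠ p : B × X in 𝓝 (b, u), ∀ k ∈ Finset.range (r + 1),
      ‖iteratedFDerivWithin ℝ k (chartRep I I' (g p.1) x y) (range I) (extChartAt I x p.2) -
        iteratedFDerivWithin ℝ k (chartRep I I' (g b) x y) (range I) (extChartAt I x p.2)‖ ≤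
          ε / 2 := by
      rw [Filter.eventually_all_finset]
      exact fun k hk => h1 k (by simpa [Nat.lt_succ_iff] using hk)
    filter_upwards [hmaps, h2] with p hp1 hp2
    exact ⟨hp1, fun _ k hk => hp2 k (by simpa [Nat.lt_succ_iff] using hk)⟩
  filter_upwards [main] with c hc
  exact ⟨fun u hu => (hc u hu).1, ε / 2, half_lt_self hε, fun k hk u hu => (hc u hu).2 hu k hk⟩

/-- The inverse `h'` makes each `h b` a diffeomorphism. Continuity in the parameter is read off from
`h` alone, because the topology on diffeomorphisms is induced from that on smooth maps. -/
theorem IsDiffFamily.of_mfamAt {U : Set B} (hU : IsOpen U) {h : B → X → Y} {h' : B → Y → X}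
    (hh : ∀ b ∈ U, ∀ x, MFamAt I I' h b x) (hh' : ∀ b ∈ U, ∀ y, MFamAt I' I h' b y)
    (hl : ∀ b ∈ U, ∀ x, h' b (h b x) = x) (hr : ∀ b ∈ U, ∀ y, h b (h' b y) = y) :
    IsDiffFamily I I' U h := by
  refine ⟨fun b => ⟨⟨h b, h' b, hl b b.2, hr b b.2⟩, fun x => (hh b b.2 x).contMDiffAt,
    fun y => (hh' b b.2 y).contMDiffAt⟩, ?_, fun _ _ => rfl⟩
  refine continuous_diffeo_of_mfamAt fun b x => ?_
  exact (mfamAt_subtype hU (fun _ _ => rfl)).2 (hh b b.2 x)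

end MFamAt

/-! ### Families with values in the interval and in open subsets -/

section SpecialTargets

variable {B E H E' H' X Y : Type*} [TopologicalSpace B]
  [NormedAddCommGroup E] [NormedSpace ℝ E] [TopologicalSpace H] {I : ModelWithCorners ℝ E H}
  [NormedAddCommGroup E'] [NormedSpace ℝ E'] [TopologicalSpace H'] {I' : ModelWithCorners ℝ E' H'}
  [TopologicalSpace X] [ChartedSpace H X] [TopologicalSpace Y] [ChartedSpace H' Y]
  {b₀ : B} {x₀ : X}

theorem extChartAt_ico_apply (t s : Ico (0 : ℝ) 1) : extChartAt (𝓡∂ 1) t s = !₂[(s : ℝ)] := rfl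

theorem chartRep_ico (g : X → Ico (0 : ℝ) 1) (t : Ico (0 : ℝ) 1) (v : E) :
    chartRep I (𝓡∂ 1) g x₀ t v = !₂[(g ((extChartAt I x₀).symm v) : ℝ)] := rfl

theorem chartRep_real (g : X → ℝ) (t : ℝ) (v : E) :
    chartRep I 𝓘(ℝ, ℝ) g x₀ t v = g ((extChartAt I x₀).symm v) := rfl

theorem contDiff_vecSingle {N : ℕ∞ω} : ContDiff ℝ N fun r : ℝ => !₂[r] := by
  refine contDiff_euclidean.2 fun i => ?_
  fin_cases i
  exact contDiff_id

/-- The charts of `[0,1)` are all `t ↦ !₂[t]`, so smoothness into `[0,1)` can be tested in `ℝ`. -/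
theorem mfamAt_ico {f : B → X → Ico (0 : ℝ) 1}
    (h : MFamAt I 𝓘(ℝ, ℝ) (fun b x => (f b x : ℝ)) b₀ x₀) : MFamAt I (𝓡∂ 1) f b₀ x₀ := by
  refine ⟨?_, fun N => ?_⟩
  · exact (Topology.IsInducing.subtypeVal.continuousAt_iff).2 h.1
  · have h1 := h.2 N
    have h2 := FamAt.comp (g := fun (_ : B) (r : ℝ) => !₂[r]) I.uniqueDiffOn uniqueDiffOn_univ
      ⟨_, rfl⟩ (famAt_const uniqueDiffOn_univ (mem_univ _)
        contDiff_vecSingle.contDiffAt.contDiffWithinAt) h1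
      (Eventually.of_forall fun _ => mem_univ _)
    refine h2.congr ⟨_, rfl⟩ (Eventually.of_forall fun p => ?_)
    rw [chartRep_ico, chartRep_real]

theorem contMDiff_coe_ico : ContMDiff (𝓡∂ 1) 𝓘(ℝ, ℝ) ∞ ((↑) : Ico (0 : ℝ) 1 → ℝ) := by
  have : Nonempty (Ico (0 : ℝ) 1) := ⟨⟨0, le_rfl, one_pos⟩⟩
  have h1 : ContMDiff (𝓡∂ 1) (𝓡∂ 1) ∞ icoToHalfSpace :=
    contMDiff_isOpenEmbedding isOpenEmbedding_icoToHalfSpace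
  have h2 : ContMDiff (𝓡∂ 1) 𝓘(ℝ, ℝ) ∞ (fun p : EuclideanHalfSpace 1 => p.1 0) :=
    ((EuclideanSpace.proj (𝕜 := ℝ) (0 : Fin 1)).contDiff.contMDiff).comp
      (𝓡∂ 1).contMDiff
  exact h2.comp h1

theorem MFamAt.coe_ico {f : B → X → Ico (0 : ℝ) 1} (h : MFamAt I (𝓡∂ 1) f b₀ x₀) :
    MFamAt I 𝓘(ℝ, ℝ) (fun b x => (f b x : ℝ)) b₀ x₀ :=
  (mfamAt_const (contMDiff_coe_ico.contMDiffAt)).comp h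

theorem mfamAt_opens {W : TopologicalSpace.Opens Y} {f : B → X → W}
    (h : MFamAt I I' (fun b x => (f b x : Y)) b₀ x₀) : MFamAt I I' f b₀ x₀ :=
  ⟨(Topology.IsInducing.subtypeVal.continuousAt_iff).2 h.1, fun N => h.2 N⟩

end SpecialTargets

/-! ### The inverse function theorem with parameters on a half-space -/

section HalfSpaceIFT

variable {B E F : Type*} [TopologicalSpace B]
  [NormedAddCommGroup E] [NormedSpace ℝ E] [NormedAddCommGroup F] [NormedSpace ℝ F]
  {ℓ : E →L[ℝ] ℝ} {ℓ' : F →L[ℝ] ℝ}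

theorem convex_nonneg_clm : Convex ℝ {x | 0 ≤ ℓ x} := by
  intro x hx y hy a b ha hb _
  simp only [mem_ofPred_eq, map_add, map_smul, smul_eq_mul] at *
  positivity

theorem interior_nonneg_clm [CompleteSpace E] {e : E} (he : ℓ e = 1) :
    interior {x | 0 ≤ ℓ x} = {x | 0 < ℓ x} := by
  have hs : Function.Surjective ℓ := fun r => ⟨r • e, by simp [he]⟩
  have := ℓ.interior_preimage hs (Ici 0)
  rw [interior_Ici] at this
  exact this

/-- A map between half-spaces with surjective derivative at a point that is sent to the boundary:
the point is on the boundary, and the derivative preserves inward vectors. -/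
theorem inward_of_surjective {T : E → F} {T' : E →L[ℝ] F} {y : E} {e : E} (he : ℓ e = 1)
    (hT : HasFDerivWithinAt T T' {x | 0 ≤ ℓ x} y) (hy : 0 ≤ ℓ y)
    (hmaps : ∀ᶠ x in 𝓝[{x | 0 ≤ ℓ x}] y, 0 ≤ ℓ' (T x)) (hTy : ℓ' (T y) = 0) {w : E}
    (hw : ℓ' (T' w) ≠ 0) : ℓ y = 0 ∧ ∃ a > 0, ∀ v, ℓ' (T' v) = a * ℓ v := by
  have hd : HasFDerivWithinAt (fun x => ℓ' (T x)) (ℓ'.comp T') {x | 0 ≤ ℓ x} y :=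
    ℓ'.hasFDerivAt.comp_hasFDerivWithinAt y hT
  -- `ℓ' ∘ T` is nonnegative and vanishes at `y`, so `y` is a minimum on the half-space. In the
  -- interior its derivative would be zero, contrary to `hw`; on the boundary the derivative is
  -- nonnegative on inward vectors.
  have hmin : IsLocalMinOn (fun x => ℓ' (T x)) {x | 0 ≤ ℓ x} y := by
    filter_upwards [hmaps] with x hx
    rwa [hTy]
  have hy0 : ℓ y = 0 := by
    by_contra hne
    have hpos : 0 < ℓ y := lt_of_le_of_ne hy (Ne.symm hne)
    have hn : {x | 0 ≤ ℓ x} ∈ 𝓝 y := by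
      filter_upwards [ℓ.continuous.continuousAt.eventually (lt_mem_nhds hpos)] with x hx using hx.le
    have h0 := (hmin.isLocalMin hn).hasFDerivAt_eq_zero (hd.hasFDerivAt hn)
    exact hw (DFunLike.congr_fun h0 w)
  have hnn : ∀ v, 0 ≤ ℓ v → 0 ≤ ℓ' (T' v) := by
    intro v hv
    refine hmin.hasFDerivWithinAt_nonneg hd ?_
    refine mem_posTangentConeAt_of_segment_subset ?_
    refine convex_nonneg_clm.segment_subset hy ?_
    simp only [mem_ofPred_eq, map_add]
    linarith
  -- Both signs of the tangential part `v - ℓ v • e` point weakly inwards, so `ℓ' ∘ T'` kills it and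
  -- only the normal part remains.
  have hlin : ∀ v, ℓ' (T' v) = ℓ' (T' e) * ℓ v := by
    intro v
    have h1 := hnn (v - ℓ v • e) (by simp [he])
    have h2 := hnn (-(v - ℓ v • e)) (by simp [he])
    simp only [map_sub, map_neg, map_smul, smul_eq_mul] at h1 h2
    linarith
  refine ⟨hy0, ℓ' (T' e), lt_of_le_of_ne (hnn e (by simp [he])) ?_, hlin⟩
  intro h0
  apply hw
  rw [hlin, ← h0, zero_mul]

variable {f : B → E → F} {f' : B → E → E →L[ℝ] F} {b₀ : B} {x₀ : E} {A : E ≃L[ℝ] F}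

/-- Quantitative inverse function theorem on a half-space, with parameters. -/
theorem halfSpace_inverse_quantitative [CompleteSpace E] {e : E} (he : ℓ e = 1) (hx₀ : 0 ≤ ℓ x₀)
    (hd : ∀ᶠ p : B × E in 𝓝 b₀ ×ˢ 𝓝[{x | 0 ≤ ℓ x}] x₀,
      HasFDerivWithinAt (f p.1) (f' p.1 p.2) {x | 0 ≤ ℓ x} p.2)
    (hf' : Tendsto (fun p : B × E => f' p.1 p.2) (𝓝 b₀ ×ˢ 𝓝[{x | 0 ≤ ℓ x}] x₀)
      (𝓝 (A : E →L[ℝ] F)))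
    (hbd : ∀ᶠ p : B × E in 𝓝 b₀ ×ˢ 𝓝[{x | 0 ≤ ℓ x}] x₀, ℓ p.2 = 0 → ℓ' (f p.1 p.2) = 0)
    (hpos : ℓ x₀ = 0 → 0 < ℓ' (A e)) :
    ∃ V ∈ 𝓝 b₀, ∃ δ > 0, ∃ c > 0,
      (∀ b ∈ V, ∀ x ∈ Metric.ball x₀ δ, ∀ y ∈ Metric.ball x₀ δ, 0 ≤ ℓ x → 0 ≤ ℓ y →
        c * ‖x - y‖ ≤ ‖f b x - f b y‖) ∧
      ∀ b ∈ V, ∀ x, 0 ≤ ℓ x → ∀ ρ ≥ 0, Metric.closedBall x ρ ⊆ Metric.ball x₀ δ →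
        ∀ y, 0 ≤ ℓ' y → ‖y - f b x‖ ≤ c * ρ → ∃ z, 0 ≤ ℓ z ∧ ‖z - x‖ ≤ ρ ∧ f b z = y := by
  classical
  have hnt : Nontrivial E := ⟨e, 0, by rintro rfl; simp at he⟩
  set n : ℝ := ‖(A.symm : F →L[ℝ] E)‖ with hn
  have hn0 : 0 < n := by
    rw [hn, norm_pos_iff]
    intro h0
    have h1 : (A.symm : F →L[ℝ] E) (A e) = 0 := by rw [h0]; simp
    simp only [ContinuousLinearEquiv.coe_coe, ContinuousLinearEquiv.symm_apply_apply] at h1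
    rw [h1] at he
    simp at he
  set K : ℝ := 1 + ‖ℓ‖ * ‖e‖ with hK
  have hK0 : 0 < K := by positivity
  -- The retraction below is `K`-Lipschitz, so this `ε` makes the extended map approximate `A` to
  -- within `n⁻¹ / 2`, half of what the inverse function theorem tolerates. The remaining half `n⁻¹
  -- / 2` is the constant `c` of both conclusions.
  set ε : ℝ := n⁻¹ / 2 / K with hε
  have hε0 : 0 < ε := by positivity
  -- the retraction onto the half-space
  let r : E → E := fun x => x - min (ℓ x) 0 • e
  have hrS : ∀ x, 0 ≤ ℓ (r x) := by
    intro x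
    simp only [r, map_sub, map_smul, he, smul_eq_mul, mul_one]
    linarith [min_le_left (ℓ x) 0]
  have hr_id : ∀ x, 0 ≤ ℓ x → r x = x := by
    intro x hx
    simp [r, min_eq_right hx]
  have hrK : ∀ x y, ‖r x - r y‖ ≤ K * ‖x - y‖ := by
    intro x y
    have e1 : r x - r y = (x - y) - (min (ℓ x) 0 - min (ℓ y) 0) • e := by
      simp only [r, sub_smul]
      abel
    rw [e1]
    refine (norm_sub_le _ _).trans ?_
    rw [norm_smul, hK, add_mul, one_mul]
    refine add_le_add_right ?_ _
    have h1 : ‖min (ℓ x) 0 - min (ℓ y) 0‖ ≤ ‖ℓ‖ * ‖x - y‖ := by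
      refine le_trans ?_ (ℓ.le_opNorm (x - y))
      rw [map_sub, Real.norm_eq_abs, Real.norm_eq_abs]
      have := abs_min_sub_min_le_max (ℓ x) 0 (ℓ y) 0
      simpa using this
    calc _ ≤ ‖ℓ‖ * ‖x - y‖ * ‖e‖ := by gcongr
      _ = _ := by ring
  -- the neighbourhood
  have hnear : ∀ᶠ p : B × E in 𝓝 b₀ ×ˢ 𝓝[{x | 0 ≤ ℓ x}] x₀,
      HasFDerivWithinAt (f p.1) (f' p.1 p.2) {x | 0 ≤ ℓ x} p.2 ∧ ‖f' p.1 p.2 - A‖ ≤ ε ∧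
        (ℓ p.2 = 0 → ℓ' (f p.1 p.2) = 0) := by
    have h2 := (Metric.tendsto_nhds.1 hf') ε hε0
    filter_upwards [hd, h2, hbd] with p h1 h2 h3
    refine ⟨h1, ?_, h3⟩
    rw [← dist_eq_norm]
    exact h2.le
  obtain ⟨V, hV, U, hU, hVU⟩ := eventually_prod_iff.1 hnear
  obtain ⟨δ₀, hδ₀, hδU⟩ := Metric.mem_nhdsWithin_iff.1 hU
  -- If the centre is interior, the ball is kept in the interior. Thus a preimage can leave the
  -- half-space only when the centre is on the boundary, where `hpos` is available.
  obtain ⟨δ₁, hδ₁, hδint⟩ : ∃ δ₁ > 0, ℓ x₀ ≠ 0 → ∀ x ∈ Metric.ball x₀ δ₁, 0 < ℓ x := by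
    by_cases h0 : ℓ x₀ = 0
    · exact ⟨1, one_pos, fun h => absurd h0 h⟩
    · have hp : 0 < ℓ x₀ := lt_of_le_of_ne hx₀ (Ne.symm h0)
      obtain ⟨δ₁, h1, h2⟩ := Metric.eventually_nhds_iff_ball.1
        (ℓ.continuous.continuousAt.eventually (lt_mem_nhds hp))
      exact ⟨δ₁, h1, fun _ => h2⟩
  set δ : ℝ := min (δ₀ / K) δ₁ with hδ
  have hδpos : 0 < δ := lt_min (by positivity) hδ₁
  have hball : ∀ x ∈ Metric.ball x₀ δ, r x ∈ Metric.ball x₀ δ₀ := by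
    intro x hx
    rw [mem_ball_iff_norm] at hx ⊢
    have h1 := hrK x x₀
    rw [hr_id x₀ hx₀] at h1
    refine h1.trans_lt ?_
    have : ‖x - x₀‖ < δ₀ / K := hx.trans_le (min_le_left _ _)
    rw [lt_div_iff₀ hK0] at this
    linarith
  have hconv : Convex ℝ ({x | 0 ≤ ℓ x} ∩ Metric.ball x₀ δ₀) :=
    convex_nonneg_clm.inter (convex_ball _ _)
  -- `G b` equals `f b` on the half-space and continues it by `A` in the normal direction, so the
  -- inverse function theorem on full balls applies to it.
  let G : B → E → F := fun b x => f b (r x) + A (x - r x)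
  have hGid : ∀ b x, 0 ≤ ℓ x → G b x = f b x := fun b x hx => by simp [G, hr_id x hx]
  let c₀ : NNReal := ⟨n⁻¹ / 2, by positivity⟩
  have hG : ∀ b, V b → ApproximatesLinearOn (G b) (A : E →L[ℝ] F) (Metric.ball x₀ δ) c₀ := by
    intro b hb x hx y hy
    have h1 : ‖f b (r x) - f b (r y) - A (r x - r y)‖ ≤ ε * ‖r x - r y‖ := by
      refine hconv.norm_image_sub_le_of_norm_hasFDerivWithin_le' (𝕜 := ℝ) (f' := f' b)
        (φ := (A : E →L[ℝ] F)) ?_ ?_ ⟨hrS y, hball y hy⟩ ⟨hrS x, hball x hx⟩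
      · intro z hz
        exact (hVU hb (hδU ⟨hz.2, hz.1⟩)).1.mono inter_subset_left
      · intro z hz
        exact (hVU hb (hδU ⟨hz.2, hz.1⟩)).2.1
    have e1 : G b x - G b y - (A : E →L[ℝ] F) (x - y) =
        f b (r x) - f b (r y) - A (r x - r y) := by
      simp only [G, ContinuousLinearEquiv.coe_coe, map_sub]
      abel
    rw [e1]
    refine h1.trans ?_
    calc ε * ‖r x - r y‖ ≤ ε * (K * ‖x - y‖) := by gcongr; exact hrK x y
      _ = (n⁻¹ / 2) * ‖x - y‖ := by rw [hε]; field_simp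
      _ = _ := rfl
  have hc₀ : c₀ < ‖(A.symm : F →L[ℝ] E)‖₊⁻¹ := by
    rw [← NNReal.coe_lt_coe]
    change n⁻¹ / 2 < n⁻¹
    exact half_lt_self (by positivity)
  refine ⟨{b | V b}, hV, δ, hδpos, n⁻¹ / 2, by positivity, ?_, ?_⟩
  · intro b hb x hx y hy hx0 hy0
    have h1 := ((hG b hb).antilipschitz (Or.inr hc₀)).le_mul_dist ⟨x, hx⟩ ⟨y, hy⟩
    simp only [Set.domRestrict_apply, hGid b x hx0, hGid b y hy0, Subtype.dist_eq, dist_eq_norm] at h1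
    have e1 : (((‖(A.symm : F →L[ℝ] E)‖₊⁻¹ - c₀)⁻¹ : NNReal) : ℝ) = (n⁻¹ / 2)⁻¹ := by
      rw [NNReal.coe_inv, NNReal.coe_sub hc₀.le]
      change (n⁻¹ - n⁻¹ / 2)⁻¹ = _
      congr 1
      ring
    rw [e1] at h1
    rwa [← div_eq_inv_mul, le_div_iff₀ (by positivity), mul_comm] at h1
  · intro b hb x hx0 ρ hρ hsub y hy0 hy
    have h1 := (hG b hb).surjOn_closedBall_of_nonlinearRightInverse A.toNonlinearRightInverse hρ hsub
    have e1 : (((A.toNonlinearRightInverse.nnnorm : ℝ)⁻¹ - c₀) : ℝ) = n⁻¹ / 2 := by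
      change n⁻¹ - n⁻¹ / 2 = _
      ring
    rw [e1, hGid b x hx0] at h1
    obtain ⟨z, hz, hzy⟩ := h1 (mem_closedBall_iff_norm.2 hy)
    -- If `z` were outside, `f b` would send `r z` to the boundary, and `ℓ' (G b z) = ℓ z * ℓ' (A
    -- e)` would be negative, although `ℓ' y` is not.
    have hzS : 0 ≤ ℓ z := by
      by_contra hneg
      push Not at hneg
      have hzb := hsub hz
      have h0 : ℓ x₀ = 0 := by
        by_contra hne
        exact absurd (hδint hne z (Metric.ball_subset_ball (min_le_right _ _) hzb)) (not_lt.2 hneg.le)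
      have hrz : ℓ (r z) = 0 := by
        simp [r, he, min_eq_left hneg.le]
      have h2 := (hVU hb (hδU ⟨hball z hzb, hrS z⟩)).2.2 hrz
      have h3 : z - r z = ℓ z • e := by simp [r, min_eq_left hneg.le]
      have h4 : ℓ' y = ℓ z * ℓ' (A e) := by
        rw [← hzy]
        simp only [G, h3, map_add, h2, map_smul, smul_eq_mul, zero_add]
      have h5 := mul_neg_of_neg_of_pos hneg (hpos h0)
      linarith
    refine ⟨z, hzS, mem_closedBall_iff_norm.1 hz, ?_⟩
    rw [← hGid b z hzS, hzy]

/-- A local inverse of a family of smooth maps with invertible derivative is a smooth family. -/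
theorem FamAt.of_local_inverse [CompleteSpace E] {s : Set E} {t : Set F} (hs : UniqueDiffOn ℝ s)
    (ht : UniqueDiffOn ℝ t) (hx₀ : x₀ ∈ s) {g : B → F → E}
    (hf : ∀ N, FamAt N s f b₀ x₀) (hA : _root_.fderivWithin ℝ (f b₀) s x₀ = A) (hy₀ : f b₀ x₀ ∈ t)
    (hopen : 𝓝 b₀ ×ˢ 𝓝[t] (f b₀ x₀) ≤
      map (fun p : B × E => (p.1, f p.1 p.2)) (𝓝 b₀ ×ˢ 𝓝[s] x₀))
    (hg : ∀ᶠ p in 𝓝 b₀ ×ˢ 𝓝[s] x₀, g p.1 (f p.1 p.2) = p.2)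
    (hcontg : ∀ᶠ q in 𝓝 b₀ ×ˢ 𝓝[t] (f b₀ x₀), ContinuousWithinAt (g q.1) t q.2) (N : ℕ) :
    FamAt N t g b₀ (f b₀ x₀) := by
  have hgx : g b₀ (f b₀ x₀) = x₀ := eventually_prod_nhdsWithin_self hx₀ hg
  -- By `hopen` all points near the image are of the form `(b, f b x)` with `(b, x)` nearby, so
  -- statements about the inverse need only be checked at such points.
  have htrans : ∀ {P : B × F → Prop}, (∀ᶠ p in 𝓝 b₀ ×ˢ 𝓝[s] x₀, P (p.1, f p.1 p.2)) →
      ∀ᶠ q in 𝓝 b₀ ×ˢ 𝓝[t] (f b₀ x₀), P q := fun h => hopen h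
  have hlim : Tendsto (fun q : B × F => (q.1, g q.1 q.2)) (𝓝 b₀ ×ˢ 𝓝[t] (f b₀ x₀))
      (𝓝 b₀ ×ˢ 𝓝[s] x₀) := by
    refine Tendsto.mono_left ?_ hopen
    rw [tendsto_map'_iff]
    refine tendsto_id.congr' ?_
    filter_upwards [hg] with p hp
    simp [hp]
  have hgs : ∀ᶠ q in 𝓝 b₀ ×ˢ 𝓝[t] (f b₀ x₀), g q.1 q.2 ∈ s :=
    hlim.eventually eventually_snd_mem_prod_nhdsWithin
  have hfg : ∀ᶠ q in 𝓝 b₀ ×ˢ 𝓝[t] (f b₀ x₀), f q.1 (g q.1 q.2) = q.2 :=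
    htrans (hg.mono fun p hp => by simp only [hp])
  -- the derivative of the inverse
  let f' : B → E → E →L[ℝ] F := fun b => _root_.fderivWithin ℝ (f b) s
  let g' : B → F → F →L[ℝ] E := fun b y => (f' b (g b y)).inverse
  have hf'lim : Tendsto (fun p : B × E => f' p.1 p.2) (𝓝 b₀ ×ˢ 𝓝[s] x₀)
      (𝓝 (A : E →L[ℝ] F)) := by
    rw [← hA]
    exact ((hf 1).fderivWithin hs hx₀).tendsto
  have hinv : ∀ᶠ p in 𝓝 b₀ ×ˢ 𝓝[s] x₀, f' p.1 p.2 ∈ range ((↑) : (E ≃L[ℝ] F) → E →L[ℝ] F) :=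
    hf'lim.eventually A.nhds
  have hgderiv : ∀ᶠ q in 𝓝 b₀ ×ˢ 𝓝[t] (f b₀ x₀),
      HasFDerivWithinAt (g q.1) (g' q.1 q.2) t q.2 := by
    filter_upwards [hcontg, hlim.eventually hinv, hlim.eventually (hf 1).1, hgs,
      eventually_prod_nhdsWithin_slice hfg, eventually_prod_nhdsWithin_slice hgs,
      eventually_snd_mem_prod_nhdsWithin] with q h1 h2 h3 h4 h5 h6 h7
    obtain ⟨A', hA'⟩ := h2
    have h8 : HasFDerivWithinAt (f q.1) (A' : E →L[ℝ] F) s (g q.1 q.2) := by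
      rw [hA']
      exact (h3.differentiableWithinAt (by simp)).hasFDerivWithinAt
    have h9 := h8.of_local_left_inverse (s := t) (tendsto_nhdsWithin_iff.2 ⟨h1, h6⟩) h7 h5
    simp only [g']
    rw [← hA', ContinuousLinearMap.inverse_equiv]
    exact h9
  have hglim : Tendsto (fun q : B × F => g q.1 q.2) (𝓝 b₀ ×ˢ 𝓝[t] (f b₀ x₀))
      (𝓝 (g b₀ (f b₀ x₀))) := by
    rw [hgx]
    exact (tendsto_snd.comp hlim).mono_right nhdsWithin_le_nhds
  -- The derivative of `g` is inversion applied to `Df ∘ g`. If `g` is a family of order `N`, so is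
  -- its derivative, and `g` has order `N + 1`.
  induction N with
  | zero =>
    refine ⟨?_, fun k hk => ?_⟩
    · filter_upwards [eventually_prod_nhdsWithin_slice hcontg,
        eventually_snd_mem_prod_nhdsWithin] with q h1 h2
      exact (contDiffWithinAt_zero h2).2 ⟨_, h1, fun y hy => hy.2.mono inter_subset_left⟩
    · obtain rfl : k = 0 := by omega
      rw [iteratedFDerivWithin_zero_eq_comp]
      exact ((continuousMultilinearCurryFin0 ℝ F E).symm.continuous.tendsto _).comp hglim
  | succ N ih =>
    refine FamAt.of_hasFDerivWithinAt ht hy₀ hglim hgderiv ?_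
    have h1 : FamAt N s f' b₀ (g b₀ (f b₀ x₀)) := by
      rw [hgx]
      exact (hf (N + 1)).fderivWithin hs hx₀
    have h2 : FamAt N t (fun b y => f' b (g b y)) b₀ (f b₀ x₀) :=
      FamAt.comp ht hs hy₀ h1 ih hgs
    have h3 : f' b₀ (g b₀ (f b₀ x₀)) = A := by rw [hgx]; exact hA
    refine FamAt.comp (g := fun _ => ContinuousLinearMap.inverse) ht uniqueDiffOn_univ hy₀ ?_ h2
      (Eventually.of_forall fun _ => mem_univ _)
    rw [h3]
    exact famAt_const uniqueDiffOn_univ (mem_univ _)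
      (contDiffAt_map_inverse A).contDiffWithinAt

end HalfSpaceIFT

/-! ### The inverse function theorem for families on manifolds with boundary -/

section ManifoldIFT

variable {B E H E' H' X Y : Type*} [TopologicalSpace B]
  [NormedAddCommGroup E] [NormedSpace ℝ E] [TopologicalSpace H] {I : ModelWithCorners ℝ E H}
  [NormedAddCommGroup E'] [NormedSpace ℝ E'] [TopologicalSpace H'] {I' : ModelWithCorners ℝ E' H'}
  [TopologicalSpace X] [ChartedSpace H X] [TopologicalSpace Y] [ChartedSpace H' Y]
  {ℓ : E →L[ℝ] ℝ} {ℓ' : E' →L[ℝ] ℝ} {b₀ : B} {x₀ : X} {f : B → X → Y}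

/-- The model with corners `I` is a closed half-space, defined by the linear form `ℓ`. -/
structure IsHalfSpaceModel (I : ModelWithCorners ℝ E H) (ℓ : E →L[ℝ] ℝ) : Prop where
  range_eq : range I = {x | 0 ≤ ℓ x}
  exists_one : ∃ e, ℓ e = 1

/-- Being an interior point does not depend on the chart, so the boundary can be read off from `ℓ`
in the chart of any `x₀` around the point. -/
theorem IsHalfSpaceModel.isBoundaryPoint_iff [IsManifold I ∞ X] [CompleteSpace E]
    (hI : IsHalfSpaceModel I ℓ) {x : X} (hx : x ∈ (chartAt H x₀).source) :
    I.IsBoundaryPoint x ↔ ℓ (extChartAt I x₀ x) = 0 := by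
  obtain ⟨e, he⟩ := hI.exists_one
  rw [I.isBoundaryPoint_iff_not_isInteriorPoint,
    I.isInteriorPoint_iff_of_mem_atlas (n := ∞) (by simp) (chart_mem_atlas H x₀) hx]
  have h1 : (chartAt H x₀).extend I x ∈ interior ((chartAt H x₀).extend I).target ↔
      (chartAt H x₀).extend I x ∈ interior (range I) := by
    constructor
    · exact fun h => (chartAt H x₀).interior_extend_target_subset_interior_range h
    · exact fun h => (chartAt H x₀).mem_interior_extend_target
        ((chartAt H x₀).map_source hx) h
  rw [h1, hI.range_eq, interior_nonneg_clm he]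
  have h2 : 0 ≤ ℓ (extChartAt I x₀ x) := by
    have : extChartAt I x₀ x ∈ range I := ⟨_, rfl⟩
    rwa [hI.range_eq] at this
  constructor
  · exact fun h => le_antisymm (not_lt.1 h) h2
  · exact fun h h3 => h3.ne' h

theorem IsHalfSpaceModel.nonneg (hI : IsHalfSpaceModel I ℓ) (x x₀ : X) :
    0 ≤ ℓ (extChartAt I x₀ x) := by
  have : extChartAt I x₀ x ∈ range I := ⟨_, rfl⟩
  rwa [hI.range_eq] at this

/-- The map `(b, x) ↦ (b, f b x)` is open at `(b, x)`. -/
def TotOpenAt (f : B → X → Y) (b : B) (x : X) : Prop :=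
  𝓝 (b, f b x) ≤ map (fun q : B × X => (q.1, f q.1 q.2)) (𝓝 (b, x))

variable (I I') in
/-- Every local inverse of the family `f` at `(b, x)` is a continuous family of smooth maps. -/
def InvFamAt (f : B → X → Y) (b : B) (x : X) : Prop :=
  ∀ g : B → Y → X, (∀ᶠ q : B × X in 𝓝 (b, x), g q.1 (f q.1 q.2) = q.2) → MFamAt I' I g b (f b x)

theorem TotOpenAt.continuousAt {g : B → Y → X} {b : B} {x : X} (h : TotOpenAt f b x)
    (hg : ∀ᶠ q : B × X in 𝓝 (b, x), g q.1 (f q.1 q.2) = q.2) :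
    ContinuousAt (fun p : B × Y => g p.1 p.2) (b, f b x) := by
  have h0 : g b (f b x) = x := hg.self_of_nhds
  rw [ContinuousAt]
  simp only [h0]
  refine Tendsto.mono_left ?_ h
  rw [tendsto_map'_iff]
  refine (continuous_snd.tendsto (b, x)).congr' ?_
  filter_upwards [hg] with q hq
  simp only [Function.comp_apply, hq]

theorem nhds_eq_map_extChartAt_symm {b : B} {x u : X} (hu : u ∈ (chartAt H x).source) :
    𝓝 (b, u) = map (fun p : B × E => (p.1, (extChartAt I x).symm p.2))
      (𝓝 b ×ˢ 𝓝[range I] (extChartAt I x u)) := by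
  rw [← extChartAt_source I] at hu
  have h1 := map_extChartAt_symm_nhdsWithin_range' hu
  rw [nhds_prod_eq, ← h1]
  conv_lhs => rw [← map_id (f := 𝓝 b)]
  rw [Filter.prod_map_map_eq]
  rfl

theorem map_extChartAt_nhds_prod {b : B} {x u : X} (hu : u ∈ (chartAt H x).source) :
    map (fun p : B × X => (p.1, extChartAt I x p.2)) (𝓝 (b, u)) =
      𝓝 b ×ˢ 𝓝[range I] (extChartAt I x u) := by
  rw [← extChartAt_source I] at hu
  have h1 := map_extChartAt_nhds' hu
  rw [nhds_prod_eq, ← h1]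
  conv_rhs => rw [← map_id (f := 𝓝 b)]
  rw [Filter.prod_map_map_eq]
  rfl

variable [IsManifold I ∞ X] [IsManifold I' ∞ Y]

/-- Openness is required at all points near `(b, x)`: it makes the local inverse continuous on a
whole neighbourhood, as `FamAt.of_local_inverse` demands. -/
theorem MFamAt.local_inverse [CompleteSpace E] {b : B} {x x₁ : X} {y₁ : Y} {A : E ≃L[ℝ] E'}
    (hx : x ∈ (chartAt H x₁).source) (hy : f b x ∈ (chartAt H' y₁).source)
    (hf : MFamAt I I' f b x)
    (hA : fderivWithin ℝ (chartRep I I' (f b) x₁ y₁) (range I) (extChartAt I x₁ x) = A)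
    (hopen : ∀ᶠ p : B × X in 𝓝 (b, x), TotOpenAt f p.1 p.2) : InvFamAt I I' f b x := by
  intro g hg
  have hgc : ∀ᶠ p : B × X in 𝓝 (b, x), ContinuousAt (fun q : B × Y => g q.1 q.2)
      (p.1, f p.1 p.2) := by
    filter_upwards [hopen, eventually_eventually_nhds.2 hg] with p h1 h2 using h1.continuousAt h2
  have hxs : ∀ᶠ p : B × X in 𝓝 (b, x), p.2 ∈ (chartAt H x₁).source :=
    continuousAt_snd.eventually ((chartAt H x₁).open_source.mem_nhds hx)
  have hys : ∀ᶠ p : B × X in 𝓝 (b, x), f p.1 p.2 ∈ (chartAt H' y₁).source :=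
    hf.1.eventually ((chartAt H' y₁).open_source.mem_nhds hy)
  have hgx : g b (f b x) = x := hg.self_of_nhds
  have hFz : chartRep I I' (f b) x₁ y₁ (extChartAt I x₁ x) = extChartAt I' y₁ (f b x) :=
    chartRep_extChartAt hx
  have hl := tendsto_prod_extChartAt_symm (I := I) (b₀ := b) hx
  have ht := eventually_snd_mem_extChartAt_target (I := I) (b₀ := b) hx
  have hopen' : 𝓝 b ×ˢ 𝓝[range I'] (chartRep I I' (f b) x₁ y₁ (extChartAt I x₁ x)) ≤
      map (fun p : B × E => (p.1, chartRep I I' (f p.1) x₁ y₁ p.2))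
        (𝓝 b ×ˢ 𝓝[range I] (extChartAt I x₁ x)) := by
    rw [hFz, ← map_extChartAt_nhds_prod hy]
    refine (map_mono hopen.self_of_nhds).trans ?_
    simp only
    rw [nhds_eq_map_extChartAt_symm (I := I) hx, map_map, map_map]
    rfl
  refine mfamAt_of_famAt (x := y₁) (y := x₁) hgc.self_of_nhds hy (by rwa [hgx]) fun N => ?_
  rw [← hFz]
  refine FamAt.of_local_inverse (A := A) I.uniqueDiffOn I'.uniqueDiffOn ⟨_, rfl⟩
    (fun N => hf.famAt hx hy) hA ⟨_, rfl⟩ hopen' ?_ ?_ N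
  · filter_upwards [hl.eventually hg, hl.eventually hys, ht] with p h1 h2 h3
    simp only [chartRep, Function.comp_apply]
    rw [(extChartAt I' y₁).left_inv (by rwa [extChartAt_source]), h1,
      (extChartAt I x₁).right_inv h3]
  · refine hopen' ?_
    rw [mem_map]
    filter_upwards [hl.eventually hgc, hl.eventually hys, hl.eventually hxs,
      hl.eventually hg] with p h1 h2 h3 h4
    have h5 : ContinuousAt (g p.1) (f p.1 ((extChartAt I x₁).symm p.2)) :=
      ContinuousAt.comp (f := fun y => (p.1, y)) h1 (by fun_prop)
    have h6 : (extChartAt I' y₁).symm (chartRep I I' (f p.1) x₁ y₁ p.2) =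
        f p.1 ((extChartAt I x₁).symm p.2) :=
      (extChartAt I' y₁).left_inv (by rwa [extChartAt_source])
    have h7 : ContinuousAt (extChartAt I' y₁).symm (chartRep I I' (f p.1) x₁ y₁ p.2) :=
      continuousAt_extChartAt_symm' (by rwa [extChartAt_source])
    have h8 : ContinuousAt (extChartAt I x₁) (g p.1 (f p.1 ((extChartAt I x₁).symm p.2))) := by
      rw [h4]
      exact continuousAt_extChartAt' (by rwa [extChartAt_source])
    refine ContinuousAt.continuousWithinAt ?_
    refine ContinuousAt.comp (f := g p.1 ∘ (extChartAt I' y₁).symm) (g := extChartAt I x₁) ?_ ?_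
    · simp only [Function.comp_apply]
      rw [h6]
      exact h8
    · refine ContinuousAt.comp ?_ h7
      rw [h6]
      exact h5

/-- The inverse function theorem for continuous families of smooth maps between manifolds with
boundary, which send the boundary to the boundary. -/
theorem MFamAt.inverse_function [CompleteSpace E] [CompleteSpace E'] (hI : IsHalfSpaceModel I ℓ)
    (hI' : IsHalfSpaceModel I' ℓ') (hf : ∀ᶠ p : B × X in 𝓝 (b₀, x₀), MFamAt I I' f p.1 p.2)
    (hinv : ∃ A : E ≃L[ℝ] E', mfderiv I I' (f b₀) x₀ = (A : E →L[ℝ] E'))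
    (hbd : ∀ᶠ p : B × X in 𝓝 (b₀, x₀), I.IsBoundaryPoint p.2 → I'.IsBoundaryPoint (f p.1 p.2)) :
    (∃ U ∈ 𝓝 (b₀, x₀), InjOn (fun p : B × X => (p.1, f p.1 p.2)) U) ∧
      ∀ᶠ p : B × X in 𝓝 (b₀, x₀), TotOpenAt f p.1 p.2 ∧ InvFamAt I I' f p.1 p.2 := by
  obtain ⟨A, hA⟩ := hinv
  obtain ⟨e, he⟩ := hI.exists_one
  have hf₀ := hf.self_of_nhds
  simp only at hf₀
  set y₀ := f b₀ x₀ with hy₀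
  set F : B → E → E' := fun b => chartRep I I' (f b) x₀ y₀ with hF
  set z₀ := extChartAt I x₀ x₀ with hz₀
  have hxs : ∀ᶠ p : B × X in 𝓝 (b₀, x₀), p.2 ∈ (chartAt H x₀).source :=
    continuousAt_snd.eventually ((chartAt H x₀).open_source.mem_nhds (mem_chart_source H x₀))
  have hys : ∀ᶠ p : B × X in 𝓝 (b₀, x₀), f p.1 p.2 ∈ (chartAt H' y₀).source :=
    hf₀.1.eventually ((chartAt H' y₀).open_source.mem_nhds (mem_chart_source H' y₀))
  have hl := tendsto_prod_extChartAt_symm (I := I) (b₀ := b₀) (mem_chart_source H x₀)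
  have ht := eventually_snd_mem_extChartAt_target (I := I) (b₀ := b₀) (mem_chart_source H x₀)
  have hFam : ∀ N, FamAt N (range I) F b₀ z₀ := hf₀.2
  have hmd : MDifferentiableAt I I' (f b₀) x₀ := hf₀.contMDiffAt.mdifferentiableAt (by simp)
  have hA' : fderivWithin ℝ (F b₀) (range I) z₀ = A := by
    rw [← hA]
    exact hmd.mfderiv.symm
  have hlim : Tendsto (fun p : B × E => fderivWithin ℝ (F p.1) (range I) p.2)
      (𝓝 b₀ ×ˢ 𝓝[range I] z₀) (𝓝 (A : E →L[ℝ] E')) := by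
    rw [← hA']
    exact ((hFam 1).fderivWithin I.uniqueDiffOn ⟨_, rfl⟩).tendsto
  have hd : ∀ᶠ p : B × E in 𝓝 b₀ ×ˢ 𝓝[range I] z₀,
      HasFDerivWithinAt (F p.1) (fderivWithin ℝ (F p.1) (range I) p.2) (range I) p.2 := by
    filter_upwards [(hFam 1).1] with p hp
    exact (hp.differentiableWithinAt (by simp)).hasFDerivWithinAt
  have hbd' : ∀ᶠ p : B × E in 𝓝 b₀ ×ˢ 𝓝[range I] z₀, ℓ p.2 = 0 → ℓ' (F p.1 p.2) = 0 := by
    filter_upwards [hl.eventually hbd, hl.eventually hxs, hl.eventually hys, ht] with p h1 h2 h3 h4 h5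
    have h6 := (hI'.isBoundaryPoint_iff h3).1 (h1 ((hI.isBoundaryPoint_iff h2).2 (by
      rwa [(extChartAt I x₀).right_inv h4])))
    exact h6
  have hz₀S : 0 ≤ ℓ z₀ := hI.nonneg x₀ x₀
  -- At a boundary point the derivative is invertible and the image stays in the half-space, so
  -- inward vectors go to inward vectors.
  have hpos : ℓ z₀ = 0 → 0 < ℓ' (A e) := by
    intro h0
    have h1 : ℓ' (F b₀ z₀) = 0 := eventually_prod_nhdsWithin_self (show z₀ ∈ range I from ⟨_, rfl⟩) hbd' h0
    have h2 := eventually_prod_nhdsWithin_self (show z₀ ∈ range I from ⟨_, rfl⟩) hd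
    simp only at h2
    rw [hA', hI.range_eq] at h2
    obtain ⟨e', he'⟩ := hI'.exists_one
    obtain ⟨-, a, ha, h3⟩ := inward_of_surjective (ℓ := ℓ) (ℓ' := ℓ') he h2 hz₀S
      (Eventually.of_forall fun z => hI'.nonneg _ _) h1 (w := A.symm e') (by simp [he'])
    have := h3 e
    simp only [ContinuousLinearEquiv.coe_coe, he, mul_one] at this
    rwa [this]
  have hq := halfSpace_inverse_quantitative (b₀ := b₀) (f := F)
    (f' := fun b => fderivWithin ℝ (F b) (range I)) (ℓ := ℓ) (ℓ' := ℓ') (A := A) he hz₀S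
    (by rw [← hI.range_eq]; exact hd) (by rw [← hI.range_eq]; exact hlim)
    (by rw [← hI.range_eq]; exact hbd') hpos
  obtain ⟨V, hV, δ, hδ, c, hc, hanti, hsurj⟩ := hq
  have hball : ∀ᶠ p : B × X in 𝓝 (b₀, x₀), extChartAt I x₀ p.2 ∈ Metric.ball z₀ δ :=
    ((continuousAt_extChartAt x₀).comp (x := ((b₀, x₀) : B × X)) continuousAt_snd).eventually
      (Metric.ball_mem_nhds _ hδ)
  have hVe : ∀ᶠ p : B × X in 𝓝 (b₀, x₀), p.1 ∈ V := continuousAt_fst.eventually hV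
  have hAe : ∀ᶠ p : B × X in 𝓝 (b₀, x₀), fderivWithin ℝ (F p.1) (range I) (extChartAt I x₀ p.2) ∈
      range ((↑) : (E ≃L[ℝ] E') → E →L[ℝ] E') :=
    (hlim.comp (tendsto_prod_extChartAt (I := I) (mem_chart_source H x₀))).eventually A.nhds
  have hFx : ∀ b x, x ∈ (chartAt H x₀).source → F b (extChartAt I x₀ x) = extChartAt I' y₀ (f b x) :=
    fun b x hx => chartRep_extChartAt hx
  -- For `b'` near `b`, the surjectivity estimate centred at the image of `x` covers a ball of
  -- radius `c * ρ` independent of `b'`. This is openness of the total map, not only of each `f b`.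
  have hopen : ∀ᶠ p : B × X in 𝓝 (b₀, x₀), TotOpenAt f p.1 p.2 := by
    filter_upwards [eventually_eventually_nhds.2 hxs, eventually_eventually_nhds.2 hys,
      eventually_eventually_nhds.2 hVe, hball, hf] with p hxp hyp hVp hbp hfp
    obtain ⟨b, x⟩ := p
    simp only at hxp hyp hVp hbp hfp
    have hxp0 : x ∈ (chartAt H x₀).source := hxp.self_of_nhds
    have hyp0 : f b x ∈ (chartAt H' y₀).source := hyp.self_of_nhds
    intro W hW
    rw [mem_map] at hW
    have hlx := tendsto_prod_extChartAt_symm (I := I) (b₀ := b) hxp0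
    have h1 := hlx.eventually (hxp.and (hyp.and (hVp.and hW)))
    obtain ⟨V₁, hV₁, P, hP, hVP⟩ := eventually_prod_iff.1 h1
    obtain ⟨ρ₁, hρ₁, hρP⟩ := Metric.mem_nhdsWithin_iff.1 hP
    obtain ⟨ρ₂, hρ₂, hρδ⟩ := Metric.nhds_basis_closedBall.mem_iff.1 (Metric.isOpen_ball.mem_nhds hbp)
    -- Half of `ρ₁`, so that the closed ball of radius `ρ` lies in the open ball of radius `ρ₁`.
    set ρ := min (ρ₁ / 2) ρ₂ with hρ
    have hρ0 : 0 < ρ := lt_min (half_pos hρ₁) hρ₂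
    have hρP' : ∀ z ∈ Metric.closedBall (extChartAt I x₀ x) ρ, z ∈ range I → P z := by
      intro z hz hzI
      refine hρP ⟨?_, hzI⟩
      refine Metric.closedBall_subset_ball (lt_of_le_of_lt (min_le_left _ _) (half_lt_self hρ₁)) hz
    have hsub : Metric.closedBall (extChartAt I x₀ x) ρ ⊆ Metric.ball z₀ δ :=
      (Metric.closedBall_subset_closedBall (min_le_right _ _)).trans hρδ
    have hdist : ∀ᶠ q : B × Y in 𝓝 (b, f b x),
        ‖extChartAt I' y₀ q.2 - extChartAt I' y₀ (f q.1 x)‖ < c * ρ := by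
      have hc1 : ContinuousAt (fun q : B × Y => extChartAt I' y₀ q.2) (b, f b x) :=
        ContinuousAt.comp (f := fun q : B × Y => q.2) (continuousAt_extChartAt' (I := I')
          (by rwa [extChartAt_source])) continuousAt_snd
      have hc2 : ContinuousAt (fun q : B × Y => extChartAt I' y₀ (f q.1 x)) (b, f b x) := by
        refine ContinuousAt.comp (g := extChartAt I' y₀) (f := fun q : B × Y => f q.1 x)
          (continuousAt_extChartAt' (I := I') (by rwa [extChartAt_source])) ?_
        exact ContinuousAt.comp (g := fun p : B × X => f p.1 p.2) (f := fun q : B × Y => (q.1, x))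
          hfp.1 (by fun_prop)
      have hc3 := (hc1.sub hc2).norm
      have h0 : ‖extChartAt I' y₀ (f b x) - extChartAt I' y₀ (f b x)‖ < c * ρ := by
        rw [sub_self, norm_zero]
        positivity
      exact hc3.eventually (gt_mem_nhds h0)
    have hV₁' : ∀ᶠ q : B × Y in 𝓝 (b, f b x), V₁ q.1 := continuousAt_fst.eventually hV₁
    have hy₁ : ∀ᶠ q : B × Y in 𝓝 (b, f b x), q.2 ∈ (chartAt H' y₀).source :=
      continuousAt_snd.eventually ((chartAt H' y₀).open_source.mem_nhds hyp0)
    filter_upwards [hdist, hV₁', hy₁] with q hq1 hq2 hq3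
    have hxP := hρP' _ (Metric.mem_closedBall_self hρ0.le) ⟨_, rfl⟩
    have hqV : q.1 ∈ V := (hVP hq2 hxP).2.2.1
    obtain ⟨z, hzS, hzρ, hzq⟩ := hsurj q.1 hqV (extChartAt I x₀ x) (hI.nonneg _ _) ρ hρ0.le hsub
      (extChartAt I' y₀ q.2) (hI'.nonneg _ _) (by rw [hFx _ _ hxp0]; exact hq1.le)
    have hzP := hρP' z (mem_closedBall_iff_norm.2 hzρ) (by rw [hI.range_eq]; exact hzS)
    obtain ⟨h2, h3, h4, h5⟩ := hVP hq2 hzP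
    have h6 : f q.1 ((extChartAt I x₀).symm z) = q.2 := by
      refine (extChartAt I' y₀).injOn (by rwa [extChartAt_source]) (by rwa [extChartAt_source]) ?_
      exact hzq
    have h7 := h5
    simp only [h6] at h7
    exact h7
  refine ⟨⟨_, hxs.and (hys.and (hVe.and hball)), ?_⟩, ?_⟩
  · rintro ⟨b, x⟩ ⟨h1, h2, h3, h4⟩ ⟨b', x'⟩ ⟨h1', h2', h3', h4'⟩ heq
    obtain ⟨rfl, heq⟩ := Prod.mk_inj.1 heq
    simp only at *
    have h5 := hanti b h3 _ h4 _ h4' (hI.nonneg _ _) (hI.nonneg _ _)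
    rw [hFx _ _ h1, hFx _ _ h1', heq, sub_self, norm_zero] at h5
    have h6 : ‖extChartAt I x₀ x - extChartAt I x₀ x'‖ ≤ 0 := by
      by_contra hneg
      push Not at hneg
      nlinarith
    have h7 := sub_eq_zero.1 (norm_le_zero_iff.1 h6)
    rw [(extChartAt I x₀).injOn (by rwa [extChartAt_source]) (by rwa [extChartAt_source]) h7]
  · filter_upwards [hopen, eventually_eventually_nhds.2 hopen, hAe, hxs, hys, hf] with
      p h1 h2 h3 h4 h5 h6
    obtain ⟨A₁, hA₁⟩ := h3
    exact ⟨h1, MFamAt.local_inverse h4 h5 h6 hA₁.symm h2⟩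

end ManifoldIFT

/-! ### Derivatives at boundary points and of immersions -/

section Tangent

variable {E H E' H' X Y : Type*}
  [NormedAddCommGroup E] [NormedSpace ℝ E] [TopologicalSpace H] {I : ModelWithCorners ℝ E H}
  [NormedAddCommGroup E'] [NormedSpace ℝ E'] [TopologicalSpace H'] {I' : ModelWithCorners ℝ E' H'}
  [TopologicalSpace X] [ChartedSpace H X] [TopologicalSpace Y] [ChartedSpace H' Y]
  {ℓ : E →L[ℝ] ℝ} {ℓ' : E' →L[ℝ] ℝ} {f : X → Y} {x : X}

theorem isHalfSpaceModel_halfSpace (n : ℕ) :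
    IsHalfSpaceModel (𝓡∂ (n + 1)) (EuclideanSpace.proj (0 : Fin (n + 1)) : _ →L[ℝ] ℝ) :=
  ⟨range_modelWithCornersEuclideanHalfSpace _, EuclideanSpace.single 0 1, by simp⟩

theorem isHalfSpaceModel_prod (n : ℕ) :
    IsHalfSpaceModel ((𝓡 n).prod (𝓡∂ 1)) ((EuclideanSpace.proj (0 : Fin 1) : _ →L[ℝ] ℝ).comp
      (ContinuousLinearMap.snd ℝ (EuclideanSpace ℝ (Fin n)) (EuclideanSpace ℝ (Fin 1)))) := by
  refine ⟨?_, (0, EuclideanSpace.single 0 1), by simp⟩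
  rw [ModelWithCorners.range_prod, range_modelWithCornersEuclideanHalfSpace]
  ext p
  simp

/-- A differentiable map to a manifold with boundary, which hits the boundary and is not tangent
to it there, maps from a boundary point and is inward pointing. -/
theorem MDifferentiableAt.inward_scale [IsManifold I ∞ X] [IsManifold I' ∞ Y] [CompleteSpace E]
    [CompleteSpace E']
    (hI : IsHalfSpaceModel I ℓ) (hI' : IsHalfSpaceModel I' ℓ') (hf : MDifferentiableAt I I' f x)
    (hx : I'.IsBoundaryPoint (f x))
    (hA : ∃ A : E ≃L[ℝ] E', mfderiv I I' f x = (A : E →L[ℝ] E')) :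
    I.IsBoundaryPoint x ∧ ∃ a > 0, ∀ v : E, ℓ' (mfderiv I I' f x v : E') = a * ℓ v := by
  rw [hI.isBoundaryPoint_iff (mem_chart_source H x)]
  obtain ⟨e, he⟩ := hI.exists_one
  obtain ⟨e', he'⟩ := hI'.exists_one
  obtain ⟨A, hA⟩ := hA
  have h0 : mfderiv I I' f x (A.symm e') = e' :=
    (DFunLike.congr_fun hA _).trans (A.apply_symm_apply e')
  have hw : ℓ' (mfderiv I I' f x (A.symm e') : E') ≠ 0 :=
    (congrArg ℓ' h0).trans_ne (by rw [he']; exact one_ne_zero)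
  have h1 := hf.hasMFDerivAt.2
  rw [hI.range_eq] at h1
  refine (inward_of_surjective (ℓ := ℓ) (ℓ' := ℓ') he h1 (hI.nonneg x x)
    (Eventually.of_forall fun z => hI'.nonneg _ _) ?_ hw)
  simp only [writtenInExtChartAt, Function.comp_apply, extChartAt_to_inv]
  exact (hI'.isBoundaryPoint_iff (mem_chart_source _ _)).1 hx

theorem mfderiv_bijective_of_local_inverse {g : Y → X} (hf : MDifferentiableAt I I' f x)
    (hg : MDifferentiableAt I' I g (f x)) (hgf : ∀ᶠ z in 𝓝 x, g (f z) = z)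
    (hfg : ∀ᶠ y in 𝓝 (f x), f (g y) = y) :
    ∃ A : E ≃L[ℝ] E', mfderiv I I' f x = (A : E →L[ℝ] E') := by
  have hgx : g (f x) = x := hgf.self_of_nhds
  have h1 : (mfderiv I' I g (f x)).comp (mfderiv I I' f x) = ContinuousLinearMap.id ℝ E := by
    rw [← mfderiv_comp x hg hf]
    exact (EventuallyEq.mfderiv_eq (f := id) (f₁ := g ∘ f) hgf).trans mfderiv_id
  have h2 : (mfderiv I I' f x).comp (mfderiv I' I g (f x)) = ContinuousLinearMap.id ℝ E' := by
    have h3 := mfderiv_comp_of_eq (x := f x) (y := x) hf hg hgx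
    have h4 := (EventuallyEq.mfderiv_eq (I := I') (I' := I') (f := id) (f₁ := f ∘ g) hfg).trans mfderiv_id
    rw [h3] at h4
    -- All tangent spaces are the model space, so the derivatives at `g (f x)` and at `x` can be
    -- compared once the base point is generalised.
    have h5 : ∀ z, z = x → (mfderiv I I' f z : E →L[ℝ] E') = mfderiv I I' f x := by
      rintro _ rfl
      rfl
    have h6 := h5 _ hgx
    rw [← h6]
    exact h4
  exact ⟨ContinuousLinearEquiv.equivOfInverse (mfderiv I I' f x) (mfderiv I' I g (f x))
    (fun v => DFunLike.congr_fun h1 v) (fun v => DFunLike.congr_fun h2 v), rfl⟩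

open Manifold in
-- In the normal form of an immersion, projection to the first factor is a smooth local left
-- inverse, and the chain rule gives injectivity. The source has no boundary, so the inverse of its
-- chart is smooth on an open set.
theorem Manifold.IsImmersionAt.mfderiv_injective [IsManifold I ∞ X] [IsManifold I' ∞ Y]
    [BoundarylessManifold I X] [I.Boundaryless]
    (hf : IsImmersionAt I I' ∞ f x) : Function.Injective (mfderiv I I' f x) := by
  obtain ⟨F, _, _, h⟩ := hf
  have hfd : MDifferentiableAt I I' f x := h.contMDiffAt.mdifferentiableAt (by simp)
  set φ := h.domChart
  set ψ := h.codChart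
  set r : Y → X := (φ.extend I).symm ∘ (fun v => (h.equiv.symm v).1) ∘ ψ.extend I' with hr
  have hrf : ∀ z ∈ φ.source, r (f z) = z := by
    intro z hz
    have hz' : z ∈ (φ.extend I).source := by rwa [φ.extend_source]
    have h1 := h.writtenInCharts ((φ.extend I).map_source hz')
    simp only [Function.comp_apply] at h1
    rw [(φ.extend I).left_inv hz'] at h1
    simp only [hr, Function.comp_apply]
    rw [show ψ.extend I' (f z) = _ from h1]
    simp only [ContinuousLinearEquiv.symm_apply_apply]
    exact (φ.extend I).left_inv hz'
  have hx := h.mem_domChart_source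
  have hx' : x ∈ (φ.extend I).source := by rwa [φ.extend_source]
  have hval : (h.equiv.symm (ψ.extend I' (f x))).1 = φ.extend I x := by
    have h1 := h.writtenInCharts ((φ.extend I).map_source hx')
    simp only [Function.comp_apply] at h1
    rw [(φ.extend I).left_inv hx'] at h1
    rw [show ψ.extend I' (f x) = _ from h1]
    simp
  have hrd : MDifferentiableAt I' I r (f x) := by
    have h1 : ContMDiffAt I' 𝓘(ℝ, E') ∞ (ψ.extend I') (f x) :=
      ψ.contMDiffAt_extend h.codChart_mem_maximalAtlas h.mem_codChart_source
    have h2 : ContMDiff 𝓘(ℝ, E') 𝓘(ℝ, E) ∞ (fun v => (h.equiv.symm v).1) :=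
      ContDiff.contMDiff (by fun_prop)
    have h3 : ContMDiffAt 𝓘(ℝ, E) I ∞ (φ.extend I).symm (φ.extend I x) := by
      refine (contMDiffOn_extend_symm h.domChart_mem_maximalAtlas).contMDiffAt ?_
      refine IsOpen.mem_nhds ?_ ⟨_, φ.map_source hx, rfl⟩
      exact I.toHomeomorph.isOpenMap _ φ.open_target
    have h4 := ContMDiffAt.comp_of_eq (x := f x) h3 ((h2 _).comp (f x) h1) hval
    exact h4.mdifferentiableAt (by simp)
  have h1 : (mfderiv I' I r (f x)).comp (mfderiv I I' f x) = ContinuousLinearMap.id ℝ E := by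
    rw [← mfderiv_comp x hrd hfd]
    refine (EventuallyEq.mfderiv_eq (f := id) (f₁ := r ∘ f) ?_).trans mfderiv_id
    filter_upwards [φ.open_source.mem_nhds hx] with z hz using hrf z hz
  intro v w hvw
  have h2 : mfderiv I' I r (f x) (mfderiv I I' f x v) = v := DFunLike.congr_fun h1 v
  have h3 : mfderiv I' I r (f x) (mfderiv I I' f x w) = w := DFunLike.congr_fun h1 w
  rw [← h2, ← h3, hvw]

end Tangent

/-! ### Calculus on the half-open interval -/

section IcoCurves

theorem extChartAt_ico_symm_apply {t : Ico (0 : ℝ) 1} {v : EuclideanSpace ℝ (Fin 1)}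
    (hv : v ∈ (extChartAt (𝓡∂ 1) t).target) : ((extChartAt (𝓡∂ 1) t).symm v : ℝ) = v 0 := by
  have h := (extChartAt (𝓡∂ 1) t).right_inv hv
  rw [extChartAt_ico_apply] at h
  exact (congrArg (fun w : EuclideanSpace ℝ (Fin 1) => w 0) h)

theorem hasMFDerivAt_coe_ico (t : Ico (0 : ℝ) 1) :
    HasMFDerivAt (𝓡∂ 1) 𝓘(ℝ, ℝ) ((↑) : Ico (0 : ℝ) 1 → ℝ) t
      (EuclideanSpace.proj (0 : Fin 1) : EuclideanSpace ℝ (Fin 1) →L[ℝ] ℝ) := by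
  refine ⟨continuous_subtype_val.continuousAt, ?_⟩
  refine (ContinuousLinearMap.hasFDerivWithinAt _).congr_of_eventuallyEq ?_ ?_
  · filter_upwards [extChartAt_target_mem_nhdsWithin (I := 𝓡∂ 1) t] with v hv
    exact extChartAt_ico_symm_apply hv
  · exact extChartAt_ico_symm_apply (mem_extChartAt_target t)

/-- The point of `[0,1)` given by a real number; the values outside of `[0,1)` are irrelevant. -/
def icoOfReal (s : ℝ) : Ico (0 : ℝ) 1 :=
  ⟨if 0 ≤ s ∧ s < 1 then s else 0, by split_ifs with h; exacts [h, by simp]⟩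

theorem icoOfReal_coe (t : Ico (0 : ℝ) 1) : icoOfReal t = t :=
  Subtype.ext (if_pos t.2)

theorem coe_icoOfReal {s : ℝ} (h0 : 0 ≤ s) (h1 : s < 1) : (icoOfReal s : ℝ) = s :=
  if_pos ⟨h0, h1⟩

/-- Translates manifold derivatives on `[0,1)` into one-variable ones, to which the mean value
theorem and monotonicity criteria apply. The default value of `icoOfReal` for `s ≥ 1` is harmless,
since `t < 1` and only `s` near `t` matters. -/
theorem hasDerivWithinAt_comp_icoOfReal {u : Ico (0 : ℝ) 1 → ℝ} {t : Ico (0 : ℝ) 1}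
    (hu : MDifferentiableAt (𝓡∂ 1) 𝓘(ℝ, ℝ) u t) :
    HasDerivWithinAt (fun s => u (icoOfReal s))
      (mfderiv (𝓡∂ 1) 𝓘(ℝ, ℝ) u t (!₂[(1 : ℝ)] : EuclideanSpace ℝ (Fin 1)) : ℝ) (Ici 0) t := by
  have h1 := hu.hasMFDerivAt.2
  rw [extChartAt_ico_apply] at h1
  have h2 : HasDerivWithinAt (fun s : ℝ => (!₂[s] : EuclideanSpace ℝ (Fin 1)))
      (!₂[(1 : ℝ)] : EuclideanSpace ℝ (Fin 1)) (Ici 0) (t : ℝ) := by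
    have : (fun s : ℝ => (!₂[s] : EuclideanSpace ℝ (Fin 1))) =
        fun s => s • (!₂[(1 : ℝ)] : EuclideanSpace ℝ (Fin 1)) := by
      ext s i
      fin_cases i
      simp
    rw [this]
    simpa using (hasDerivWithinAt_id (t : ℝ) (Ici 0)).smul_const
      (!₂[(1 : ℝ)] : EuclideanSpace ℝ (Fin 1))
  have h3 : MapsTo (fun s : ℝ => (!₂[s] : EuclideanSpace ℝ (Fin 1))) (Ici 0) (range (𝓡∂ 1)) := by
    intro s hs
    rw [range_modelWithCornersEuclideanHalfSpace]
    simpa using hs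
  have h4 := h1.comp_hasDerivWithinAt (t : ℝ) h2 h3
  have h5 : ∀ s : ℝ, 0 ≤ s → s < 1 → u (icoOfReal s) =
      writtenInExtChartAt (𝓡∂ 1) 𝓘(ℝ, ℝ) t u (!₂[s] : EuclideanSpace ℝ (Fin 1)) := by
    intro s hs0 hs1
    have h6 : (!₂[s] : EuclideanSpace ℝ (Fin 1)) = extChartAt (𝓡∂ 1) t (icoOfReal s) := by
      rw [extChartAt_ico_apply, coe_icoOfReal hs0 hs1]
    rw [h6]
    simp only [writtenInExtChartAt, Function.comp_apply]
    rw [(extChartAt (𝓡∂ 1) t).left_inv (by simp)]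
    rfl
  refine h4.congr_of_eventuallyEq ?_ (h5 _ t.2.1 t.2.2)
  filter_upwards [self_mem_nhdsWithin, mem_nhdsWithin_of_mem_nhds (gt_mem_nhds t.2.2)] with s hs hs1
    using h5 s hs hs1

/-- Multiplication of `t ∈ [0,1)` by `s ∈ [0,1]`. -/
def icoScale (s : Icc (0 : ℝ) 1) (t : Ico (0 : ℝ) 1) : Ico (0 : ℝ) 1 :=
  ⟨s * t, mul_nonneg s.2.1 t.2.1, (mul_le_of_le_one_left t.2.1 s.2.2).trans_lt t.2.2⟩

theorem coe_icoScale (s : Icc (0 : ℝ) 1) (t : Ico (0 : ℝ) 1) : (icoScale s t : ℝ) = s * t := rfl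

theorem icoScale_zero_right (s : Icc (0 : ℝ) 1) : icoScale s 0 = 0 :=
  Subtype.ext (by rw [coe_icoScale]; exact mul_zero _)

theorem icoScale_zero_left (t : Ico (0 : ℝ) 1) : icoScale 0 t = 0 :=
  Subtype.ext (by rw [coe_icoScale]; exact zero_mul _)

theorem MFamAt.map₂ {B E H X : Type*} [TopologicalSpace B] [NormedAddCommGroup E] [NormedSpace ℝ E]
    [TopologicalSpace H] {I : ModelWithCorners ℝ E H} [TopologicalSpace X] [ChartedSpace H X]
    {u v : B → X → ℝ} {b : B} {x : X} (hu : MFamAt I 𝓘(ℝ, ℝ) u b x) (hv : MFamAt I 𝓘(ℝ, ℝ) v b x)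
    {g : ℝ × ℝ → ℝ} (hg : ContDiff ℝ ∞ g) :
    MFamAt I 𝓘(ℝ, ℝ) (fun b x => g (u b x, v b x)) b x := by
  refine ⟨hg.continuous.continuousAt.comp (f := fun p : B × X => (u p.1 p.2, v p.1 p.2))
    (hu.1.prodMk hv.1), fun N => ?_⟩
  refine FamAt.comp (g := fun _ => g) I.uniqueDiffOn uniqueDiffOn_univ ⟨_, rfl⟩
    (famAt_const uniqueDiffOn_univ (mem_univ _) ?_)
    ((hu.2 N).prodMk I.uniqueDiffOn ⟨_, rfl⟩ (hv.2 N)) (Eventually.of_forall fun _ => mem_univ _)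
  exact (hg.of_le (by exact_mod_cast le_top)).contDiffAt.contDiffWithinAt

theorem mfamAt_icoScale {B : Type*} [TopologicalSpace B] {s : B → Icc (0 : ℝ) 1} {b : B}
    (hs : ContinuousAt s b) (t : Ico (0 : ℝ) 1) :
    MFamAt (𝓡∂ 1) (𝓡∂ 1) (fun b t => icoScale (s b) t) b t := by
  refine mfamAt_ico ?_
  have h1 : MFamAt (𝓡∂ 1) 𝓘(ℝ, ℝ) (fun b (_ : Ico (0 : ℝ) 1) => (s b : ℝ)) b t :=
    mfamAt_of_continuousAt (continuous_subtype_val.continuousAt.comp hs)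
  have h2 : MFamAt (𝓡∂ 1) 𝓘(ℝ, ℝ) (fun (_ : B) (t : Ico (0 : ℝ) 1) => (t : ℝ)) b t :=
    mfamAt_const contMDiff_coe_ico.contMDiffAt
  exact h1.map₂ h2 (g := fun q : ℝ × ℝ => q.1 * q.2) (by fun_prop)

/-- The tangent vector at `t = 0` of `[0,1)`. -/
abbrev icoUnit : EuclideanSpace ℝ (Fin 1) := !₂[(1 : ℝ)]

theorem mfderiv_icoScale (s : Icc (0 : ℝ) 1) :
    MDifferentiableAt (𝓡∂ 1) (𝓡∂ 1) (icoScale s) 0 ∧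
    (mfderiv (𝓡∂ 1) (𝓡∂ 1) (icoScale s) 0 icoUnit : EuclideanSpace ℝ (Fin 1)) = (s : ℝ) • icoUnit := by
  have h1 : MDifferentiableAt (𝓡∂ 1) (𝓡∂ 1) (icoScale s) 0 :=
    (mfamAt_icoScale (B := Unit) (s := fun _ => s) (b := ()) continuousAt_const
      0).contMDiffAt.mdifferentiableAt (by simp)
  refine ⟨h1, ?_⟩
  have h2 := (hasMFDerivAt_coe_ico (icoScale s 0)).comp 0 h1.hasMFDerivAt
  have h3 : HasMFDerivAt (𝓡∂ 1) 𝓘(ℝ, ℝ) (fun t : Ico (0 : ℝ) 1 => (s : ℝ) * t) 0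
      (((s : ℝ) • ContinuousLinearMap.id ℝ ℝ).comp
        (EuclideanSpace.proj (0 : Fin 1) : EuclideanSpace ℝ (Fin 1) →L[ℝ] ℝ)) := by
    refine HasMFDerivAt.comp (g := fun r : ℝ => (s : ℝ) * r) (0 : Ico (0 : ℝ) 1) ?_
      (hasMFDerivAt_coe_ico 0)
    refine HasFDerivAt.hasMFDerivAt ?_
    exact (hasFDerivAt_id _).const_smul (s : ℝ)
  have h4 := DFunLike.congr_fun (hasMFDerivAt_unique h2 h3) icoUnit
  have h5 : ∀ v w : EuclideanSpace ℝ (Fin 1), v 0 = w 0 → v = w := by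
    intro v w h
    ext i
    fin_cases i
    exact h
  exact h5 _ _ h4

end IcoCurves

/-! ### Derivatives of coordinate changes -/

section CoordChange

variable {E H X : Type*} [NormedAddCommGroup E] [NormedSpace ℝ E] [TopologicalSpace H]
  {I : ModelWithCorners ℝ E H} [TopologicalSpace X] [ChartedSpace H X] [IsManifold I ∞ X]

theorem hasFDerivWithinAt_coordChange {x₀ x₁ x : X} (hx : x ∈ (chartAt H x₀).source)
    (hx₁ : x ∈ (chartAt H x₁).source) :
    ∃ T' : E →L[ℝ] E, HasFDerivWithinAt (extChartAt I x₁ ∘ (extChartAt I x₀).symm) T' (range I)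
      (extChartAt I x₀ x) := by
  have h1 : ContDiffWithinAt ℝ ∞ (extChartAt I x₁ ∘ (extChartAt I x₀).symm) (range I)
      (extChartAt I x₀ x) := by
    refine contDiffWithinAt_ext_coord_change x₁ x₀ ?_
    rw [PartialEquiv.trans_source]
    have hx' : x ∈ (extChartAt I x₀).source := by rwa [extChartAt_source]
    refine ⟨(extChartAt I x₀).map_source hx', ?_⟩
    simp only [mem_preimage, (extChartAt I x₀).left_inv hx', extChartAt_source]
    exact hx₁
  exact ⟨_, (h1.differentiableWithinAt (by simp)).hasFDerivWithinAt⟩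

/-- The derivative of a coordinate change to the preferred chart at `x` has a right inverse. -/
theorem exists_hasFDerivWithinAt_coordChange {x₀ x : X} (hx : x ∈ (chartAt H x₀).source) :
    ∃ T' : E →L[ℝ] E, HasFDerivWithinAt (extChartAt I x ∘ (extChartAt I x₀).symm) T' (range I)
      (extChartAt I x₀ x) ∧ ∃ w : E → E, ∀ v, T' (w v) = v := by
  have hx' : x ∈ (extChartAt I x₀).source := by rwa [extChartAt_source]
  obtain ⟨T', hT'⟩ := hasFDerivWithinAt_coordChange (I := I) hx (mem_chart_source H x)
  obtain ⟨S', hS'⟩ := hasFDerivWithinAt_coordChange (I := I) (mem_chart_source H x) hx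
  refine ⟨T', hT', S', fun v => ?_⟩
  have h1 : (extChartAt I x₀ ∘ (extChartAt I x).symm) (extChartAt I x x) = extChartAt I x₀ x := by
    simp
  rw [← h1] at hT'
  have h2 := hT'.comp _ hS' (t := range I) (fun z _ => ⟨_, rfl⟩)
  have h3 : HasFDerivWithinAt (id : E → E) (T'.comp S') (range I) (extChartAt I x x) := by
    refine h2.congr_of_eventuallyEq ?_ ?_
    · have h4 : ∀ᶠ z in 𝓝[range I] (extChartAt I x x),
          (extChartAt I x).symm z ∈ (extChartAt I x₀).source := by
        have h5 : ContinuousAt (extChartAt I x).symm (extChartAt I x x) :=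
          continuousAt_extChartAt_symm x
        refine (h5.eventually ((isOpen_extChartAt_source x₀).mem_nhds ?_)).filter_mono
          nhdsWithin_le_nhds
        rwa [extChartAt_to_inv]
      filter_upwards [h4, extChartAt_target_mem_nhdsWithin (I := I) x] with z h5 h6
      simp only [Function.comp_apply, id]
      rw [(extChartAt I x₀).left_inv h5, (extChartAt I x).right_inv h6]
    · simp only [Function.comp_apply, extChartAt_to_inv, (extChartAt I x₀).left_inv hx', id]
  exact DFunLike.congr_fun ((I.uniqueDiffOn _ ⟨_, rfl⟩).eq h3 (hasFDerivWithinAt_id _ _)) v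

end CoordChange

/-! ### Pushing the boundary inwards inside one chart -/

section Push

variable {n : ℕ} {X : Type*} [TopologicalSpace X] [ChartedSpace (EuclideanHalfSpace (n + 1)) X]

/-- The initial velocity of a curve `γ : [0,1) → X`, in the preferred chart at `γ 0`. -/
def initialVelocity (γ : Ico (0 : ℝ) 1 → X) : EuclideanSpace ℝ (Fin (n + 1)) :=
  mfderiv (𝓡∂ 1) (𝓡∂ (n + 1)) γ 0 icoUnit

theorem initialVelocity_const (x : X) : initialVelocity (n := n) (fun _ : Ico (0 : ℝ) 1 => x) = 0 := by
  unfold initialVelocity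
  rw [mfderiv_const]
  rfl

theorem initialVelocity_comp_icoScale {γ : Ico (0 : ℝ) 1 → X}
    (hγ : MDifferentiableAt (𝓡∂ 1) (𝓡∂ (n + 1)) γ 0) (s : Icc (0 : ℝ) 1) :
    initialVelocity (n := n) (fun t => γ (icoScale s t)) = (s : ℝ) • initialVelocity (n := n) γ := by
  have h1 : HasMFDerivAt (𝓡∂ 1) (𝓡∂ (n + 1)) γ (icoScale s 0) (mfderiv (𝓡∂ 1) (𝓡∂ (n + 1)) γ 0) := by
    have h2 := hγ.hasMFDerivAt
    have h3 : ∀ z, z = (0 : Ico (0 : ℝ) 1) → HasMFDerivAt (𝓡∂ 1) (𝓡∂ (n + 1)) γ z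
        (mfderiv (𝓡∂ 1) (𝓡∂ (n + 1)) γ 0) := by
      rintro _ rfl
      exact h2
    exact h3 _ (icoScale_zero_right s)
  have h2 := (HasMFDerivAt.comp 0 h1 (mfderiv_icoScale s).1.hasMFDerivAt).mfderiv
  have h3 := DFunLike.congr_fun h2 icoUnit
  refine h3.trans ?_
  have h4 := congrArg (mfderiv (𝓡∂ 1) (𝓡∂ (n + 1)) γ 0) (mfderiv_icoScale s).2
  exact h4.trans (ContinuousLinearMap.map_smul _ _ _)

variable [IsManifold (𝓡∂ (n + 1)) ∞ X]

/-- A smooth family of maps `X → X`, supported in a chart domain, which starts with the identity and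
moves the boundary inwards near a given point. -/
theorem exists_chart_push [T2Space X] (x₀ : X) : ∃ p : X → Ico (0 : ℝ) 1 → X,
    ContMDiff ((𝓡∂ (n + 1)).prod (𝓡∂ 1)) (𝓡∂ (n + 1)) ∞ (fun q : X × Ico (0 : ℝ) 1 => p q.1 q.2) ∧
    (∀ x, p x 0 = x) ∧
    (∀ x, (𝓡∂ (n + 1)).IsBoundaryPoint x → 0 ≤ initialVelocity (n := n) (p x) 0) ∧
    ∀ᶠ x in 𝓝 x₀, (𝓡∂ (n + 1)).IsBoundaryPoint x → 0 < initialVelocity (n := n) (p x) 0 := by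
  set I := 𝓡∂ (n + 1)
  set φ := extChartAt I x₀ with hφ
  let χ : SmoothBumpFunction I x₀ := Classical.arbitrary _
  set e : EuclideanSpace ℝ (Fin (n + 1)) := EuclideanSpace.single 0 1 with he
  have hsupp : tsupport χ ⊆ φ.source := by
    rw [hφ, extChartAt_source]
    exact χ.tsupport_subset_chartAt_source
  have hK : IsCompact (φ '' tsupport χ) :=
    χ.hasCompactSupport.isCompact.image_of_continuousOn ((continuousOn_extChartAt x₀).mono hsupp)
  set O : Set (EuclideanSpace ℝ (Fin (n + 1))) := I.symm ⁻¹' (chartAt _ x₀).target with hO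
  have hOo : IsOpen O := (chartAt _ x₀).open_target.preimage I.continuous_symm
  have hOt : φ.target = O ∩ range I := extChartAt_target I x₀
  -- The support of the bump function is compact, so its image in the chart can be translated by a
  -- uniform amount in direction `e` without leaving the open set `O`. In the inward direction it
  -- also stays in the half-space.
  have hκ : ∀ᶠ s : ℝ in 𝓝 0, ∀ z ∈ φ '' tsupport χ, z + s • e ∈ O := by
    refine hK.eventually_forall_of_forall_eventually fun z hz => ?_
    obtain ⟨x, hx, rfl⟩ := hz
    have h1 : φ x + (0 : ℝ) • e ∈ O := by
      rw [zero_smul, add_zero]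
      exact (hOt ▸ φ.map_source (hsupp hx) : φ x ∈ O ∩ range I).1
    have h2 : Continuous fun q : ℝ × EuclideanSpace ℝ (Fin (n + 1)) => q.2 + q.1 • e := by fun_prop
    exact (h2.continuousAt (x := ((0 : ℝ), φ x))).eventually (hOo.mem_nhds h1)
  obtain ⟨κ, hκ0, hκ⟩ := Metric.nhds_basis_closedBall.mem_iff.1 hκ
  have hmem : ∀ x ∈ φ.source, ∀ t : ℝ, 0 ≤ t → t ≤ 1 → φ x + (κ * χ x * t) • e ∈ φ.target := by
    intro x hx t ht0 ht1
    have hc : 0 ≤ κ * χ x * t := by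
      have := χ.nonneg (x := x)
      positivity
    rw [hOt]
    constructor
    · by_cases hxs : x ∈ tsupport χ
      · refine hκ ?_ _ ⟨x, hxs, rfl⟩
        rw [mem_closedBall_zero_iff, Real.norm_eq_abs, abs_of_nonneg hc]
        have h1 : χ x * t ≤ 1 := mul_le_one₀ χ.le_one ht0 ht1
        nlinarith
      · rw [image_eq_zero_of_notMem_tsupport hxs]
        simp only [mul_zero, zero_mul, zero_smul, add_zero]
        exact (hOt ▸ φ.map_source hx : φ x ∈ O ∩ range I).1
    · have h1 : φ x ∈ range I := ⟨_, rfl⟩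
      rw [range_modelWithCornersEuclideanHalfSpace] at h1 ⊢
      have h1' : 0 ≤ φ x 0 := h1
      simp only [mem_ofPred_eq, PiLp.add_apply, PiLp.smul_apply, he, PiLp.single_apply,
        smul_eq_mul]
      simp only [if_true, mul_one]
      linarith
  classical
  -- In the chart, `x` moves along the inward normal `e` with speed `κ * χ x`. The bump function
  -- makes the two branches fit together smoothly.
  set p : X → Ico (0 : ℝ) 1 → X := fun x t =>
    if x ∈ φ.source then φ.symm (φ x + (κ * χ x * t) • e) else x with hp
  have hp1 : ∀ x ∈ φ.source, ∀ t, p x t = φ.symm (φ x + (κ * χ x * t) • e) :=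
    fun x hx t => if_pos hx
  have hp2 : ∀ x ∉ tsupport χ, ∀ t, p x t = x := by
    intro x hx t
    by_cases hxs : x ∈ φ.source
    · rw [hp1 x hxs, image_eq_zero_of_notMem_tsupport hx]
      simp only [mul_zero, zero_mul, zero_smul, add_zero]
      exact φ.left_inv hxs
    · exact if_neg hxs
  have hso : IsOpen φ.source := isOpen_extChartAt_source x₀
  have hp0 : ∀ x, p x 0 = x := by
    intro x
    by_cases hxs : x ∈ φ.source
    · rw [hp1 x hxs]
      simp only [Ico.coe_zero, mul_zero, zero_smul, add_zero]
      exact φ.left_inv hxs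
    · exact if_neg hxs
  have hsmooth : ContMDiff (I.prod (𝓡∂ 1)) I ∞ (fun q : X × Ico (0 : ℝ) 1 => p q.1 q.2) := by
    rintro ⟨x, t⟩
    by_cases hxs : x ∈ φ.source
    · have h1 : ContMDiffAt (I.prod (𝓡∂ 1)) 𝓘(ℝ, EuclideanSpace ℝ (Fin (n + 1))) ∞
          (fun q : X × Ico (0 : ℝ) 1 => φ q.1 + (κ * χ q.1 * q.2) • e) (x, t) := by
        have h2 : ContMDiffAt (I.prod (𝓡∂ 1)) 𝓘(ℝ, EuclideanSpace ℝ (Fin (n + 1))) ∞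
            (fun q : X × Ico (0 : ℝ) 1 => φ q.1) (x, t) :=
          (contMDiffAt_extChartAt' (by rwa [hφ, extChartAt_source] at hxs)).comp (x, t)
            contMDiffAt_fst
        have h3 : ContMDiffAt (I.prod (𝓡∂ 1)) 𝓘(ℝ, ℝ) ∞
            (fun q : X × Ico (0 : ℝ) 1 => χ q.1) (x, t) :=
          (χ.contMDiff.contMDiffAt).comp (x, t) contMDiffAt_fst
        have h4 : ContMDiffAt (I.prod (𝓡∂ 1)) 𝓘(ℝ, ℝ) ∞
            (fun q : X × Ico (0 : ℝ) 1 => (q.2 : ℝ)) (x, t) :=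
          (contMDiff_coe_ico.contMDiffAt).comp (x, t) contMDiffAt_snd
        have h5 : ContMDiffAt (I.prod (𝓡∂ 1)) 𝓘(ℝ, ℝ) ∞
            (fun q : X × Ico (0 : ℝ) 1 => κ * χ q.1 * q.2) (x, t) :=
          ((contMDiffAt_const (I' := 𝓘(ℝ, ℝ)) (c := κ)).smul h3).smul h4
        have h6 : ContMDiffAt (I.prod (𝓡∂ 1)) 𝓘(ℝ, EuclideanSpace ℝ (Fin (n + 1))) ∞
            (fun q : X × Ico (0 : ℝ) 1 => (κ * χ q.1 * q.2) • e) (x, t) :=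
          h5.smul (contMDiffAt_const (c := e))
        exact h2.add h6
      have h5 : ContMDiffWithinAt 𝓘(ℝ, EuclideanSpace ℝ (Fin (n + 1))) I ∞ φ.symm φ.target
          (φ x + (κ * χ x * t) • e) :=
        contMDiffOn_extChartAt_symm x₀ _ (hmem x hxs t t.2.1 t.2.2.le)
      have h6 : ContMDiffWithinAt (I.prod (𝓡∂ 1)) I ∞ (fun q : X × Ico (0 : ℝ) 1 => p q.1 q.2)
          (Prod.fst ⁻¹' φ.source) (x, t) := by
        refine (h5.comp (x, t) h1.contMDiffWithinAt ?_).congr ?_ ?_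
        · exact fun q hq => hmem q.1 hq q.2 q.2.2.1 q.2.2.2.le
        · exact fun q hq => hp1 q.1 hq q.2
        · exact hp1 x hxs t
      exact h6.contMDiffAt ((hso.preimage continuous_fst).mem_nhds hxs)
    · have h1 : x ∉ tsupport χ := fun h => hxs (hsupp h)
      refine (contMDiffAt_fst (I := I) (J := 𝓡∂ 1) (n := ∞)).congr_of_eventuallyEq ?_
      have h2 : IsOpen ((tsupport χ)ᶜ) := (isClosed_tsupport χ).isOpen_compl
      filter_upwards [(h2.preimage continuous_fst).mem_nhds
        (show (x, t) ∈ Prod.fst ⁻¹' (tsupport χ)ᶜ from h1)] with q hq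
      exact hp2 q.1 hq q.2
  -- The velocity is `κ * χ x` times `e` in the chart at `x₀`, but `initialVelocity` uses the
  -- preferred chart at `x`. The coordinate change scales normal components on the boundary by some
  -- `a > 0`.
  have hvel : ∀ x ∈ φ.source, I.IsBoundaryPoint x → ∃ a > 0,
      initialVelocity (n := n) (p x) 0 = a * (κ * χ x) := by
    intro x hxs hxb
    have hxs' : x ∈ (chartAt (EuclideanHalfSpace (n + 1)) x₀).source := by
      rwa [hφ, extChartAt_source] at hxs
    obtain ⟨T', hT', w, hw⟩ := exists_hasFDerivWithinAt_coordChange (I := I) hxs' 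
    have hI := isHalfSpaceModel_halfSpace n
    have hT'' := hT'
    rw [hI.range_eq] at hT''
    obtain ⟨-, a, ha, hav⟩ := inward_of_surjective (e := e) (by simp [he]) hT'' (hI.nonneg x x₀)
      (ℓ' := EuclideanSpace.proj (0 : Fin (n + 1))) (Eventually.of_forall fun z => hI.nonneg _ _) (by
        simp only [Function.comp_apply]
        rw [(extChartAt I x₀).left_inv hxs]
        exact (hI.isBoundaryPoint_iff (mem_chart_source _ _)).1 hxb) (w := w e) (by
        rw [hw]
        simp [he])
    refine ⟨a, ha, ?_⟩
    have hD : HasFDerivWithinAt (writtenInExtChartAt (𝓡∂ 1) I (0 : Ico (0 : ℝ) 1) (p x))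
        (T'.comp ((ContinuousLinearMap.toSpanSingleton ℝ ((κ * χ x) • e)).comp
          (EuclideanSpace.proj (0 : Fin 1) : EuclideanSpace ℝ (Fin 1) →L[ℝ] ℝ)))
        (range (𝓡∂ 1)) (extChartAt (𝓡∂ 1) (0 : Ico (0 : ℝ) 1) 0) := by
      set L : EuclideanSpace ℝ (Fin 1) →L[ℝ] EuclideanSpace ℝ (Fin (n + 1)) :=
        (ContinuousLinearMap.toSpanSingleton ℝ ((κ * χ x) • e)).comp
          (EuclideanSpace.proj (0 : Fin 1) : EuclideanSpace ℝ (Fin 1) →L[ℝ] ℝ) with hL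
      have hL0 : ∀ v, L v = (κ * χ x * v 0) • e := by
        intro v
        simp [hL, smul_smul, mul_comm]
      have h1 : HasFDerivWithinAt (fun v => φ x + L v) L (range (𝓡∂ 1))
          (extChartAt (𝓡∂ 1) (0 : Ico (0 : ℝ) 1) 0) := L.hasFDerivWithinAt.const_add _
      have h2 : φ x + L (extChartAt (𝓡∂ 1) (0 : Ico (0 : ℝ) 1) 0) = φ x := by
        rw [hL0, extChartAt_ico_apply]
        simp
      rw [← h2] at hT'
      have h4 : ∀ v ∈ (extChartAt (𝓡∂ 1) (0 : Ico (0 : ℝ) 1)).target,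
          writtenInExtChartAt (𝓡∂ 1) I (0 : Ico (0 : ℝ) 1) (p x) v =
            (extChartAt I x ∘ φ.symm) (φ x + L v) := by
        intro v hv
        simp only [writtenInExtChartAt, Function.comp_apply, hp0]
        rw [hp1 x hxs, extChartAt_ico_symm_apply hv, hL0]
      refine ((HasFDerivWithinAt.comp (f := fun v => φ x + L v) _ hT' h1 ?_).congr_of_eventuallyEq ?_ (h4 _ (mem_extChartAt_target _)))
      · intro v hv
        rw [range_modelWithCornersEuclideanHalfSpace] at hv ⊢
        have hv0 : 0 ≤ v 0 := hv
        have h5 := hI.nonneg x x₀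
        have h6 := χ.nonneg (x := x)
        beta_reduce
        rw [hL0]
        simp only [mem_ofPred_eq, PiLp.add_apply, PiLp.smul_apply, he, PiLp.single_apply,
          smul_eq_mul, if_true, mul_one]
        exact add_nonneg h5 (by positivity)
      · filter_upwards [extChartAt_target_mem_nhdsWithin (I := 𝓡∂ 1) (0 : Ico (0 : ℝ) 1)] with v hv
        exact h4 v hv
    have hc : ContinuousAt (p x) 0 :=
      (hsmooth.continuous.comp (f := fun t => (x, t)) (by fun_prop)).continuousAt
    have h1 : initialVelocity (n := n) (p x) = T' ((κ * χ x) • e) := by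
      unfold initialVelocity
      rw [HasMFDerivAt.mfderiv ⟨hc, hD⟩]
      change T' (ContinuousLinearMap.toSpanSingleton ℝ ((κ * χ x) • e) (1 : ℝ)) = _
      rw [ContinuousLinearMap.toSpanSingleton_apply, one_smul]
    rw [h1]
    exact (hav _).trans (by simp [he])
  refine ⟨p, hsmooth, hp0, ?_, ?_⟩
  · intro x hxb
    by_cases hxs : x ∈ φ.source
    · obtain ⟨a, ha, h⟩ := hvel x hxs hxb
      rw [h]
      have := χ.nonneg (x := x)
      positivity
    · have h1 : x ∉ tsupport χ := fun h => hxs (hsupp h)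
      rw [funext (hp2 x h1), initialVelocity_const]
      simp
  · filter_upwards [χ.support_mem_nhds] with x hx hxb
    obtain ⟨a, ha, h⟩ := hvel x (hsupp (subset_tsupport _ hx)) hxb
    rw [h]
    have : 0 < χ x := lt_of_le_of_ne χ.nonneg (Ne.symm hx)
    positivity

end Push

/-! ### Smooth maps between manifolds over the base -/

section SmoothOver

variable {E H E' H' E'' H'' E₁ H₁ F F' F'' T B Z Z' Z'' : Type*}
  [NormedAddCommGroup E] [NormedSpace ℝ E] [TopologicalSpace H] {I : ModelWithCorners ℝ E H}
  [NormedAddCommGroup E'] [NormedSpace ℝ E'] [TopologicalSpace H'] {I' : ModelWithCorners ℝ E' H'}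
  [NormedAddCommGroup E''] [NormedSpace ℝ E''] [TopologicalSpace H'']
  {I'' : ModelWithCorners ℝ E'' H''}
  [NormedAddCommGroup E₁] [NormedSpace ℝ E₁] [TopologicalSpace H₁] {J : ModelWithCorners ℝ E₁ H₁}
  [TopologicalSpace F] [ChartedSpace H F] [TopologicalSpace F'] [ChartedSpace H' F']
  [TopologicalSpace F''] [ChartedSpace H'' F'']
  [TopologicalSpace T] [ChartedSpace H₁ T]
  [TopologicalSpace B] [TopologicalSpace Z] [TopologicalSpace Z'] [TopologicalSpace Z'']
  {P : ManifoldOver I F B Z} {P' : ManifoldOver I' F' B Z'} {P'' : ManifoldOver I'' F'' B Z''}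

/-- The expression of the map `Ψ` between total spaces in local trivialisations. -/
def trivRep {proj : Z → B} {proj' : Z' → B} (e : Trivialization F proj)
    (e' : Trivialization F' proj') (Ψ : Z → Z') (b : B) (x : F) : F' :=
  (e' (Ψ (e.toOpenPartialHomeomorph.symm (b, x)))).2

section

variable {proj : Z → B} {proj' : Z' → B} {proj'' : Z'' → B} {e : Trivialization F proj}
    {e' : Trivialization F' proj'} {e'' : Trivialization F'' proj''} {Ψ : Z → Z'} {Ψ' : Z' → Z''}

theorem Bundle.Trivialization.symm_mk_snd {b : B} {z : Z} (hz : proj z = b) (hb : b ∈ e.baseSet) :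
    e.toOpenPartialHomeomorph.symm (b, (e z).2) = z := by
  subst hz
  have h1 : ((proj z, (e z).2) : B × F) = e z := Prod.ext (e.coe_fst' hb).symm rfl
  rw [h1]
  exact e.toOpenPartialHomeomorph.left_inv (e.mem_source.2 hb)

theorem trivRep_self {b : B} {z : Z} (hz : proj z = b) (hb : b ∈ e.baseSet) :
    trivRep e e' Ψ b (e z).2 = (e' (Ψ z)).2 := by
  unfold trivRep
  rw [e.symm_mk_snd hz hb]

theorem proj_symm {b : B} (hb : b ∈ e.baseSet) (x : F) :
    proj (e.toOpenPartialHomeomorph.symm (b, x)) = b := e.proj_symm_apply' hb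

theorem snd_apply_symm {b : B} (hb : b ∈ e.baseSet) (x : F) :
    (e (e.toOpenPartialHomeomorph.symm (b, x))).2 = x := by
  rw [e.apply_symm_apply' hb]

theorem symm_trivRep (hΨ : ∀ z, proj' (Ψ z) = proj z) {b : B} (hb : b ∈ e.baseSet)
    (hb' : b ∈ e'.baseSet) (x : F) :
    e'.toOpenPartialHomeomorph.symm (b, trivRep e e' Ψ b x) =
      Ψ (e.toOpenPartialHomeomorph.symm (b, x)) :=
  e'.symm_mk_snd (by rw [hΨ, proj_symm hb]) hb'

theorem trivRep_comp (hΨ : ∀ z, proj' (Ψ z) = proj z) {b : B} (hb : b ∈ e.baseSet)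
    (hb' : b ∈ e'.baseSet) (x : F) :
    trivRep e' e'' Ψ' b (trivRep e e' Ψ b x) = trivRep e e'' (Ψ' ∘ Ψ) b x := by
  unfold trivRep
  rw [e'.symm_mk_snd (by rw [hΨ, proj_symm hb]) hb']
  rfl

end

theorem ManifoldOver.isLocalTriv_of_mem {e : Trivialization F P.proj} (he : e ∈ P.atlas) :
    P.IsLocalTriv e :=
  fun e' he' => ⟨P.isDiffFamily e he e' he', P.isDiffFamily e' he' e he⟩

theorem ManifoldOver.exists_isLocalTriv (P : ManifoldOver I F B Z) (b : B) :
    ∃ e, P.IsLocalTriv e ∧ b ∈ e.baseSet := by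
  obtain ⟨e, he, hb⟩ := P.exists_mem_atlas b
  exact ⟨e, P.isLocalTriv_of_mem he, hb⟩

variable [IsManifold I ∞ F] [IsManifold I' ∞ F'] [IsManifold I'' ∞ F'']

/-- Compatibility is only postulated with members of the atlas, so the change from `e` to `e'` is
factored through one of them. -/
theorem ManifoldOver.IsLocalTriv.mfamAt [LocallyCompactSpace F] {e e' : Trivialization F P.proj}
    (he : P.IsLocalTriv e) (he' : P.IsLocalTriv e') {b : B} (hb : b ∈ e.baseSet)
    (hb' : b ∈ e'.baseSet) (x : F) : MFamAt I I (trivRep e e' id) b x := by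
  obtain ⟨e₁, he₁, hb₁⟩ := P.exists_mem_atlas b
  have h1 := (he e₁ he₁).1.mfamAt (e.open_baseSet.inter e₁.open_baseSet) ⟨hb, hb₁⟩ x
  have h2 := (he' e₁ he₁).2.mfamAt (e₁.open_baseSet.inter e'.open_baseSet) ⟨hb₁, hb'⟩
    (e.coordChange e₁ b x)
  refine (h2.comp h1).congr ?_
  filter_upwards [continuousAt_fst.eventually (e.open_baseSet.mem_nhds hb),
    continuousAt_fst.eventually (e₁.open_baseSet.mem_nhds hb₁)] with p hp hp₁
  exact trivRep_comp (e := e) (e' := e₁) (e'' := e') (Ψ := id) (Ψ' := id) (fun _ => rfl) hp hp₁ p.2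

/-- A smooth map of manifolds over `B`: in local trivialisations it is a continuous family
of smooth maps of the fibres. -/
structure SmoothOver (P : ManifoldOver I F B Z) (P' : ManifoldOver I' F' B Z') (Ψ : Z → Z') :
    Prop where
  proj_eq : ∀ z, P'.proj (Ψ z) = P.proj z
  exists_mfamAt : ∀ b, ∃ e e', P.IsLocalTriv e ∧ P'.IsLocalTriv e' ∧ b ∈ e.baseSet ∧
    b ∈ e'.baseSet ∧ ∀ x, MFamAt I I' (trivRep e e' Ψ) b x

variable {Ψ : Z → Z'} {Ψ' : Z' → Z''}

section

variable {proj : Z → B} {proj' : Z' → B} {proj'' : Z'' → B} {e : Trivialization F proj}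
    {e' : Trivialization F' proj'} {e'' : Trivialization F'' proj''}

theorem MFamAt.trivRep_comp (hΨ : ∀ z, proj' (Ψ z) = proj z) {b : B} (hb : b ∈ e.baseSet)
    (hb' : b ∈ e'.baseSet) {x : F} (h' : MFamAt I' I'' (trivRep e' e'' Ψ') b (trivRep e e' Ψ b x))
    (h : MFamAt I I' (trivRep e e' Ψ) b x) : MFamAt I I'' (trivRep e e'' (Ψ' ∘ Ψ)) b x := by
  refine (h'.comp h).congr ?_
  filter_upwards [continuousAt_fst.eventually (e.open_baseSet.mem_nhds hb),
    continuousAt_fst.eventually (e'.open_baseSet.mem_nhds hb')] with p hp hp'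
  exact _root_.trivRep_comp hΨ hp hp' p.2

theorem continuousAt_of_trivRep (hΨ : ∀ z, proj' (Ψ z) = proj z) {z : Z} {b : B} (hz : proj z = b)
    (hb : b ∈ e.baseSet) (hb' : b ∈ e'.baseSet)
    (h : ContinuousAt (fun p : B × F => trivRep e e' Ψ p.1 p.2) (b, (e z).2)) :
    ContinuousAt Ψ z := by
  subst hz
  have hez : e z = (proj z, (e z).2) := Prod.ext (e.coe_fst' hb) rfl
  have h1 : ContinuousAt e z := e.continuousAt (e.mem_source.2 hb)
  have h2 : ContinuousAt (fun w => e'.toOpenPartialHomeomorph.symm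
      ((e w).1, trivRep e e' Ψ (e w).1 (e w).2)) z := by
    refine ContinuousAt.comp (g := e'.toOpenPartialHomeomorph.symm)
      (f := fun w => ((e w).1, trivRep e e' Ψ (e w).1 (e w).2)) ?_ ?_
    · refine e'.toOpenPartialHomeomorph.continuousAt_symm (e'.mem_target.2 ?_)
      rw [hez]
      exact hb'
    · refine h1.fst.prodMk ?_
      rw [← hez] at h
      exact ContinuousAt.comp (g := fun p : B × F => trivRep e e' Ψ p.1 p.2) (f := e) h h1
  refine h2.congr ?_
  have ho : ∀ᶠ w in 𝓝 z, w ∈ e.source := e.open_source.mem_nhds (e.mem_source.2 hb)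
  have ho' : ∀ᶠ w in 𝓝 z, (e w).1 ∈ e'.baseSet :=
    h1.fst.eventually (e'.open_baseSet.mem_nhds (by beta_reduce; rw [hez]; exact hb'))
  filter_upwards [ho, ho'] with w hw hw'
  rw [e.coe_fst hw] at hw' ⊢
  rw [e.mem_source] at hw
  rw [symm_trivRep hΨ hw hw', e.symm_mk_snd rfl hw]

end

/-- The definition provides one good pair of trivialisations around each `b`; transition functions
carry smoothness to every other pair. -/
theorem SmoothOver.mfamAt [LocallyCompactSpace F] [LocallyCompactSpace F'] (h : SmoothOver P P' Ψ)
    {e : Trivialization F P.proj} {e' : Trivialization F' P'.proj} (he : P.IsLocalTriv e)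
    (he' : P'.IsLocalTriv e') {b : B} (hb : b ∈ e.baseSet) (hb' : b ∈ e'.baseSet) (x : F) :
    MFamAt I I' (trivRep e e' Ψ) b x := by
  obtain ⟨e₁, e₁', he₁, he₁', hb₁, hb₁', h1⟩ := h.exists_mfamAt b
  have h2 := he.mfamAt he₁ hb hb₁ x
  have h3 := MFamAt.trivRep_comp (Ψ := id) (Ψ' := Ψ) (fun _ => rfl) hb hb₁ (h1 _) h2
  exact MFamAt.trivRep_comp (Ψ := Ψ ∘ id) (Ψ' := id) (fun z => h.proj_eq _) hb hb₁'
    (he₁'.mfamAt he' hb₁' hb' _) h3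

theorem SmoothOver.comp [LocallyCompactSpace F] [LocallyCompactSpace F'] [LocallyCompactSpace F'']
    (h' : SmoothOver P' P'' Ψ') (h : SmoothOver P P' Ψ) : SmoothOver P P'' (Ψ' ∘ Ψ) := by
  refine ⟨fun z => (h'.proj_eq _).trans (h.proj_eq z), fun b => ?_⟩
  obtain ⟨e, he, hb⟩ := P.exists_isLocalTriv b
  obtain ⟨e', he', hb'⟩ := P'.exists_isLocalTriv b
  obtain ⟨e'', he'', hb''⟩ := P''.exists_isLocalTriv b
  exact ⟨e, e'', he, he'', hb, hb'', fun x => MFamAt.trivRep_comp h.proj_eq hb hb'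
    (h'.mfamAt he' he'' hb' hb'' _) (h.mfamAt he he' hb hb' x)⟩

theorem SmoothOver.continuous (h : SmoothOver P P' Ψ) : Continuous Ψ := by
  refine continuous_iff_continuousAt.2 fun z => ?_
  obtain ⟨e, e', -, -, hb, hb', h1⟩ := h.exists_mfamAt (P.proj z)
  exact continuousAt_of_trivRep h.proj_eq rfl hb hb' (h1 _).1

variable [IsManifold J ∞ T]

theorem ManifoldOver.IsLocalTriv.prodFibre {e : Trivialization F P.proj} (he : P.IsLocalTriv e) :
    (P.prod J T).IsLocalTriv (e.prodFibre T) := by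
  rintro _ ⟨e', he', rfl⟩
  exact ⟨(he e' he').1.prod_id J, (he e' he').2.prod_id J⟩

theorem trivRep_prodFibre {e : Trivialization F P.proj} {proj' : Z' → B}
    {e' : Trivialization F' proj'} {Ψ : Z × T → Z'} (b : B) (q : F × T) :
    trivRep (e.prodFibre T) e' Ψ b q =
      (e' (Ψ (e.toOpenPartialHomeomorph.symm (b, q.1), q.2))).2 := rfl

theorem ManifoldOver.continuous_proj (P : ManifoldOver I F B Z) : Continuous P.proj := by
  refine continuous_iff_continuousAt.2 fun z => ?_
  obtain ⟨e, -, hb⟩ := P.exists_mem_atlas (P.proj z)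
  exact e.continuousAt_proj (e.mem_source.2 hb)

theorem SmoothOver.prodMk_snd [LocallyCompactSpace F] [LocallyCompactSpace F']
    [LocallyCompactSpace T] {Ψ : Z × T → Z'} (h : SmoothOver (P.prod J T) P' Ψ) :
    SmoothOver (P.prod J T) (P'.prod J T) (fun p => (Ψ p, p.2)) := by
  refine ⟨h.proj_eq, fun b => ?_⟩
  obtain ⟨e, he, hb⟩ := P.exists_isLocalTriv b
  obtain ⟨e', he', hb'⟩ := P'.exists_isLocalTriv b
  refine ⟨e.prodFibre T, e'.prodFibre T, he.prodFibre, he'.prodFibre, hb, hb', fun x => ?_⟩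
  exact (h.mfamAt he.prodFibre he' hb hb' x).prodMk (mfamAt_const contMDiffAt_snd)

theorem SmoothOver.fst [LocallyCompactSpace F] :
    SmoothOver (P.prod J T) P (Prod.fst : Z × T → Z) := by
  refine ⟨fun _ => rfl, fun b => ?_⟩
  obtain ⟨e, he, hb⟩ := P.exists_isLocalTriv b
  refine ⟨e.prodFibre T, e, he.prodFibre, he, hb, hb, fun x => ?_⟩
  refine MFamAt.congr (f := fun _ (q : F × T) => q.1) (mfamAt_const contMDiffAt_fst) ?_
  filter_upwards [continuousAt_fst.eventually (e.open_baseSet.mem_nhds hb)] with p hp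
  exact (snd_apply_symm (e := e) hp p.2.1).symm

end SmoothOver

/-! ### Initial velocities under pushes and diffeomorphisms -/

section Velocity

variable {n : ℕ} {X : Type*} [TopologicalSpace X] [ChartedSpace (EuclideanHalfSpace (n + 1)) X]
  [IsManifold (𝓡∂ (n + 1)) ∞ X]

/-- The initial velocity of the curve obtained by pushing the points of `γ` along `p`. -/
theorem initialVelocity_push {p : X → Ico (0 : ℝ) 1 → X}
    (hp : ContMDiff ((𝓡∂ (n + 1)).prod (𝓡∂ 1)) (𝓡∂ (n + 1)) ∞ (fun q : X × Ico (0 : ℝ) 1 => p q.1 q.2))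
    (hp0 : ∀ x, p x 0 = x) {γ : Ico (0 : ℝ) 1 → X}
    (hγ : MDifferentiableAt (𝓡∂ 1) (𝓡∂ (n + 1)) γ 0) (s : Icc (0 : ℝ) 1) :
    initialVelocity (n := n) (fun t => p (γ t) (icoScale s t)) =
      initialVelocity (n := n) γ + (s : ℝ) • initialVelocity (n := n) (p (γ 0)) := by
  have hpd : MDifferentiable ((𝓡∂ (n + 1)).prod (𝓡∂ 1)) (𝓡∂ (n + 1))
      (fun q : X × Ico (0 : ℝ) 1 => p q.1 q.2) := hp.mdifferentiable (by simp)
  have hsd : MDifferentiable (𝓡∂ 1) (𝓡∂ 1) (icoScale s) := fun t =>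
    (mfamAt_icoScale (B := Unit) (s := fun _ => s) (b := ()) continuousAt_const
      t).contMDiffAt.mdifferentiableAt (by simp)
  have hqd : MDifferentiableAt ((𝓡∂ (n + 1)).prod (𝓡∂ 1)) (𝓡∂ (n + 1))
      (fun q : X × Ico (0 : ℝ) 1 => p q.1 (icoScale s q.2)) (γ 0, 0) :=
    (hpd _).comp (γ 0, (0 : Ico (0 : ℝ) 1))
      (mdifferentiableAt_fst.prodMk ((hsd _).comp (γ 0, (0 : Ico (0 : ℝ) 1)) mdifferentiableAt_snd))
  have h1 := mfderiv_comp (I' := (𝓡∂ (n + 1)).prod (𝓡∂ 1)) (0 : Ico (0 : ℝ) 1)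
    (g := fun q : X × Ico (0 : ℝ) 1 => p q.1 (icoScale s q.2)) (f := fun t => (γ t, t)) hqd
    (hγ.prodMk mdifferentiableAt_id)
  have h2 := hγ.mfderiv_prod (mdifferentiableAt_id (I := 𝓡∂ 1) (x := (0 : Ico (0 : ℝ) 1)))
  have h3 : initialVelocity (n := n) (fun t => p (γ t) (icoScale s t)) =
      (mfderiv ((𝓡∂ (n + 1)).prod (𝓡∂ 1)) (𝓡∂ (n + 1))
        (fun q : X × Ico (0 : ℝ) 1 => p q.1 (icoScale s q.2)) (γ 0, 0)
        (initialVelocity (n := n) γ, icoUnit) : EuclideanSpace ℝ (Fin (n + 1))) := by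
    unfold initialVelocity
    refine (DFunLike.congr_fun h1 icoUnit).trans ?_
    have h4 := DFunLike.congr_fun h2 icoUnit
    refine congrArg (mfderiv ((𝓡∂ (n + 1)).prod (𝓡∂ 1)) (𝓡∂ (n + 1))
        (fun q : X × Ico (0 : ℝ) 1 => p q.1 (icoScale s q.2)) (γ 0, 0)) ?_
    refine h4.trans ?_
    rw [mfderiv_id]
    rfl
  rw [h3]
  -- The derivative is the sum of the two partial ones. At time zero the push is the identity, so
  -- the first slot contributes the velocity of `γ` and the second that of the push.
  refine (mfderiv_prod_eq_add_apply hqd).trans ?_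
  have h5 : (fun z : X => p z (icoScale s 0)) = id := by
    funext z
    rw [icoScale_zero_right, hp0]
    rfl
  have h6 : MDifferentiableAt (𝓡∂ 1) (𝓡∂ (n + 1)) (p (γ 0)) 0 :=
    (hpd (γ 0, 0)).comp (0 : Ico (0 : ℝ) 1) (f := fun t => (γ 0, t))
      (mdifferentiableAt_const.prodMk mdifferentiableAt_id)
  have h7 := initialVelocity_comp_icoScale h6 s
  rw [← h7]
  refine congrArg₂ (fun a b : EuclideanSpace ℝ (Fin (n + 1)) => a + b) ?_ rfl
  have h8 : ∀ f : X → X, f = id → (mfderiv (𝓡∂ (n + 1)) (𝓡∂ (n + 1)) f (γ 0)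
    (initialVelocity (n := n) γ) : EuclideanSpace ℝ (Fin (n + 1))) = initialVelocity (n := n) γ := by
    rintro f rfl
    rw [mfderiv_id]
    rfl
  exact h8 _ h5

/-- A local diffeomorphism scales the normal component of velocities by a positive factor
at the boundary. -/
theorem initialVelocity_comp {Y : Type*} [TopologicalSpace Y]
    [ChartedSpace (EuclideanHalfSpace (n + 1)) Y] [IsManifold (𝓡∂ (n + 1)) ∞ Y] {h : X → Y}
    {γ : Ico (0 : ℝ) 1 → X} (hγ : MDifferentiableAt (𝓡∂ 1) (𝓡∂ (n + 1)) γ 0)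
    (hh : MDifferentiableAt (𝓡∂ (n + 1)) (𝓡∂ (n + 1)) h (γ 0))
    (hA : ∃ A : EuclideanSpace ℝ (Fin (n + 1)) ≃L[ℝ] EuclideanSpace ℝ (Fin (n + 1)),
      mfderiv (𝓡∂ (n + 1)) (𝓡∂ (n + 1)) h (γ 0) =
        (A : EuclideanSpace ℝ (Fin (n + 1)) →L[ℝ] EuclideanSpace ℝ (Fin (n + 1))))
    (hb : (𝓡∂ (n + 1)).IsBoundaryPoint (h (γ 0))) :
    ∃ a > 0, initialVelocity (n := n) (h ∘ γ) 0 = a * initialVelocity (n := n) γ 0 := by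
  have hI := isHalfSpaceModel_halfSpace n
  obtain ⟨-, a, ha, h1⟩ := hh.inward_scale hI hI hb hA
  refine ⟨a, ha, ?_⟩
  have h2 := DFunLike.congr_fun (mfderiv_comp (0 : Ico (0 : ℝ) 1) hh hγ) icoUnit
  have h3 : initialVelocity (n := n) (h ∘ γ) = (mfderiv (𝓡∂ (n + 1)) (𝓡∂ (n + 1)) h (γ 0)
    (initialVelocity (n := n) γ) : EuclideanSpace ℝ (Fin (n + 1))) := h2
  rw [h3]
  exact h1 _

end Velocity

/-! ### Maps which extend the boundary and move it inwards -/

section PreCollar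

variable {n : ℕ} {B M X 𝓜 𝓧 : Type*}
    [TopologicalSpace B]
    [TopologicalSpace M] [ChartedSpace (EuclideanSpace ℝ (Fin n)) M] [IsManifold (𝓡 n) ∞ M]
    [LocallyCompactSpace M]
    [TopologicalSpace X] [ChartedSpace (EuclideanHalfSpace (n + 1)) X]
    [IsManifold (𝓡∂ (n + 1)) ∞ X] [LocallyCompactSpace X]
    [TopologicalSpace 𝓜] [TopologicalSpace 𝓧]
    {ι : M → X} {P𝓜 : ManifoldOver (𝓡 n) M B 𝓜} {P𝓧 : ManifoldOver (𝓡∂ (n + 1)) X B 𝓧}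
    {j : 𝓜 → 𝓧}

theorem ManifoldOver.IsLocalTriv.exists_mfderiv_eq {E H F Z : Type*} [NormedAddCommGroup E]
    [NormedSpace ℝ E] [TopologicalSpace H] {I : ModelWithCorners ℝ E H} [TopologicalSpace F]
    [ChartedSpace H F] [IsManifold I ∞ F] [LocallyCompactSpace F] [TopologicalSpace Z]
    {P : ManifoldOver I F B Z} {e e' : Trivialization F P.proj}
    (he : P.IsLocalTriv e) (he' : P.IsLocalTriv e') {b : B} (hb : b ∈ e.baseSet)
    (hb' : b ∈ e'.baseSet) (x : F) :
    ∃ A : E ≃L[ℝ] E, mfderiv I I (trivRep e e' id b) x = (A : E →L[ℝ] E) := by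
  refine mfderiv_bijective_of_local_inverse (g := trivRep e' e id b)
    ((he.mfamAt he' hb hb' x).contMDiffAt.mdifferentiableAt (by simp))
    ((he'.mfamAt he hb' hb _).contMDiffAt.mdifferentiableAt (by simp))
    (Eventually.of_forall fun z => ?_) (Eventually.of_forall fun z => ?_)
  · rw [trivRep_comp (Ψ := id) (fun _ => rfl) hb hb']
    exact snd_apply_symm hb z
  · rw [trivRep_comp (Ψ := id) (fun _ => rfl) hb' hb]
    exact snd_apply_symm hb' z

theorem IsBoundaryInclusion.isBoundaryPoint (hι : IsBoundaryInclusion n ι) (m : M) :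
    (𝓡∂ (n + 1)).IsBoundaryPoint (ι m) := by
  have : ι m ∈ (𝓡∂ (n + 1)).boundary X := hι.range_eq ▸ mem_range_self m
  exact this

theorem IsBoundaryInclusion.contMDiff (hι : IsBoundaryInclusion n ι) :
    ContMDiff (𝓡 n) (𝓡∂ (n + 1)) ∞ ι := hι.isSmoothEmbedding.contMDiff

theorem IsBoundaryInclusion.isEmbedding (hι : IsBoundaryInclusion n ι) :
    Topology.IsEmbedding ι := hι.isSmoothEmbedding.isEmbedding

/-- In the adapted trivialisation the point is `ι m`. The transition map has invertible derivative,
and by `MDifferentiableAt.inward_scale` only boundary points are sent to the boundary by such a map.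
-/
theorem IsBoundaryOver.isBoundaryPoint (hι : IsBoundaryInclusion n ι)
    (hj : IsBoundaryOver ι P𝓜 P𝓧 j) {e : Trivialization X P𝓧.proj} (he : P𝓧.IsLocalTriv e) {z : 𝓜}
    (hz : P𝓜.proj z ∈ e.baseSet) : (𝓡∂ (n + 1)).IsBoundaryPoint (e (j z)).2 := by
  obtain ⟨e₀, e₁, he₀, he₁, hb₀, hb₁, h⟩ := hj.exists_localTriv (P𝓜.proj z)
  have h1 : trivRep e e₁ id (P𝓜.proj z) (e (j z)).2 = ι (e₀ z).2 := by
    rw [trivRep_self (hj.proj_eq z) hz]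
    exact h z hb₀ hb₁
  have hI := isHalfSpaceModel_halfSpace n
  refine (MDifferentiableAt.inward_scale hI hI
    ((he.mfamAt he₁ hz hb₁ (e (j z)).2).contMDiffAt.mdifferentiableAt (by simp)) ?_
    (he.exists_mfderiv_eq he₁ hz hb₁ (e (j z)).2)).1
  rw [h1]
  exact hι.isBoundaryPoint _

/-- In adapted trivialisations `j` is the constant family `ι`. -/
theorem IsBoundaryOver.smoothOver (hι : IsBoundaryInclusion n ι) (hj : IsBoundaryOver ι P𝓜 P𝓧 j) :
    SmoothOver P𝓜 P𝓧 j := by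
  refine ⟨hj.proj_eq, fun b => ?_⟩
  obtain ⟨e₀, e, he₀, he, hb₀, hb, h⟩ := hj.exists_localTriv b
  refine ⟨e₀, e, he₀, he, hb₀, hb, fun x => ?_⟩
  refine MFamAt.congr (f := fun _ => ι) (mfamAt_const hι.contMDiff.contMDiffAt) ?_
  filter_upwards [continuousAt_fst.eventually (e₀.open_baseSet.mem_nhds hb₀),
    continuousAt_fst.eventually (e.open_baseSet.mem_nhds hb)] with p hp₀ hp
  have h1 := proj_symm (e := e₀) hp₀ p.2
  have h2 := h (e₀.toOpenPartialHomeomorph.symm (p.1, p.2)) (by rwa [h1]) (by rwa [h1])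
  rw [snd_apply_symm hp₀] at h2
  exact h2.symm

theorem IsBoundaryOver.injective (hι : IsBoundaryInclusion n ι) (hj : IsBoundaryOver ι P𝓜 P𝓧 j) :
    Function.Injective j := by
  intro z w hzw
  have hp : P𝓜.proj w = P𝓜.proj z := by rw [← hj.proj_eq, ← hj.proj_eq, hzw]
  obtain ⟨e₀, e, he₀, he, hb₀, hb, h⟩ := hj.exists_localTriv (P𝓜.proj z)
  have h1 := h z hb₀ hb
  have h2 := h w (by rwa [hp]) (by rwa [hp])
  rw [hzw, h2] at h1
  rw [← e₀.symm_mk_snd rfl hb₀, ← e₀.symm_mk_snd hp hb₀, hι.isEmbedding.injective h1]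

theorem SmoothOver.mdifferentiableAt_curve {C : 𝓜 × Ico (0 : ℝ) 1 → 𝓧}
    (hC : SmoothOver (P𝓜.prod (𝓡∂ 1) (Ico (0 : ℝ) 1)) P𝓧 C) {e : Trivialization X P𝓧.proj}
    (he : P𝓧.IsLocalTriv e) {z : 𝓜} (hz : P𝓜.proj z ∈ e.baseSet) (t : Ico (0 : ℝ) 1) :
    MDifferentiableAt (𝓡∂ 1) (𝓡∂ (n + 1)) (fun t => (e (C (z, t))).2) t := by
  have hlc : LocallyCompactSpace (Ico (0 : ℝ) 1) :=
    Manifold.locallyCompact_of_finiteDimensional (𝓡∂ 1)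
  obtain ⟨e₀, he₀, hb₀⟩ := P𝓜.exists_isLocalTriv (P𝓜.proj z)
  have h1 := (hC.mfamAt he₀.prodFibre he hb₀ hz ((e₀ z).2, t)).contMDiffAt
  have h2 : (fun t => (e (C (z, t))).2) =
      trivRep (e₀.prodFibre (Ico (0 : ℝ) 1)) e C (P𝓜.proj z) ∘ fun t => ((e₀ z).2, t) := by
    funext t
    simp only [Function.comp_apply, trivRep_prodFibre]
    rw [e₀.symm_mk_snd rfl hb₀]
  rw [h2]
  exact (h1.mdifferentiableAt (by simp)).comp t (mdifferentiableAt_const.prodMk mdifferentiableAt_id)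

/-- A smooth map `𝓜 × [0,1) → 𝓧` over `B` which extends `j`, and whose initial velocity does not
point out of the boundary. -/
structure IsPreCollar (P𝓜 : ManifoldOver (𝓡 n) M B 𝓜) (P𝓧 : ManifoldOver (𝓡∂ (n + 1)) X B 𝓧)
    (j : 𝓜 → 𝓧) (C : 𝓜 × Ico (0 : ℝ) 1 → 𝓧) : Prop where
  smoothOver : SmoothOver (P𝓜.prod (𝓡∂ 1) (Ico (0 : ℝ) 1)) P𝓧 C
  apply_zero : ∀ z, C (z, 0) = j z
  nonneg : ∀ z e, P𝓧.IsLocalTriv e → P𝓜.proj z ∈ e.baseSet →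
    0 ≤ initialVelocity (n := n) (fun t => (e (C (z, t))).2) 0

/-- The map `C` moves the boundary point `z` to the interior with positive velocity. -/
def InwardAt (P𝓜 : ManifoldOver (𝓡 n) M B 𝓜) (P𝓧 : ManifoldOver (𝓡∂ (n + 1)) X B 𝓧)
    (C : 𝓜 × Ico (0 : ℝ) 1 → 𝓧) (z : 𝓜) : Prop :=
  ∀ e, P𝓧.IsLocalTriv e → P𝓜.proj z ∈ e.baseSet →
    0 < initialVelocity (n := n) (fun t => (e (C (z, t))).2) 0

/-- The sign of the normal velocity is therefore intrinsic, and each push can be studied in the one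
trivialisation used to define it. -/
theorem initialVelocity_triv_change (hι : IsBoundaryInclusion n ι) (hj : IsBoundaryOver ι P𝓜 P𝓧 j)
    {C : 𝓜 × Ico (0 : ℝ) 1 → 𝓧} (hC : SmoothOver (P𝓜.prod (𝓡∂ 1) (Ico (0 : ℝ) 1)) P𝓧 C)
    (hC0 : ∀ z, C (z, 0) = j z) {e e' : Trivialization X P𝓧.proj} (he : P𝓧.IsLocalTriv e)
    (he' : P𝓧.IsLocalTriv e') {z : 𝓜} (hz : P𝓜.proj z ∈ e.baseSet) (hz' : P𝓜.proj z ∈ e'.baseSet) :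
    ∃ a > 0, initialVelocity (n := n) (fun t => (e' (C (z, t))).2) 0 =
      a * initialVelocity (n := n) (fun t => (e (C (z, t))).2) 0 := by
  have h1 : (fun t => (e' (C (z, t))).2) =
      trivRep e e' id (P𝓜.proj z) ∘ fun t => (e (C (z, t))).2 := by
    funext t
    simp only [Function.comp_apply]
    rw [trivRep_self (show P𝓧.proj (C (z, t)) = P𝓜.proj z from hC.proj_eq (z, t)) hz]
    rfl
  have h2 : trivRep e e' id (P𝓜.proj z) (e (C (z, 0))).2 = (e' (j z)).2 := by
    rw [trivRep_self (show P𝓧.proj (C (z, 0)) = P𝓜.proj z from hC.proj_eq (z, 0)) hz, hC0]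
    rfl
  rw [h1]
  refine initialVelocity_comp (hC.mdifferentiableAt_curve he hz 0)
    ((he.mfamAt he' hz hz' _).contMDiffAt.mdifferentiableAt (by simp))
    (he.exists_mfderiv_eq he' hz hz' _) ?_
  rw [h2]
  exact hj.isBoundaryPoint hι he' hz'

theorem isPreCollar_fst (hι : IsBoundaryInclusion n ι) (hj : IsBoundaryOver ι P𝓜 P𝓧 j) :
    IsPreCollar P𝓜 P𝓧 j (j ∘ Prod.fst) := by
  have hlc : LocallyCompactSpace (Ico (0 : ℝ) 1) :=
    Manifold.locallyCompact_of_finiteDimensional (𝓡∂ 1)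
  refine ⟨(hj.smoothOver hι).comp SmoothOver.fst, fun _ => rfl, fun z e he hz => ?_⟩
  simp only [Function.comp_apply]
  rw [initialVelocity_const]
  simp

open Classical in
/-- The push `p` of the fibre, scaled by `s`, performed in a local trivialisation. -/
def pushOver (e : Trivialization X P𝓧.proj) (p : X → Ico (0 : ℝ) 1 → X) (s : B → Icc (0 : ℝ) 1)
    (q : 𝓧 × Ico (0 : ℝ) 1) : 𝓧 :=
  if P𝓧.proj q.1 ∈ e.baseSet then e.toOpenPartialHomeomorph.symm
    (P𝓧.proj q.1, p (e q.1).2 (icoScale (s (P𝓧.proj q.1)) q.2)) else q.1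

section pushOver

variable {e : Trivialization X P𝓧.proj} {p : X → Ico (0 : ℝ) 1 → X} {s : B → Icc (0 : ℝ) 1}

theorem pushOver_of_mem {q : 𝓧 × Ico (0 : ℝ) 1} (hq : P𝓧.proj q.1 ∈ e.baseSet) :
    pushOver e p s q = e.toOpenPartialHomeomorph.symm
      (P𝓧.proj q.1, p (e q.1).2 (icoScale (s (P𝓧.proj q.1)) q.2)) := if_pos hq

theorem proj_pushOver (q : 𝓧 × Ico (0 : ℝ) 1) : P𝓧.proj (pushOver e p s q) = P𝓧.proj q.1 := by
  by_cases h : P𝓧.proj q.1 ∈ e.baseSet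
  · rw [pushOver_of_mem h, proj_symm h]
  · rw [pushOver, if_neg h]

theorem apply_pushOver {q : 𝓧 × Ico (0 : ℝ) 1} (hq : P𝓧.proj q.1 ∈ e.baseSet) :
    (e (pushOver e p s q)).2 = p (e q.1).2 (icoScale (s (P𝓧.proj q.1)) q.2) := by
  rw [pushOver_of_mem hq, snd_apply_symm hq]

theorem pushOver_of_scale_eq_zero (hp0 : ∀ x, p x 0 = x) {q : 𝓧 × Ico (0 : ℝ) 1}
    (hq : icoScale (s (P𝓧.proj q.1)) q.2 = 0) : pushOver e p s q = q.1 := by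
  by_cases h : P𝓧.proj q.1 ∈ e.baseSet
  · rw [pushOver_of_mem h, hq, hp0, e.symm_mk_snd rfl h]
  · rw [pushOver, if_neg h]

/-- Outside the base set of `e` the scale `s` vanishes on a neighbourhood, where the push is the
identity on fibres; so the two branches of `pushOver` fit together. -/
theorem smoothOver_pushOver (he : P𝓧.IsLocalTriv e)
    (hp : ContMDiff ((𝓡∂ (n + 1)).prod (𝓡∂ 1)) (𝓡∂ (n + 1)) ∞ (fun q : X × Ico (0 : ℝ) 1 => p q.1 q.2))
    (hp0 : ∀ x, p x 0 = x) (hs : Continuous s) (hse : ∀ b ∉ e.baseSet, ∀ᶠ c in 𝓝 b, s c = 0) :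
    SmoothOver (P𝓧.prod (𝓡∂ 1) (Ico (0 : ℝ) 1)) P𝓧 (pushOver e p s) := by
  refine ⟨proj_pushOver, fun b => ?_⟩
  by_cases hb : b ∈ e.baseSet
  · refine ⟨e.prodFibre _, e, he.prodFibre, he, hb, hb, fun x => ?_⟩
    have h1 : MFamAt ((𝓡∂ (n + 1)).prod (𝓡∂ 1)) (𝓡∂ 1)
        (fun b (q : X × Ico (0 : ℝ) 1) => icoScale (s b) q.2) b x :=
      MFamAt.comp (g := fun b t => icoScale (s b) t) (f := fun _ (q : X × Ico (0 : ℝ) 1) => q.2)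
        (mfamAt_icoScale hs.continuousAt _) (mfamAt_const contMDiffAt_snd)
    have h2 : MFamAt ((𝓡∂ (n + 1)).prod (𝓡∂ 1)) (𝓡∂ (n + 1))
        (fun _ (q : X × Ico (0 : ℝ) 1) => q.1) b x := mfamAt_const contMDiffAt_fst
    have h3 := MFamAt.comp (g := fun _ (q : X × Ico (0 : ℝ) 1) => p q.1 q.2)
      (mfamAt_const hp.contMDiffAt) (h2.prodMk h1)
    refine h3.congr ?_
    filter_upwards [continuousAt_fst.eventually (e.open_baseSet.mem_nhds hb)] with c hc
    change _ = (e (pushOver e p s (e.toOpenPartialHomeomorph.symm (c.1, c.2.1), c.2.2))).2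
    rw [apply_pushOver (by rwa [proj_symm hc]), snd_apply_symm hc, proj_symm hc]
  · obtain ⟨e₁, he₁, hb₁⟩ := P𝓧.exists_isLocalTriv b
    refine ⟨e₁.prodFibre _, e₁, he₁.prodFibre, he₁, hb₁, hb₁, fun x => ?_⟩
    refine MFamAt.congr (f := fun _ (q : X × Ico (0 : ℝ) 1) => q.1) (mfamAt_const contMDiffAt_fst) ?_
    filter_upwards [continuousAt_fst.eventually (e₁.open_baseSet.mem_nhds hb₁),
      continuousAt_fst.eventually (hse b hb)] with c hc hc'
    change _ = (e₁ (pushOver e p s (e₁.toOpenPartialHomeomorph.symm (c.1, c.2.1), c.2.2))).2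
    rw [pushOver_of_scale_eq_zero hp0, snd_apply_symm hc]
    rw [proj_symm hc, hc', icoScale_zero_left]

end pushOver

/-- The new map is `C` followed by a push around `j z₀` with the same time. Velocities add; the new
term is nonnegative everywhere and positive on `N`, so inward points stay inward. As `N` depends on
`z₀` but not on `C`, finitely many pushes can be performed in a row. -/
theorem IsPreCollar.exists_push [T2Space X] [CompactSpace B] [T2Space B]
    (hι : IsBoundaryInclusion n ι) (hj : IsBoundaryOver ι P𝓜 P𝓧 j) (z₀ : 𝓜) :
    ∃ N ∈ 𝓝 z₀, ∀ C, IsPreCollar P𝓜 P𝓧 j C → ∃ C', IsPreCollar P𝓜 P𝓧 j C' ∧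
      ∀ z, InwardAt P𝓜 P𝓧 C z ∨ z ∈ N → InwardAt P𝓜 P𝓧 C' z := by
  have hlc : LocallyCompactSpace (Ico (0 : ℝ) 1) :=
    Manifold.locallyCompact_of_finiteDimensional (𝓡∂ 1)
  obtain ⟨e, he, hb⟩ := P𝓧.exists_isLocalTriv (P𝓜.proj z₀)
  obtain ⟨p, hp, hp0, hpv, hpe⟩ := exists_chart_push (n := n) (e (j z₀)).2
  obtain ⟨V, hV, hVc, hVe⟩ := exists_mem_nhds_isClosed_subset (e.open_baseSet.mem_nhds hb)
  -- Urysohn in the compact Hausdorff base: `u` is `1` at the base point and `0` outside the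
  -- interior of a closed neighbourhood `V` contained in the base set. Hence it vanishes near every
  -- point outside that base set.
  obtain ⟨u, hu0, hu1, hu⟩ := exists_continuous_zero_one_of_isClosed
    (isOpen_interior (s := V)).isClosed_compl (isClosed_singleton (x := P𝓜.proj z₀)) (by
      rw [disjoint_singleton_right]
      exact fun h => h (mem_interior_iff_mem_nhds.2 hV))
  set s : B → Icc (0 : ℝ) 1 := fun b => ⟨u b, hu b⟩ with hs
  have hsc : Continuous s := Continuous.subtype_mk u.continuous _
  have hse : ∀ b ∉ e.baseSet, ∀ᶠ c in 𝓝 b, s c = 0 := by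
    intro b hbe
    filter_upwards [hVc.isOpen_compl.mem_nhds (fun h => hbe (hVe h))] with c hc
    exact Subtype.ext (hu0 (fun h => hc (interior_subset h)))
  have hjc : Continuous j := (hj.smoothOver hι).continuous
  have hcont : ContinuousAt (fun z => (e (j z)).2) z₀ := by
    have h1 : ContinuousAt e (j z₀) := e.continuousAt (e.mem_source.2 (by rwa [hj.proj_eq]))
    exact (ContinuousAt.comp (g := e) h1 hjc.continuousAt).snd
  have hs0 : ∀ᶠ z in 𝓝 z₀, 0 < (s (P𝓜.proj z) : ℝ) := by
    have h1 : Continuous fun z => (s (P𝓜.proj z) : ℝ) :=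
      continuous_subtype_val.comp (hsc.comp P𝓜.continuous_proj)
    refine h1.continuousAt.eventually (lt_mem_nhds ?_)
    change 0 < u (P𝓜.proj z₀)
    rw [hu1 rfl]
    exact one_pos
  refine ⟨_, hs0.and (hcont.eventually hpe), fun C hC => ?_⟩
  set C' : 𝓜 × Ico (0 : ℝ) 1 → 𝓧 := fun q => pushOver e p s (C q, q.2) with hC'
  have hsm : SmoothOver (P𝓜.prod (𝓡∂ 1) (Ico (0 : ℝ) 1)) P𝓧 C' :=
    (smoothOver_pushOver he hp hp0 hsc hse).comp hC.smoothOver.prodMk_snd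
  have hC'0 : ∀ z, C' (z, 0) = j z := by
    intro z
    simp only [hC']
    rw [pushOver_of_scale_eq_zero hp0 (icoScale_zero_right _), hC.apply_zero]
  have hproj : ∀ z t, P𝓧.proj (C (z, t)) = P𝓜.proj z := fun z t => hC.smoothOver.proj_eq (z, t)
  have hvel : ∀ z, P𝓜.proj z ∈ e.baseSet →
      initialVelocity (n := n) (fun t => (e (C' (z, t))).2) =
        initialVelocity (n := n) (fun t => (e (C (z, t))).2) +
          (s (P𝓜.proj z) : ℝ) • initialVelocity (n := n) (p (e (j z)).2) := by
    intro z hz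
    have h1 : (fun t => (e (C' (z, t))).2) =
        fun t => p ((fun t => (e (C (z, t))).2) t) (icoScale (s (P𝓜.proj z)) t) := by
      funext t
      simp only [hC']
      rw [apply_pushOver (by rwa [hproj]), hproj]
    rw [h1, initialVelocity_push hp hp0 (hC.smoothOver.mdifferentiableAt_curve he hz 0)]
    simp only [hC.apply_zero]
  have hout : ∀ z, P𝓜.proj z ∉ e.baseSet → ∀ t, C' (z, t) = C (z, t) := by
    intro z hz t
    simp only [hC']
    rw [pushOver, if_neg (by rwa [hproj])]
  have hcoord : ∀ z, P𝓜.proj z ∈ e.baseSet → initialVelocity (n := n) (fun t => (e (C' (z, t))).2) 0 =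
        initialVelocity (n := n) (fun t => (e (C (z, t))).2) 0 +
          s (P𝓜.proj z) * initialVelocity (n := n) (p (e (j z)).2) 0 := by
    intro z hz
    rw [hvel z hz]
    simp
  have hpn : ∀ z, P𝓜.proj z ∈ e.baseSet →
      0 ≤ s (P𝓜.proj z) * initialVelocity (n := n) (p (e (j z)).2) 0 := fun z hz =>
    mul_nonneg (s _).2.1 (hpv _ (hj.isBoundaryPoint hι he hz))
  refine ⟨C', ⟨hsm, hC'0, fun z e' he' hz' => ?_⟩, fun z hz e' he' hz' => ?_⟩
  · by_cases hze : P𝓜.proj z ∈ e.baseSet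
    · obtain ⟨a, ha, h1⟩ := initialVelocity_triv_change hι hj hsm hC'0 he he' hze hz'
      rw [h1, hcoord z hze]
      exact mul_nonneg ha.le (add_nonneg (hC.nonneg z e he hze) (hpn z hze))
    · simp only [hout z hze]
      exact hC.nonneg z e' he' hz'
  · by_cases hze : P𝓜.proj z ∈ e.baseSet
    · obtain ⟨a, ha, h1⟩ := initialVelocity_triv_change hι hj hsm hC'0 he he' hze hz'
      rw [h1, hcoord z hze]
      refine mul_pos ha ?_
      rcases hz with hz | hz
      · exact add_pos_of_pos_of_nonneg (hz e he hze) (hpn z hze)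
      · refine add_pos_of_nonneg_of_pos (hC.nonneg z e he hze) ?_
        exact mul_pos hz.1 (hz.2 (hj.isBoundaryPoint hι he hze))
    · rcases hz with hz | hz
      · simp only [hout z hze]
        exact hz e' he' hz'
      · exact absurd (hse _ hze).self_of_nhds (fun h => by
          have := hz.1
          rw [h] at this
          exact lt_irrefl _ this)

/-- Compactness of `𝓜`. The property of sets used in the induction quantifies over all pre-collars
`C`, so that for a union the second push is applied to the result of the first. -/
theorem exists_isPreCollar_inward [T2Space X] [CompactSpace B] [T2Space B] [CompactSpace 𝓜]
    (hι : IsBoundaryInclusion n ι) (hj : IsBoundaryOver ι P𝓜 P𝓧 j) :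
    ∃ C, IsPreCollar P𝓜 P𝓧 j C ∧ ∀ z, InwardAt P𝓜 P𝓧 C z := by
  have h := isCompact_univ.induction_on (X := 𝓜) (p := fun S => ∀ C, IsPreCollar P𝓜 P𝓧 j C →
    ∃ C', IsPreCollar P𝓜 P𝓧 j C' ∧ ∀ z, InwardAt P𝓜 P𝓧 C z ∨ z ∈ S → InwardAt P𝓜 P𝓧 C' z)
    (fun C hC => ⟨C, hC, by simp⟩)
    (fun S S' hS h C hC => by
      obtain ⟨C', h1, h2⟩ := h C hC
      exact ⟨C', h1, fun z hz => h2 z (hz.imp_right fun hz => hS hz)⟩)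
    (fun S S' h h' C hC => by
      obtain ⟨C', h1, h2⟩ := h C hC
      obtain ⟨C'', h3, h4⟩ := h' C' h1
      refine ⟨C'', h3, fun z hz => h4 z ?_⟩
      rcases hz with hz | hz | hz
      · exact Or.inl (h2 z (Or.inl hz))
      · exact Or.inl (h2 z (Or.inr hz))
      · exact Or.inr hz)
    (fun z _ => by
      obtain ⟨N, hN, h⟩ := IsPreCollar.exists_push hι hj z
      exact ⟨N, mem_nhdsWithin_of_mem_nhds hN, h⟩)
  obtain ⟨C, h1, h2⟩ := h _ (isPreCollar_fst hι hj)
  exact ⟨C, h1, fun z => h2 z (Or.inr (mem_univ z))⟩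

end PreCollar

/-! ### Openness and smooth local inverses over the base -/

section GoodAt

variable {E H E' H' F F' B Z Z' : Type*}
  [NormedAddCommGroup E] [NormedSpace ℝ E] [TopologicalSpace H] {I : ModelWithCorners ℝ E H}
  [NormedAddCommGroup E'] [NormedSpace ℝ E'] [TopologicalSpace H'] {I' : ModelWithCorners ℝ E' H'}
  [TopologicalSpace F] [ChartedSpace H F] [TopologicalSpace F'] [ChartedSpace H' F']
  [IsManifold I ∞ F] [IsManifold I' ∞ F']
  [TopologicalSpace B] [TopologicalSpace Z] [TopologicalSpace Z']
  {P : ManifoldOver I F B Z} {P' : ManifoldOver I' F' B Z'} {Ψ : Z → Z'}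

/-- The map `Ψ` over `B` is open at `z`, and the inverses of its expressions in local
trivialisations are continuous families of smooth maps. -/
structure OpenSmoothAt (P : ManifoldOver I F B Z) (P' : ManifoldOver I' F' B Z') (Ψ : Z → Z')
    (z : Z) : Prop where
  nhds_le : 𝓝 (Ψ z) ≤ map Ψ (𝓝 z)
  invFamAt : ∀ e e', P.IsLocalTriv e → P'.IsLocalTriv e' → P.proj z ∈ e.baseSet →
    P.proj z ∈ e'.baseSet → InvFamAt I I' (trivRep e e' Ψ) (P.proj z) (e z).2

theorem ManifoldOver.eventually_mem_baseSet {X : Type*} [TopologicalSpace X] {proj : Z → B}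
    (e : Trivialization F proj) {b : B} (hb : b ∈ e.baseSet) (x : X) :
    ∀ᶠ p : B × X in 𝓝 (b, x), p.1 ∈ e.baseSet :=
  continuousAt_fst.eventually (e.open_baseSet.mem_nhds hb)

theorem nhds_le_map_of_totOpenAt {proj : Z → B} {proj' : Z' → B} {e : Trivialization F proj}
    {e' : Trivialization F' proj'} {z : Z} (hΨ : ∀ z, proj' (Ψ z) = proj z)
    (hb : proj z ∈ e.baseSet) (hb' : proj z ∈ e'.baseSet)
    (h : TotOpenAt (trivRep e e' Ψ) (proj z) (e z).2) : 𝓝 (Ψ z) ≤ map Ψ (𝓝 z) := by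
  intro S hS
  have hez : (proj z, (e z).2) = e z := Prod.ext (e.coe_fst' hb).symm rfl
  have hsz : e.toOpenPartialHomeomorph.symm (proj z, (e z).2) = z := e.symm_mk_snd rfl hb
  have h1 : ∀ᶠ p in 𝓝 (proj z, (e z).2), Ψ (e.toOpenPartialHomeomorph.symm p) ∈ S := by
    have hc : ContinuousAt e.toOpenPartialHomeomorph.symm (proj z, (e z).2) :=
      e.toOpenPartialHomeomorph.continuousAt_symm (e.mem_target.2 hb)
    rw [ContinuousAt, hsz] at hc
    exact hc.eventually hS
  have h2 : ∀ᶠ q in 𝓝 (proj z, trivRep e e' Ψ (proj z) (e z).2), ∃ p : B × F,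
      (p.1, trivRep e e' Ψ p.1 p.2) = q ∧ p.1 ∈ e.baseSet ∧ p.1 ∈ e'.baseSet ∧
        Ψ (e.toOpenPartialHomeomorph.symm p) ∈ S := by
    refine h ?_
    rw [mem_map]
    filter_upwards [h1, ManifoldOver.eventually_mem_baseSet e hb _,
      ManifoldOver.eventually_mem_baseSet e' hb' _] with p hp1 hp2 hp3
    exact ⟨p, rfl, hp2, hp3, hp1⟩
  have hs' : Ψ z ∈ e'.source := e'.mem_source.2 (by rwa [hΨ])
  have h3 : e' (Ψ z) = (proj z, trivRep e e' Ψ (proj z) (e z).2) := by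
    rw [trivRep_self rfl hb]
    exact Prod.ext (by rw [e'.coe_fst hs', hΨ]) rfl
  rw [← h3] at h2
  have h4 := (e'.continuousAt hs').eventually h2
  filter_upwards [h4, e'.open_source.mem_nhds hs'] with w hw hws
  obtain ⟨p, hp1, hp2, hp3, hp4⟩ := hw
  have h5 : w = Ψ (e.toOpenPartialHomeomorph.symm p) := by
    have h6 : e'.toOpenPartialHomeomorph.symm (e' w) = w := e'.toOpenPartialHomeomorph.left_inv hws
    rw [← h6]
    refine (congrArg e'.toOpenPartialHomeomorph.symm hp1.symm).trans ?_
    exact symm_trivRep hΨ hp2 hp3 p.2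
  rw [h5]
  exact hp4

/-- A local inverse in one pair of trivialisations, conjugated by transition functions, is a local
inverse in the other pair; it is a smooth family there, and conjugating back preserves this. -/
theorem InvFamAt.triv_change [LocallyCompactSpace F] [LocallyCompactSpace F']
    (hΨ : ∀ z, P'.proj (Ψ z) = P.proj z) {e e₁ : Trivialization F P.proj}
    {e' e₁' : Trivialization F' P'.proj} (he : P.IsLocalTriv e) (he₁ : P.IsLocalTriv e₁)
    (he' : P'.IsLocalTriv e') (he₁' : P'.IsLocalTriv e₁') {z : Z} {b : B} (hz : P.proj z = b)
    (hb : b ∈ e.baseSet) (hb₁ : b ∈ e₁.baseSet) (hb' : b ∈ e'.baseSet) (hb₁' : b ∈ e₁'.baseSet)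
    (h : InvFamAt I I' (trivRep e e' Ψ) b (e z).2) :
    InvFamAt I I' (trivRep e₁ e₁' Ψ) b (e₁ z).2 := by
  intro g₁ hg₁
  have hk : trivRep e₁ e id b (e₁ z).2 = (e z).2 := trivRep_self hz hb₁
  have hk' : trivRep e e₁ id b (e z).2 = (e₁ z).2 := trivRep_self hz hb
  have hf : trivRep e e' Ψ b (e z).2 = (e' (Ψ z)).2 := trivRep_self hz hb
  have hf₁ : trivRep e₁ e₁' Ψ b (e₁ z).2 = (e₁' (Ψ z)).2 := trivRep_self hz hb₁
  have h1 : MFamAt I' I (fun b y => trivRep e₁ e id b (g₁ b (trivRep e' e₁' id b y))) b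
      (trivRep e e' Ψ b (e z).2) := by
    refine h _ ?_
    have hK : ContinuousAt (fun p : B × F => (p.1, trivRep e e₁ id p.1 p.2)) (b, (e z).2) :=
      continuousAt_fst.prodMk (he.mfamAt he₁ hb hb₁ _).1
    have h2 := hK.eventually (p := fun q : B × F => g₁ q.1 (trivRep e₁ e₁' Ψ q.1 q.2) = q.2)
      (by beta_reduce; rw [hk']; exact hg₁)
    filter_upwards [h2, ManifoldOver.eventually_mem_baseSet e hb _,
      ManifoldOver.eventually_mem_baseSet e₁ hb₁ _, ManifoldOver.eventually_mem_baseSet e' hb' _,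
      ManifoldOver.eventually_mem_baseSet e₁' hb₁' _] with p hp h3 h4 h5 h6
    have h7 : trivRep e' e₁' id p.1 (trivRep e e' Ψ p.1 p.2) =
        trivRep e₁ e₁' Ψ p.1 (trivRep e e₁ id p.1 p.2) := by
      rw [trivRep_comp hΨ h3 h5, trivRep_comp (Ψ := id) (fun _ => rfl) h3 h4]
      rfl
    rw [h7, hp, trivRep_comp (Ψ := id) (fun _ => rfl) h3 h4]
    exact snd_apply_symm h3 _
  rw [hf] at h1
  rw [hf₁]
  have hkk : trivRep e₁' e' id b (e₁' (Ψ z)).2 = (e' (Ψ z)).2 :=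
    trivRep_self (by rw [hΨ, hz]) hb₁'
  have h8 := h1.comp_of_eq (he₁'.mfamAt he' hb₁' hb' (e₁' (Ψ z)).2) hkk
  have h9 := (he.mfamAt he₁ hb hb₁ _).comp h8
  refine h9.congr ?_
  filter_upwards [ManifoldOver.eventually_mem_baseSet e hb _,
      ManifoldOver.eventually_mem_baseSet e₁ hb₁ _, ManifoldOver.eventually_mem_baseSet e' hb' _,
      ManifoldOver.eventually_mem_baseSet e₁' hb₁' _] with p h3 h4 h5 h6
  rw [trivRep_comp (Ψ := id) (fun _ => rfl) h4 h3, trivRep_comp (Ψ := id) (fun _ => rfl) h6 h5]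
  have h10 : trivRep e₁' e₁' (id ∘ id) p.1 p.2 = p.2 := snd_apply_symm h6 _
  rw [h10]
  exact snd_apply_symm h4 _

theorem openSmoothAt_of_triv [LocallyCompactSpace F] [LocallyCompactSpace F']
    (hΨ : ∀ z, P'.proj (Ψ z) = P.proj z) {e : Trivialization F P.proj}
    {e' : Trivialization F' P'.proj} (he : P.IsLocalTriv e) (he' : P'.IsLocalTriv e') {z : Z}
    (hb : P.proj z ∈ e.baseSet) (hb' : P.proj z ∈ e'.baseSet)
    (ho : TotOpenAt (trivRep e e' Ψ) (P.proj z) (e z).2)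
    (h : InvFamAt I I' (trivRep e e' Ψ) (P.proj z) (e z).2) : OpenSmoothAt P P' Ψ z :=
  ⟨nhds_le_map_of_totOpenAt hΨ hb hb' ho, fun _ _ he₁ he₁' hb₁ hb₁' =>
    h.triv_change hΨ he he₁ he' he₁' rfl hb hb₁ hb' hb₁'⟩

end GoodAt

/-! ### Rescaling the collar parameter -/

section Scale

/-- Division by `s` inverts the scaling only locally, because `u / s` may leave `[0,1)`. -/
theorem exists_icoScale_inverse {s : Icc (0 : ℝ) 1} (hs : 0 < (s : ℝ)) (t : Ico (0 : ℝ) 1) :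
    ∃ r : Ico (0 : ℝ) 1 → Ico (0 : ℝ) 1, ContinuousAt r (icoScale s t) ∧ r (icoScale s t) = t ∧
      ∀ᶠ u in 𝓝 (icoScale s t), icoScale s (r u) = u := by
  have h1 : ∀ᶠ u : Ico (0 : ℝ) 1 in 𝓝 (icoScale s t), (icoOfReal (u / s) : ℝ) = u / s := by
    have h2 : Continuous fun u : Ico (0 : ℝ) 1 => (u : ℝ) / s := by fun_prop
    have h3 : (icoScale s t : ℝ) / s < 1 := by
      rw [coe_icoScale, mul_div_cancel_left₀ _ hs.ne']
      exact t.2.2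
    filter_upwards [h2.continuousAt.eventually (gt_mem_nhds h3)] with u hu
    exact coe_icoOfReal (div_nonneg u.2.1 hs.le) hu
  refine ⟨fun u => icoOfReal (u / s), ?_, ?_, ?_⟩
  · rw [Topology.IsInducing.subtypeVal.continuousAt_iff]
    have h2 : Continuous fun u : Ico (0 : ℝ) 1 => (u : ℝ) / s := by fun_prop
    exact h2.continuousAt.congr (h1.mono fun u hu => hu.symm)
  · beta_reduce
    rw [coe_icoScale, mul_div_cancel_left₀ _ hs.ne', icoOfReal_coe]
  · filter_upwards [h1] with u hu
    refine Subtype.ext ?_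
    rw [coe_icoScale, hu, mul_div_cancel₀ _ hs.ne']

theorem icoScale_injective {s : Icc (0 : ℝ) 1} (hs : 0 < (s : ℝ)) :
    Function.Injective (icoScale s) := by
  intro t u h
  have h1 := congrArg (Subtype.val) h
  rw [coe_icoScale, coe_icoScale] at h1
  exact Subtype.ext (mul_left_cancel₀ hs.ne' h1)

variable {B E H X E' H' Y : Type*} [TopologicalSpace B] [NormedAddCommGroup E] [NormedSpace ℝ E]
    [TopologicalSpace H] {I : ModelWithCorners ℝ E H} [TopologicalSpace X] [ChartedSpace H X]
    [NormedAddCommGroup E'] [NormedSpace ℝ E'] [TopologicalSpace H'] {I' : ModelWithCorners ℝ E' H'}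
    [TopologicalSpace Y] [ChartedSpace H' Y] [IsManifold I ∞ X] [IsManifold I' ∞ Y]

/-- If `g` inverts the rescaled map, then `g` with its time multiplied by `s` inverts `f` and is
thus a smooth family. The time of `g` itself is recovered by dividing by `s` in `ℝ`. -/
theorem InvFamAt.icoScale {f : B → X × Ico (0 : ℝ) 1 → Y} {s : Icc (0 : ℝ) 1} (hs : 0 < (s : ℝ))
    {b : B} {x : X} {t : Ico (0 : ℝ) 1}
    (h : InvFamAt (I.prod (𝓡∂ 1)) I' f b (x, _root_.icoScale s t)) :
    InvFamAt (I.prod (𝓡∂ 1)) I' (fun b q => f b (q.1, _root_.icoScale s q.2)) b (x, t) := by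
  intro g hg
  obtain ⟨r, hrc, hrt, hr⟩ := exists_icoScale_inverse hs t
  have h1 : MFamAt I' (I.prod (𝓡∂ 1)) (fun b y => ((g b y).1, _root_.icoScale s (g b y).2)) b
      (f b (x, _root_.icoScale s t)) := by
    refine h _ ?_
    have hc : ContinuousAt (fun p : B × X × Ico (0 : ℝ) 1 => (p.1, p.2.1, r p.2.2))
        (b, x, _root_.icoScale s t) := by
      refine continuousAt_fst.prodMk (continuousAt_snd.fst.prodMk ?_)
      exact ContinuousAt.comp (g := r) hrc continuousAt_snd.snd
    have h2 := hc.eventually (p := fun p : B × X × Ico (0 : ℝ) 1 =>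
      g p.1 (f p.1 (p.2.1, _root_.icoScale s p.2.2)) = p.2) (by beta_reduce; rw [hrt]; exact hg)
    have h3 : ∀ᶠ p : B × X × Ico (0 : ℝ) 1 in 𝓝 (b, x, _root_.icoScale s t),
        _root_.icoScale s (r p.2.2) = p.2.2 := by
      have hc2 : ContinuousAt (fun p : B × X × Ico (0 : ℝ) 1 => p.2.2) (b, x, _root_.icoScale s t) :=
        continuousAt_snd.snd
      exact hc2.eventually hr
    filter_upwards [h2, h3] with p hp1 hp2
    simp only [hp2] at hp1
    rw [hp1]
    exact Prod.ext rfl hp2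
  have h2 : MFamAt I' I (fun b y => (g b y).1) b (f b (x, _root_.icoScale s t)) :=
    MFamAt.comp (g := fun _ (q : X × Ico (0 : ℝ) 1) => q.1)
      (f := fun b y => ((g b y).1, _root_.icoScale s (g b y).2)) (mfamAt_const contMDiffAt_fst) h1
  have h3 : MFamAt I' (𝓡∂ 1) (fun b y => _root_.icoScale s (g b y).2) b
      (f b (x, _root_.icoScale s t)) :=
    MFamAt.comp (g := fun _ (q : X × Ico (0 : ℝ) 1) => q.2)
      (f := fun b y => ((g b y).1, _root_.icoScale s (g b y).2)) (mfamAt_const contMDiffAt_snd) h1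
  refine MFamAt.prodMk h2 (g := fun b y => (g b y).2) (mfamAt_ico ?_)
  have h4 := h3.coe_ico.map₂ h3.coe_ico (g := fun q : ℝ × ℝ => q.1 / s) (by fun_prop)
  refine h4.congr (Eventually.of_forall fun p => ?_)
  simp only [coe_icoScale]
  exact mul_div_cancel_left₀ _ hs.ne'

end Scale

/-! ### Invertibility of the derivative at the boundary -/

section Invertible

theorem ContinuousLinearMap.exists_equiv_of_injective {E E' : Type*} [NormedAddCommGroup E]
    [NormedSpace ℝ E] [NormedAddCommGroup E'] [NormedSpace ℝ E'] [FiniteDimensional ℝ E]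
    [FiniteDimensional ℝ E'] (D : E →L[ℝ] E') (hD : ∀ v, D v = 0 → v = 0)
    (h : Module.finrank ℝ E = Module.finrank ℝ E') : ∃ A : E ≃L[ℝ] E', D = (A : E →L[ℝ] E') := by
  have hinj : Function.Injective (D : E →ₗ[ℝ] E') :=
    (injective_iff_map_eq_zero (D : E →ₗ[ℝ] E')).2 hD
  refine ⟨(LinearMap.linearEquivOfInjective (D : E →ₗ[ℝ] E') hinj h).toContinuousLinearEquiv, ?_⟩
  ext v
  rfl

variable {n : ℕ} {M X : Type*}
    [TopologicalSpace M] [ChartedSpace (EuclideanSpace ℝ (Fin n)) M] [IsManifold (𝓡 n) ∞ M]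
    [TopologicalSpace X] [ChartedSpace (EuclideanHalfSpace (n + 1)) X]
    [IsManifold (𝓡∂ (n + 1)) ∞ X] [LocallyCompactSpace M] [LocallyCompactSpace X] {ι : M → X}

theorem isBoundaryPoint_prod_ico {m : M} {t : Ico (0 : ℝ) 1} :
    ((𝓡 n).prod (𝓡∂ 1)).IsBoundaryPoint (m, t) ↔ t = 0 := by
  rw [(isHalfSpaceModel_prod n).isBoundaryPoint_iff (mem_chart_source _ (m, t))]
  have h1 : (extChartAt ((𝓡 n).prod (𝓡∂ 1)) (m, t) (m, t)).2 = !₂[(t : ℝ)] := rfl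
  simp only [ContinuousLinearMap.comp_apply, ContinuousLinearMap.coe_snd', h1]
  constructor
  · exact fun h => Subtype.ext h
  · rintro rfl
    rfl

/-- The zeroth coordinate vanishes identically on the boundary, hence along `ι`. -/
theorem IsBoundaryInclusion.mfderiv_apply_zero (hι : IsBoundaryInclusion n ι) (m : M)
    (v : EuclideanSpace ℝ (Fin n)) :
    (EuclideanSpace.proj (0 : Fin (n + 1)) : EuclideanSpace ℝ (Fin (n + 1)) →L[ℝ] ℝ)
      (mfderiv (𝓡 n) (𝓡∂ (n + 1)) ι m v) = 0 := by
  have hI := isHalfSpaceModel_halfSpace n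
  have h1 := (hι.contMDiff.contMDiffAt (x := m)).mdifferentiableAt (by simp) |>.hasMFDerivAt.2
  have h2 := (EuclideanSpace.proj (0 : Fin (n + 1)) : _ →L[ℝ] ℝ).hasFDerivAt.comp_hasFDerivWithinAt
    _ h1
  have h3 : HasFDerivWithinAt ((EuclideanSpace.proj (0 : Fin (n + 1)) : _ →L[ℝ] ℝ) ∘
      writtenInExtChartAt (𝓡 n) (𝓡∂ (n + 1)) m ι) (0 : EuclideanSpace ℝ (Fin n) →L[ℝ] ℝ)
      (range (𝓡 n)) (extChartAt (𝓡 n) m m) := by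
    have h4 : ∀ y, ι y ∈ (chartAt (EuclideanHalfSpace (n + 1)) (ι m)).source →
        (EuclideanSpace.proj (0 : Fin (n + 1)) : _ →L[ℝ] ℝ) (extChartAt (𝓡∂ (n + 1)) (ι m) (ι y)) = 0 :=
      fun y hy => (hI.isBoundaryPoint_iff hy).1 (hι.isBoundaryPoint y)
    refine (hasFDerivWithinAt_const (0 : ℝ) _ _).congr_of_eventuallyEq ?_ ?_
    · have h5 : ContinuousAt (fun v => ι ((extChartAt (𝓡 n) m).symm v)) (extChartAt (𝓡 n) m m) :=
        ContinuousAt.comp (g := ι) (by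
          rw [extChartAt_to_inv]
          exact hι.contMDiff.continuous.continuousAt) (continuousAt_extChartAt_symm m)
      have h6 := h5.eventually ((chartAt (EuclideanHalfSpace (n + 1)) (ι m)).open_source.mem_nhds (by
        beta_reduce
        rw [extChartAt_to_inv]
        exact mem_chart_source _ _))
      filter_upwards [mem_nhdsWithin_of_mem_nhds h6] with v hv
      exact h4 _ hv
    · simp only [writtenInExtChartAt, Function.comp_apply, extChartAt_to_inv]
      exact h4 _ (mem_chart_source _ _)
  exact DFunLike.congr_fun (((𝓡 n).uniqueDiffOn _ ⟨_, rfl⟩).eq h2 h3) v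

theorem IsBoundaryInclusion.mfderiv_injective (hι : IsBoundaryInclusion n ι) (m : M) :
    Function.Injective (mfderiv (𝓡 n) (𝓡∂ (n + 1)) ι m) :=
  (hι.isSmoothEmbedding.isImmersion.isImmersionAt m).mfderiv_injective

/-- The derivative at the boundary of a map which extends `ι` inwards is invertible. -/
theorem IsBoundaryInclusion.exists_mfderiv_eq (hι : IsBoundaryInclusion n ι)
    {f : M × Ico (0 : ℝ) 1 → X} {m : M}
    (hf : MDifferentiableAt ((𝓡 n).prod (𝓡∂ 1)) (𝓡∂ (n + 1)) f (m, 0)) (h0 : ∀ m, f (m, 0) = ι m)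
    (hv : initialVelocity (n := n) (fun t => f (m, t)) 0 ≠ 0) :
    ∃ A : (EuclideanSpace ℝ (Fin n) × EuclideanSpace ℝ (Fin 1)) ≃L[ℝ] EuclideanSpace ℝ (Fin (n + 1)),
      mfderiv ((𝓡 n).prod (𝓡∂ 1)) (𝓡∂ (n + 1)) f (m, 0) =
        (A : (EuclideanSpace ℝ (Fin n) × EuclideanSpace ℝ (Fin 1)) →L[ℝ]
          EuclideanSpace ℝ (Fin (n + 1))) := by
  refine ContinuousLinearMap.exists_equiv_of_injective (E := EuclideanSpace ℝ (Fin n) ×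
    EuclideanSpace ℝ (Fin 1)) (E' := EuclideanSpace ℝ (Fin (n + 1))) _ ?_ (by simp)
  rintro ⟨v, w⟩ hvw
  have h1 := mfderiv_prod_eq_add_apply hf (v := (v, w))
  have h2 : w = w 0 • icoUnit := by
    ext i
    fin_cases i
    simp
  have h3 : ∀ f' : M → X, f' = ι → (mfderiv (𝓡 n) (𝓡∂ (n + 1)) f' m v :
      EuclideanSpace ℝ (Fin (n + 1))) = mfderiv (𝓡 n) (𝓡∂ (n + 1)) ι m v := by
    rintro f' rfl
    rfl
  have h4 : (mfderiv (𝓡∂ 1) (𝓡∂ (n + 1)) (fun t => f (m, t)) 0 w : EuclideanSpace ℝ (Fin (n + 1))) =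
      w 0 • initialVelocity (n := n) (fun t => f (m, t)) := by
    refine (congrArg (mfderiv (𝓡∂ 1) (𝓡∂ (n + 1)) (fun t => f (m, t)) 0) h2).trans ?_
    exact ContinuousLinearMap.map_smul _ _ _
  let D : EuclideanSpace ℝ (Fin n) →L[ℝ] EuclideanSpace ℝ (Fin (n + 1)) :=
    mfderiv (𝓡 n) (𝓡∂ (n + 1)) ι m
  have h5 : D v +
      w 0 • initialVelocity (n := n) (fun t => f (m, t)) = 0 := by
    have h6 := h1.symm.trans hvw
    rw [← h4, show D v = _ from (h3 (fun m => f (m, 0)) (funext h0)).symm]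
    exact h6
  -- The part tangent to the boundary has zeroth coordinate `0` and the velocity has a nonzero one.
  -- So the normal component vanishes first, and then the tangential one because `ι` is an
  -- immersion.
  have h6 : w 0 = 0 := by
    have h7 := congrArg (fun u : EuclideanSpace ℝ (Fin (n + 1)) => u 0) h5
    simp only [PiLp.add_apply, PiLp.smul_apply, smul_eq_mul, PiLp.zero_apply] at h7
    rw [show D v 0 = 0 from hι.mfderiv_apply_zero m v, zero_add] at h7
    exact (mul_eq_zero.1 h7).resolve_right hv
  rw [h6, zero_smul, add_zero] at h5
  have h7 : v = 0 := hι.mfderiv_injective m (h5.trans (ContinuousLinearMap.map_zero _).symm)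
  rw [h7, h2, h6, zero_smul]
  rfl

end Invertible

/-! ### Existence of a collar over the base -/

section CollarOver

variable {n : ℕ} {B M X 𝓜 𝓧 : Type*}
    [TopologicalSpace B]
    [TopologicalSpace M] [ChartedSpace (EuclideanSpace ℝ (Fin n)) M] [IsManifold (𝓡 n) ∞ M]
    [LocallyCompactSpace M]
    [TopologicalSpace X] [ChartedSpace (EuclideanHalfSpace (n + 1)) X]
    [IsManifold (𝓡∂ (n + 1)) ∞ X] [LocallyCompactSpace X]
    [TopologicalSpace 𝓜] [TopologicalSpace 𝓧]
    {ι : M → X} {P𝓜 : ManifoldOver (𝓡 n) M B 𝓜} {P𝓧 : ManifoldOver (𝓡∂ (n + 1)) X B 𝓧}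
    {j : 𝓜 → 𝓧} {C Φ : 𝓜 × Ico (0 : ℝ) 1 → 𝓧}

theorem smoothOver_scale (s : Icc (0 : ℝ) 1) :
    SmoothOver (P𝓜.prod (𝓡∂ 1) (Ico (0 : ℝ) 1)) (P𝓜.prod (𝓡∂ 1) (Ico (0 : ℝ) 1))
      (fun q => (q.1, icoScale s q.2)) := by
  refine ⟨fun _ => rfl, fun b => ?_⟩
  obtain ⟨e, he, hb⟩ := P𝓜.exists_isLocalTriv b
  refine ⟨e.prodFibre _, e.prodFibre _, he.prodFibre, he.prodFibre, hb, hb, fun x => ?_⟩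
  have h1 : MFamAt ((𝓡 n).prod (𝓡∂ 1)) (𝓡∂ 1)
      (fun _ (q : M × Ico (0 : ℝ) 1) => icoScale s q.2) b x :=
    MFamAt.comp (g := fun _ t => icoScale s t) (f := fun _ (q : M × Ico (0 : ℝ) 1) => q.2)
      (mfamAt_icoScale continuousAt_const _) (mfamAt_const contMDiffAt_snd)
  refine MFamAt.congr (f := fun _ (q : M × Ico (0 : ℝ) 1) => (q.1, icoScale s q.2))
    ((mfamAt_const contMDiffAt_fst).prodMk h1) ?_
  filter_upwards [ManifoldOver.eventually_mem_baseSet e hb _] with c hc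
  refine Prod.ext ?_ rfl
  exact (snd_apply_symm (e := e) hc c.2.1).symm

theorem OpenSmoothAt.scale (hC : SmoothOver (P𝓜.prod (𝓡∂ 1) (Ico (0 : ℝ) 1)) P𝓧 C)
    {s : Icc (0 : ℝ) 1} (hs : 0 < (s : ℝ)) {z : 𝓜} {t : Ico (0 : ℝ) 1}
    (h : OpenSmoothAt (P𝓜.prod (𝓡∂ 1) (Ico (0 : ℝ) 1)) P𝓧 C (z, icoScale s t)) :
    OpenSmoothAt (P𝓜.prod (𝓡∂ 1) (Ico (0 : ℝ) 1)) P𝓧 (fun q => C (q.1, icoScale s q.2)) (z, t) := by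
  have hlc : LocallyCompactSpace (Ico (0 : ℝ) 1) :=
    Manifold.locallyCompact_of_finiteDimensional (𝓡∂ 1)
  refine ⟨?_, fun e₁ e₁' he₁ he₁' hb₁ hb₁' => ?_⟩
  · obtain ⟨r, hrc, hrt, hr⟩ := exists_icoScale_inverse hs t
    refine h.nhds_le.trans ?_
    intro S hS
    rw [mem_map] at hS ⊢
    have hc : ContinuousAt (fun q : 𝓜 × Ico (0 : ℝ) 1 => (q.1, r q.2)) (z, icoScale s t) :=
      continuousAt_fst.prodMk (ContinuousAt.comp (g := r) hrc continuousAt_snd)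
    have h1 := hc.eventually (p := fun q => C (q.1, icoScale s q.2) ∈ S) (by
      beta_reduce
      rw [hrt]
      exact hS)
    have hc2 : ContinuousAt (fun q : 𝓜 × Ico (0 : ℝ) 1 => q.2) (z, icoScale s t) := continuousAt_snd
    filter_upwards [h1, hc2.eventually hr] with q hq1 hq2
    simp only [hq2] at hq1
    exact hq1
  · obtain ⟨e, he, hb⟩ := P𝓜.exists_isLocalTriv (P𝓜.proj z)
    obtain ⟨e', he', hb'⟩ := P𝓧.exists_isLocalTriv (P𝓜.proj z)
    refine InvFamAt.triv_change (z := (z, t)) (P := P𝓜.prod (𝓡∂ 1) (Ico (0 : ℝ) 1))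
      (Ψ := fun q => C (q.1, icoScale s q.2)) (e := e.prodFibre _) (e' := e')
      (fun q => hC.proj_eq (q.1, icoScale s q.2)) he.prodFibre
      he₁ he' he₁' rfl hb hb₁ hb' hb₁' ?_
    exact InvFamAt.icoScale hs (h.invFamAt _ _ he.prodFibre he' hb hb')

/-- A collar of the boundary over `B`. -/
structure IsCollarOver (P𝓜 : ManifoldOver (𝓡 n) M B 𝓜) (P𝓧 : ManifoldOver (𝓡∂ (n + 1)) X B 𝓧)
    (j : 𝓜 → 𝓧) (Φ : 𝓜 × Ico (0 : ℝ) 1 → 𝓧) : Prop where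
  smoothOver : SmoothOver (P𝓜.prod (𝓡∂ 1) (Ico (0 : ℝ) 1)) P𝓧 Φ
  apply_zero : ∀ z, Φ (z, 0) = j z
  injective : Function.Injective Φ
  openSmoothAt : ∀ q, OpenSmoothAt (P𝓜.prod (𝓡∂ 1) (Ico (0 : ℝ) 1)) P𝓧 Φ q

theorem IsCollarOver.scale (h : IsCollarOver P𝓜 P𝓧 j Φ) {s : Icc (0 : ℝ) 1} (hs : 0 < (s : ℝ)) :
    IsCollarOver P𝓜 P𝓧 j (fun q => Φ (q.1, icoScale s q.2)) := by
  have hlc : LocallyCompactSpace (Ico (0 : ℝ) 1) :=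
    Manifold.locallyCompact_of_finiteDimensional (𝓡∂ 1)
  refine ⟨h.smoothOver.comp (smoothOver_scale s), fun z => ?_, ?_, fun q => ?_⟩
  · simp only [icoScale_zero_right]
    exact h.apply_zero z
  · intro p q hpq
    have h1 := Prod.mk_inj.1 (h.injective hpq)
    exact Prod.ext h1.1 (icoScale_injective hs h1.2)
  · exact OpenSmoothAt.scale h.smoothOver hs (h.openSmoothAt _)

/-- In adapted trivialisations `C` is a family of maps on `M × [0,1)` which restrict to `ι` at time
zero. The boundary goes to the boundary, and positive normal velocity makes the derivative
invertible, so `MFamAt.inverse_function` applies. -/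
theorem IsPreCollar.locally (hι : IsBoundaryInclusion n ι) (hj : IsBoundaryOver ι P𝓜 P𝓧 j)
    (hC : IsPreCollar P𝓜 P𝓧 j C) {z₀ : 𝓜} (hz : InwardAt P𝓜 P𝓧 C z₀) :
    (∃ U ∈ 𝓝 (z₀, (0 : Ico (0 : ℝ) 1)), InjOn C U) ∧
    ∀ᶠ q in 𝓝 (z₀, (0 : Ico (0 : ℝ) 1)), OpenSmoothAt (P𝓜.prod (𝓡∂ 1) (Ico (0 : ℝ) 1)) P𝓧 C q := by
  have hlc : LocallyCompactSpace (Ico (0 : ℝ) 1) :=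
    Manifold.locallyCompact_of_finiteDimensional (𝓡∂ 1)
  obtain ⟨e₀, e, he₀, he, hb₀, hb, h⟩ := hj.exists_localTriv (P𝓜.proj z₀)
  set b₀ := P𝓜.proj z₀ with hb₀_def
  set ê := e₀.prodFibre (Ico (0 : ℝ) 1) with hê
  set f := trivRep ê e C with hf
  have hfC : ∀ b m t, f b (m, t) = (e (C (e₀.toOpenPartialHomeomorph.symm (b, m), t))).2 :=
    fun b m t => rfl
  have hproj : ∀ q, P𝓧.proj (C q) = P𝓜.proj q.1 := hC.smoothOver.proj_eq
  set x₀ : M × Ico (0 : ℝ) 1 := ((e₀ z₀).2, 0) with hx₀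
  have hm : ∀ b ∈ e₀.baseSet, b ∈ e.baseSet → ∀ x, MFamAt ((𝓡 n).prod (𝓡∂ 1)) (𝓡∂ (n + 1)) f b x :=
    fun b h1 h2 x => hC.smoothOver.mfamAt he₀.prodFibre he h1 h2 x
  have hfz : ∀ b ∈ e₀.baseSet, b ∈ e.baseSet → ∀ m, f b (m, 0) = ι m := by
    intro b h1 h2 m
    have h3 := h (e₀.toOpenPartialHomeomorph.symm (b, m)) (by rwa [proj_symm h1])
      (by rwa [proj_symm h1])
    rw [snd_apply_symm h1] at h3
    rw [hfC, hC.apply_zero, h3]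
  have hev₀ := ManifoldOver.eventually_mem_baseSet e₀ hb₀ x₀
  have hev := ManifoldOver.eventually_mem_baseSet e hb x₀
  obtain ⟨⟨U, hU, hUi⟩, hgood⟩ := MFamAt.inverse_function (b₀ := b₀) (x₀ := x₀) (f := f)
    (isHalfSpaceModel_prod n) (isHalfSpaceModel_halfSpace n) (by
      filter_upwards [hev₀, hev] with p h1 h2 using hm p.1 h1 h2 p.2) (by
      refine hι.exists_mfderiv_eq ((hm b₀ hb₀ hb x₀).contMDiffAt.mdifferentiableAt (by simp))
        (hfz b₀ hb₀ hb) (ne_of_gt ?_)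
      have h1 := hz e he hb
      have h2 : (fun t => f b₀ ((e₀ z₀).2, t)) = fun t => (e (C (z₀, t))).2 := by
        funext t
        rw [hfC, e₀.symm_mk_snd rfl hb₀]
      rw [h2]
      exact h1) (by
      filter_upwards [hev₀, hev] with p h1 h2 h3
      obtain ⟨b, m, t⟩ := p
      obtain rfl := isBoundaryPoint_prod_ico.1 h3
      have h4 := hfz b h1 h2 m
      exact h4 ▸ hι.isBoundaryPoint m)
  have hsrc : ∀ᶠ q : 𝓜 × Ico (0 : ℝ) 1 in 𝓝 (z₀, 0), P𝓜.proj q.1 ∈ e₀.baseSet ∧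
      P𝓜.proj q.1 ∈ e.baseSet := by
    have h1 : ContinuousAt (fun q : 𝓜 × Ico (0 : ℝ) 1 => P𝓜.proj q.1) (z₀, 0) :=
      (P𝓜.continuous_proj.comp continuous_fst).continuousAt
    exact (h1.eventually (e₀.open_baseSet.mem_nhds hb₀)).and
      (h1.eventually (e.open_baseSet.mem_nhds hb))
  have hcoord : Tendsto (fun q : 𝓜 × Ico (0 : ℝ) 1 => (P𝓜.proj q.1, ((e₀ q.1).2, q.2)))
      (𝓝 (z₀, 0)) (𝓝 (b₀, x₀)) := by
    have h1 : ContinuousAt (fun q : 𝓜 × Ico (0 : ℝ) 1 => e₀ q.1) (z₀, 0) :=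
      ContinuousAt.comp (g := e₀) (e₀.continuousAt (e₀.mem_source.2 hb₀)) continuousAt_fst
    exact ((P𝓜.continuous_proj.comp continuous_fst).continuousAt).prodMk
      (h1.snd.prodMk continuousAt_snd)
  have hfq : ∀ q : 𝓜 × Ico (0 : ℝ) 1, P𝓜.proj q.1 ∈ e₀.baseSet →
      f (P𝓜.proj q.1) ((e₀ q.1).2, q.2) = (e (C q)).2 := by
    intro q hq
    rw [hfC, e₀.symm_mk_snd rfl hq]
  refine ⟨⟨_, hsrc.and (hcoord.eventually hU), ?_⟩, ?_⟩
  · rintro q ⟨⟨h1, h2⟩, h3⟩ q' ⟨⟨h1', h2'⟩, h3'⟩ heq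
    have hp : P𝓜.proj q.1 = P𝓜.proj q'.1 := by rw [← hproj, ← hproj, heq]
    have h4 := hUi h3 h3' (Prod.ext hp (by
      simp only
      rw [hfq q h1, hfq q' h1', heq]))
    simp only [Prod.mk.injEq] at h4
    refine Prod.ext ?_ h4.2.2
    rw [← e₀.symm_mk_snd rfl h1, ← e₀.symm_mk_snd rfl h1', h4.2.1, hp]
  · filter_upwards [hsrc, hcoord.eventually hgood] with q h1 h2
    exact openSmoothAt_of_triv (e := ê) (e' := e) (P := P𝓜.prod (𝓡∂ 1) (Ico (0 : ℝ) 1))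
      hC.smoothOver.proj_eq he₀.prodFibre he h1.1 h1.2 h2.1 h2.2

/-- `C` is injective on the compact set `𝓜 × {0}` and locally injective at its points, hence
injective on a neighbourhood of it. By compactness a uniform time interval is good, and rescaling
turns it into `[0,1)`. -/
theorem exists_isCollarOver [T2Space X] [CompactSpace B] [T2Space B] [CompactSpace 𝓜] [T2Space 𝓧]
    (hι : IsBoundaryInclusion n ι) (hj : IsBoundaryOver ι P𝓜 P𝓧 j) :
    ∃ Φ, IsCollarOver P𝓜 P𝓧 j Φ := by
  have hlc : LocallyCompactSpace (Ico (0 : ℝ) 1) :=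
    Manifold.locallyCompact_of_finiteDimensional (𝓡∂ 1)
  obtain ⟨C, hC, hpos⟩ := exists_isPreCollar_inward hι hj
  have hK : IsCompact ((univ : Set 𝓜) ×ˢ {(0 : Ico (0 : ℝ) 1)}) := isCompact_univ.prod isCompact_singleton
  have hinj : InjOn C ((univ : Set 𝓜) ×ˢ {(0 : Ico (0 : ℝ) 1)}) := by
    rintro ⟨z, t⟩ ⟨-, rfl⟩ ⟨z', t'⟩ ⟨-, rfl⟩ h
    rw [hC.apply_zero, hC.apply_zero] at h
    rw [hj.injective hι h]
  obtain ⟨U, hU, hUi⟩ := hinj.exists_mem_nhdsSet hK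
    (fun q _ => hC.smoothOver.continuous.continuousAt) (by
      rintro ⟨z, t⟩ ⟨-, rfl⟩
      exact (hC.locally hι hj (hpos z)).1)
  have hev : ∀ᶠ t in 𝓝 (0 : Ico (0 : ℝ) 1), ∀ z ∈ (univ : Set 𝓜), (z, t) ∈ U ∧
      OpenSmoothAt (P𝓜.prod (𝓡∂ 1) (Ico (0 : ℝ) 1)) P𝓧 C (z, t) := by
    refine isCompact_univ.eventually_forall_of_forall_eventually fun z _ => ?_
    have h1 : U ∈ 𝓝 (z, (0 : Ico (0 : ℝ) 1)) := mem_nhdsSet_iff_forall.1 hU _ ⟨mem_univ _, rfl⟩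
    have h2 := (eventually_mem_set.2 h1).and (hC.locally hι hj (hpos z)).2
    exact (continuous_swap.tendsto ((0 : Ico (0 : ℝ) 1), z)).eventually h2
  obtain ⟨ε, hε, hεU⟩ := Metric.mem_nhds_iff.1 hev
  -- All rescaled times `s * t` with `t < 1` stay strictly below `ε`; the minimum with `1` keeps
  -- them in `[0,1)`.
  set s : Icc (0 : ℝ) 1 := ⟨min ε 1, le_min hε.le zero_le_one, min_le_right _ _⟩ with hs
  have hs0 : 0 < (s : ℝ) := lt_min hε one_pos
  have hmem : ∀ t : Ico (0 : ℝ) 1, ∀ z, (z, icoScale s t) ∈ U ∧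
      OpenSmoothAt (P𝓜.prod (𝓡∂ 1) (Ico (0 : ℝ) 1)) P𝓧 C (z, icoScale s t) := by
    intro t z
    refine hεU ?_ z (mem_univ z)
    rw [Metric.mem_ball, Subtype.dist_eq, Real.dist_eq, coe_icoScale, Ico.coe_zero, sub_zero,
      abs_of_nonneg (mul_nonneg hs0.le t.2.1)]
    calc (s : ℝ) * t < s * 1 := mul_lt_mul_of_pos_left t.2.2 hs0
      _ ≤ ε := by rw [mul_one]; exact min_le_left _ _
  refine ⟨fun q => C (q.1, icoScale s q.2), hC.smoothOver.comp (smoothOver_scale s), fun z => ?_, ?_,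
    fun q => ?_⟩
  · simp only [icoScale_zero_right]
    exact hC.apply_zero z
  · intro p q hpq
    have h1 := Prod.mk_inj.1 (hUi (hmem _ _).1 (hmem _ _).1 hpq)
    exact Prod.ext h1.1 (icoScale_injective hs0 h1.2)
  · exact OpenSmoothAt.scale hC.smoothOver hs0 (hmem _ _).2

end CollarOver

/-! ### Reparametrising the collar of the fibre -/

section Stretch

/-- A smooth cutoff function, equal to `1` for `t ≤ t₀ / 4` and to `0` for `t ≥ t₀ / 2`. -/
def collarCutoff (t₀ t : ℝ) : ℝ := Real.smoothTransition (2 - 4 / t₀ * t)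

theorem contDiff_collarCutoff {t₀ : ℝ} : ContDiff ℝ ∞ (collarCutoff t₀) :=
  Real.smoothTransition.contDiff.comp (by fun_prop)

theorem collarCutoff_of_le {t₀ t : ℝ} (h₀ : 0 < t₀) (h : t ≤ t₀ / 4) : collarCutoff t₀ t = 1 := by
  refine Real.smoothTransition.one_of_one_le ?_
  have : 4 / t₀ * t ≤ 1 := by
    calc 4 / t₀ * t ≤ 4 / t₀ * (t₀ / 4) := by gcongr
      _ = 1 := by field_simp
  linarith

theorem collarCutoff_of_ge {t₀ t : ℝ} (h₀ : 0 < t₀) (h : t₀ / 2 ≤ t) : collarCutoff t₀ t = 0 := by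
  refine Real.smoothTransition.zero_of_nonpos ?_
  have : 2 ≤ 4 / t₀ * t := by
    calc (2 : ℝ) = 4 / t₀ * (t₀ / 2) := by field_simp; norm_num
      _ ≤ _ := by gcongr
  linarith

theorem collarCutoff_nonneg {t₀ t : ℝ} : 0 ≤ collarCutoff t₀ t := Real.smoothTransition.nonneg _

theorem collarCutoff_le_one {t₀ t : ℝ} : collarCutoff t₀ t ≤ 1 := Real.smoothTransition.le_one _

theorem deriv_collarCutoff_nonpos {t₀ : ℝ} (h₀ : 0 < t₀) (t : ℝ) :
    deriv (collarCutoff t₀) t ≤ 0 := by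
  have h : Antitone (collarCutoff t₀) := by
    intro s t hst
    refine Real.smoothTransition.monotone ?_
    have : 4 / t₀ * s ≤ 4 / t₀ * t := by gcongr
    linarith
  exact h.deriv_nonpos

/-- Interpolation between `κ * s` (for small `t`) and `t`, evaluated at `p = (t, s)`. -/
def collarStretch (κ t₀ : ℝ) (p : ℝ × ℝ) : ℝ :=
  collarCutoff t₀ p.1 * (κ * p.2) + (1 - collarCutoff t₀ p.1) * p.1

theorem contDiff_collarStretch {κ t₀ : ℝ} : ContDiff ℝ ∞ (collarStretch κ t₀) := by
  have h : ContDiff ℝ ∞ fun p : ℝ × ℝ => collarCutoff t₀ p.1 :=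
    contDiff_collarCutoff.comp contDiff_fst
  unfold collarStretch
  fun_prop

theorem collarStretch_of_le {κ t₀ t s : ℝ} (h₀ : 0 < t₀) (h : t ≤ t₀ / 4) :
    collarStretch κ t₀ (t, s) = κ * s := by
  simp [collarStretch, collarCutoff_of_le h₀ h]

theorem collarStretch_of_ge {κ t₀ t s : ℝ} (h₀ : 0 < t₀) (h : t₀ / 2 ≤ t) :
    collarStretch κ t₀ (t, s) = t := by
  simp [collarStretch, collarCutoff_of_ge h₀ h]

theorem collarStretch_nonneg {κ t₀ t s : ℝ} (hκ : 0 ≤ κ) (ht : 0 ≤ t) (hs : 0 ≤ s) :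
    0 ≤ collarStretch κ t₀ (t, s) :=
  add_nonneg (mul_nonneg collarCutoff_nonneg (mul_nonneg hκ hs))
    (mul_nonneg (sub_nonneg.2 collarCutoff_le_one) ht)

theorem collarStretch_le {κ t₀ t s : ℝ} (h : κ * s ≤ t) : collarStretch κ t₀ (t, s) ≤ t := by
  have := mul_le_mul_of_nonneg_left h (collarCutoff_nonneg (t₀ := t₀) (t := t))
  simp only [collarStretch]
  linarith

/-- With `χ` the cutoff, the derivative is `χ' * (κ * u - t) + χ * κ * d + (1 - χ)`. The first term
is nonnegative because `χ` decreases and `κ * u ≤ t`; the others have positive sum. This is why `κ`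
must be small. -/
theorem exists_hasDerivWithinAt_collarStretch {κ t₀ t d : ℝ} {u : ℝ → ℝ} {S : Set ℝ} (h₀ : 0 < t₀)
    (hκ : 0 < κ) (hu : HasDerivWithinAt u d S t) (hd : 0 < d) (h : κ * u t ≤ t) :
    ∃ d' > 0, HasDerivWithinAt (fun s => collarStretch κ t₀ (s, u s)) d' S t := by
  have h1 : HasDerivWithinAt (collarCutoff t₀) (deriv (collarCutoff t₀) t) S t :=
    (contDiff_collarCutoff.differentiable (by simp) t).hasDerivAt.hasDerivWithinAt
  refine ⟨_, ?_, (h1.mul (hu.const_mul κ)).add ((h1.const_sub 1).mul (hasDerivWithinAt_id t S))⟩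
  have h2 := mul_nonneg_of_nonpos_of_nonpos (deriv_collarCutoff_nonpos h₀ t) (sub_nonpos.2 h)
  have h3 : 0 < collarCutoff t₀ t * (κ * d) + (1 - collarCutoff t₀ t) := by
    rcases (collarCutoff_nonneg (t₀ := t₀) (t := t)).eq_or_lt with h4 | h4
    · rw [← h4]; norm_num
    · exact add_pos_of_pos_of_nonneg (mul_pos h4 (mul_pos hκ hd)) (sub_nonneg.2 collarCutoff_le_one)
  linarith

variable {n : ℕ} {B M : Type*} [TopologicalSpace B]
    [TopologicalSpace M] [ChartedSpace (EuclideanSpace ℝ (Fin n)) M] [IsManifold (𝓡 n) ∞ M]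

/-- The derivative is block triangular, with the identity in the `M` direction and `d` in the
interval direction. -/
theorem exists_mfderiv_eq_of_fst_eq {g : M × Ico (0 : ℝ) 1 → M × Ico (0 : ℝ) 1}
    {q : M × Ico (0 : ℝ) 1}
    (hg : MDifferentiableAt ((𝓡 n).prod (𝓡∂ 1)) ((𝓡 n).prod (𝓡∂ 1)) g q)
    (hfst : ∀ p, (g p).1 = p.1) {d : ℝ} (hd0 : 0 < d)
    (hd : HasDerivWithinAt (fun s => ((g (q.1, icoOfReal s)).2 : ℝ)) d (Ici 0) q.2) :
    ∃ A : (EuclideanSpace ℝ (Fin n) × EuclideanSpace ℝ (Fin 1)) ≃L[ℝ]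
        (EuclideanSpace ℝ (Fin n) × EuclideanSpace ℝ (Fin 1)),
      mfderiv ((𝓡 n).prod (𝓡∂ 1)) ((𝓡 n).prod (𝓡∂ 1)) g q =
        (A : (EuclideanSpace ℝ (Fin n) × EuclideanSpace ℝ (Fin 1)) →L[ℝ]
          (EuclideanSpace ℝ (Fin n) × EuclideanSpace ℝ (Fin 1))) := by
  let D : (EuclideanSpace ℝ (Fin n) × EuclideanSpace ℝ (Fin 1)) →L[ℝ]
    (EuclideanSpace ℝ (Fin n) × EuclideanSpace ℝ (Fin 1)) :=
      mfderiv ((𝓡 n).prod (𝓡∂ 1)) ((𝓡 n).prod (𝓡∂ 1)) g q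
  have hD : HasMFDerivAt ((𝓡 n).prod (𝓡∂ 1)) ((𝓡 n).prod (𝓡∂ 1)) g q D := hg.hasMFDerivAt
  have hfst' : (Prod.fst ∘ g : M × Ico (0 : ℝ) 1 → M) = Prod.fst := funext hfst
  have h1 : ∀ v, (D v).1 = v.1 := by
    have h2 : HasMFDerivAt ((𝓡 n).prod (𝓡∂ 1)) (𝓡 n) (Prod.fst ∘ g : M × Ico (0 : ℝ) 1 → M) q
      ((ContinuousLinearMap.fst ℝ (EuclideanSpace ℝ (Fin n)) (EuclideanSpace ℝ (Fin 1))).comp D) :=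
      (hasMFDerivAt_fst (I := 𝓡 n) (I' := 𝓡∂ 1) (g q)).comp q hD
    have h3 : HasMFDerivAt ((𝓡 n).prod (𝓡∂ 1)) (𝓡 n) (Prod.fst : M × Ico (0 : ℝ) 1 → M) q
      (ContinuousLinearMap.fst ℝ (EuclideanSpace ℝ (Fin n)) (EuclideanSpace ℝ (Fin 1))) :=
      hasMFDerivAt_fst (I := 𝓡 n) (I' := 𝓡∂ 1) q
    rw [hfst'] at h2
    intro v
    exact DFunLike.congr_fun (hasMFDerivAt_unique h2 h3) v
  have h4 : (D (0, icoUnit)).2 0 = d := by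
    have h5 : HasMFDerivAt (𝓡∂ 1) ((𝓡 n).prod (𝓡∂ 1)) (fun t : Ico (0 : ℝ) 1 => (q.1, t)) q.2
        (ContinuousLinearMap.prod (0 : EuclideanSpace ℝ (Fin 1) →L[ℝ] EuclideanSpace ℝ (Fin n))
          (ContinuousLinearMap.id ℝ (EuclideanSpace ℝ (Fin 1)))) :=
      (hasMFDerivAt_const (I := 𝓡∂ 1) (I' := 𝓡 n) q.1 q.2).prodMk (hasMFDerivAt_id (I := 𝓡∂ 1) q.2)
    have h6 := HasMFDerivAt.comp (I := 𝓡∂ 1) (I' := (𝓡 n).prod (𝓡∂ 1)) (I'' := (𝓡 n).prod (𝓡∂ 1))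
      (f := fun t : Ico (0 : ℝ) 1 => (q.1, t)) (g := g) q.2 hD h5
    have h7 := (hasMFDerivAt_snd (I := 𝓡 n) (I' := 𝓡∂ 1) (g q)).comp q.2 h6
    have h8 := (hasMFDerivAt_coe_ico (g q).2).comp q.2 h7
    have h9 := hasDerivWithinAt_comp_icoOfReal h8.mdifferentiableAt
    have h10 := (uniqueDiffOn_Ici (0 : ℝ) _ q.2.2.1).eq_deriv _ hd h9
    rw [h8.mfderiv] at h10
    exact h10.symm
  refine ContinuousLinearMap.exists_equiv_of_injective D ?_ rfl
  rintro ⟨v, u⟩ hvu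
  have hv : v = 0 := by
    have := h1 (v, u)
    rw [hvu] at this
    exact this.symm
  subst hv
  have h2 : u = u 0 • icoUnit := by
    ext i
    fin_cases i
    simp
  have h3 : D (0, u) = u 0 • D (0, icoUnit) := by
    rw [← map_smul, Prod.smul_mk, smul_zero, ← h2]
  rw [hvu] at h3
  have h5 := congrArg (fun p : EuclideanSpace ℝ (Fin n) × EuclideanSpace ℝ (Fin 1) => p.2 0) h3
  simp only [Prod.smul_snd, PiLp.smul_apply, h4, Prod.snd_zero, PiLp.zero_apply, smul_eq_mul] at h5
  have h6 : u 0 = 0 := by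
    rcases mul_eq_zero.1 h5.symm with h | h
    · exact h
    · exact absurd h hd0.ne'
  rw [h2, h6, zero_smul]
  rfl

/-- The diffeomorphisms of `M × [0,1)` which interpolate between `(m, t) ↦ (m, κ * σ b (m, t))` for
small `t` and the identity. -/
theorem exists_collar_stretch {σ : B → M × Ico (0 : ℝ) 1 → ℝ} {N : Set B} (hN : IsOpen N)
    {t₀ κ : ℝ} (ht₀ : 0 < t₀) (ht₁ : t₀ < 1) (hκ : 0 < κ)
    (hσ : ∀ b ∈ N, ∀ q : M × Ico (0 : ℝ) 1, (q.2 : ℝ) < t₀ →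
      MFamAt ((𝓡 n).prod (𝓡∂ 1)) 𝓘(ℝ, ℝ) σ b q)
    (hd : ∀ b ∈ N, ∀ q : M × Ico (0 : ℝ) 1, (q.2 : ℝ) < t₀ →
      ∃ d > 0, HasDerivWithinAt (fun s => σ b (q.1, icoOfReal s)) d (Ici 0) q.2)
    (hσ0 : ∀ b ∈ N, ∀ q, 0 ≤ σ b q)
    (hσκ : ∀ b ∈ N, ∀ q : M × Ico (0 : ℝ) 1, (q.2 : ℝ) < t₀ → κ * σ b q ≤ q.2) :
    ∃ G G' : B → M × Ico (0 : ℝ) 1 → M × Ico (0 : ℝ) 1, ∀ b ∈ N,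
      (∀ q, MFamAt ((𝓡 n).prod (𝓡∂ 1)) ((𝓡 n).prod (𝓡∂ 1)) G b q) ∧
      (∀ q, MFamAt ((𝓡 n).prod (𝓡∂ 1)) ((𝓡 n).prod (𝓡∂ 1)) G' b q) ∧
      (∀ q, G' b (G b q) = q) ∧ (∀ q, G b (G' b q) = q) ∧
      (∀ q, (G b q).1 = q.1) ∧ (∀ m, StrictMono fun t => (G b (m, t)).2) ∧
      (∀ q, (q.2 : ℝ) ≤ t₀ / 4 → ((G b q).2 : ℝ) = κ * σ b q) ∧
      ∀ q, t₀ / 2 ≤ (q.2 : ℝ) → G b q = q := by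
  classical
  have hlc : LocallyCompactSpace M := Manifold.locallyCompact_of_finiteDimensional (𝓡 n)
  set w : B → M × Ico (0 : ℝ) 1 → ℝ := fun b q => collarStretch κ t₀ ((q.2 : ℝ), σ b q) with hw
  have hw_ge : ∀ b q, t₀ / 2 ≤ (q.2 : ℝ) → w b q = q.2 := fun b q h => collarStretch_of_ge ht₀ h
  have hw0 : ∀ b ∈ N, ∀ q, 0 ≤ w b q := fun b hb q =>
    collarStretch_nonneg hκ.le q.2.2.1 (hσ0 b hb q)
  have hwt : ∀ b ∈ N, ∀ q, w b q ≤ q.2 := by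
    intro b hb q
    by_cases h : (q.2 : ℝ) < t₀
    · exact collarStretch_le (hσκ b hb q h)
    · exact (hw_ge b q (by push Not at h; linarith)).le
  have hw1 : ∀ b ∈ N, ∀ q, w b q < 1 := fun b hb q => (hwt b hb q).trans_lt q.2.2.2
  have hwm : ∀ b ∈ N, ∀ q, MFamAt ((𝓡 n).prod (𝓡∂ 1)) 𝓘(ℝ, ℝ) w b q := by
    intro b hb q
    have h1 : MFamAt ((𝓡 n).prod (𝓡∂ 1)) 𝓘(ℝ, ℝ)
        (fun (_ : B) (q : M × Ico (0 : ℝ) 1) => (q.2 : ℝ)) b q :=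
      mfamAt_const (contMDiff_coe_ico.contMDiffAt.comp q contMDiffAt_snd)
    by_cases h : (q.2 : ℝ) < t₀
    · exact h1.map₂ (hσ b hb q h) contDiff_collarStretch
    · refine h1.congr ?_
      have h2 : ContinuousAt (fun p : B × M × Ico (0 : ℝ) 1 => (p.2.2 : ℝ)) (b, q) := by fun_prop
      filter_upwards [h2.eventually (lt_mem_nhds (show t₀ / 2 < q.2 by linarith))] with p hp
      exact (hw_ge _ _ hp.le).symm
  have hwd : ∀ b ∈ N, ∀ q : M × Ico (0 : ℝ) 1, ∃ d > 0,
      HasDerivWithinAt (fun s => w b (q.1, icoOfReal s)) d (Ici 0) q.2 := by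
    intro b hb q
    have h5 : ∀ᶠ s : ℝ in 𝓝[Ici 0] (q.2 : ℝ), (icoOfReal s : ℝ) = s := by
      filter_upwards [self_mem_nhdsWithin, mem_nhdsWithin_of_mem_nhds (gt_mem_nhds q.2.2.2)] with s hs hs1
        using coe_icoOfReal hs hs1
    by_cases h : (q.2 : ℝ) < t₀
    · obtain ⟨d, hd0, hd⟩ := hd b hb q h
      obtain ⟨d', hd'0, hd'⟩ := exists_hasDerivWithinAt_collarStretch ht₀ hκ hd hd0
        (by rw [icoOfReal_coe]; exact hσκ b hb q h)
      refine ⟨d', hd'0, hd'.congr_of_eventuallyEq ?_ ?_⟩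
      · filter_upwards [h5] with s hs
        simp only [hw, hs]
      · simp only [hw, icoOfReal_coe]
    · refine ⟨1, one_pos, (hasDerivWithinAt_id _ _).congr_of_eventuallyEq ?_ ?_⟩
      · filter_upwards [h5, mem_nhdsWithin_of_mem_nhds
          (lt_mem_nhds (show t₀ / 2 < q.2 by linarith))] with s hs hs2
        rw [hw_ge _ _ (by rw [hs]; exact le_of_lt hs2)]
        exact hs
      · rw [icoOfReal_coe, hw_ge _ _ (by push Not at h; linarith)]
        rfl
  have hwmono : ∀ b ∈ N, ∀ m, StrictMono fun t => w b (m, t) := by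
    intro b hb m
    choose d hd0 hd' using fun t => hwd b hb (m, t)
    have h1 : StrictMonoOn (fun s => w b (m, icoOfReal s)) (Ico 0 1) := by
      have h2 : ∀ s : ℝ, s ∈ Ico (0 : ℝ) 1 →
          HasDerivWithinAt (fun s => w b (m, icoOfReal s)) (d (icoOfReal s)) (Ici 0) s := by
        intro s hs
        have := hd' (icoOfReal s)
        simp only [coe_icoOfReal hs.1 hs.2] at this
        exact this
      refine strictMonoOn_of_hasDerivWithinAt_pos (convex_Ico 0 1) (f' := fun s => d (icoOfReal s))
        (fun s hs => ((h2 s hs).continuousWithinAt).mono Ico_subset_Ici_self) (fun s hs => ?_)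
        (fun s _ => hd0 _)
      exact (h2 s (interior_subset hs)).mono (interior_subset.trans Ico_subset_Ici_self)
    intro t t' htt
    have := h1 t.2 t'.2 htt
    simpa only [icoOfReal_coe] using this
  set G : B → M × Ico (0 : ℝ) 1 → M × Ico (0 : ℝ) 1 := fun b q => (q.1, icoOfReal (w b q)) with hG
  have hG2 : ∀ b ∈ N, ∀ q, ((G b q).2 : ℝ) = w b q := fun b hb q =>
    coe_icoOfReal (hw0 b hb q) (hw1 b hb q)
  have hGm : ∀ b ∈ N, ∀ q, MFamAt ((𝓡 n).prod (𝓡∂ 1)) ((𝓡 n).prod (𝓡∂ 1)) G b q := by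
    intro b hb q
    refine MFamAt.prodMk (mfamAt_const contMDiffAt_fst) (mfamAt_ico ((hwm b hb q).congr ?_))
    have h2 : ∀ᶠ p : B × M × Ico (0 : ℝ) 1 in 𝓝 (b, q), p.1 ∈ N :=
      continuousAt_fst.eventually (hN.mem_nhds hb)
    filter_upwards [h2] with p hp
    exact (hG2 _ hp _).symm
  have hGmono : ∀ b ∈ N, ∀ m, StrictMono fun t => (G b (m, t)).2 := by
    intro b hb m t t' htt
    change ((G b (m, t)).2 : ℝ) < (G b (m, t')).2
    rw [hG2 b hb, hG2 b hb]
    exact hwmono b hb m htt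
  have hGid : ∀ b ∈ N, ∀ q, t₀ / 2 ≤ (q.2 : ℝ) → G b q = q := by
    intro b hb q hq
    exact Prod.ext rfl (Subtype.ext ((hG2 b hb q).trans (hw_ge b q hq)))
  have hGz : ∀ b ∈ N, ∀ m, G b (m, 0) = (m, 0) := by
    intro b hb m
    refine Prod.ext rfl (Subtype.ext ?_)
    have h1 := hw0 b hb (m, 0)
    have h2 := hwt b hb (m, 0)
    exact (hG2 b hb _).trans (le_antisymm h2 h1)
  have hGinj : ∀ b ∈ N, Function.Injective (G b) := by
    rintro b hb ⟨m, t⟩ ⟨m', t'⟩ h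
    obtain rfl : m = m' := congrArg Prod.fst h
    exact Prod.ext rfl ((hGmono b hb m).injective (congrArg Prod.snd h))
  have hGsurj : ∀ b ∈ N, Function.Surjective (G b) := by
    rintro b hb ⟨m, t⟩
    by_cases h : t₀ / 2 ≤ (t : ℝ)
    · exact ⟨_, hGid b hb (m, t) h⟩
    · push Not at h
      set T : Ico (0 : ℝ) 1 := ⟨t₀ / 2, by linarith, by linarith⟩ with hT
      have hc : Continuous fun t => (w b (m, t)) := by
        refine continuous_iff_continuousAt.2 fun s => ?_
        exact ContinuousAt.comp (f := fun s => (m, s)) (hwm b hb (m, s)).continuousAt_fibre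
          (by fun_prop)
      have hc' : ContinuousOn (fun s => w b (m, icoOfReal s)) (Icc 0 (t₀ / 2)) := by
        have h3 : ContinuousOn icoOfReal (Icc 0 (t₀ / 2)) := by
          refine Topology.IsInducing.subtypeVal.continuousOn_iff.2 ?_
          refine continuousOn_id.congr fun s hs => ?_
          exact coe_icoOfReal hs.1 (by have := hs.2; linarith)
        exact hc.comp_continuousOn h3
      -- Beyond `t₀ / 2` the map is the identity; below, the values from `0` to `t₀ / 2` are
      -- attained on each segment by the intermediate value theorem.
      have h1 := intermediate_value_Icc (by linarith) hc'
      have h2 : (t : ℝ) ∈ Icc (w b (m, icoOfReal 0)) (w b (m, icoOfReal (t₀ / 2))) := by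
        have h3 : icoOfReal (t₀ / 2) = T := icoOfReal_coe T
        have h4 : icoOfReal 0 = (0 : Ico (0 : ℝ) 1) := icoOfReal_coe 0
        rw [h3, h4, hw_ge b (m, T) le_rfl]
        exact ⟨(hwt b hb (m, 0)).trans t.2.1, h.le⟩
      obtain ⟨s, hs, hst⟩ := h1 h2
      exact ⟨(m, icoOfReal s), Prod.ext rfl (Subtype.ext ((hG2 b hb _).trans hst))⟩
  have hbij : ∀ b ∈ N, Function.Bijective (G b) := fun b hb => ⟨hGinj b hb, hGsurj b hb⟩
  -- For `b ∉ N` the map `G b` may fail to be bijective; the value there is a mere default.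
  set G' : B → M × Ico (0 : ℝ) 1 → M × Ico (0 : ℝ) 1 := fun b q =>
    if h : Function.Bijective (G b) then (Equiv.ofBijective (G b) h).symm q else q with hG'
  have hl : ∀ b ∈ N, ∀ q, G' b (G b q) = q := by
    intro b hb q
    simp only [hG', dif_pos (hbij b hb)]
    exact (Equiv.ofBijective (G b) (hbij b hb)).symm_apply_apply q
  have hr : ∀ b ∈ N, ∀ q, G b (G' b q) = q := by
    intro b hb q
    simp only [hG', dif_pos (hbij b hb)]
    exact (Equiv.ofBijective (G b) (hbij b hb)).apply_symm_apply q
  refine ⟨G, G', fun b hb => ⟨hGm b hb, fun q => ?_, hl b hb, hr b hb, fun q => rfl, hGmono b hb,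
    fun q hq => (hG2 b hb q).trans (collarStretch_of_le ht₀ hq), hGid b hb⟩⟩
  have hNe : ∀ q, ∀ᶠ p : B × M × Ico (0 : ℝ) 1 in 𝓝 (b, q), p.1 ∈ N := fun q =>
    continuousAt_fst.eventually (hN.mem_nhds hb)
  -- `G b` has invertible derivative everywhere and fixes the points `(m, 0)`, so the inverse
  -- function theorem makes the global inverse a smooth family.
  have hinv : ∀ q, InvFamAt ((𝓡 n).prod (𝓡∂ 1)) ((𝓡 n).prod (𝓡∂ 1)) G b q := by
    intro q
    refine (MFamAt.inverse_function (isHalfSpaceModel_prod n) (isHalfSpaceModel_prod n)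
      ((hNe q).mono fun p hp => hGm p.1 hp p.2) ?_ ?_).2.self_of_nhds.2
    · obtain ⟨d, hd0, hd⟩ := hwd b hb q
      have h1 : (fun s => ((G b (q.1, icoOfReal s)).2 : ℝ)) = fun s => w b (q.1, icoOfReal s) :=
        funext fun s => hG2 b hb _
      rw [← h1] at hd
      exact exists_mfderiv_eq_of_fst_eq ((hGm b hb q).contMDiffAt.mdifferentiableAt (by simp))
        (fun _ => rfl) hd0 hd
    · filter_upwards [hNe q] with p hp h3
      obtain ⟨c, m, t⟩ := p
      obtain rfl := isBoundaryPoint_prod_ico.1 h3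
      exact (hGz c hp m).symm ▸ h3
  have h1 := hinv (G' b q) G' (by filter_upwards [hNe (G' b q)] with p hp using hl p.1 hp p.2)
  rwa [hr b hb] at h1

end Stretch

/-! ### Compatible and modified local trivialisations -/

section LocalTrivs

variable {E H F B Z : Type*}
  [NormedAddCommGroup E] [NormedSpace ℝ E] [TopologicalSpace H] {I : ModelWithCorners ℝ E H}
  [TopologicalSpace F] [ChartedSpace H F] [IsManifold I ∞ F]
  [TopologicalSpace B] [TopologicalSpace Z] {P : ManifoldOver I F B Z}

theorem ManifoldOver.IsLocalTriv.isDiffFamily [LocallyCompactSpace F] {e e' : Trivialization F P.proj}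
    (he : P.IsLocalTriv e) (he' : P.IsLocalTriv e') :
    IsDiffFamily I I (e.baseSet ∩ e'.baseSet) (e.coordChange e') := by
  refine IsDiffFamily.of_mfamAt (h' := trivRep e' e id) (e.open_baseSet.inter e'.open_baseSet)
    (fun b hb x => he.mfamAt he' hb.1 hb.2 x) (fun b hb x => he'.mfamAt he hb.2 hb.1 x)
    (fun b hb x => ?_) (fun b hb x => ?_)
  · exact (trivRep_comp (Ψ := id) (Ψ' := id) (fun _ => rfl) hb.1 hb.2 x).trans
      (snd_apply_symm hb.1 x)
  · exact (trivRep_comp (Ψ := id) (Ψ' := id) (fun _ => rfl) hb.2 hb.1 x).trans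
      (snd_apply_symm hb.2 x)

/-- It suffices to be compatible with one local trivialisation over a larger base set, since changes
to the atlas factor through it. -/
theorem ManifoldOver.IsLocalTriv.of_mfamAt [LocallyCompactSpace F] {e e' : Trivialization F P.proj}
    (he : P.IsLocalTriv e) (hsub : e'.baseSet ⊆ e.baseSet)
    (h : ∀ b ∈ e'.baseSet, ∀ x, MFamAt I I (trivRep e e' id) b x)
    (h' : ∀ b ∈ e'.baseSet, ∀ x, MFamAt I I (trivRep e' e id) b x) : P.IsLocalTriv e' := by
  intro e₁ he₁
  have he₁' := P.isLocalTriv_of_mem he₁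
  have h1 : ∀ b ∈ e₁.baseSet ∩ e'.baseSet, ∀ x, MFamAt I I (trivRep e₁ e' id) b x := fun b hb x =>
    MFamAt.trivRep_comp (Ψ := id) (Ψ' := id) (e' := e) (fun _ => rfl) hb.1 (hsub hb.2) (h b hb.2 _)
      (he₁'.mfamAt he hb.1 (hsub hb.2) x)
  have h2 : ∀ b ∈ e₁.baseSet ∩ e'.baseSet, ∀ x, MFamAt I I (trivRep e' e₁ id) b x := fun b hb x =>
    MFamAt.trivRep_comp (Ψ := id) (Ψ' := id) (e' := e) (fun _ => rfl) hb.2 (hsub hb.2)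
      (he.mfamAt he₁' (hsub hb.2) hb.1 _) (h' b hb.2 x)
  have h3 : ∀ b ∈ e₁.baseSet ∩ e'.baseSet, ∀ x,
      trivRep e₁ e' id b (trivRep e' e₁ id b x) = x := fun b hb x =>
    (trivRep_comp (Ψ := id) (Ψ' := id) (fun _ => rfl) hb.2 hb.1 x).trans (snd_apply_symm hb.2 x)
  have h4 : ∀ b ∈ e₁.baseSet ∩ e'.baseSet, ∀ x,
      trivRep e' e₁ id b (trivRep e₁ e' id b x) = x := fun b hb x =>
    (trivRep_comp (Ψ := id) (Ψ' := id) (fun _ => rfl) hb.1 hb.2 x).trans (snd_apply_symm hb.1 x)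
  have ho := e₁.open_baseSet.inter e'.open_baseSet
  refine ⟨?_, IsDiffFamily.of_mfamAt ho h1 h2 h4 h3⟩
  rw [inter_comm]
  exact IsDiffFamily.of_mfamAt ho h2 h1 h3 h4

/-- A local trivialisation can be modified by a continuous family of diffeomorphisms. -/
theorem ManifoldOver.IsLocalTriv.exists_modify [LocallyCompactSpace F] {e : Trivialization F P.proj}
    (he : P.IsLocalTriv e) {N : Set B} (hN : IsOpen N) (hNe : N ⊆ e.baseSet) {h h' : B → F → F}
    (hh : ∀ b ∈ N, ∀ x, MFamAt I I h b x) (hh' : ∀ b ∈ N, ∀ x, MFamAt I I h' b x)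
    (hl : ∀ b ∈ N, ∀ x, h' b (h b x) = x) (hr : ∀ b ∈ N, ∀ x, h b (h' b x) = x) :
    ∃ e' : Trivialization F P.proj, P.IsLocalTriv e' ∧ e'.baseSet = N ∧
      ∀ w, (e' w).2 = h (P.proj w) (e w).2 := by
  have hc : ContinuousOn (fun p : B × F => h p.1 p.2) (N ×ˢ univ) := fun p hp =>
    (hh p.1 hp.1 p.2).1.continuousWithinAt
  have hc' : ContinuousOn (fun p : B × F => h' p.1 p.2) (N ×ˢ univ) := fun p hp =>
    (hh' p.1 hp.1 p.2).1.continuousWithinAt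
  have hsub : P.proj ⁻¹' N ⊆ e.source := fun w hw => e.mem_source.2 (hNe hw)
  let e' : Trivialization F P.proj :=
    { toFun := fun w => (P.proj w, h (P.proj w) (e w).2)
      invFun := fun p => e.toOpenPartialHomeomorph.symm (p.1, h' p.1 p.2)
      source := P.proj ⁻¹' N
      target := N ×ˢ univ
      map_source' := fun w hw => ⟨hw, mem_univ _⟩
      map_target' := fun p hp => by
        rw [mem_preimage, proj_symm (hNe hp.1)]
        exact hp.1
      left_inv' := fun w hw => by
        simp only [hl _ hw]
        exact e.symm_mk_snd rfl (hNe hw)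
      right_inv' := fun p hp => by
        simp only [proj_symm (hNe hp.1), snd_apply_symm (hNe hp.1), hr _ hp.1]
      open_source := hN.preimage P.continuous_proj
      open_target := hN.prod isOpen_univ
      continuousOn_toFun := by
        refine P.continuous_proj.continuousOn.prodMk ?_
        refine hc.comp (f := fun w => (P.proj w, (e w).2))
          (P.continuous_proj.continuousOn.prodMk ?_) (fun w hw => ⟨hw, mem_univ _⟩)
        exact (e.toOpenPartialHomeomorph.continuousOn.mono hsub).snd
      continuousOn_invFun := by
        refine ContinuousOn.comp (t := e.target) e.toOpenPartialHomeomorph.continuousOn_symm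
          (f := fun p : B × F => (p.1, h' p.1 p.2)) (continuousOn_fst.prodMk hc')
          (fun p hp => e.mem_target.2 (hNe hp.1))
      baseSet := N
      open_baseSet := hN
      source_eq := rfl
      target_eq := rfl
      proj_toFun := fun w hw => rfl }
  have hN' : ∀ {b : B}, b ∈ N → ∀ x, ∀ᶠ p : B × F in 𝓝 (b, x), p.1 ∈ N := fun hb x =>
    continuousAt_fst.eventually (hN.mem_nhds hb)
  refine ⟨e', he.of_mfamAt hNe (fun b hb x => (hh b hb x).congr ?_)
    (fun b hb x => (hh' b hb x).congr ?_), rfl, fun w => rfl⟩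
  · filter_upwards [hN' hb x] with p hp
    change _ = h (P.proj (e.toOpenPartialHomeomorph.symm (p.1, p.2)))
      (e (e.toOpenPartialHomeomorph.symm (p.1, p.2))).2
    rw [proj_symm (hNe hp), snd_apply_symm (hNe hp)]
  · filter_upwards [hN' hb x] with p hp
    exact (snd_apply_symm (hNe hp) (h' p.1 p.2)).symm

end LocalTrivs

/-! ### Collars of a single manifold: the one-point base -/

section Trivial

variable {E H : Type*} [NormedAddCommGroup E] [NormedSpace ℝ E] [TopologicalSpace H]

/-- The trivialisation of a space over a point. -/
def pointTriv (F : Type*) [TopologicalSpace F] : Trivialization F (fun _ : F => PUnit.unit.{1}) where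
  toFun x := (PUnit.unit, x)
  invFun p := p.2
  source := univ
  target := univ
  map_source' _ _ := mem_univ _
  map_target' _ _ := mem_univ _
  left_inv' _ _ := rfl
  right_inv' _ _ := rfl
  open_source := isOpen_univ
  open_target := isOpen_univ
  continuousOn_toFun := by fun_prop
  continuousOn_invFun := continuousOn_snd
  baseSet := univ
  open_baseSet := isOpen_univ
  source_eq := rfl
  target_eq := univ_prod_univ.symm
  proj_toFun _ _ := rfl

/-- A manifold, considered as a manifold over a point. -/
def pointManifoldOver (I : ModelWithCorners ℝ E H) (F : Type*) [TopologicalSpace F]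
    [ChartedSpace H F] [IsManifold I ∞ F] : ManifoldOver I F PUnit.{1} F where
  proj _ := PUnit.unit
  atlas := {pointTriv F}
  exists_mem_atlas _ := ⟨_, rfl, mem_univ _⟩
  isDiffFamily := by
    rintro _ rfl _ rfl
    exact IsDiffFamily.of_mfamAt (h' := fun _ x => x) (isOpen_univ.inter isOpen_univ)
      (fun b _ x => mfamAt_const contMDiffAt_id) (fun b _ x => mfamAt_const contMDiffAt_id)
      (fun _ _ _ => rfl) (fun _ _ _ => rfl)

variable {n : ℕ} {M X : Type*}
    [TopologicalSpace M] [ChartedSpace (EuclideanSpace ℝ (Fin n)) M] [IsManifold (𝓡 n) ∞ M]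
    [TopologicalSpace X] [ChartedSpace (EuclideanHalfSpace (n + 1)) X]
    [IsManifold (𝓡∂ (n + 1)) ∞ X]

/-- An open collar with smooth inverse. -/
structure IsGoodCollar (ι : M → X) (c : M × Ico (0 : ℝ) 1 → X) : Prop where
  contMDiff : ContMDiff ((𝓡 n).prod (𝓡∂ 1)) (𝓡∂ (n + 1)) ∞ c
  apply_zero : ∀ m, c (m, 0) = ι m
  injective : Function.Injective c
  isOpenMap : IsOpenMap c
  contMDiffAt_inv : ∀ c' : X → M × Ico (0 : ℝ) 1, Function.LeftInverse c' c → ∀ q,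
    ContMDiffAt (𝓡∂ (n + 1)) ((𝓡 n).prod (𝓡∂ 1)) ∞ c' (c q)

theorem exists_isCollarOver_point [CompactSpace M] [T2Space X] {ι : M → X}
    (hι : IsBoundaryInclusion n ι) :
    ∃ c, IsCollarOver (pointManifoldOver (𝓡 n) M) (pointManifoldOver (𝓡∂ (n + 1)) X) ι c := by
  have hlcM : LocallyCompactSpace M := Manifold.locallyCompact_of_finiteDimensional (𝓡 n)
  have hlcX : LocallyCompactSpace X := Manifold.locallyCompact_of_finiteDimensional (𝓡∂ (n + 1))
  exact exists_isCollarOver hι ⟨fun _ => rfl, fun _ => ⟨pointTriv M, pointTriv X,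
    ManifoldOver.isLocalTriv_of_mem rfl, ManifoldOver.isLocalTriv_of_mem rfl, mem_univ _, mem_univ _,
    fun z _ _ => rfl⟩⟩

theorem IsCollarOver.isGoodCollar {ι : M → X} {c : M × Ico (0 : ℝ) 1 → X}
    (hc : IsCollarOver (pointManifoldOver (𝓡 n) M) (pointManifoldOver (𝓡∂ (n + 1)) X) ι c) :
    IsGoodCollar (n := n) ι c := by
  have hlcM : LocallyCompactSpace M := Manifold.locallyCompact_of_finiteDimensional (𝓡 n)
  have hlcX : LocallyCompactSpace X := Manifold.locallyCompact_of_finiteDimensional (𝓡∂ (n + 1))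
  have hlc : LocallyCompactSpace (Ico (0 : ℝ) 1) :=
    Manifold.locallyCompact_of_finiteDimensional (𝓡∂ 1)
  have he₀ : (pointManifoldOver (𝓡 n) M).IsLocalTriv (pointTriv M) :=
    ManifoldOver.isLocalTriv_of_mem rfl
  have he : (pointManifoldOver (𝓡∂ (n + 1)) X).IsLocalTriv (pointTriv X) :=
    ManifoldOver.isLocalTriv_of_mem rfl
  refine ⟨fun q => ?_, hc.apply_zero, hc.injective, ?_, fun c' hc' q => ?_⟩
  · exact (hc.smoothOver.mfamAt (e := (pointTriv M).prodFibre _) he₀.prodFibre he (mem_univ _)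
      (mem_univ PUnit.unit) q).contMDiffAt
  · exact IsOpenMap.of_nhds_le fun q => (hc.openSmoothAt q).nhds_le
  · refine ((hc.openSmoothAt q).invFamAt ((pointTriv M).prodFibre _) (pointTriv X) he₀.prodFibre he
      (mem_univ _) (mem_univ _) (fun _ => c') ?_).contMDiffAt
    exact Eventually.of_forall fun p => hc' p.2

end Trivial

/-! ### Continuity of the derivative in the collar direction -/

section CurveDerivative

variable {n : ℕ} {B M : Type*} [TopologicalSpace B]
    [TopologicalSpace M] [ChartedSpace (EuclideanSpace ℝ (Fin n)) M] [IsManifold (𝓡 n) ∞ M]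

/-- The derivative of a continuous family of smooth functions in the `[0,1)` direction is
continuous. -/
theorem MFamAt.continuousAt_derivWithin {σ : B → M × Ico (0 : ℝ) 1 → ℝ} {b : B}
    {q : M × Ico (0 : ℝ) 1} (hσ : MFamAt ((𝓡 n).prod (𝓡∂ 1)) 𝓘(ℝ, ℝ) σ b q) :
    ContinuousAt (fun p : B × M × Ico (0 : ℝ) 1 =>
      derivWithin (fun s => σ p.1 (p.2.1, icoOfReal s)) (Ici 0) p.2.2) (b, q) ∧
    ∀ᶠ p : B × M × Ico (0 : ℝ) 1 in 𝓝 (b, q),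
      HasDerivWithinAt (fun s => σ p.1 (p.2.1, icoOfReal s))
        (derivWithin (fun s => σ p.1 (p.2.1, icoOfReal s)) (Ici 0) p.2.2) (Ici 0) p.2.2 := by
  set J := (𝓡 n).prod (𝓡∂ 1) with hJ
  set τ : B → EuclideanSpace ℝ (Fin n) × EuclideanSpace ℝ (Fin 1) → ℝ :=
    fun b v => σ b ((extChartAt J q).symm v) with hτ
  have hfam : FamAt (0 + 1) (range J) τ b (extChartAt J q q) := hσ.2 1
  have hq : extChartAt J q q ∈ range J := ⟨_, rfl⟩
  have ht := tendsto_prod_extChartAt (I := J) (b₀ := b) (mem_chart_source _ q)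
  have hcont := (hfam.fderivWithin J.uniqueDiffOn hq).tendsto.comp ht
  have hdiff := ht.eventually hfam.1
  have hsrc : ∀ᶠ p : B × M × Ico (0 : ℝ) 1 in 𝓝 (b, q), p.2 ∈ (extChartAt J q).source :=
    continuousAt_snd.eventually (extChartAt_source_mem_nhds q)
  have key : ∀ᶠ p : B × M × Ico (0 : ℝ) 1 in 𝓝 (b, q),
      HasDerivWithinAt (fun s => σ p.1 (p.2.1, icoOfReal s))
        (fderivWithin ℝ (τ p.1) (range J) (extChartAt J q p.2) (0, icoUnit)) (Ici 0) p.2.2 := by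
    filter_upwards [hdiff, hsrc] with p hp hps
    have h1 : HasFDerivWithinAt (τ p.1) (fderivWithin ℝ (τ p.1) (range J) (extChartAt J q p.2))
        (range J) (extChartAt J q p.2) := (hp.differentiableWithinAt (by simp)).hasFDerivWithinAt
    have hr0 : ∀ m s, 0 ≤ s → s < 1 → ((extChartAt (𝓡 n) q.1 m, !₂[s]) :
        EuclideanSpace ℝ (Fin n) × EuclideanSpace ℝ (Fin 1)) =
          extChartAt J q (m, icoOfReal s) := by
      intro m s hs0 hs1
      have : extChartAt J q (m, icoOfReal s) = (extChartAt (𝓡 n) q.1 m, !₂[(icoOfReal s : ℝ)]) := rfl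
      rw [this, coe_icoOfReal hs0 hs1]
    have h2 : HasDerivWithinAt (fun s : ℝ => ((extChartAt (𝓡 n) q.1 p.2.1, !₂[s]) :
        EuclideanSpace ℝ (Fin n) × EuclideanSpace ℝ (Fin 1))) (0, icoUnit) (Ici 0) (p.2.2 : ℝ) := by
      have h3 : (fun s : ℝ => (!₂[s] : EuclideanSpace ℝ (Fin 1))) = fun s => s • icoUnit := by
        ext s i
        fin_cases i
        simp
      refine (hasDerivWithinAt_const _ _ _).prodMk ?_
      rw [h3]
      simpa using (hasDerivWithinAt_id (p.2.2 : ℝ) (Ici 0)).smul_const icoUnit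
    have hval := hr0 p.2.1 p.2.2 p.2.2.2.1 p.2.2.2.2
    rw [icoOfReal_coe] at hval
    have h4 : ∀ᶠ s : ℝ in 𝓝[Ici 0] (p.2.2 : ℝ), 0 ≤ s ∧ s < 1 := by
      filter_upwards [self_mem_nhdsWithin, mem_nhdsWithin_of_mem_nhds (gt_mem_nhds p.2.2.2.2)]
        with s hs hs1 using ⟨hs, hs1⟩
    have hmaps : MapsTo (fun s : ℝ => ((extChartAt (𝓡 n) q.1 p.2.1, !₂[s]) :
        EuclideanSpace ℝ (Fin n) × EuclideanSpace ℝ (Fin 1))) (Ici 0) (range J) := by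
      intro s hs
      rw [(isHalfSpaceModel_prod n).range_eq]
      simpa using hs
    rw [← hval] at h1 ⊢
    have h5 := h1.comp_hasDerivWithinAt (p.2.2 : ℝ) h2 hmaps
    have hsrc2 : ∀ s : ℝ, (p.2.1, icoOfReal s) ∈ (extChartAt J q).source := by
      intro s
      rw [hJ, extChartAt_prod, PartialEquiv.prod_source] at hps ⊢
      exact ⟨hps.1, by simp⟩
    have h6 : ∀ s : ℝ, 0 ≤ s → s < 1 → σ p.1 (p.2.1, icoOfReal s) =
        τ p.1 (extChartAt (𝓡 n) q.1 p.2.1, !₂[s]) := by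
      intro s hs0 hs1
      rw [hr0 _ _ hs0 hs1]
      simp only [hτ]
      rw [(extChartAt J q).left_inv (hsrc2 s)]
    refine h5.congr_of_eventuallyEq ?_ (h6 _ p.2.2.2.1 p.2.2.2.2)
    filter_upwards [h4] with s hs using h6 s hs.1 hs.2
  have heq : ∀ᶠ p : B × M × Ico (0 : ℝ) 1 in 𝓝 (b, q),
      fderivWithin ℝ (τ p.1) (range J) (extChartAt J q p.2) (0, icoUnit) =
        derivWithin (fun s => σ p.1 (p.2.1, icoOfReal s)) (Ici 0) p.2.2 := by
    filter_upwards [key] with p hp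
    exact (hp.derivWithin (uniqueDiffOn_Ici (0 : ℝ) _ p.2.2.2.1)).symm
  refine ⟨?_, ?_⟩
  · have h7 : ContinuousAt (fun p : B × M × Ico (0 : ℝ) 1 =>
        fderivWithin ℝ (τ p.1) (range J) (extChartAt J q p.2)) (b, q) := hcont
    exact (h7.clm_apply continuousAt_const).congr heq
  · filter_upwards [key, heq] with p hp1 hp2
    rwa [hp2] at hp1

end CurveDerivative

/-! ### Extending collar maps by the identity -/

section Extend

variable {n : ℕ} {B M X : Type*} [TopologicalSpace B]
    [TopologicalSpace M] [ChartedSpace (EuclideanSpace ℝ (Fin n)) M] [IsManifold (𝓡 n) ∞ M]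
    [TopologicalSpace X] [ChartedSpace (EuclideanHalfSpace (n + 1)) X]
    [IsManifold (𝓡∂ (n + 1)) ∞ X] {ι : M → X} {c : M × Ico (0 : ℝ) 1 → X}

open Classical in
/-- Transport of a map of `M × [0,1)` to `X` along a collar, extended by the identity. -/
def collarExtend (c : M × Ico (0 : ℝ) 1 → X) (g : M × Ico (0 : ℝ) 1 → M × Ico (0 : ℝ) 1) (x : X) : X :=
  if h : ∃ q, c q = x then c (g h.choose) else x

theorem collarExtend_apply (hc : Function.Injective c)
    (g : M × Ico (0 : ℝ) 1 → M × Ico (0 : ℝ) 1) (q : M × Ico (0 : ℝ) 1) :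
    collarExtend c g (c q) = c (g q) := by
  have h : ∃ q', c q' = c q := ⟨q, rfl⟩
  rw [collarExtend, dif_pos h, hc h.choose_spec]

theorem collarExtend_of_notMem (g : M × Ico (0 : ℝ) 1 → M × Ico (0 : ℝ) 1) {x : X}
    (hx : x ∉ range c) : collarExtend c g x = x := dif_neg hx

theorem collarExtend_comp (hc : Function.Injective c) {g g' : M × Ico (0 : ℝ) 1 → M × Ico (0 : ℝ) 1}
    (h : ∀ q, g' (g q) = q) (x : X) : collarExtend c g' (collarExtend c g x) = x := by
  by_cases hx : x ∈ range c
  · obtain ⟨q, rfl⟩ := hx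
    rw [collarExtend_apply hc, collarExtend_apply hc, h]
  · rw [collarExtend_of_notMem g hx, collarExtend_of_notMem g' hx]

theorem IsGoodCollar.exists_leftInverse (hc : IsGoodCollar (n := n) ι c) [Nonempty M] :
    ∃ c' : X → M × Ico (0 : ℝ) 1, Function.LeftInverse c' c :=
  ⟨_, Function.leftInverse_invFun hc.injective⟩

theorem isCompact_ico_le {r : ℝ} (hr : r < 1) : IsCompact {t : Ico (0 : ℝ) 1 | (t : ℝ) ≤ r} := by
  rw [Topology.IsInducing.subtypeVal.isCompact_iff]
  convert isCompact_Icc (a := (0 : ℝ)) (b := r)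
  ext s
  constructor
  · rintro ⟨t, ht, rfl⟩
    exact ⟨t.2.1, ht⟩
  · intro hs
    exact ⟨⟨s, hs.1, hs.2.trans_lt hr⟩, hs.2, rfl⟩

/-- On the open set `range c` the map is `G` in collar coordinates. Outside, `c '' (M × [0, r])` is
compact, hence closed in the Hausdorff space `X`, so near a point outside `range c` the map is the
identity. -/
theorem IsGoodCollar.mfamAt_collarExtend [CompactSpace M] [T2Space X]
    (hc : IsGoodCollar (n := n) ι c) {N : Set B} (hN : IsOpen N)
    {G : B → M × Ico (0 : ℝ) 1 → M × Ico (0 : ℝ) 1} {r : ℝ} (hr : r < 1)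
    (hG : ∀ b ∈ N, ∀ q, MFamAt ((𝓡 n).prod (𝓡∂ 1)) ((𝓡 n).prod (𝓡∂ 1)) G b q)
    (hGid : ∀ b ∈ N, ∀ q, r ≤ (q.2 : ℝ) → G b q = q) {b : B} (hb : b ∈ N) (x : X) :
    MFamAt (𝓡∂ (n + 1)) (𝓡∂ (n + 1)) (fun b => collarExtend c (G b)) b x := by
  have hN' : ∀ᶠ p : B × X in 𝓝 (b, x), p.1 ∈ N := continuousAt_fst.eventually (hN.mem_nhds hb)
  by_cases hx : x ∈ range c
  · obtain ⟨q, rfl⟩ := hx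
    have : Nonempty M := ⟨q.1⟩
    obtain ⟨c', hc'⟩ := hc.exists_leftInverse
    have h1 : MFamAt (𝓡∂ (n + 1)) ((𝓡 n).prod (𝓡∂ 1)) (fun _ : B => c') b (c q) :=
      mfamAt_const (hc.contMDiffAt_inv c' hc' q)
    have h2 := MFamAt.comp (hG b hb (c' (c q))) h1
    have h3 := MFamAt.comp (g := fun _ : B => c) (mfamAt_const (hc.contMDiff.contMDiffAt)) h2
    refine h3.congr ?_
    have h4 : ∀ᶠ p : B × X in 𝓝 (b, c q), p.2 ∈ range c :=
      continuousAt_snd.eventually (hc.isOpenMap.isOpen_range.mem_nhds ⟨q, rfl⟩)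
    filter_upwards [h4] with p hp
    obtain ⟨q', hq'⟩ := hp
    rw [← hq', hc', collarExtend_apply hc.injective]
  · have hK : IsClosed (c '' (univ ×ˢ {t : Ico (0 : ℝ) 1 | (t : ℝ) ≤ r})) :=
      ((isCompact_univ.prod (isCompact_ico_le hr)).image hc.contMDiff.continuous).isClosed
    have h4 : ∀ᶠ p : B × X in 𝓝 (b, x), p.2 ∉ c '' (univ ×ˢ {t : Ico (0 : ℝ) 1 | (t : ℝ) ≤ r}) :=
      continuousAt_snd.eventually (hK.isOpen_compl.mem_nhds fun h => hx (image_subset_range _ _ h))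
    refine MFamAt.congr (f := fun _ : B => id) (mfamAt_const contMDiffAt_id) ?_
    filter_upwards [h4, hN'] with p hp hpN
    by_cases hpr : p.2 ∈ range c
    · obtain ⟨q, hq⟩ := hpr
      have h5 : r ≤ (q.2 : ℝ) := by
        by_contra h
        push Not at h
        exact hp ⟨q, ⟨mem_univ _, h.le⟩, hq⟩
      rw [← hq, collarExtend_apply hc.injective, hGid _ hpN q h5]
      rfl
    · rw [collarExtend_of_notMem _ hpr]
      rfl

end Extend

/-! ### Collars over the base and their inverses in local trivialisations -/

section CollarInverse

variable {n : ℕ} {B M X 𝓜 𝓧 : Type*}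
    [TopologicalSpace B]
    [TopologicalSpace M] [ChartedSpace (EuclideanSpace ℝ (Fin n)) M] [IsManifold (𝓡 n) ∞ M]
    [LocallyCompactSpace M]
    [TopologicalSpace X] [ChartedSpace (EuclideanHalfSpace (n + 1)) X]
    [IsManifold (𝓡∂ (n + 1)) ∞ X] [LocallyCompactSpace X]
    [TopologicalSpace 𝓜] [TopologicalSpace 𝓧]
    {ι : M → X} {P𝓜 : ManifoldOver (𝓡 n) M B 𝓜} {P𝓧 : ManifoldOver (𝓡∂ (n + 1)) X B 𝓧}
    {j : 𝓜 → 𝓧} {Φ : 𝓜 × Ico (0 : ℝ) 1 → 𝓧}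

theorem IsCollarOver.proj_eq (hΦ : IsCollarOver P𝓜 P𝓧 j Φ) (q : 𝓜 × Ico (0 : ℝ) 1) :
    P𝓧.proj (Φ q) = P𝓜.proj q.1 := hΦ.smoothOver.proj_eq q

theorem IsCollarOver.isOpenMap (hΦ : IsCollarOver P𝓜 P𝓧 j Φ) : IsOpenMap Φ :=
  IsOpenMap.of_nhds_le fun q => (hΦ.openSmoothAt q).nhds_le

/-- A collar over `B`, in local trivialisations. -/
theorem IsCollarOver.mfamAt (hΦ : IsCollarOver P𝓜 P𝓧 j Φ) {e₀ : Trivialization M P𝓜.proj}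
    {e : Trivialization X P𝓧.proj} (he₀ : P𝓜.IsLocalTriv e₀) (he : P𝓧.IsLocalTriv e) {b : B}
    (hb₀ : b ∈ e₀.baseSet) (hb : b ∈ e.baseSet) (q : M × Ico (0 : ℝ) 1) :
    MFamAt ((𝓡 n).prod (𝓡∂ 1)) (𝓡∂ (n + 1))
      (fun b q => (e (Φ (e₀.toOpenPartialHomeomorph.symm (b, q.1), q.2))).2) b q :=
  have _hlc : LocallyCompactSpace (Ico (0 : ℝ) 1) :=
    Manifold.locallyCompact_of_finiteDimensional (𝓡∂ 1)
  hΦ.smoothOver.mfamAt (e := e₀.prodFibre (Ico (0 : ℝ) 1)) he₀.prodFibre he hb₀ hb q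

/-- The inverse of a collar over `B`, in local trivialisations. -/
theorem IsCollarOver.mfamAt_inv (hΦ : IsCollarOver P𝓜 P𝓧 j Φ) {S : 𝓧 → 𝓜 × Ico (0 : ℝ) 1}
    (hS : Function.LeftInverse S Φ) {e₀ : Trivialization M P𝓜.proj} {e : Trivialization X P𝓧.proj}
    (he₀ : P𝓜.IsLocalTriv e₀) (he : P𝓧.IsLocalTriv e) {b : B} (hb₀ : b ∈ e₀.baseSet)
    (hb : b ∈ e.baseSet) {q : 𝓜 × Ico (0 : ℝ) 1} (hq : P𝓜.proj q.1 = b) :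
    MFamAt (𝓡∂ (n + 1)) ((𝓡 n).prod (𝓡∂ 1))
      (fun b x => ((e₀ (S (e.toOpenPartialHomeomorph.symm (b, x))).1).2,
        (S (e.toOpenPartialHomeomorph.symm (b, x))).2)) b (e (Φ q)).2 := by
  have hlc : LocallyCompactSpace (Ico (0 : ℝ) 1) :=
    Manifold.locallyCompact_of_finiteDimensional (𝓡∂ 1)
  subst hq
  have h1 := (hΦ.openSmoothAt q).invFamAt (e₀.prodFibre (Ico (0 : ℝ) 1)) e he₀.prodFibre he hb₀ hb
  have h2 := h1 (fun b x => ((e₀ (S (e.toOpenPartialHomeomorph.symm (b, x))).1).2,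
        (S (e.toOpenPartialHomeomorph.symm (b, x))).2)) (by
    filter_upwards [ManifoldOver.eventually_mem_baseSet e₀ hb₀ _,
      ManifoldOver.eventually_mem_baseSet e hb _] with p hp0 hp
    have h3 : e.toOpenPartialHomeomorph.symm (p.1, trivRep (e₀.prodFibre (Ico (0 : ℝ) 1)) e Φ p.1 p.2) =
        Φ (e₀.toOpenPartialHomeomorph.symm (p.1, p.2.1), p.2.2) :=
      symm_trivRep (e := e₀.prodFibre (Ico (0 : ℝ) 1)) (e' := e) hΦ.proj_eq hp0 hp p.2
    refine (congrArg (fun w => ((e₀ (S w).1).2, (S w).2)) h3).trans ?_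
    simp only [hS _]
    exact Prod.ext (snd_apply_symm hp0 _) rfl)
  have h4 : trivRep (e₀.prodFibre (Ico (0 : ℝ) 1)) e Φ (P𝓜.proj q.1)
      ((e₀.prodFibre (Ico (0 : ℝ) 1)) q).2 = (e (Φ q)).2 :=
    trivRep_self (e := e₀.prodFibre (Ico (0 : ℝ) 1)) rfl hb₀
  exact (congrArg (fun y => MFamAt (𝓡∂ (n + 1)) ((𝓡 n).prod (𝓡∂ 1))
    (fun b x => ((e₀ (S (e.toOpenPartialHomeomorph.symm (b, x))).1).2,
      (S (e.toOpenPartialHomeomorph.symm (b, x))).2)) (P𝓜.proj q.1) y) h4).mp h2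

end CollarInverse

/-! ### Tools for comparing two collars -/

section Compare

variable {n : ℕ} {B M : Type*} [TopologicalSpace B]
    [TopologicalSpace M] [ChartedSpace (EuclideanSpace ℝ (Fin n)) M] [IsManifold (𝓡 n) ∞ M]

/-- At such a point the normal component of the derivative is a positive multiple of the normal
component of the vector; the derivative along the interval is that multiple. -/
theorem exists_hasDerivWithinAt_pos_of_isBoundaryPoint {F : M × Ico (0 : ℝ) 1 → M × Ico (0 : ℝ) 1}
    {q : M × Ico (0 : ℝ) 1}
    (hF : MDifferentiableAt ((𝓡 n).prod (𝓡∂ 1)) ((𝓡 n).prod (𝓡∂ 1)) F q)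
    (hA : ∃ A : (EuclideanSpace ℝ (Fin n) × EuclideanSpace ℝ (Fin 1)) ≃L[ℝ]
        (EuclideanSpace ℝ (Fin n) × EuclideanSpace ℝ (Fin 1)),
      mfderiv ((𝓡 n).prod (𝓡∂ 1)) ((𝓡 n).prod (𝓡∂ 1)) F q =
        (A : (EuclideanSpace ℝ (Fin n) × EuclideanSpace ℝ (Fin 1)) →L[ℝ]
          (EuclideanSpace ℝ (Fin n) × EuclideanSpace ℝ (Fin 1))))
    (hq : ((𝓡 n).prod (𝓡∂ 1)).IsBoundaryPoint (F q)) :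
    ∃ a > 0, HasDerivWithinAt (fun s => ((F (q.1, icoOfReal s)).2 : ℝ)) a (Ici 0) q.2 := by
  obtain ⟨-, a, ha, haD⟩ := hF.inward_scale (isHalfSpaceModel_prod n) (isHalfSpaceModel_prod n) hq hA
  refine ⟨a, ha, ?_⟩
  let D : (EuclideanSpace ℝ (Fin n) × EuclideanSpace ℝ (Fin 1)) →L[ℝ]
    (EuclideanSpace ℝ (Fin n) × EuclideanSpace ℝ (Fin 1)) :=
      mfderiv ((𝓡 n).prod (𝓡∂ 1)) ((𝓡 n).prod (𝓡∂ 1)) F q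
  have hD : HasMFDerivAt ((𝓡 n).prod (𝓡∂ 1)) ((𝓡 n).prod (𝓡∂ 1)) F q D := hF.hasMFDerivAt
  have h5 : HasMFDerivAt (𝓡∂ 1) ((𝓡 n).prod (𝓡∂ 1)) (fun t : Ico (0 : ℝ) 1 => (q.1, t)) q.2
      (ContinuousLinearMap.prod (0 : EuclideanSpace ℝ (Fin 1) →L[ℝ] EuclideanSpace ℝ (Fin n))
        (ContinuousLinearMap.id ℝ (EuclideanSpace ℝ (Fin 1)))) :=
    (hasMFDerivAt_const (I := 𝓡∂ 1) (I' := 𝓡 n) q.1 q.2).prodMk (hasMFDerivAt_id (I := 𝓡∂ 1) q.2)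
  have h6 := HasMFDerivAt.comp (I := 𝓡∂ 1) (I' := (𝓡 n).prod (𝓡∂ 1)) (I'' := (𝓡 n).prod (𝓡∂ 1))
    (f := fun t : Ico (0 : ℝ) 1 => (q.1, t)) (g := F) q.2 hD h5
  have h7 := (hasMFDerivAt_snd (I := 𝓡 n) (I' := 𝓡∂ 1) (F q)).comp q.2 h6
  have h8 := (hasMFDerivAt_coe_ico (F q).2).comp q.2 h7
  have h9 := hasDerivWithinAt_comp_icoOfReal h8.mdifferentiableAt
  rw [h8.mfderiv] at h9
  have h10 := haD (0, icoUnit)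
  have h11 : a * (((EuclideanSpace.proj (0 : Fin 1) : _ →L[ℝ] ℝ).comp
      (ContinuousLinearMap.snd ℝ (EuclideanSpace ℝ (Fin n)) (EuclideanSpace ℝ (Fin 1))))
        (0, icoUnit)) = a := by simp
  rw [h11] at h10
  rw [← h10]
  exact h9

/-- The tube lemma for the compact fibre `M`: a condition near each `(b₀, (m, 0))` holds over one
neighbourhood of `b₀` and for one range of times. -/
theorem exists_uniform_of_eventually [CompactSpace M] {b₀ : B} {P : B × M × Ico (0 : ℝ) 1 → Prop}
    (h : ∀ m, ∀ᶠ p in 𝓝 (b₀, (m, (0 : Ico (0 : ℝ) 1))), P p) :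
    ∃ N : Set B, IsOpen N ∧ b₀ ∈ N ∧ ∃ t₀ : ℝ, 0 < t₀ ∧ t₀ < 1 ∧
      ∀ b ∈ N, ∀ q : M × Ico (0 : ℝ) 1, (q.2 : ℝ) < t₀ → P (b, q) := by
  have h1 : ∀ᶠ s : B × Ico (0 : ℝ) 1 in 𝓝 (b₀, 0), ∀ m ∈ (univ : Set M), P (s.1, (m, s.2)) := by
    refine isCompact_univ.eventually_forall_of_forall_eventually fun m _ => ?_
    have hc : ContinuousAt (fun p : (B × Ico (0 : ℝ) 1) × M => (p.1.1, (p.2, p.1.2)))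
        ((b₀, 0), m) := by fun_prop
    exact hc.eventually (h m)
  rw [nhds_prod_eq] at h1
  obtain ⟨pa, hpa, pb, hpb, hab⟩ := eventually_prod_iff.1 h1
  obtain ⟨N, hN, hNo, hbN⟩ := eventually_nhds_iff.1 hpa
  obtain ⟨ε, hε, hεU⟩ := Metric.mem_nhds_iff.1 hpb
  refine ⟨N, hNo, hbN, min ε (1 / 2), lt_min hε (by norm_num), (min_le_right _ _).trans_lt (by norm_num),
    fun b hb q hq => hab (hN b hb) (hεU ?_) q.1 (mem_univ _)⟩
  rw [Metric.mem_ball, Subtype.dist_eq, Real.dist_eq, Ico.coe_zero, sub_zero, abs_of_nonneg q.2.2.1]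
  exact hq.trans_le (min_le_left _ _)

end Compare

/-! ### The time coordinate of a collar over the base, seen in the fibre -/

section CollarTime

variable {n : ℕ} {B M X 𝓜 𝓧 : Type*}
    [TopologicalSpace B]
    [TopologicalSpace M] [ChartedSpace (EuclideanSpace ℝ (Fin n)) M] [IsManifold (𝓡 n) ∞ M]
    [CompactSpace M] [LocallyCompactSpace M]
    [TopologicalSpace X] [ChartedSpace (EuclideanHalfSpace (n + 1)) X]
    [IsManifold (𝓡∂ (n + 1)) ∞ X] [LocallyCompactSpace X]
    [TopologicalSpace 𝓜] [TopologicalSpace 𝓧]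
    {ι : M → X} {P𝓜 : ManifoldOver (𝓡 n) M B 𝓜} {P𝓧 : ManifoldOver (𝓡∂ (n + 1)) X B 𝓧}
    {j : 𝓜 → 𝓧} {Φ : 𝓜 × Ico (0 : ℝ) 1 → 𝓧} {c : M × Ico (0 : ℝ) 1 → X}
    {S : 𝓧 → 𝓜 × Ico (0 : ℝ) 1} {e₀ : Trivialization M P𝓜.proj}
    {e : Trivialization X P𝓧.proj} {b : B}

/-- Where `j` is read as `ι`, both collars start from the same boundary, so they agree at time zero.
-/
theorem IsCollarOver.symm_collar_zero (hΦ : IsCollarOver P𝓜 P𝓧 j Φ) (hc : IsGoodCollar (n := n) ι c)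
    (hej : ∀ z, P𝓜.proj z ∈ e₀.baseSet → P𝓜.proj z ∈ e.baseSet → (e (j z)).2 = ι (e₀ z).2)
    (hb₀ : b ∈ e₀.baseSet) (hb : b ∈ e.baseSet) (m : M) :
    e.toOpenPartialHomeomorph.symm (b, c (m, 0)) = Φ (e₀.toOpenPartialHomeomorph.symm (b, m), 0) := by
  have h1 := hej (e₀.toOpenPartialHomeomorph.symm (b, m)) (by rwa [proj_symm hb₀])
    (by rwa [proj_symm hb₀])
  rw [snd_apply_symm hb₀] at h1
  rw [hc.apply_zero, ← h1, hΦ.apply_zero, e.symm_mk_snd (b := b) ?_ hb]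
  rw [← hΦ.apply_zero, hΦ.proj_eq, proj_symm hb₀]

theorem IsCollarOver.mfamAt_comp_inv (hΦ : IsCollarOver P𝓜 P𝓧 j Φ) (hS : Function.LeftInverse S Φ)
    (hc : IsGoodCollar (n := n) ι c) (he₀ : P𝓜.IsLocalTriv e₀) (he : P𝓧.IsLocalTriv e)
    (hb₀ : b ∈ e₀.baseSet) (hb : b ∈ e.baseSet) {q : M × Ico (0 : ℝ) 1}
    (hq : e.toOpenPartialHomeomorph.symm (b, c q) ∈ range Φ) :
    MFamAt ((𝓡 n).prod (𝓡∂ 1)) ((𝓡 n).prod (𝓡∂ 1))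
      (fun b q => ((e₀ (S (e.toOpenPartialHomeomorph.symm (b, c q))).1).2,
        (S (e.toOpenPartialHomeomorph.symm (b, c q))).2)) b q := by
  obtain ⟨q', hq'⟩ := hq
  have h1 := hΦ.mfamAt_inv hS he₀ he hb₀ hb (q := q') (by
    rw [← hΦ.proj_eq, hq', proj_symm hb])
  rw [hq', snd_apply_symm hb] at h1
  exact MFamAt.comp (f := fun _ : B => c) h1 (mfamAt_const hc.contMDiff.contMDiffAt)

/-- In trivialisations, the inverse of `Φ` after `c` fixes `(m, 0)` and has the inverse of `c` after
`Φ` as a smooth local inverse. Its derivative is thus invertible, and the normal component is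
positive. -/
theorem IsCollarOver.exists_hasDerivWithinAt_time (hΦ : IsCollarOver P𝓜 P𝓧 j Φ)
    (hS : Function.LeftInverse S Φ) (hc : IsGoodCollar (n := n) ι c) (he₀ : P𝓜.IsLocalTriv e₀)
    (he : P𝓧.IsLocalTriv e)
    (hej : ∀ z, P𝓜.proj z ∈ e₀.baseSet → P𝓜.proj z ∈ e.baseSet → (e (j z)).2 = ι (e₀ z).2)
    (hb₀ : b ∈ e₀.baseSet) (hb : b ∈ e.baseSet) (m : M) :
    ∃ a > 0, HasDerivWithinAt
      (fun s => ((S (e.toOpenPartialHomeomorph.symm (b, c (m, icoOfReal s)))).2 : ℝ)) a (Ici 0) 0 := by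
  have hne : Nonempty M := ⟨m⟩
  obtain ⟨c', hc'⟩ := hc.exists_leftInverse
  have h0 := hΦ.symm_collar_zero hc hej hb₀ hb m
  have hF := (hΦ.mfamAt_comp_inv hS hc he₀ he hb₀ hb (q := (m, 0)) ⟨_, h0.symm⟩).contMDiffAt
  set F : M × Ico (0 : ℝ) 1 → M × Ico (0 : ℝ) 1 := fun q =>
    ((e₀ (S (e.toOpenPartialHomeomorph.symm (b, c q))).1).2,
        (S (e.toOpenPartialHomeomorph.symm (b, c q))).2) with hFdef
  have hF0 : F (m, 0) = (m, 0) := by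
    simp only [hFdef]
    rw [h0, hS]
    exact Prod.ext (snd_apply_symm hb₀ _) rfl
  set f : M × Ico (0 : ℝ) 1 → X := fun q =>
    (e (Φ (e₀.toOpenPartialHomeomorph.symm (b, q.1), q.2))).2 with hf
  have hfm : ContMDiffAt ((𝓡 n).prod (𝓡∂ 1)) (𝓡∂ (n + 1)) ∞ f (m, 0) :=
    (hΦ.mfamAt he₀ he hb₀ hb (m, 0)).contMDiffAt
  have hf0 : f (m, 0) = c (m, 0) := by
    simp only [hf]
    rw [← h0, snd_apply_symm hb]
  have hK : ContMDiffAt ((𝓡 n).prod (𝓡∂ 1)) ((𝓡 n).prod (𝓡∂ 1)) ∞ (c' ∘ f) (F (m, 0)) := by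
    rw [hF0]
    refine ContMDiffAt.comp (m, (0 : Ico (0 : ℝ) 1)) ?_ hfm
    rw [hf0]
    exact hc.contMDiffAt_inv c' hc' _
  have hprojf : ∀ q : M × Ico (0 : ℝ) 1,
      P𝓧.proj (Φ (e₀.toOpenPartialHomeomorph.symm (b, q.1), q.2)) = b := fun q => by
    rw [hΦ.proj_eq, proj_symm hb₀]
  have hgf : ∀ᶠ q in 𝓝 (m, (0 : Ico (0 : ℝ) 1)), (c' ∘ f) (F q) = q := by
    have h1 : ContinuousAt (fun q => e.toOpenPartialHomeomorph.symm (b, c q)) (m, (0 : Ico (0 : ℝ) 1)) :=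
      ContinuousAt.comp (f := fun q => (b, c q))
        (e.toOpenPartialHomeomorph.continuousAt_symm (e.mem_target.2 hb))
        (continuousAt_const.prodMk hc.contMDiff.continuous.continuousAt)
    have h2 := h1.eventually (hΦ.isOpenMap.isOpen_range.mem_nhds ⟨_, h0.symm⟩)
    filter_upwards [h2] with q hq
    obtain ⟨q', hq'⟩ := hq
    have h3 : P𝓜.proj q'.1 = b := by rw [← hΦ.proj_eq, hq', proj_symm hb]
    simp only [Function.comp_apply, hFdef, hf]
    rw [← hq', hS, e₀.symm_mk_snd h3 hb₀, hq', snd_apply_symm hb, hc']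
  have hfg : ∀ᶠ q in 𝓝 (F (m, 0)), F ((c' ∘ f) q) = q := by
    rw [hF0]
    have h2 := hfm.continuousAt.eventually (hc.isOpenMap.isOpen_range.mem_nhds (by
      rw [hf0]
      exact ⟨_, rfl⟩))
    filter_upwards [h2] with q hq
    obtain ⟨q', hq'⟩ := hq
    have h3 : e.toOpenPartialHomeomorph.symm (b, f q) =
        Φ (e₀.toOpenPartialHomeomorph.symm (b, q.1), q.2) := e.symm_mk_snd (hprojf q) hb
    have h4 : c (c' (f q)) = f q := by rw [← hq', hc']
    simp only [Function.comp_apply, hFdef, h4, h3]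
    rw [hS]
    exact Prod.ext (snd_apply_symm hb₀ _) rfl
  have hFd : MDifferentiableAt ((𝓡 n).prod (𝓡∂ 1)) ((𝓡 n).prod (𝓡∂ 1)) F (m, 0) :=
    hF.mdifferentiableAt (by simp)
  exact exists_hasDerivWithinAt_pos_of_isBoundaryPoint (q := (m, 0)) hFd
    (mfderiv_bijective_of_local_inverse hFd (hK.mdifferentiableAt (by simp)) hgf hfg)
    (hF0.symm ▸ isBoundaryPoint_prod_ico.2 rfl)

/-- In the coordinates given by the collar `c`, the collar parameter of `Φ` is comparable to that of
`c`. -/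
theorem IsCollarOver.exists_time_bounds [Nonempty M] (hΦ : IsCollarOver P𝓜 P𝓧 j Φ)
    (hS : Function.LeftInverse S Φ) (hc : IsGoodCollar (n := n) ι c) (he₀ : P𝓜.IsLocalTriv e₀)
    (he : P𝓧.IsLocalTriv e)
    (hej : ∀ z, P𝓜.proj z ∈ e₀.baseSet → P𝓜.proj z ∈ e.baseSet → (e (j z)).2 = ι (e₀ z).2)
    (hb₀ : b ∈ e₀.baseSet) (hb : b ∈ e.baseSet) :
    ∃ N : Set B, IsOpen N ∧ b ∈ N ∧ N ⊆ e₀.baseSet ∧ N ⊆ e.baseSet ∧ ∃ t₀ : ℝ, 0 < t₀ ∧ t₀ < 1 ∧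
      ∃ C : ℝ, 0 < C ∧ ∀ b ∈ N, ∀ q : M × Ico (0 : ℝ) 1, (q.2 : ℝ) < t₀ →
        e.toOpenPartialHomeomorph.symm (b, c q) ∈ range Φ ∧
        MFamAt ((𝓡 n).prod (𝓡∂ 1)) 𝓘(ℝ, ℝ)
          (fun b q => ((S (e.toOpenPartialHomeomorph.symm (b, c q))).2 : ℝ)) b q ∧
        (∃ d > 0, HasDerivWithinAt
          (fun s => ((S (e.toOpenPartialHomeomorph.symm (b, c (q.1, icoOfReal s)))).2 : ℝ)) d
            (Ici 0) q.2) ∧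
        ((S (e.toOpenPartialHomeomorph.symm (b, c q))).2 : ℝ) ≤ C * q.2 := by
  set σ : B → M × Ico (0 : ℝ) 1 → ℝ := fun b q =>
    ((S (e.toOpenPartialHomeomorph.symm (b, c q))).2 : ℝ) with hσ
  set D : B × M × Ico (0 : ℝ) 1 → ℝ := fun p =>
    derivWithin (fun s => σ p.1 (p.2.1, icoOfReal s)) (Ici 0) p.2.2 with hD
  have h0 : ∀ b ∈ e₀.baseSet, b ∈ e.baseSet → ∀ m,
      e.toOpenPartialHomeomorph.symm (b, c (m, 0)) = Φ (e₀.toOpenPartialHomeomorph.symm (b, m), 0) :=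
    fun b h1 h2 m => hΦ.symm_collar_zero hc hej h1 h2 m
  have hσm : ∀ b ∈ e₀.baseSet, b ∈ e.baseSet → ∀ q,
      e.toOpenPartialHomeomorph.symm (b, c q) ∈ range Φ →
      MFamAt ((𝓡 n).prod (𝓡∂ 1)) 𝓘(ℝ, ℝ) σ b q := by
    intro b h1 h2 q hq
    have h3 := hΦ.mfamAt_comp_inv hS hc he₀ he h1 h2 hq
    exact (MFamAt.comp (g := fun _ (q : M × Ico (0 : ℝ) 1) => q.2)
      (mfamAt_const contMDiffAt_snd) h3).coe_ico
  have hσ0 : ∀ m, MFamAt ((𝓡 n).prod (𝓡∂ 1)) 𝓘(ℝ, ℝ) σ b (m, 0) := fun m =>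
    hσm b hb₀ hb _ ⟨_, (h0 b hb₀ hb m).symm⟩
  have hDc : ∀ m, ContinuousAt D (b, (m, 0)) := fun m => (hσ0 m).continuousAt_derivWithin.1
  have hDpos : ∀ m, 0 < D (b, (m, 0)) := by
    intro m
    obtain ⟨a, ha, had⟩ := hΦ.exists_hasDerivWithinAt_time hS hc he₀ he hej hb₀ hb m
    have h1 : D (b, (m, 0)) = a := had.derivWithin (uniqueDiffOn_Ici (0 : ℝ) _ self_mem_Ici)
    rwa [h1]
  -- A strict bound for the time derivative on the compact boundary, so that it persists for nearby
  -- `b` and small times.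
  obtain ⟨C, hC⟩ : ∃ C, ∀ m, D (b, (m, 0)) < C := by
    have hcont : Continuous fun m => D (b, (m, 0)) := continuous_iff_continuousAt.2 fun m =>
      ContinuousAt.comp (f := fun m => (b, (m, (0 : Ico (0 : ℝ) 1)))) (hDc m) (by fun_prop)
    obtain ⟨C, hC⟩ := (isCompact_range hcont).bddAbove
    exact ⟨C + 1, fun m => (hC ⟨m, rfl⟩).trans_lt (lt_add_one C)⟩
  have hC0 : 0 < C := (hDpos (Classical.arbitrary M)).trans (hC _)
  have hev : ∀ m, ∀ᶠ p in 𝓝 (b, (m, (0 : Ico (0 : ℝ) 1))), p.1 ∈ e₀.baseSet ∧ p.1 ∈ e.baseSet ∧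
      e.toOpenPartialHomeomorph.symm (p.1, c p.2) ∈ range Φ ∧ 0 < D p ∧ D p < C ∧
      HasDerivWithinAt (fun s => σ p.1 (p.2.1, icoOfReal s)) (D p) (Ici 0) p.2.2 := by
    intro m
    have h1 : ContinuousAt (fun p : B × M × Ico (0 : ℝ) 1 =>
        e.toOpenPartialHomeomorph.symm (p.1, c p.2)) (b, (m, (0 : Ico (0 : ℝ) 1))) :=
      ContinuousAt.comp (f := fun p : B × M × Ico (0 : ℝ) 1 => (p.1, c p.2))
        (e.toOpenPartialHomeomorph.continuousAt_symm (e.mem_target.2 hb))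
        (continuousAt_fst.prodMk (hc.contMDiff.continuous.comp continuous_snd).continuousAt)
    filter_upwards [ManifoldOver.eventually_mem_baseSet e₀ hb₀ _,
      ManifoldOver.eventually_mem_baseSet e hb _,
      h1.eventually (hΦ.isOpenMap.isOpen_range.mem_nhds ⟨_, (h0 b hb₀ hb m).symm⟩),
      (hDc m).eventually (lt_mem_nhds (hDpos m)), (hDc m).eventually (gt_mem_nhds (hC m)),
      (hσ0 m).continuousAt_derivWithin.2] with p h2 h3 h4 h5 h6 h7 using ⟨h2, h3, h4, h5, h6, h7⟩
  obtain ⟨N, hNo, hbN, t₀, ht₀, ht₁, hN⟩ := exists_uniform_of_eventually hev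
  have hN0 : ∀ b ∈ N, b ∈ e₀.baseSet ∧ b ∈ e.baseSet := fun b hb =>
    have h1 := hN b hb (Classical.arbitrary M, 0) ht₀
    ⟨h1.1, h1.2.1⟩
  refine ⟨N, hNo, hbN, fun b hb => (hN0 b hb).1, fun b hb => (hN0 b hb).2, t₀, ht₀, ht₁, C, hC0,
    fun b hb q hq => ?_⟩
  obtain ⟨h1, h2, h3, h4, h5, h6⟩ := hN b hb q hq
  refine ⟨h3, hσm b h1 h2 q h3, ⟨_, h4, h6⟩, ?_⟩
  -- Mean value inequality on `[0, q.2]`: `σ` vanishes at time zero and its derivative is below `C`.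
  have hmvt := Convex.norm_image_sub_le_of_norm_hasDerivWithin_le (C := C)
    (f := fun s => σ b (q.1, icoOfReal s)) (f' := fun s => D (b, (q.1, icoOfReal s)))
    (s := Icc 0 (q.2 : ℝ)) (x := 0) (y := q.2) ?_ ?_ (convex_Icc _ _) ⟨le_rfl, q.2.2.1⟩
    ⟨q.2.2.1, le_rfl⟩
  · have hz : σ b (q.1, 0) = 0 := by
      simp only [hσ, h0 b h1 h2 q.1, hS _]
      rfl
    have hz' : icoOfReal 0 = (0 : Ico (0 : ℝ) 1) := icoOfReal_coe 0
    simp only [icoOfReal_coe, hz', hz, sub_zero, Real.norm_eq_abs, abs_of_nonneg q.2.2.1] at hmvt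
    exact (le_abs_self _).trans hmvt
  · intro s hs
    have hs1 : s < 1 := hs.2.trans_lt q.2.2.2
    have h7 := (hN b hb (q.1, icoOfReal s) (by
      simp only [coe_icoOfReal hs.1 hs1]
      exact hs.2.trans_lt hq)).2.2.2.2.2
    simp only [coe_icoOfReal hs.1 hs1] at h7
    exact h7.mono Icc_subset_Ici_self
  · intro s hs
    have hs1 : s < 1 := hs.2.trans_lt q.2.2.2
    have h7 := (hN b hb (q.1, icoOfReal s) (by
      simp only [coe_icoOfReal hs.1 hs1]
      exact hs.2.trans_lt hq)).2.2.2
    rw [Real.norm_eq_abs, abs_of_pos h7.1]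
    exact h7.2.1.le

end CollarTime

/-! ### Trivialisations which match the levels of two collars -/

section Straighten

variable {n : ℕ} {B M X 𝓜 𝓧 : Type*}
    [TopologicalSpace B]
    [TopologicalSpace M] [ChartedSpace (EuclideanSpace ℝ (Fin n)) M] [IsManifold (𝓡 n) ∞ M]
    [CompactSpace M] [LocallyCompactSpace M]
    [TopologicalSpace X] [ChartedSpace (EuclideanHalfSpace (n + 1)) X]
    [IsManifold (𝓡∂ (n + 1)) ∞ X] [LocallyCompactSpace X] [T2Space X]
    [TopologicalSpace 𝓜] [TopologicalSpace 𝓧]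
    {ι : M → X} {P𝓜 : ManifoldOver (𝓡 n) M B 𝓜} {P𝓧 : ManifoldOver (𝓡∂ (n + 1)) X B 𝓧}
    {j : 𝓜 → 𝓧} {Φ : 𝓜 × Ico (0 : ℝ) 1 → 𝓧} {c : M × Ico (0 : ℝ) 1 → X}

theorem exists_pos_lt_of_continuous [Nonempty M] {f : M → ℝ} (hf : Continuous f) (h : ∀ m, 0 < f m) :
    ∃ δ > 0, ∀ m, δ < f m := by
  obtain ⟨m, -, hm⟩ := isCompact_univ.exists_isMinOn univ_nonempty hf.continuousOn
  exact ⟨f m / 2, half_pos (h m), fun m' => (half_lt_self (h m)).trans_le (hm (mem_univ m'))⟩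

/-- Local trivialisations can be chosen so that they map the level sets of the collar `Φ` over `B` to
those of the collar `c` of the fibre, up to an arbitrary small factor `κ`. -/
theorem IsCollarOver.exists_straighten (hj : IsBoundaryOver ι P𝓜 P𝓧 j)
    (hΦ : IsCollarOver P𝓜 P𝓧 j Φ) (hc : IsGoodCollar (n := n) ι c) (b₀ : B) :
    ∃ N : Set B, IsOpen N ∧ b₀ ∈ N ∧ ∃ κ₀ > (0 : ℝ), ∃ δ > (0 : ℝ),
      ∀ κ : Icc (0 : ℝ) 1, 0 < (κ : ℝ) → (κ : ℝ) ≤ κ₀ →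
      ∃ e : Trivialization X P𝓧.proj, P𝓧.IsLocalTriv e ∧ e.baseSet = N ∧
        ∀ w, P𝓧.proj w ∈ N → ∀ t : Ico (0 : ℝ) 1, (t : ℝ) < δ →
          ((∃ z, w = Φ (z, t)) ↔ ∃ m, (e w).2 = c (m, icoScale κ t)) := by
  obtain ⟨e₀, e, he₀, he, hb₀, hb, hej⟩ := hj.exists_localTriv b₀
  rcases isEmpty_or_nonempty M with hM | hM
  -- Without boundary both sides of the equivalence are false, and `e` serves unchanged.
  · refine ⟨e.baseSet, e.open_baseSet, hb, 1, one_pos, 1, one_pos, fun κ _ _ => ⟨e, he, rfl,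
      fun w hw t _ => ⟨?_, ?_⟩⟩⟩
    · rintro ⟨z, -⟩
      obtain ⟨e₁, -, -⟩ := P𝓜.exists_isLocalTriv (P𝓜.proj z)
      exact (hM.false (e₁ z).2).elim
    · rintro ⟨m, -⟩
      exact (hM.false m).elim
  have hM𝓜 : Nonempty 𝓜 := ⟨e₀.toOpenPartialHomeomorph.symm (b₀, Classical.arbitrary M)⟩
  obtain ⟨S, hS⟩ : ∃ S : 𝓧 → 𝓜 × Ico (0 : ℝ) 1, Function.LeftInverse S Φ :=
    ⟨_, Function.leftInverse_invFun hΦ.injective⟩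
  obtain ⟨N₁, hN₁o, hbN₁, hN₁e₀, hN₁e, t₀, ht₀, ht₁, C, hC0, hN₁⟩ :=
    hΦ.exists_time_bounds hS hc he₀ he hej hb₀ hb
  set σ : B → M × Ico (0 : ℝ) 1 → ℝ := fun b q =>
    ((S (e.toOpenPartialHomeomorph.symm (b, c q))).2 : ℝ) with hσ
  have hσΦ : ∀ b ∈ N₁, ∀ q : M × Ico (0 : ℝ) 1, (q.2 : ℝ) < t₀ →
      ∃ z, P𝓜.proj z = b ∧ e.toOpenPartialHomeomorph.symm (b, c q) =
        Φ (z, (S (e.toOpenPartialHomeomorph.symm (b, c q))).2) := by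
    intro b hb q hq
    obtain ⟨p, hp⟩ := (hN₁ b hb q hq).1
    refine ⟨p.1, ?_, ?_⟩
    · rw [← hΦ.proj_eq, hp, proj_symm (hN₁e hb)]
    · rw [← hp, hS]
  -- The part of the collar `c` where the stretched time is exactly `κ * σ`.
  set O : Set X := c '' {q | (q.2 : ℝ) < t₀ / 4} with hO
  have hOo : IsOpen O := by
    refine hc.isOpenMap _ ?_
    exact isOpen_lt (by fun_prop) continuous_const
  -- For small times `Φ` stays in `O`, so its levels are seen where the stretch is known.
  obtain ⟨N₂, hN₂o, hbN₂, t₁, ht₁0, -, hN₂⟩ := exists_uniform_of_eventually (b₀ := b₀)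
    (P := fun p : B × M × Ico (0 : ℝ) 1 =>
      (e (Φ (e₀.toOpenPartialHomeomorph.symm (p.1, p.2.1), p.2.2))).2 ∈ O) (fun m => by
      refine (hΦ.mfamAt he₀ he hb₀ hb (m, 0)).1.eventually (hOo.mem_nhds ?_)
      refine ⟨(m, 0), by simpa using ht₀, ?_⟩
      exact (snd_apply_symm hb _).symm.trans (congrArg (fun w => (e w).2)
        (hΦ.symm_collar_zero hc hej hb₀ hb m)))
  -- The last time at which the stretch is surely `κ * σ`. A positive lower bound `δ` for `σ` there
  -- makes every point with `σ < δ` lie below it; this is needed for the converse, from levels of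
  -- `c` to levels of `Φ`.
  set τ : Ico (0 : ℝ) 1 := ⟨t₀ / 4, by linarith, by linarith⟩ with hτ
  have hτt : (τ : ℝ) < t₀ := by
    simp only [hτ]
    linarith
  have hστ : ∀ m, 0 < σ b₀ (m, τ) := by
    intro m
    refine lt_of_le_of_ne (S _).2.2.1 fun h => ?_
    obtain ⟨z, hz, hzΦ⟩ := hσΦ b₀ hbN₁ (m, τ) hτt
    have h1 : (S (e.toOpenPartialHomeomorph.symm (b₀, c (m, τ)))).2 = 0 := Subtype.ext h.symm
    have h2 := hΦ.symm_collar_zero hc hej hb₀ hb (e₀ z).2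
    rw [e₀.symm_mk_snd hz hb₀] at h2
    rw [h1, ← h2] at hzΦ
    have h3 := congrArg (fun w => (e w).2) hzΦ
    simp only [snd_apply_symm hb] at h3
    have h4 := congrArg (fun q : M × Ico (0 : ℝ) 1 => (q.2 : ℝ)) (hc.injective h3)
    simp only [hτ, Ico.coe_zero] at h4
    linarith
  have hσc : ∀ m, ContinuousAt (fun p : B × M => σ p.1 (p.2, τ)) (b₀, m) := fun m =>
    ContinuousAt.comp (f := fun p : B × M => (p.1, (p.2, τ)))
      (g := fun p : B × M × Ico (0 : ℝ) 1 => σ p.1 p.2) (x := (b₀, m)) (hN₁ b₀ hbN₁ (m, τ) hτt).2.1.1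
      (by fun_prop)
  obtain ⟨δ, hδ, hδσ⟩ := exists_pos_lt_of_continuous (f := fun m => σ b₀ (m, τ))
    (continuous_iff_continuousAt.2 fun m => ContinuousAt.comp (f := fun m => (b₀, m)) (hσc m)
      (by fun_prop)) hστ
  have hN₃ : ∀ᶠ b in 𝓝 b₀, ∀ m ∈ (univ : Set M), δ < σ b (m, τ) :=
    isCompact_univ.eventually_forall_of_forall_eventually fun m _ =>
      (hσc m).eventually (lt_mem_nhds (hδσ m))
  obtain ⟨N₃, hN₃, hN₃o, hbN₃⟩ := eventually_nhds_iff.1 hN₃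
  -- `κ ≤ 1 / C` together with `σ ≤ C * t` gives `κ * σ ≤ t`, the smallness required by
  -- `exists_collar_stretch`.
  refine ⟨N₁ ∩ N₂ ∩ N₃, (hN₁o.inter hN₂o).inter hN₃o, ⟨⟨hbN₁, hbN₂⟩, hbN₃⟩, 1 / C, by positivity,
    min t₁ δ, lt_min ht₁0 hδ, fun κ hκ hκC => ?_⟩
  obtain ⟨G, G', hG⟩ := exists_collar_stretch (σ := σ) hN₁o ht₀ ht₁ hκ
    (fun b hb q hq => (hN₁ b hb q hq).2.1) (fun b hb q hq => (hN₁ b hb q hq).2.2.1)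
    (fun b _ q => (S _).2.2.1) (fun b hb q hq => by
      calc (κ : ℝ) * σ b q ≤ 1 / C * (C * q.2) := by
            refine mul_le_mul hκC (hN₁ b hb q hq).2.2.2 (S _).2.2.1 (by positivity)
        _ = q.2 := by field_simp)
  have hG'id : ∀ b ∈ N₁, ∀ q, t₀ / 2 ≤ (q.2 : ℝ) → G' b q = q := by
    intro b hb q hq
    obtain ⟨-, -, h1, -, -, -, -, h2⟩ := hG b hb
    have h3 := h1 q
    rwa [h2 q hq] at h3
  have hsub : N₁ ∩ N₂ ∩ N₃ ⊆ N₁ := fun b hb => hb.1.1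
  obtain ⟨e', he', hbase, hee'⟩ := he.exists_modify ((hN₁o.inter hN₂o).inter hN₃o)
    (hsub.trans hN₁e) (h := fun b => collarExtend c (G b)) (h' := fun b => collarExtend c (G' b))
    (fun b hb x => hc.mfamAt_collarExtend hN₁o (r := t₀ / 2) (by linarith)
      (fun b hb => (hG b hb).1) (fun b hb => (hG b hb).2.2.2.2.2.2.2) (hsub hb) x)
    (fun b hb x => hc.mfamAt_collarExtend hN₁o (r := t₀ / 2) (by linarith)
      (fun b hb => (hG b hb).2.1) hG'id (hsub hb) x)
    (fun b hb x => collarExtend_comp hc.injective (hG b (hsub hb)).2.2.1 x)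
    (fun b hb x => collarExtend_comp hc.injective (hG b (hsub hb)).2.2.2.1 x)
  refine ⟨e', he', hbase, fun w hw t ht => ?_⟩
  have hw1 := hsub hw
  obtain ⟨-, -, hl, hr, hG1, hGmono, hGσ, -⟩ := hG _ hw1
  rw [hee']
  constructor
  · rintro ⟨z, rfl⟩
    have hz : P𝓜.proj z = P𝓧.proj (Φ (z, t)) := (hΦ.proj_eq (z, t)).symm
    set b := P𝓧.proj (Φ (z, t)) with hb_def
    have h1 := hN₂ b hw.1.2 ((e₀ z).2, t) (ht.trans_le (min_le_left _ _))
    simp only [e₀.symm_mk_snd hz (hN₁e₀ hw1)] at h1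
    obtain ⟨q, hq, hqe⟩ := h1
    rw [← hqe, collarExtend_apply hc.injective]
    have h2 : e.toOpenPartialHomeomorph.symm (b, c q) = Φ (z, t) := by
      rw [hqe]
      exact e.symm_mk_snd rfl (hN₁e hw1)
    refine ⟨q.1, congrArg c (Prod.ext (hG1 q) (Subtype.ext ?_))⟩
    rw [hGσ q (le_of_lt hq), coe_icoScale]
    simp only [hσ]
    rw [h2, hS]
  · rintro ⟨m, hm⟩
    set b := P𝓧.proj w with hb_def
    set q := G' b (m, icoScale κ t) with hq
    have hGq : G b q = (m, icoScale κ t) := hr _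
    have h1 : (e w).2 = c q := by
      rw [← collarExtend_comp hc.injective hl (e w).2, hm, collarExtend_apply hc.injective]
    have hqm : q.1 = m := by rw [← hG1 q, hGq]
    have hw2 : w = e.toOpenPartialHomeomorph.symm (b, c q) := by
      rw [← h1]
      exact (e.symm_mk_snd rfl (hN₁e hw1)).symm
    -- Otherwise monotonicity of the stretch would give `κ * σ < κ * t` at time `τ`, whereas `t < δ
    -- < σ` there.
    have hle : (q.2 : ℝ) ≤ t₀ / 4 := by
      by_contra h
      push Not at h
      have h2 : (G b (m, τ)).2 < (G b (m, q.2)).2 := hGmono m h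
      rw [← hqm, Prod.mk.eta, hGq] at h2
      have h3 : ((G b (q.1, τ)).2 : ℝ) < κ * t := h2
      rw [hGσ _ le_rfl] at h3
      have h4 := lt_of_mul_lt_mul_left h3 hκ.le
      have h5 := hN₃ b hw.2 q.1 (mem_univ _)
      have h6 := ht.trans_le (min_le_right _ _)
      linarith
    have h2 := hGσ q hle
    rw [hGq, coe_icoScale] at h2
    have h3 : (t : ℝ) = σ b q := mul_left_cancel₀ hκ.ne' h2
    obtain ⟨z, -, hz⟩ := hσΦ b hw1 q (by linarith)
    refine ⟨z, ?_⟩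
    rw [hw2, hz]
    exact congrArg (fun t => Φ (z, t)) (Subtype.ext h3.symm)

end Straighten

/-! ### Topology of the total space -/

section TotalSpace

variable {E H F B Z : Type*}
  [NormedAddCommGroup E] [NormedSpace ℝ E] [TopologicalSpace H] {I : ModelWithCorners ℝ E H}
  [TopologicalSpace F] [ChartedSpace H F] [IsManifold I ∞ F] [TopologicalSpace B] [TopologicalSpace Z]

/-- Over a compact neighbourhood inside a base set, the total space is the image of a product of
compact sets; finitely many such neighbourhoods cover `B`. -/
theorem ManifoldOver.compactSpace (P : ManifoldOver I F B Z) [CompactSpace B] [T2Space B]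
    [CompactSpace F] : CompactSpace Z := by
  have h : ∀ b : B, ∃ K ∈ 𝓝 b, IsCompact (P.proj ⁻¹' K) := by
    intro b
    obtain ⟨e, -, hb⟩ := P.exists_mem_atlas b
    obtain ⟨K, hK, hKe, hKc⟩ := local_compact_nhds (e.open_baseSet.mem_nhds hb)
    refine ⟨K, hK, ?_⟩
    have h1 : P.proj ⁻¹' K = e.toOpenPartialHomeomorph.symm '' (K ×ˢ univ) := by
      ext z
      constructor
      · exact fun hz => ⟨(P.proj z, (e z).2), ⟨hz, mem_univ _⟩, e.symm_mk_snd rfl (hKe hz)⟩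
      · rintro ⟨⟨c, x⟩, ⟨hc, -⟩, rfl⟩
        rw [mem_preimage, proj_symm (hKe hc)]
        exact hc
    rw [h1]
    exact (hKc.prod isCompact_univ).image_of_continuousOn
      (e.toOpenPartialHomeomorph.continuousOn_symm.mono fun p hp => e.mem_target.2 (hKe hp.1))
  choose K hK hKc using h
  obtain ⟨t, -, ht⟩ := isCompact_univ.elim_nhds_subcover K fun b _ => hK b
  refine ⟨(t.isCompact_biUnion fun b _ => hKc b).of_isClosed_subset isClosed_univ fun z _ => ?_⟩
  have := ht (mem_univ (P.proj z))
  simpa only [mem_iUnion, mem_preimage] using this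

theorem ManifoldOver.t2Space (P : ManifoldOver I F B Z) [T2Space B] [T2Space F] : T2Space Z := by
  refine ⟨fun z w hzw => ?_⟩
  have hc := P.continuous_proj
  by_cases h : P.proj z = P.proj w
  · obtain ⟨e, -, hb⟩ := P.exists_mem_atlas (P.proj z)
    have hz : z ∈ e.source := e.mem_source.2 hb
    have hw : w ∈ e.source := e.mem_source.2 (h ▸ hb)
    have hne : e z ≠ e w := fun h' => hzw (e.toOpenPartialHomeomorph.injOn hz hw h')
    obtain ⟨U, V, hU, hV, hzU, hwV, hUV⟩ := t2_separation hne
    refine ⟨_, _, e.toOpenPartialHomeomorph.isOpen_inter_preimage hU,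
      e.toOpenPartialHomeomorph.isOpen_inter_preimage hV, ⟨hz, hzU⟩, ⟨hw, hwV⟩, ?_⟩
    exact (hUV.preimage e).mono inter_subset_right inter_subset_right
  · obtain ⟨U, V, hU, hV, hzU, hwV, hUV⟩ := t2_separation h
    exact ⟨_, _, hU.preimage hc, hV.preimage hc, hzU, hwV, hUV.preimage _⟩

end TotalSpace

/-! ### Closed collars inside open ones -/

section ClosedCollar

variable {n : ℕ} {M X : Type*}
    [TopologicalSpace M] [ChartedSpace (EuclideanSpace ℝ (Fin n)) M] [IsManifold (𝓡 n) ∞ M]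
    [TopologicalSpace X] [ChartedSpace (EuclideanHalfSpace (n + 1)) X]
    [IsManifold (𝓡∂ (n + 1)) ∞ X] {ι : M → X} {c : M × Ico (0 : ℝ) 1 → X}

/-- Multiplication of `t ∈ [0,1]` by `s ∈ [0,1)`. -/
def iccScale (s : Ico (0 : ℝ) 1) (t : Icc (0 : ℝ) 1) : Ico (0 : ℝ) 1 := icoScale t s

theorem coe_iccScale (s : Ico (0 : ℝ) 1) (t : Icc (0 : ℝ) 1) : (iccScale s t : ℝ) = t * s := rfl

theorem iccScale_zero (s : Ico (0 : ℝ) 1) : iccScale s 0 = 0 := icoScale_zero_left s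

theorem iccScale_injective {s : Ico (0 : ℝ) 1} (hs : 0 < (s : ℝ)) :
    Function.Injective (iccScale s) := by
  intro t u h
  have h1 := congrArg Subtype.val h
  rw [coe_iccScale, coe_iccScale] at h1
  exact Subtype.ext (mul_right_cancel₀ hs.ne' h1)

theorem contMDiff_coe_iccScale (s : Ico (0 : ℝ) 1) :
    ContMDiff (𝓡∂ 1) 𝓘(ℝ, ℝ) ∞ (fun t => (iccScale s t : ℝ)) := by
  have h : ContMDiff 𝓘(ℝ, ℝ) 𝓘(ℝ, ℝ) ∞ fun r : ℝ => r * (s : ℝ) :=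
    ContDiff.contMDiff (by fun_prop)
  exact h.comp contMDiff_subtypeVal_Icc

theorem contMDiff_iccScale (s : Ico (0 : ℝ) 1) : ContMDiff (𝓡∂ 1) (𝓡∂ 1) ∞ (iccScale s) := fun _ =>
  (mfamAt_ico (B := Unit) (f := fun _ => iccScale s) (b₀ := ())
    (mfamAt_const (contMDiff_coe_iccScale s).contMDiffAt)).contMDiffAt

theorem contMDiff_prod_iccScale (s : Ico (0 : ℝ) 1) :
    ContMDiff ((𝓡 n).prod (𝓡∂ 1)) ((𝓡 n).prod (𝓡∂ 1)) ∞
      (fun q : M × Icc (0 : ℝ) 1 => (q.1, iccScale s q.2)) :=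
  contMDiff_fst.prodMk ((contMDiff_iccScale s).comp contMDiff_snd)

theorem eq_zero_of_mfderiv_subtypeVal_Icc {t : Icc (0 : ℝ) 1} {v : EuclideanSpace ℝ (Fin 1)}
    (hv : (mfderiv (𝓡∂ 1) 𝓘(ℝ, ℝ) (Subtype.val : Icc (0 : ℝ) 1 → ℝ) t v : ℝ) = 0) : v = 0 := by
  let D : EuclideanSpace ℝ (Fin 1) →L[ℝ] ℝ :=
    mfderiv (𝓡∂ 1) 𝓘(ℝ, ℝ) (Subtype.val : Icc (0 : ℝ) 1 → ℝ) t
  let w : EuclideanSpace ℝ (Fin 1) := (1 : TangentSpace (𝓡∂ 1) t)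
  have h1 : D w = 1 := mfderiv_subtypeVal_Icc_one t
  have h2 : ∀ u : EuclideanSpace ℝ (Fin 1), u = u 0 • icoUnit := by
    intro u
    ext i
    fin_cases i
    simp
  have h3 : v 0 * D icoUnit = 0 := by
    rw [← smul_eq_mul, ← map_smul, ← h2]
    exact hv
  have h4 : w 0 * D icoUnit = 1 := by
    rw [← smul_eq_mul, ← map_smul, ← h2]
    exact h1
  have h5 : v 0 = 0 := by
    rcases mul_eq_zero.1 h3 with h | h
    · exact h
    · rw [h, mul_zero] at h4
      exact absurd h4 zero_ne_one
  rw [h2 v, h5, zero_smul]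

/-- Followed by the smooth inverse of `c`, the map becomes `(m, t) ↦ (m, s * t)`, whose derivative
is injective as `s > 0`. -/
theorem IsGoodCollar.injective_mfderiv_closed (hc : IsGoodCollar (n := n) ι c) {s : Ico (0 : ℝ) 1}
    (hs : 0 < (s : ℝ)) (q : M × Icc (0 : ℝ) 1) :
    Function.Injective (mfderiv ((𝓡 n).prod (𝓡∂ 1)) (𝓡∂ (n + 1))
      (fun q : M × Icc (0 : ℝ) 1 => c (q.1, iccScale s q.2)) q) := by
  have hne : Nonempty M := ⟨q.1⟩
  obtain ⟨c', hc'⟩ := hc.exists_leftInverse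
  set φ : M × Icc (0 : ℝ) 1 → X := fun q => c (q.1, iccScale s q.2) with hφ
  have hφm : ContMDiff ((𝓡 n).prod (𝓡∂ 1)) (𝓡∂ (n + 1)) ∞ φ :=
    hc.contMDiff.comp (contMDiff_prod_iccScale s)
  have hφd := (hφm.contMDiffAt (x := q)).mdifferentiableAt (by simp)
  let D : (EuclideanSpace ℝ (Fin n) × EuclideanSpace ℝ (Fin 1)) →L[ℝ]
    EuclideanSpace ℝ (Fin (n + 1)) := mfderiv ((𝓡 n).prod (𝓡∂ 1)) (𝓡∂ (n + 1)) φ q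
  have hD : HasMFDerivAt ((𝓡 n).prod (𝓡∂ 1)) (𝓡∂ (n + 1)) φ q D := hφd.hasMFDerivAt
  have hc'd : MDifferentiableAt (𝓡∂ (n + 1)) ((𝓡 n).prod (𝓡∂ 1)) c' (φ q) :=
    (hc.contMDiffAt_inv c' hc' _).mdifferentiableAt (by simp)
  let D' : EuclideanSpace ℝ (Fin (n + 1)) →L[ℝ]
      (EuclideanSpace ℝ (Fin n) × EuclideanSpace ℝ (Fin 1)) :=
    mfderiv (𝓡∂ (n + 1)) ((𝓡 n).prod (𝓡∂ 1)) c' (φ q)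
  have hD' : HasMFDerivAt (𝓡∂ (n + 1)) ((𝓡 n).prod (𝓡∂ 1)) c' (φ q) D' := hc'd.hasMFDerivAt
  have h1 : HasMFDerivAt ((𝓡 n).prod (𝓡∂ 1)) ((𝓡 n).prod (𝓡∂ 1)) (c' ∘ φ) q (D'.comp D) :=
    hD'.comp q hD
  have hfst : (Prod.fst ∘ (c' ∘ φ) : M × Icc (0 : ℝ) 1 → M) = Prod.fst := by
    funext p
    simp only [Function.comp_apply, hφ, hc' _]
  have hsnd : (((↑) : Ico (0 : ℝ) 1 → ℝ) ∘ Prod.snd ∘ (c' ∘ φ) : M × Icc (0 : ℝ) 1 → ℝ) =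
      (fun r : ℝ => r * (s : ℝ)) ∘ Subtype.val ∘ Prod.snd := by
    funext p
    simp only [Function.comp_apply, hφ, hc' _]
    rfl
  have h2 : HasMFDerivAt ((𝓡 n).prod (𝓡∂ 1)) (𝓡 n) (Prod.fst ∘ (c' ∘ φ) : M × Icc (0 : ℝ) 1 → M) q
      ((ContinuousLinearMap.fst ℝ (EuclideanSpace ℝ (Fin n)) (EuclideanSpace ℝ (Fin 1))).comp
        (D'.comp D)) :=
    (hasMFDerivAt_fst (I := 𝓡 n) (I' := 𝓡∂ 1) ((c' ∘ φ) q)).comp q h1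
  rw [hfst] at h2
  have h3 : HasMFDerivAt ((𝓡 n).prod (𝓡∂ 1)) (𝓡 n) (Prod.fst : M × Icc (0 : ℝ) 1 → M) q
      (ContinuousLinearMap.fst ℝ (EuclideanSpace ℝ (Fin n)) (EuclideanSpace ℝ (Fin 1))) :=
    hasMFDerivAt_fst (I := 𝓡 n) (I' := 𝓡∂ 1) q
  have h4 : HasMFDerivAt ((𝓡 n).prod (𝓡∂ 1)) 𝓘(ℝ, ℝ)
      (((↑) : Ico (0 : ℝ) 1 → ℝ) ∘ Prod.snd ∘ (c' ∘ φ) : M × Icc (0 : ℝ) 1 → ℝ) q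
      ((EuclideanSpace.proj (0 : Fin 1) : EuclideanSpace ℝ (Fin 1) →L[ℝ] ℝ).comp
        ((ContinuousLinearMap.snd ℝ (EuclideanSpace ℝ (Fin n)) (EuclideanSpace ℝ (Fin 1))).comp
          (D'.comp D))) :=
    (hasMFDerivAt_coe_ico ((c' ∘ φ) q).2).comp q
      ((hasMFDerivAt_snd (I := 𝓡 n) (I' := 𝓡∂ 1) ((c' ∘ φ) q)).comp q h1)
  rw [hsnd] at h4
  let V : EuclideanSpace ℝ (Fin 1) →L[ℝ] ℝ :=
    mfderiv (𝓡∂ 1) 𝓘(ℝ, ℝ) (Subtype.val : Icc (0 : ℝ) 1 → ℝ) q.2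
  have hV : HasMFDerivAt (𝓡∂ 1) 𝓘(ℝ, ℝ) (Subtype.val : Icc (0 : ℝ) 1 → ℝ) q.2 V :=
    ((contMDiff_subtypeVal_Icc (n := ∞)).contMDiffAt.mdifferentiableAt (by simp)).hasMFDerivAt
  have hmul : HasMFDerivAt 𝓘(ℝ, ℝ) 𝓘(ℝ, ℝ) (fun r : ℝ => r * (s : ℝ)) (q.2 : ℝ)
      ((s : ℝ) • ContinuousLinearMap.id ℝ ℝ) :=
    HasFDerivAt.hasMFDerivAt ((hasFDerivAt_id _).mul_const (s : ℝ))
  have h5 : HasMFDerivAt ((𝓡 n).prod (𝓡∂ 1)) 𝓘(ℝ, ℝ)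
      ((fun r : ℝ => r * (s : ℝ)) ∘ Subtype.val ∘ Prod.snd : M × Icc (0 : ℝ) 1 → ℝ) q
      (((s : ℝ) • ContinuousLinearMap.id ℝ ℝ).comp (V.comp
        (ContinuousLinearMap.snd ℝ (EuclideanSpace ℝ (Fin n)) (EuclideanSpace ℝ (Fin 1))))) :=
    hmul.comp q (hV.comp q (hasMFDerivAt_snd (I := 𝓡 n) (I' := 𝓡∂ 1) q))
  have key : ∀ v : EuclideanSpace ℝ (Fin n) × EuclideanSpace ℝ (Fin 1), D v = 0 → v = 0 := by
    rintro v hv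
    have h6 := DFunLike.congr_fun (hasMFDerivAt_unique h2 h3) v
    have h7 := DFunLike.congr_fun (hasMFDerivAt_unique h4 h5) v
    have h8 : D' (D v) = 0 := by rw [hv, map_zero]
    refine Prod.ext ?_ ?_
    · exact h6.symm.trans (congrArg Prod.fst h8)
    · have h9 : (s : ℝ) * V v.2 = 0 := h7.symm.trans
        (congrArg (fun p : EuclideanSpace ℝ (Fin n) × EuclideanSpace ℝ (Fin 1) => p.2 0) h8)
      exact eq_zero_of_mfderiv_subtypeVal_Icc ((mul_eq_zero.1 h9).resolve_left hs.ne')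
  exact (injective_iff_map_eq_zero D).2 key

/-- `M × [0,1]` is compact, so the map is a closed embedding; `M × [0,1)` is dense in it, so the
image is the closure of `W`. -/
theorem IsGoodCollar.isClosedCollar [CompactSpace M] [T2Space X] (hc : IsGoodCollar (n := n) ι c)
    {s : Ico (0 : ℝ) 1} (hs : 0 < (s : ℝ)) {W : TopologicalSpace.Opens X}
    (hW : (W : Set X) = c '' {q | (q.2 : ℝ) < s}) :
    IsClosedCollar n ι W (fun q => c (q.1, iccScale s q.2)) := by
  set φ : M × Icc (0 : ℝ) 1 → X := fun q => c (q.1, iccScale s q.2) with hφ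
  have hφm : ContMDiff ((𝓡 n).prod (𝓡∂ 1)) (𝓡∂ (n + 1)) ∞ φ :=
    hc.contMDiff.comp (contMDiff_prod_iccScale s)
  have himage : φ '' {q | (q.2 : ℝ) < 1} = W := by
    rw [hW]
    ext x
    constructor
    · rintro ⟨q, hq, rfl⟩
      exact ⟨_, mul_lt_of_lt_one_left hs hq, rfl⟩
    · rintro ⟨q, hq, rfl⟩
      have h1 : (q.2 : ℝ) / s < 1 := (div_lt_one hs).2 hq
      refine ⟨(q.1, ⟨q.2 / s, div_nonneg q.2.2.1 hs.le, h1.le⟩), h1, congrArg c (Prod.ext rfl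
        (Subtype.ext ?_))⟩
      rw [coe_iccScale]
      exact div_mul_cancel₀ _ hs.ne'
  have hdense : closure {q : M × Icc (0 : ℝ) 1 | (q.2 : ℝ) < 1} = univ := by
    have h1 : {q : M × Icc (0 : ℝ) 1 | (q.2 : ℝ) < 1} = univ ×ˢ Iio 1 := by
      ext q
      exact ⟨fun h => ⟨mem_univ _, h⟩, fun h => h.2⟩
    rw [h1, closure_prod_eq, closure_univ, closure_Iio' ⟨0, zero_lt_one⟩]
    ext q
    exact ⟨fun _ => mem_univ _, fun _ => ⟨mem_univ _, q.2.2.2⟩⟩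
  refine ⟨fun m => ?_, ?_, hφm, hc.injective_mfderiv_closed hs, himage, ?_⟩
  · simp only [hφ, iccScale_zero, hc.apply_zero]
  · refine (hφm.continuous.isClosedEmbedding fun p q h => ?_).isEmbedding
    have h1 := Prod.mk_inj.1 (hc.injective h)
    exact Prod.ext h1.1 (iccScale_injective hs h1.2)
  · refine Subset.antisymm ?_ ?_
    · rw [← image_univ, ← hdense, ← himage]
      exact image_closure_subset_closure_image hφm.continuous
    · refine closure_minimal ?_ (isCompact_range hφm.continuous).isClosed
      rw [← himage]
      exact image_subset_range _ _

end ClosedCollar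

/-! ### The submanifold, its structure group and the isomorphism -/

section Assembly

variable {n : ℕ} {B M X 𝓜 𝓧 : Type*}
    [TopologicalSpace B]
    [TopologicalSpace M] [ChartedSpace (EuclideanSpace ℝ (Fin n)) M] [IsManifold (𝓡 n) ∞ M]
    [LocallyCompactSpace M]
    [TopologicalSpace X] [ChartedSpace (EuclideanHalfSpace (n + 1)) X]
    [IsManifold (𝓡∂ (n + 1)) ∞ X] [LocallyCompactSpace X]
    [TopologicalSpace 𝓜] [TopologicalSpace 𝓧]
    {ι : M → X} {P𝓜 : ManifoldOver (𝓡 n) M B 𝓜} {P𝓧 : ManifoldOver (𝓡∂ (n + 1)) X B 𝓧}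
    {j : 𝓜 → 𝓧} {Φ : 𝓜 × Ico (0 : ℝ) 1 → 𝓧} {c : M × Ico (0 : ℝ) 1 → X}

theorem IsCollarOver.isOpenEmbedding (hΦ : IsCollarOver P𝓜 P𝓧 j Φ) : Topology.IsOpenEmbedding Φ :=
  .of_continuous_injective_isOpenMap hΦ.smoothOver.continuous hΦ.injective hΦ.isOpenMap

/-- A collar over `B` restricts to collars of the boundaries of the fibres. -/
theorem IsCollarOver.isCollar (hΦ : IsCollarOver P𝓜 P𝓧 j Φ) {e₀ : Trivialization M P𝓜.proj}
    {e : Trivialization X P𝓧.proj} (he₀ : P𝓜.IsLocalTriv e₀) (he : P𝓧.IsLocalTriv e) {b : B}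
    (hb₀ : b ∈ e₀.baseSet) (hb : b ∈ e.baseSet) :
    IsCollar n (fun m => (e (j (e₀.toOpenPartialHomeomorph.symm (b, m)))).2)
      (fun q => (e (Φ (e₀.toOpenPartialHomeomorph.symm (b, q.1), q.2))).2) := by
  have hproj : ∀ q : M × Ico (0 : ℝ) 1,
      P𝓧.proj (Φ (e₀.toOpenPartialHomeomorph.symm (b, q.1), q.2)) = b := fun q => by
    rw [hΦ.proj_eq, proj_symm hb₀]
  have hsymm : ∀ q : M × Ico (0 : ℝ) 1, e.toOpenPartialHomeomorph.symm
      (b, (e (Φ (e₀.toOpenPartialHomeomorph.symm (b, q.1), q.2))).2) =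
        Φ (e₀.toOpenPartialHomeomorph.symm (b, q.1), q.2) := fun q => e.symm_mk_snd (hproj q) hb
  set f : M × Ico (0 : ℝ) 1 → X := fun q =>
    (e (Φ (e₀.toOpenPartialHomeomorph.symm (b, q.1), q.2))).2 with hf
  have hinj : Function.Injective f := by
    intro p q hpq
    have h1 : Φ (e₀.toOpenPartialHomeomorph.symm (b, p.1), p.2) =
        Φ (e₀.toOpenPartialHomeomorph.symm (b, q.1), q.2) := by
      rw [← hsymm p, ← hsymm q]
      exact congrArg (fun x => e.toOpenPartialHomeomorph.symm (b, x)) hpq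
    have h2 := Prod.mk_inj.1 (hΦ.injective h1)
    have h3 := congrArg (fun z => (e₀ z).2) h2.1
    simp only [snd_apply_symm hb₀] at h3
    exact Prod.ext h3 h2.2
  refine ⟨fun m => by simp only [hf, hΦ.apply_zero], hinj, fun q => ?_⟩
  have hne : Nonempty (𝓜 × Ico (0 : ℝ) 1) := ⟨(e₀.toOpenPartialHomeomorph.symm (b, q.1), 0)⟩
  obtain ⟨S, hS⟩ : ∃ S : 𝓧 → 𝓜 × Ico (0 : ℝ) 1, Function.LeftInverse S Φ :=
    ⟨_, Function.leftInverse_invFun hΦ.injective⟩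
  set g : X → M × Ico (0 : ℝ) 1 := fun x => ((e₀ (S (e.toOpenPartialHomeomorph.symm (b, x))).1).2,
    (S (e.toOpenPartialHomeomorph.symm (b, x))).2) with hg
  have hgf : Function.LeftInverse g f := by
    intro p
    simp only [hg]
    rw [hsymm p, hS]
    exact Prod.ext (snd_apply_symm hb₀ _) rfl
  have hrange : range f = (fun x => e.toOpenPartialHomeomorph.symm (b, x)) ⁻¹' range Φ := by
    ext x
    constructor
    · rintro ⟨p, rfl⟩
      exact ⟨_, (hsymm p).symm⟩
    · rintro ⟨p, hp⟩
      have h1 : P𝓜.proj p.1 = b := by rw [← hΦ.proj_eq, hp, proj_symm hb]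
      refine ⟨((e₀ p.1).2, p.2), ?_⟩
      simp only [hf]
      rw [e₀.symm_mk_snd h1 hb₀, Prod.mk.eta, hp, snd_apply_symm hb]
  have hopen : IsOpen (range f) := by
    rw [hrange]
    refine hΦ.isOpenMap.isOpen_range.preimage (continuous_iff_continuousAt.2 fun x => ?_)
    exact ContinuousAt.comp (f := fun x => (b, x))
      (e.toOpenPartialHomeomorph.continuousAt_symm (e.mem_target.2 hb)) (by fun_prop)
  refine ⟨{
      toFun := f
      invFun := g
      source := univ
      target := range f
      map_source' := fun p _ => ⟨p, rfl⟩
      map_target' := fun _ _ => mem_univ _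
      left_inv' := fun p _ => hgf p
      right_inv' := ?_
      open_source := isOpen_univ
      open_target := hopen
      contMDiffOn_toFun := fun p _ => ?_
      contMDiffOn_invFun := ?_ }, mem_univ _, fun p _ => rfl⟩
  · rintro _ ⟨p, rfl⟩
    rw [hgf]
  · exact (hΦ.mfamAt he₀ he hb₀ hb p).contMDiffAt.contMDiffWithinAt
  · rintro _ ⟨p, rfl⟩
    exact (hΦ.mfamAt_inv hS he₀ he hb₀ hb
      (q := (e₀.toOpenPartialHomeomorph.symm (b, p.1), p.2))
      (proj_symm hb₀ _)).contMDiffAt.contMDiffWithinAt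

/-- A collar over `B` is an isomorphism of manifolds over `B` onto its image. -/
theorem IsCollarOver.isIso (hΦ : IsCollarOver P𝓜 P𝓧 j Φ) {W : TopologicalSpace.Opens X}
    {A : Set (Trivialization X P𝓧.proj)} (hA : P𝓧.IsSubmanifoldAtlas W (range Φ) A)
    (hW : (W : Set X).Nonempty → Nonempty M) (Ψ : 𝓜 × Ico (0 : ℝ) 1 ≃ₜ range Φ)
    (hΨ : ∀ q, (Ψ q : 𝓧) = Φ q) :
    (P𝓜.prod (𝓡∂ 1) (Ico (0 : ℝ) 1)).IsIso (P𝓧.restrict hA) Ψ := by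
  refine ⟨fun q => (congrArg P𝓧.proj (hΨ q)).trans (hΦ.proj_eq q), ?_⟩
  rintro _ ⟨e₀, he₀, rfl⟩ _ ⟨e, he, rfl⟩
  have he₀' := P𝓜.isLocalTriv_of_mem he₀
  have he' := hA.isLocalTriv e he
  change IsDiffFamily _ _ (e₀.baseSet ∩ e.baseSet) _
  have hUo := e₀.open_baseSet.inter e.open_baseSet
  -- If `𝓜` is empty there is no left inverse of `Φ` to choose. A point of `M` or `W` over the base
  -- set would then produce a point of `𝓜`, so all conditions are vacuous and the inverse is a
  -- default.
  rcases isEmpty_or_nonempty 𝓜 with hM | hM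
  · refine IsDiffFamily.of_mfamAt (h' := fun _ x => (Classical.choice (hW ⟨x, x.2⟩), 0)) hUo ?_ ?_ ?_ ?_
    · exact fun b _ x => (hM.false (e₀.toOpenPartialHomeomorph.symm (b, x.1))).elim
    · exact fun b _ y => (hM.false (e₀.toOpenPartialHomeomorph.symm
        (b, Classical.choice (hW ⟨y, y.2⟩)))).elim
    · exact fun b _ x => (hM.false (e₀.toOpenPartialHomeomorph.symm (b, x.1))).elim
    · exact fun b _ y => (hM.false (e₀.toOpenPartialHomeomorph.symm
        (b, Classical.choice (hW ⟨y, y.2⟩)))).elim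
  obtain ⟨S, hS⟩ : ∃ S : 𝓧 → 𝓜 × Ico (0 : ℝ) 1, Function.LeftInverse S Φ :=
    ⟨_, Function.leftInverse_invFun hΦ.injective⟩
  have hproj : ∀ b ∈ e₀.baseSet, ∀ q : M × Ico (0 : ℝ) 1,
      P𝓧.proj (Φ (e₀.toOpenPartialHomeomorph.symm (b, q.1), q.2)) = b := fun b hb q => by
    rw [hΦ.proj_eq, proj_symm hb]
  set e' := e.restrictSub W (range Φ) (hA.mem_iff e he) hA.nonempty_fibre hA.nonempty_total with he'_def
  have hval : ∀ z : range Φ, P𝓧.proj z ∈ e.baseSet → ((e' z).2 : X) = (e z).2 := by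
    intro z hz
    exact congrArg Subtype.val (dif_pos ((hA.mem_iff e he z hz).1 z.2))
  have hf : ∀ b ∈ e₀.baseSet ∩ e.baseSet, ∀ q : M × Ico (0 : ℝ) 1,
      ((e' (Ψ (e₀.toOpenPartialHomeomorph.symm (b, q.1), q.2))).2 : X) =
        (e (Φ (e₀.toOpenPartialHomeomorph.symm (b, q.1), q.2))).2 := by
    intro b hb q
    rw [hval _ (by rw [hΨ, hproj b hb.1]; exact hb.2), hΨ]
  have hback : ∀ b ∈ e₀.baseSet ∩ e.baseSet, ∀ y : W, ∃ q, P𝓜.proj q.1 = b ∧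
      e.toOpenPartialHomeomorph.symm (b, (y : X)) = Φ q ∧ (e (Φ q)).2 = y := by
    intro b hb y
    obtain ⟨q, hq⟩ := e.symm_mem_of_mem_iff (hA.mem_iff e he) hb.2 (x := y)
    exact ⟨q, by rw [← hΦ.proj_eq, hq, proj_symm hb.2], hq.symm, by rw [hq, snd_apply_symm hb.2]⟩
  refine IsDiffFamily.of_mfamAt (Y := W) (h := fun b (q : M × Ico (0 : ℝ) 1) =>
      (e' (Ψ (e₀.toOpenPartialHomeomorph.symm (b, q.1), q.2))).2)
    (h' := fun b (x : W) => ((e₀ (S (e.toOpenPartialHomeomorph.symm (b, (x : X)))).1).2,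
      (S (e.toOpenPartialHomeomorph.symm (b, (x : X)))).2)) hUo ?_ ?_ ?_ ?_
  · intro b hb q
    refine mfamAt_opens (W := W) ((hΦ.mfamAt he₀' he' hb.1 hb.2 q).congr ?_)
    filter_upwards [continuousAt_fst.eventually (hUo.mem_nhds hb)] with p hp
    exact (hf p.1 hp p.2).symm
  · intro b hb y
    obtain ⟨q, hq1, hq2, hq3⟩ := hback b hb y
    have h1 := hΦ.mfamAt_inv hS he₀' he' hb.1 hb.2 hq1
    rw [hq3] at h1
    exact MFamAt.comp (f := fun (_ : B) (y : W) => (y : X)) h1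
      (mfamAt_const contMDiff_subtype_val.contMDiffAt)
  · intro b hb q
    have h1 : e.toOpenPartialHomeomorph.symm
        (b, ((e' (Ψ (e₀.toOpenPartialHomeomorph.symm (b, q.1), q.2))).2 : X)) =
        Φ (e₀.toOpenPartialHomeomorph.symm (b, q.1), q.2) := by
      rw [hf b hb q]
      exact e.symm_mk_snd (hproj b hb.1 q) hb.2
    simp only [h1, hS _]
    exact Prod.ext (snd_apply_symm hb.1 _) rfl
  · intro b hb y
    obtain ⟨q, hq1, hq2, hq3⟩ := hback b hb y
    refine Subtype.ext ((hf b hb _).trans ?_)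
    simp only [hq2, hS _]
    rw [e₀.symm_mk_snd hq1 hb.1]
    exact hq3

/-- The local trivialisations which map the level sets of the collar `Φ` over `B` at levels less
than `r` to those of the collar `c`. -/
def straightTrivs (P𝓧 : ManifoldOver (𝓡∂ (n + 1)) X B 𝓧) (Φ : 𝓜 × Ico (0 : ℝ) 1 → 𝓧)
    (c : M × Ico (0 : ℝ) 1 → X) (r : ℝ) : Set (Trivialization X P𝓧.proj) :=
  {e | P𝓧.IsLocalTriv e ∧ ∀ w, P𝓧.proj w ∈ e.baseSet → ∀ t : Ico (0 : ℝ) 1, (t : ℝ) < r →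
    ((∃ z, w = Φ (z, t)) ↔ ∃ m, (e w).2 = c (m, t))}

theorem exists_coordChange_eq {r : ℝ} {e e' : Trivialization X P𝓧.proj}
    (he : e ∈ straightTrivs P𝓧 Φ c r) (he' : e' ∈ straightTrivs P𝓧 Φ c r) {b : B}
    (hb : b ∈ e.baseSet ∩ e'.baseSet) (m : M) {t : Ico (0 : ℝ) 1} (ht : (t : ℝ) < r) :
    ∃ m', e.coordChange e' b (c (m, t)) = c (m', t) := by
  have hp : P𝓧.proj (e.toOpenPartialHomeomorph.symm (b, c (m, t))) = b := proj_symm hb.1 _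
  exact (he'.2 _ (hp.symm ▸ hb.2) t ht).1
    ((he.2 _ (hp.symm ▸ hb.1) t ht).2 ⟨m, snd_apply_symm hb.1 _⟩)

/-- Transition functions send each level of `c` below `r` to itself, since both trivialisations read
it as the same level of `Φ`. In collar coordinates they only move the `M` component, so the boundary
is preserved. -/
theorem IsGoodCollar.hasCollarStructureGroup (hc : IsGoodCollar (n := n) ι c) {r : ℝ}
    {s : Ico (0 : ℝ) 1} (hs : 0 < (s : ℝ)) (hsr : (s : ℝ) < r) :
    HasCollarStructureGroup P𝓧 (straightTrivs P𝓧 Φ c r)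
      (fun q : M × Icc (0 : ℝ) 1 => c (q.1, iccScale s q.2)) := by
  intro e he e' he'
  rcases isEmpty_or_nonempty M with hM | hM
  · refine ⟨fun _ q => q, ?_, fun b _ q => (hM.false q.1).elim⟩
    exact IsDiffFamily.of_mfamAt (h' := fun _ q => q) (e.open_baseSet.inter e'.open_baseSet)
      (fun b _ q => (hM.false q.1).elim) (fun b _ q => (hM.false q.1).elim) (fun _ _ _ => rfl)
      (fun _ _ _ => rfl)
  obtain ⟨c', hc'⟩ := hc.exists_leftInverse
  set φ : M × Icc (0 : ℝ) 1 → X := fun q => c (q.1, iccScale s q.2) with hφ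
  have hφm : ContMDiff ((𝓡 n).prod (𝓡∂ 1)) (𝓡∂ (n + 1)) ∞ φ :=
    hc.contMDiff.comp (contMDiff_prod_iccScale s)
  have hφinj : Function.Injective φ := by
    intro p q h
    have h1 := Prod.mk_inj.1 (hc.injective h)
    exact Prod.ext h1.1 (iccScale_injective hs h1.2)
  set h : ∀ _ _ : Trivialization X P𝓧.proj, B → M × Icc (0 : ℝ) 1 → M × Icc (0 : ℝ) 1 :=
    fun e e' b q => ((c' (e.coordChange e' b (φ q))).1, q.2) with hh
  have hlt : ∀ t : Icc (0 : ℝ) 1, (iccScale s t : ℝ) < r := fun t =>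
    (mul_le_of_le_one_left s.2.1 t.2.2).trans_lt hsr
  have hmap : ∀ e ∈ straightTrivs P𝓧 Φ c r, ∀ e' ∈ straightTrivs P𝓧 Φ c r,
      ∀ b ∈ e.baseSet ∩ e'.baseSet, ∀ q, e.coordChange e' b (φ q) = φ (h e e' b q) := by
    intro e he e' he' b hb q
    obtain ⟨m', hm'⟩ := exists_coordChange_eq he he' hb q.1 (hlt q.2)
    have h1 : e.coordChange e' b (φ q) = c (m', iccScale s q.2) := hm'
    simp only [hh]
    rw [h1, hc']
  have hm : ∀ e ∈ straightTrivs P𝓧 Φ c r, ∀ e' ∈ straightTrivs P𝓧 Φ c r,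
      ∀ b ∈ e.baseSet ∩ e'.baseSet, ∀ q,
      MFamAt ((𝓡 n).prod (𝓡∂ 1)) ((𝓡 n).prod (𝓡∂ 1)) (h e e') b q := by
    intro e he e' he' b hb q
    have h1 : MFamAt ((𝓡 n).prod (𝓡∂ 1)) (𝓡∂ (n + 1)) (fun b q => e.coordChange e' b (φ q)) b q :=
      MFamAt.comp (f := fun _ : B => φ) (he.1.mfamAt he'.1 hb.1 hb.2 (φ q))
        (mfamAt_const hφm.contMDiffAt)
    have h2 : MFamAt (𝓡∂ (n + 1)) ((𝓡 n).prod (𝓡∂ 1)) (fun _ : B => c') b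
        (e.coordChange e' b (φ q)) := by
      rw [hmap e he e' he' b hb q]
      exact mfamAt_const (hc.contMDiffAt_inv c' hc' _)
    exact MFamAt.prodMk (MFamAt.comp (g := fun _ (q : M × Ico (0 : ℝ) 1) => q.1)
      (mfamAt_const contMDiffAt_fst) (MFamAt.comp h2 h1)) (mfamAt_const contMDiffAt_snd)
  have hinv : ∀ e ∈ straightTrivs P𝓧 Φ c r, ∀ e' ∈ straightTrivs P𝓧 Φ c r,
      ∀ b ∈ e.baseSet ∩ e'.baseSet, ∀ q, h e' e b (h e e' b q) = q := by
    intro e he e' he' b hb q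
    refine hφinj ?_
    rw [← hmap e' he' e he b hb.symm, ← hmap e he e' he' b hb]
    exact (trivRep_comp (Ψ := id) (Ψ' := id) (fun _ => rfl) hb.1 hb.2 _).trans
      (snd_apply_symm hb.1 _)
  exact ⟨h e e', IsDiffFamily.of_mfamAt (e.open_baseSet.inter e'.open_baseSet) (hm e he e' he')
    (fun b hb => hm e' he' e he b hb.symm) (hinv e he e' he')
    (fun b hb => hinv e' he' e he b hb.symm),
    fun b hb q => ⟨hmap e he e' he' b hb q, Iff.rfl⟩⟩

/-- Both sets are the unions of the levels below `s`, of `c` and of `Φ` respectively, and these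
levels correspond. -/
theorem isSubmanifoldAtlas_straightTrivs {r : ℝ} {s : Icc (0 : ℝ) 1} (hs : 0 < (s : ℝ))
    (hsr : (s : ℝ) < r) (hcov : ∀ b, ∃ e ∈ straightTrivs P𝓧 Φ c r, b ∈ e.baseSet) :
    P𝓧.IsSubmanifoldAtlas (c '' {q | (q.2 : ℝ) < s})
      (range fun q : 𝓜 × Ico (0 : ℝ) 1 => Φ (q.1, icoScale s q.2)) (straightTrivs P𝓧 Φ c r) := by
  refine ⟨hcov, fun e he => he.1, fun e he e' he' => he.1.isDiffFamily he'.1, fun e he w hw => ?_⟩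
  constructor
  · rintro ⟨q, rfl⟩
    have h1 : (icoScale s q.2 : ℝ) < s := mul_lt_of_lt_one_right hs q.2.2.2
    obtain ⟨m, hm⟩ := (he.2 _ hw (icoScale s q.2) (h1.trans hsr)).1 ⟨q.1, rfl⟩
    exact ⟨_, h1, hm.symm⟩
  · rintro ⟨⟨m, t⟩, ht, hq⟩
    obtain ⟨z, rfl⟩ := (he.2 w hw t (lt_trans ht hsr)).2 ⟨m, hq.symm⟩
    refine ⟨(z, ⟨t / s, div_nonneg t.2.1 hs.le, (div_lt_one hs).2 ht⟩), ?_⟩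
    refine congrArg (fun t => Φ (z, t)) (Subtype.ext ?_)
    rw [coe_icoScale]
    exact mul_div_cancel₀ _ hs.ne'

/-- Trivialisations with different factors `κ` would not preserve common levels of `c`. Compactness
of `B` allows one `r` below finitely many bounds `κ b` and `δ b`; it serves both as the factor and
as the range of levels. -/
theorem IsCollarOver.exists_straightTrivs [CompactSpace B] [CompactSpace M] [T2Space X]
    (hj : IsBoundaryOver ι P𝓜 P𝓧 j) (hΦ : IsCollarOver P𝓜 P𝓧 j Φ)
    (hc : IsGoodCollar (n := n) ι c) :
    ∃ r : Icc (0 : ℝ) 1, 0 < (r : ℝ) ∧ ∀ b,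
      ∃ e ∈ straightTrivs P𝓧 Φ (fun q => c (q.1, icoScale r q.2)) r, b ∈ e.baseSet := by
  choose N hNo hbN κ hκ δ hδ H using fun b => hΦ.exists_straighten hj hc b
  obtain ⟨t, -, ht⟩ := isCompact_univ.elim_nhds_subcover N fun b _ => (hNo b).mem_nhds (hbN b)
  have hev : ∀ᶠ r in 𝓝[>] (0 : ℝ), (∀ b ∈ t, r ≤ κ b ∧ r ≤ δ b) ∧ r ≤ 1 ∧ 0 < r := by
    have h1 : ∀ a : ℝ, 0 < a → ∀ᶠ r in 𝓝[>] (0 : ℝ), r ≤ a := fun a ha =>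
      mem_nhdsWithin_of_mem_nhds (Iic_mem_nhds ha)
    have h2 : ∀ᶠ r in 𝓝[>] (0 : ℝ), 0 < r := self_mem_nhdsWithin
    exact ((eventually_all_finset t).2 fun b _ => (h1 _ (hκ b)).and (h1 _ (hδ b))).and
      ((h1 1 one_pos).and h2)
  obtain ⟨r, hr, hr1, hr0⟩ := hev.exists
  refine ⟨⟨r, hr0.le, hr1⟩, hr0, fun b => ?_⟩
  obtain ⟨b', hb', hbb'⟩ : ∃ b' ∈ t, b ∈ N b' := by
    have := ht (mem_univ b)
    simpa only [mem_iUnion, exists_prop] using this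
  obtain ⟨e, he, hbase, hee⟩ := H b' ⟨r, hr0.le, hr1⟩ hr0 (hr b' hb').1
  refine ⟨e, ⟨he, fun w hw t' ht' => hee w (hbase ▸ hw) t' (ht'.trans_le (hr b' hb').2)⟩, ?_⟩
  rw [hbase]
  exact hbb'

end Assembly

end

theorem mainTheorem10 {n : ℕ} {B M X 𝓜 𝓧 : Type*}
    [TopologicalSpace B] [CompactSpace B] [T2Space B]
    [TopologicalSpace M] [ChartedSpace (EuclideanSpace ℝ (Fin n)) M] [IsManifold (𝓡 n) ∞ M]
    [CompactSpace M]
    [TopologicalSpace X] [ChartedSpace (EuclideanHalfSpace (n + 1)) X]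
    [IsManifold (𝓡∂ (n + 1)) ∞ X] [T2Space X] [SecondCountableTopology X]
    [TopologicalSpace 𝓜] [TopologicalSpace 𝓧]
    (ι : M → X) (hι : IsBoundaryInclusion n ι)
    (P𝓜 : ManifoldOver (𝓡 n) M B 𝓜) (P𝓧 : ManifoldOver (𝓡∂ (n + 1)) X B 𝓧)
    (j : 𝓜 → 𝓧) (hj : IsBoundaryOver ι P𝓜 P𝓧 j) :
    ∃ (W : TopologicalSpace.Opens X) (𝓦 : Set 𝓧) (A : Set (Bundle.Trivialization X P𝓧.proj))
      (hA : P𝓧.IsSubmanifoldAtlas W 𝓦 A) (φ : M × Icc (0 : ℝ) 1 → X)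
      (Φ : 𝓜 × Ico (0 : ℝ) 1 ≃ₜ 𝓦),
      IsClosedCollar n ι W φ ∧
      HasCollarStructureGroup P𝓧 A φ ∧
      (P𝓜.prod (𝓡∂ 1) (Ico (0 : ℝ) 1)).IsIso (P𝓧.restrict hA) Φ ∧
      ∀ b, ∀ e₀ ∈ P𝓜.atlas, ∀ e ∈ P𝓧.atlas, b ∈ e₀.baseSet → b ∈ e.baseSet →
        IsCollar n (fun m => (e (j (e₀.toOpenPartialHomeomorph.symm (b, m)))).2)
          (fun q => (e (Φ (e₀.toOpenPartialHomeomorph.symm (b, q.1), q.2))).2) := by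
  have hlcM : LocallyCompactSpace M := Manifold.locallyCompact_of_finiteDimensional (𝓡 n)
  have hlcX : LocallyCompactSpace X := Manifold.locallyCompact_of_finiteDimensional (𝓡∂ (n + 1))
  have hc𝓜 : CompactSpace 𝓜 := P𝓜.compactSpace
  have ht𝓧 : T2Space 𝓧 := P𝓧.t2Space
  obtain ⟨Φ, hΦ⟩ := exists_isCollarOver hι hj
  obtain ⟨c₀, hc₀⟩ := exists_isCollarOver_point hι
  obtain ⟨r, hr0, hcov⟩ := hΦ.exists_straightTrivs hj hc₀.isGoodCollar
  have hc := (hc₀.scale hr0).isGoodCollar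
  -- With the factor `r` absorbed into the collar of the fibre, equal levels of `Φ` and `c`
  -- correspond.
  set c : M × Ico (0 : ℝ) 1 → X := fun q => c₀ (q.1, icoScale r q.2)
  have hr1 := r.2.2
  -- Strictly below `r`, so that the closed collar up to level `s` lies within the straightened
  -- levels. The same number is needed in `[0,1]` to rescale `Φ` and in `[0,1)` to cut off `c`.
  set s : Icc (0 : ℝ) 1 := ⟨r / 2, by linarith, by linarith⟩ with hs
  set s' : Ico (0 : ℝ) 1 := ⟨r / 2, by linarith, by linarith⟩ with hs'
  have hs0 : 0 < (s : ℝ) := half_pos hr0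
  have hsr : (s : ℝ) < r := half_lt_self hr0
  let W : TopologicalSpace.Opens X := ⟨c '' {q | (q.2 : ℝ) < s},
    hc.isOpenMap _ (isOpen_lt (by fun_prop) continuous_const)⟩
  have hA : P𝓧.IsSubmanifoldAtlas W (range fun q : 𝓜 × Ico (0 : ℝ) 1 => Φ (q.1, icoScale s q.2))
      (straightTrivs P𝓧 Φ c r) := isSubmanifoldAtlas_straightTrivs hs0 hsr hcov
  have hΦs := hΦ.scale hs0
  have hΨ : ∀ q, (hΦs.isOpenEmbedding.toIsEmbedding.toHomeomorph q : 𝓧) = Φ (q.1, icoScale s q.2) :=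
    fun q => rfl
  refine ⟨W, _, _, hA, fun q => c (q.1, iccScale s' q.2), hΦs.isOpenEmbedding.toIsEmbedding.toHomeomorph,
    hc.isClosedCollar (s := s') hs0 rfl, hc.hasCollarStructureGroup (s := s') hs0 hsr,
    hΦs.isIso hA ?_ _ hΨ, fun b e₀ he₀ e he hb₀ hb => ?_⟩
  · rintro ⟨_, q, -, -⟩
    exact ⟨q.1⟩
  · exact hΦs.isCollar (P𝓜.isLocalTriv_of_mem he₀) (P𝓧.isLocalTriv_of_mem he) hb₀ hb
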